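/- **Ribbons.** Cells are pairs $(i,j)\in\mathbb Z^2$ ($i$ increases downward, $j$ to the right); the content of $(i,j)$ is $j-i$. Let $R$ be an infinite ribbon, i.e. a family of boxes $r_c$ of content $c$ ($c\in\mathbb Z$) such that each $r_c$ is directly to the right of or directly above $r_{c-1}$, and such that $R$ is straight (a half-infinite row or column) near each of its two ends. The copies $R+(k,k)$, $k\in\mathbb Z$, tile the plane. Let $\mu\subseteq\lambda$ be partitions such that the skew shape $\lambda/\mu$ is compatible with $R$, i.e. its intersection with each copy of $R$ is contiguous (possibly empty). Let $\theta_1,\dots,\theta_n$ be the non-empty intersections, in increasing order of $k$; the contents of the cells of $\theta_i$ form an interval $[a_i,b_i)$ with $a_i<b_i$. Write $[a,b)_R=\{r_c: a\le c<b\}$ and put $$A_{\lambda/\mu,R}=\bigl(s_{[a_j,b_i)_R}\bigr)_{i,j=1}^n ,$$ where $s_D=\sum_T x^{\mathrm{wt}(T)}$ (sum over the semistandard Young tableaux $T$ of shape $D$) is the skew Schur function in $x_1,x_2,\dots$, with $s_{[a,b)_R}=1$ if $a=b$ and $0$ if $a>b$. **Temperley–Lieb immanants.** $TL_n(2)$ is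 the $\mathbb C$-algebra generated by $t_1,\dots,t_{n-1}$ with relations $t_i^2=2t_i$, $t_it_jt_i=t_i$ for $|i-j|=1$, $t_it_j=t_jt_i$ for $|i-j|>1$. A permutation is $321$-avoiding if it has no reduced decomposition of the form $\cdots s_is_js_i\cdots$ with $|i-j|=1$. $TL_n(2)$ has the basis $t_u=t_{i_1}\cdots t_{i_k}$, where $u=s_{i_1}\cdots s_{i_k}$ (reduced) runs over the $321$-avoiding permutations in $S_n$; products in $S_n$ are read from left to right (first $s_{i_1}$ is applied, then $s_{i_2}$, …). For $w=s_{i_1}\cdots s_{i_k}\in S_n$ (reduced) let $f_u(w)$ be the coefficient of $t_u$ in $(t_{i_1}-1)\cdots(t_{i_k}-1)$. For $\tau=t_u$ put $$\operatorname{Imm}^{\mathrm{TL}}_\tau(X)=\sum_{w\in S_n}f_u(w)\,x_{1,w(1)}\cdots x_{n,w(n)} .$$ The basis element $\tau=t_{i_1}\cdots t_{i_k}$ is identified with the noncrossing matching of $L_1,\dots,L_n,R_1,\dots,R_n$ given by its Temperley–Lieb diagram, the concatenation from left to right of the diagrams of $t_{i_1},\dots,t_{i_k}$. The diagram of $t_i$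 joins the $i$-th and $(i+1)$-st points on the left, joins the $i$-th and $(i+1)$-st points on the right, and joins the $j$-th point on the left to the $j$-th point on the right for $j\ne i,i+1$. The $L$'s are the left, the $R$'s the right boundary points, numbered from top to bottom. **Shuffle tableaux.** Let $\lambda_R/\mu_R$ be the skew shape whose ribbons are $[a_i,b_i)_R$ for $i=1,3,5,\dots$, placed in this order on the copies $R,R+(1,1),R+(2,2),\dots$, and let $\lambda_B/\mu_B$ be obtained in the same way from $i=2,4,6,\dots$. The shuffle diagram of shape $(\lambda_R/\mu_R)\circledast(\lambda_B/\mu_B)$ has a cell $(2i-1,2j-1)$ for every cell $(i,j)$ of $\lambda_R/\mu_R$ and a cell $(2i,2j)$ for every cell $(i,j)$ of $\lambda_B/\mu_B$. A shuffle tableau $T$ of this shape is a filling of these cells with positive integers that weakly increases along rows and strictly increases down columns; its weight is $\omega(T)=\prod_{i\ge1}x_i^{\alpha_i}$, where $\alpha_i$ is the number of entries $i$. **Type.** The Temperley–Lieb type $\psi(T)$ is a matching of points $P_1,\dots,P_n,Q_1,\dots,Q_n$. The point $Q_k$ is the position directly below the cell of the box $r_{a_k}$ of the $k$-th ribbon in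 the shuffle diagram if $r_{a_k-1}$ is below $r_{a_k}$ in $R$, and directly to the left of it otherwise; $P_k$ is the position directly above the cell of the box $r_{b_k-1}$ of the $k$-th ribbon if $r_{b_k}$ is above $r_{b_k-1}$ in $R$, and directly to the right of it otherwise. For every two diagonally neighbouring cells $(x+1,y)$, with entry $i$, and $(x,y+1)$, with entry $j$, draw the lines $(x+1,y)-(x,y)$ and $(x,y+1)-(x+1,y+1)$ if $i\le j$, and the lines $(x+1,y)-(x+1,y+1)$ and $(x,y+1)-(x,y)$ if $i>j$. If only one of the positions $(x+1,y)$ and $(x,y+1)$ is a cell of the diagram, say that of the box $r_c$ of some ribbon, draw one line from it along its own ribbon: from $(x+1,y)$ to the adjacent position in the direction from $r_c$ to $r_{c+1}$ (above or right), respectively from $(x,y+1)$ to the adjacent position in the direction from $r_c$ to $r_{c-1}$ (below or left). Two of the points $P_i,Q_i$ are matched in $\psi(T)$ if these lines join them; $\psi(T)$ is compared with the matchings of Temperley–Lieb diagrams through $P_i\leftrightarrow L_i$, $Q_i\leftrightarrow R_i$. **Statement.** For every Temperley–Lieb basis element $\tau$ of $TL_n(2)$, $$\operatorname{Imm}^{\mathrm{TL}}_\tau(A_{\lambda/\mu,R})=\sum_{\substack{T\text{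 shuffle tableau of shape }(\lambda_R/\mu_R)\circledast(\lambda_B/\mu_B)\\ \psi(T)=\tau}}\omega(T).$$ -/

import Mathlib

namespace RibbonTL

/-! ### Diagrams and semistandard fillings

Cells are pairs `(row, column) : ℤ × ℤ`; rows are numbered downwards, columns to the right.
The content of a cell `(i, j)` is `j - i`. -/

/-- A filling by positive integers of a finite set of cells that weakly increases along the rows
and strictly increases down the columns. On a skew shape these are the semistandard Young tableaux,
on a shuffle diagram they are the shuffle tableaux. -/
@[ext]
structure Tableau (D : Finset (ℤ × ℤ)) where
  entry : D → ℕ+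
  row_weak : ∀ p q : D, p.1.1 = q.1.1 → p.1.2 < q.1.2 → entry p ≤ entry q
  col_strict : ∀ p q : D, p.1.2 = q.1.2 → p.1.1 < q.1.1 → entry p < entry q

/-- The exponent vector of a tableau: how often each positive integer occurs in it. -/
noncomputable def Tableau.weight {D : Finset (ℤ × ℤ)} (T : Tableau D) : ℕ+ →₀ ℕ :=
  ∑ p : D, Finsupp.single (T.entry p) 1

/-- There are only finitely many tableaux of a given weight, so the cardinalities in
`weightSum` below are honest ones. -/
theorem Tableau.finite_weight_eq {D : Finset (ℤ × ℤ)} (d : ℕ+ →₀ ℕ) :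
    {T : Tableau D | T.weight = d}.Finite := by
  classical
  have hmem : ∀ T ∈ {T : Tableau D | T.weight = d}, ∀ p : D, T.entry p ∈ d.support := by
    intro T hT p
    have hT' : T.weight = d := hT
    rw [← hT', Finsupp.mem_support_iff, Tableau.weight, Finsupp.finsetSum_apply]
    intro h0
    have := (Finset.sum_eq_zero_iff.mp h0) p (Finset.mem_univ p)
    simp at this
  have hfin : (Set.univ.pi fun _ : D => (d.support : Set ℕ+)).Finite :=
    Set.Finite.pi fun _ => Finset.finite_toSet _
  refine Set.Finite.of_finite_image (f := Tableau.entry) (hfin.subset ?_) ?_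
  · rintro _ ⟨T, hT, rfl⟩ p _
    exact hmem T hT p
  · intro T _ T' _ h
    exact Tableau.ext h

/-- The weighted sum `∑_{T ∈ S} x^{wt(T)}` over a set of tableaux, a power series in the variables
`x₁, x₂, …`: the coefficient of `x^d` is the number of `T ∈ S` of weight `d`. -/
noncomputable def weightSum {D : Finset (ℤ × ℤ)} (S : Set (Tableau D)) : MvPowerSeries ℕ+ ℂ :=
  fun d => ({T : Tableau D | T ∈ S ∧ T.weight = d}.ncard : ℂ)

/-- The (skew) Schur function of a skew diagram. -/
noncomputable def schur (D : Finset (ℤ × ℤ)) : MvPowerSeries ℕ+ ℂ :=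
  weightSum (Set.univ : Set (Tableau D))

/-- The cells of the skew shape `lam / mu`. -/
def skewCells (lam mu : YoungDiagram) : Finset (ℤ × ℤ) :=
  (lam.cells \ mu.cells).image fun p => ((p.1 : ℤ), (p.2 : ℤ))

/-! ### Infinite ribbons -/

/-- An infinite ribbon in the plane, given by its unique box `box c` of each content `c`. Going from
content `c - 1` to content `c` one moves one step to the right or one step up, and the ribbon is
straight (a half-infinite row or column) near both of its ends. -/
structure InfiniteRibbon where
  box : ℤ → ℤ × ℤ
  content : ∀ c, (box c).2 - (box c).1 = c
  step : ∀ c, box c = box (c - 1) + (0, 1) ∨ box c = box (c - 1) + (-1, 0)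
  straight_ends : ∃ N : ℤ,
    (∀ c, N ≤ c → box (c + 1) - box c = box (N + 1) - box N) ∧
    (∀ c, c ≤ -N → box c - box (c - 1) = box (-N) - box (-N - 1))

namespace InfiniteRibbon

variable (R : InfiniteRibbon)

/-- The copies of `R` that tile the plane are the translates `R + (k, k)`, `k ∈ ℤ`. A finite set of
cells is compatible with `R` if its intersection with each copy is contiguous, i.e. consists of the
boxes of that copy whose contents lie in an interval (possibly empty). -/
def Compatible (D : Finset (ℤ × ℤ)) : Prop :=
  ∀ k : ℤ, {c : ℤ | R.box c + (k, k) ∈ D}.OrdConnected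

/-- The number `k` of the copy `R + (k, k)` that contains a given cell. -/
def copyIndex (p : ℤ × ℤ) : ℤ := p.1 - (R.box (p.2 - p.1)).1

/-- The numbers of the copies of `R` that meet `D`. -/
def copies (D : Finset (ℤ × ℤ)) : Finset ℤ := D.image R.copyIndex

/-- The number of (non-empty) ribbons into which `D` is cut by the copies of `R`. -/
def numRibbons (D : Finset (ℤ × ℤ)) : ℕ := (R.copies D).card

/-- The copy of `R` that contains the `i`-th ribbon of `D`, where the ribbons are numbered from the
inside (north-west) to the outside (south-east). -/
def copyOf (D : Finset (ℤ × ℤ)) (i : Fin (R.numRibbons D)) : ℤ :=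
  (R.copies D).orderEmbOfFin rfl i

/-- The contents of the cells of the `i`-th ribbon of `D`. -/
def ribbonContents (D : Finset (ℤ × ℤ)) (i : Fin (R.numRibbons D)) : Finset ℤ :=
  (D.filter fun p => R.copyIndex p = R.copyOf D i).image fun p => p.2 - p.1

theorem ribbonContents_nonempty (D : Finset (ℤ × ℤ)) (i : Fin (R.numRibbons D)) :
    (R.ribbonContents D i).Nonempty := by
  have h : R.copyOf D i ∈ R.copies D := Finset.orderEmbOfFin_mem _ rfl i
  obtain ⟨p, hp, hk⟩ := Finset.mem_image.mp h
  exact ⟨_, Finset.mem_image_of_mem _ (Finset.mem_filter.mpr ⟨hp, hk⟩)⟩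

/-- The ending tuple `(a_i)`: the `i`-th ribbon is `[a_i, b_i)_R`. -/
noncomputable def endingTuple (D : Finset (ℤ × ℤ)) (i : Fin (R.numRibbons D)) : ℤ :=
  (R.ribbonContents D i).min' (R.ribbonContents_nonempty D i)

/-- The starting tuple `(b_i)`: the `i`-th ribbon is `[a_i, b_i)_R`. -/
noncomputable def startingTuple (D : Finset (ℤ × ℤ)) (i : Fin (R.numRibbons D)) : ℤ :=
  (R.ribbonContents D i).max' (R.ribbonContents_nonempty D i) + 1

/-- The section `[a, b)_R` of the ribbon. -/
noncomputable def segment (a b : ℤ) : Finset (ℤ × ℤ) := (Finset.Ico a b).image R.box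

/-- The matrix `(s_{[a_j, b_i)_R})_{i,j}`, with the convention that `s_{[a_j, b_i)_R}` is `1` for
`a_j = b_i` (the Schur function of the empty shape) and `0` for `a_j > b_i`. -/
noncomputable def ribbonMatrix {n : ℕ} (a b : Fin n → ℤ) :
    Matrix (Fin n) (Fin n) (MvPowerSeries ℕ+ ℂ) :=
  Matrix.of fun i j => if a j ≤ b i then schur (R.segment (a j) (b i)) else 0

/-- The ribbon decomposition matrix `A_{D,R}` of a skew shape `D` compatible with `R`. -/
noncomputable def decompositionMatrix (D : Finset (ℤ × ℤ)) :
    Matrix (Fin (R.numRibbons D)) (Fin (R.numRibbons D)) (MvPowerSeries ℕ+ ℂ) :=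
  R.ribbonMatrix (R.endingTuple D) (R.startingTuple D)

end InfiniteRibbon

/-! ### The Temperley–Lieb algebra and Temperley–Lieb immanants

Generators are indexed by `i : Fin (n - 1)`, where `i` stands for the pair of adjacent positions
`i, i + 1` of `Fin n` (everything is counted from `0`). A word in the generators is a list. -/

/-- The defining relations of `TL_n(2)`. -/
inductive TLRel (n : ℕ) : FreeAlgebra ℂ (Fin (n - 1)) → FreeAlgebra ℂ (Fin (n - 1)) → Prop
  | sq (i : Fin (n - 1)) :
      TLRel n (FreeAlgebra.ι ℂ i * FreeAlgebra.ι ℂ i) ((2 : ℂ) • FreeAlgebra.ι ℂ i)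
  | braid (i j : Fin (n - 1)) (h : i.val + 1 = j.val ∨ j.val + 1 = i.val) :
      TLRel n (FreeAlgebra.ι ℂ i * FreeAlgebra.ι ℂ j * FreeAlgebra.ι ℂ i) (FreeAlgebra.ι ℂ i)
  | comm (i j : Fin (n - 1)) (h : i.val + 1 < j.val ∨ j.val + 1 < i.val) :
      TLRel n (FreeAlgebra.ι ℂ i * FreeAlgebra.ι ℂ j) (FreeAlgebra.ι ℂ j * FreeAlgebra.ι ℂ i)

/-- The Temperley–Lieb algebra `TL_n(2)` over `ℂ`. -/
abbrev TL (n : ℕ) : Type := RingQuot (TLRel n)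

/-- The generator `t_i` of `TL_n(2)`. -/
noncomputable def tlGen {n : ℕ} (i : Fin (n - 1)) : TL n :=
  RingQuot.mkAlgHom ℂ (TLRel n) (FreeAlgebra.ι ℂ i)

/-- The smaller one of the two positions that are exchanged by the adjacent transposition `s_i`. -/
def lowPos {n : ℕ} (i : Fin (n - 1)) : Fin n := ⟨i.val, by omega⟩

/-- The larger one of the two positions that are exchanged by the adjacent transposition `s_i`. -/
def highPos {n : ℕ} (i : Fin (n - 1)) : Fin n := ⟨i.val + 1, by omega⟩

/-- The permutation `s_{i₁} s_{i₂} ⋯ s_{i_k}` given by a word, where products of permutations are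
read from left to right (first `s_{i₁}`, then `s_{i₂}`, …), as for paths running from the left to
the right through a wiring diagram. -/
def wordPerm {n : ℕ} (l : List (Fin (n - 1))) : Equiv.Perm (Fin n) :=
  (l.map fun i => Equiv.swap (lowPos i) (highPos i)).reverse.prod

/-- `l` is a reduced decomposition of `w`. -/
def IsReducedWord {n : ℕ} (l : List (Fin (n - 1))) (w : Equiv.Perm (Fin n)) : Prop :=
  wordPerm l = w ∧ ∀ l' : List (Fin (n - 1)), wordPerm l' = w → l.length ≤ l'.length

theorem exists_reducedWord {n : ℕ} (w : Equiv.Perm (Fin n)) :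
    ∃ l : List (Fin (n - 1)), IsReducedWord l w := by
  classical
  have hex : ∃ l : List (Fin (n - 1)), wordPerm l = w := by
    rcases n with _ | n
    · exact ⟨[], Subsingleton.elim _ _⟩
    · have hw : w ∈ Submonoid.closure
          (Set.range fun i : Fin n => Equiv.swap i.castSucc i.succ) := by
        rw [Equiv.Perm.mclosure_swap_castSucc_succ]; trivial
      induction hw using Submonoid.closure_induction with
      | mem x hx =>
        obtain ⟨i, rfl⟩ := hx
        refine ⟨[i], ?_⟩
        simp only [wordPerm, List.map_cons, List.map_nil, List.reverse_singleton,
          List.prod_singleton]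
        rfl
      | one => exact ⟨[], rfl⟩
      | mul x y _ _ hx hy =>
        obtain ⟨l, rfl⟩ := hx
        obtain ⟨l', rfl⟩ := hy
        exact ⟨l' ++ l, by simp [wordPerm]⟩
  have hlen : ∃ k : ℕ, ∃ l : List (Fin (n - 1)), wordPerm l = w ∧ l.length = k :=
    ⟨_, hex.choose, hex.choose_spec, rfl⟩
  obtain ⟨l, hl, hk⟩ := Nat.find_spec hlen
  exact ⟨l, hl, fun l' hl' => hk ▸ Nat.find_min' hlen ⟨l', hl', rfl⟩⟩

/-- A chosen reduced decomposition of `w`. -/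
noncomputable def reducedWord {n : ℕ} (w : Equiv.Perm (Fin n)) : List (Fin (n - 1)) :=
  (exists_reducedWord w).choose

/-- A permutation is `321`-avoiding if none of its reduced decompositions is of the form
`⋯ s_i s_j s_i ⋯` with `|i - j| = 1`. -/
def Avoids321 {n : ℕ} (w : Equiv.Perm (Fin n)) : Prop :=
  ∀ l : List (Fin (n - 1)), IsReducedWord l w →
    ∀ i j : Fin (n - 1), (i.val + 1 = j.val ∨ j.val + 1 = i.val) → ¬ [i, j, i] <:+: l

/-- The `321`-avoiding permutations in `S_n`. They index the basis elements `t_w` of `TL_n(2)`. -/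
abbrev AvoidingPerm (n : ℕ) : Type := {w : Equiv.Perm (Fin n) // Avoids321 w}

/-- The basis element `t_u = t_{i₁} ⋯ t_{i_k}` of `TL_n(2)`, where `s_{i₁} ⋯ s_{i_k}` is a reduced
decomposition of the `321`-avoiding permutation `u`. -/
noncomputable def tlBasisElement {n : ℕ} (u : AvoidingPerm n) : TL n :=
  ((reducedWord u.1).map tlGen).prod

/-- `θ(w) = (t_{i₁} - 1) ⋯ (t_{i_k} - 1)` for a reduced decomposition `w = s_{i₁} ⋯ s_{i_k}`. -/
noncomputable def tlTheta {n : ℕ} (w : Equiv.Perm (Fin n)) : TL n :=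
  ((reducedWord w).map fun i => tlGen i - 1).prod

/-- The family `(f_u(w))_u` of the coefficients of `θ(w)` in the basis `(t_u)_u` of `TL_n(2)`. -/
noncomputable def tlCoeff {n : ℕ} (w : Equiv.Perm (Fin n)) : AvoidingPerm n →₀ ℂ :=
  Classical.epsilon fun f : AvoidingPerm n →₀ ℂ =>
    Finsupp.linearCombination ℂ tlBasisElement f = tlTheta w

/-- The Temperley–Lieb immanant `Imm_u(X) = ∑_w f_u(w) x_{1,w(1)} ⋯ x_{n,w(n)}`. -/
noncomputable def tlImmanant {n : ℕ} {A : Type*} [CommRing A] [Algebra ℂ A] (u : AvoidingPerm n)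
    (X : Matrix (Fin n) (Fin n) A) : A :=
  ∑ w : Equiv.Perm (Fin n), tlCoeff w u • ∏ i, X i (w i)

/-! ### Temperley–Lieb diagrams

A matching of the `2n` points `L_1, …, L_n, R_1, …, R_n` is recorded as the equivalence relation on
`Fin n ⊕ Fin n` (`Sum.inl i` is `L_i`, `Sum.inr i` is `R_i`) whose classes are the matched pairs. -/

/-- The lines of the Temperley–Lieb diagram of a word, the concatenation from left to right of the
diagrams of its letters. The points of the diagram are `(m, j)`: the `j`-th point (from the top) on
the `m`-th vertical line; the diagram of the letter with number `m` sits between the vertical lines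
`m` and `m + 1`. -/
inductive DiagramLine {n : ℕ} (l : List (Fin (n - 1))) : ℕ × Fin n → ℕ × Fin n → Prop
  | strand (m : ℕ) (hm : m < l.length) (j : Fin n) (hlow : j ≠ lowPos l[m])
      (hhigh : j ≠ highPos l[m]) : DiagramLine l (m, j) (m + 1, j)
  | left (m : ℕ) (hm : m < l.length) : DiagramLine l (m, lowPos l[m]) (m, highPos l[m])
  | right (m : ℕ) (hm : m < l.length) : DiagramLine l (m + 1, lowPos l[m]) (m + 1, highPos l[m])

/-- The boundary points of the Temperley–Lieb diagram of a word. -/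
def diagramBoundary {n : ℕ} (l : List (Fin (n - 1))) : Fin n ⊕ Fin n → ℕ × Fin n
  | Sum.inl i => (0, i)
  | Sum.inr i => (l.length, i)

/-- The noncrossing matching of the basis element `t_u`: two boundary points are related if they are
joined in the Temperley–Lieb diagram of `t_u`. -/
noncomputable def tlMatching {n : ℕ} (u : AvoidingPerm n) : Setoid (Fin n ⊕ Fin n) :=
  Setoid.comap (diagramBoundary (reducedWord u.1))
    (Relation.EqvGen.setoid (DiagramLine (reducedWord u.1)))

/-! ### Shuffle tableaux -/

/-- The shuffle diagram of shape `Dr ⊛ Db`. -/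
def shuffleDiagram (Dr Db : Finset (ℤ × ℤ)) : Finset (ℤ × ℤ) :=
  (Dr.image fun p => (2 * p.1 - 1, 2 * p.2 - 1)) ∪ Db.image fun p => (2 * p.1, 2 * p.2)

/-- The entries with odd number (`1, 3, 5, …` when counting from one) of a tuple. -/
def oddPart {n : ℕ} (a : Fin n → ℤ) (m : Fin ((n + 1) / 2)) : ℤ := a ⟨2 * m.val, by omega⟩

/-- The entries with even number (`2, 4, 6, …` when counting from one) of a tuple. -/
def evenPart {n : ℕ} (a : Fin n → ℤ) (m : Fin (n / 2)) : ℤ := a ⟨2 * m.val + 1, by omega⟩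

namespace InfiniteRibbon

variable (R : InfiniteRibbon)

/-- The skew shape with ending tuple `a` and starting tuple `b`: its ribbons `[a_m, b_m)_R` are
placed on the consecutive copies `R, R + (1, 1), R + (2, 2), …` of `R`. -/
noncomputable def shape {n : ℕ} (a b : Fin n → ℤ) : Finset (ℤ × ℤ) :=
  Finset.univ.biUnion fun m : Fin n =>
    (Finset.Ico (a m) (b m)).image fun c => R.box c + ((m.val : ℤ), (m.val : ℤ))

/-- The shuffle diagram of shape `(λ_R/μ_R) ⊛ (λ_B/μ_B)`, where `λ_R/μ_R` (red) has the ending and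
starting tuples `(a_i)_{i odd}`, `(b_i)_{i odd}` and `λ_B/μ_B` (blue) has the ending and starting
tuples `(a_i)_{i even}`, `(b_i)_{i even}`, counting from one. -/
noncomputable def shuffleShape {n : ℕ} (a b : Fin n → ℤ) : Finset (ℤ × ℤ) :=
  shuffleDiagram (R.shape (oddPart a) (oddPart b)) (R.shape (evenPart a) (evenPart b))

/-- The position in the shuffle diagram of the box of content `c` of the ribbon with number `k`,
counting from zero. For `k = 2m` this ribbon is the red one on the copy `R + (m, m)`, for
`k = 2m + 1` the blue one on the copy `R + (m, m)`. -/
def shufflePos (k : ℕ) (c : ℤ) : ℤ × ℤ :=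
  (2 * (R.box c).1 + k - 1, 2 * (R.box c).2 + k - 1)

/-- The place next to the position of the box `r_c` of the ribbon with number `k`, in the direction
of the box `r_{c+1}`: above it if `r_{c+1}` is above `r_c`, and to the right of it otherwise. -/
def placeAfter (k : ℕ) (c : ℤ) : ℤ × ℤ :=
  if (R.box (c + 1)).1 < (R.box c).1 then R.shufflePos k c + (-1, 0)
  else R.shufflePos k c + (0, 1)

/-- The place next to the position of the box `r_c` of the ribbon with number `k`, in the direction
of the box `r_{c-1}`: below it if `r_{c-1}` is below `r_c`, and to the left of it otherwise. -/
def placeBefore (k : ℕ) (c : ℤ) : ℤ × ℤ :=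
  if (R.box c).1 < (R.box (c - 1)).1 then R.shufflePos k c + (1, 0)
  else R.shufflePos k c + (0, -1)

/-- The lines drawn in a shuffle tableau `T`.
For two cells `(x + 1, y)` (lower left) and `(x, y + 1)` (upper right) of the shuffle diagram, with
entries `i` and `j`, vertical lines are drawn from both if `i ≤ j` and horizontal lines if `i > j`;
they lead to the places `(x, y)` and `(x + 1, y + 1)`.
If only one of two such diagonally neighbouring positions is a cell of the shuffle diagram, the line
from this cell goes along its own ribbon. (Equivalently: the missing entry counts as `-∞` if the
missing position belongs to the preceding ribbon, and as `+∞` if it belongs to the following one.) -/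
inductive ShuffleLine {n : ℕ} (a b : Fin n → ℤ) (T : Tableau (R.shuffleShape a b)) :
    ℤ × ℤ → ℤ × ℤ → Prop
  | lower_vertical (x y : ℤ) (hs : (x + 1, y) ∈ R.shuffleShape a b)
      (ht : (x, y + 1) ∈ R.shuffleShape a b) (h : T.entry ⟨_, hs⟩ ≤ T.entry ⟨_, ht⟩) :
      ShuffleLine a b T (x + 1, y) (x, y)
  | upper_vertical (x y : ℤ) (hs : (x + 1, y) ∈ R.shuffleShape a b)
      (ht : (x, y + 1) ∈ R.shuffleShape a b) (h : T.entry ⟨_, hs⟩ ≤ T.entry ⟨_, ht⟩) :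
      ShuffleLine a b T (x, y + 1) (x + 1, y + 1)
  | lower_horizontal (x y : ℤ) (hs : (x + 1, y) ∈ R.shuffleShape a b)
      (ht : (x, y + 1) ∈ R.shuffleShape a b) (h : T.entry ⟨_, ht⟩ < T.entry ⟨_, hs⟩) :
      ShuffleLine a b T (x + 1, y) (x + 1, y + 1)
  | upper_horizontal (x y : ℤ) (hs : (x + 1, y) ∈ R.shuffleShape a b)
      (ht : (x, y + 1) ∈ R.shuffleShape a b) (h : T.entry ⟨_, ht⟩ < T.entry ⟨_, hs⟩) :
      ShuffleLine a b T (x, y + 1) (x, y)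
  | lone_after (k : Fin n) (c : ℤ) (ha : a k ≤ c) (hb : c < b k)
      (h : R.shufflePos k c + (-1, 1) ∉ R.shuffleShape a b) :
      ShuffleLine a b T (R.shufflePos k c) (R.placeAfter k c)
  | lone_before (k : Fin n) (c : ℤ) (ha : a k ≤ c) (hb : c < b k)
      (h : R.shufflePos k c + (1, -1) ∉ R.shuffleShape a b) :
      ShuffleLine a b T (R.shufflePos k c) (R.placeBefore k c)

/-- The points `P_k` (as `Sum.inl k`) next to the last box and `Q_k` (as `Sum.inr k`) next to the
first box of the ribbon `[a_k, b_k)_R`. -/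
def shuffleBoundary {n : ℕ} (a b : Fin n → ℤ) : Fin n ⊕ Fin n → ℤ × ℤ
  | Sum.inl k => R.placeAfter k (b k - 1)
  | Sum.inr k => R.placeBefore k (a k)

/-- The Temperley–Lieb type `ψ(T)` of a shuffle tableau: two of the points `P_1, …, P_n,
Q_1, …, Q_n` are matched if they are joined by the lines of `T`. Here `P_i` corresponds to `L_i` and
`Q_i` to `R_i`. -/
def tlType {n : ℕ} (a b : Fin n → ℤ) (T : Tableau (R.shuffleShape a b)) :
    Setoid (Fin n ⊕ Fin n) :=
  Setoid.comap (R.shuffleBoundary a b) (Relation.EqvGen.setoid (R.ShuffleLine a b T))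

end InfiniteRibbon

end RibbonTL

namespace RibbonTL

/-! ### Two consecutive columns of values

`lo` and `hi` are the first `n` values of two adjacent columns. -/

/-- The strands `q` and `q + 1` exchange their partners between two adjacent columns. -/
def Chip (n : ℕ) (lo hi : ℕ → ℕ) (q : ℕ) : Prop := q + 1 < n ∧ lo (q + 1) ≤ hi q

instance (n : ℕ) (lo hi : ℕ → ℕ) (q : ℕ) : Decidable (Chip n lo hi q) :=
  inferInstanceAs (Decidable (_ ∧ _))

/-- The colour of the first strand that arrives at the place `q` between two columns. -/
def inFlip (n : ℕ) (lo hi : ℕ → ℕ) (flo fhi : ℕ → Bool) : ℕ → Bool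
  | 0 => flo 0
  | q + 1 => if Chip n lo hi q then fhi q else flo (q + 1)

/-- The colour of the second strand that arrives at the place `q` between two columns. -/
def outFlip (n : ℕ) (lo hi : ℕ → ℕ) (flo fhi : ℕ → Bool) (q : ℕ) : Bool :=
  if Chip n lo hi q then flo (q + 1) else fhi q

/-- Colourings of two adjacent columns that are constant along the lines between them. -/
def Compat (n : ℕ) (lo hi : ℕ → ℕ) (flo fhi : ℕ → Bool) : Prop :=
  ∀ q < n, inFlip n lo hi flo fhi q = outFlip n lo hi flo fhi q

/-- The inequalities between adjacent columns of a shuffle tableau. -/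
def GapOK (n : ℕ) (lo hi : ℕ → ℕ) : Prop :=
  (∀ q < n, lo q ≤ hi q) ∧ ∀ q, q + 2 < n → hi q < lo (q + 2)

/-- Number of the first `p` strands that have colour `κ`. -/
def colCount (η : ℕ → Bool) (κ : Bool) (p : ℕ) : ℕ := ((Finset.range p).filter (η · = κ)).card

theorem colCount_zero (η κ) : colCount η κ 0 = 0 := by simp [colCount]

theorem colCount_succ (η κ p) :
    colCount η κ (p + 1) = colCount η κ p + if η p = κ then 1 else 0 := by
  unfold colCount
  rw [Finset.range_add_one, Finset.filter_insert]
  split_ifs <;> simp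

theorem colCount_add (η p) : colCount η true p + colCount η false p = p := by
  induction p with
  | zero => simp [colCount_zero]
  | succ p ih => rw [colCount_succ, colCount_succ]; cases η p <;> simp <;> omega

theorem colCount_mono (η κ) {p q : ℕ} (h : p ≤ q) : colCount η κ p ≤ colCount η κ q := by
  unfold colCount
  exact Finset.card_le_card (Finset.filter_subset_filter _ (Finset.range_subset_range.2 h))

/-- The colour of a strand relative to the alternating colouring. -/
def flipOf (η : ℕ → Bool) (k : ℕ) : Bool := xor (η k) (Nat.bodd k)

/-- The balance of colours after the place `q`. -/
def Balanced (n : ℕ) (lo hi : ℕ → ℕ) (η η' : ℕ → Bool) (q : ℕ) : Prop :=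
  if Chip n lo hi q then ∀ κ, colCount η κ (q + 2) = colCount η' κ q + 1
  else ∀ κ, colCount η κ (q + 1) = colCount η' κ (q + 1)

/-- Given the balance at the place before, the balance at a place concerns only the two strands that
meet there. If they lie in the same column, their indices are consecutive and the balance asks for
different colours. If they lie in different columns, their indices have the same parity and the
balance asks for equal colours. In both cases this says that the colours relative to the alternating
colouring agree. -/
theorem compat_iff_balanced (n : ℕ) (lo hi : ℕ → ℕ) (η η' : ℕ → Bool) :
    Compat n lo hi (flipOf η) (flipOf η') ↔ ∀ q < n, Balanced n lo hi η η' q := by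
  suffices h : ∀ m ≤ n, (∀ q < m, inFlip n lo hi (flipOf η) (flipOf η') q =
      outFlip n lo hi (flipOf η) (flipOf η') q) ↔ ∀ q < m, Balanced n lo hi η η' q from
    h n le_rfl
  intro m
  induction m with
  | zero => simp
  | succ m ih =>
    intro hm
    rw [Nat.forall_lt_succ_right, Nat.forall_lt_succ_right, ih (by omega)]
    refine and_congr_right fun hprev => ?_
    unfold Balanced outFlip
    rcases m with _ | m
    · simp only [inFlip, Bool.forall_bool, colCount_succ, colCount_zero, flipOf, Nat.bodd_zero,
        Nat.bodd_succ]
      by_cases h2 : Chip n lo hi 0 <;> simp only [h2, if_true, if_false] <;>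
      cases h3 : η 0 <;> cases h4 : η 1 <;> cases h5 : η' 0 <;>
        simp [h3, h4, h5, colCount_succ, colCount_zero]
    · have hp := hprev m (by omega)
      unfold Balanced at hp
      simp only [inFlip]
      by_cases h1 : Chip n lo hi m
      · simp only [h1, if_true] at hp ⊢
        simp only [Bool.forall_bool, colCount_succ, flipOf, Nat.bodd_succ] at hp ⊢
        by_cases h2 : Chip n lo hi (m + 1) <;> simp only [h2, if_true, if_false] <;>
        cases h3 : η m <;> cases h4 : η (m + 1) <;> cases h5 : η (m + 2) <;> cases h6 : η' m <;>
          cases h7 : η' (m + 1) <;> cases h8 : m.bodd <;>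
          simp [h3, h4, h5, h6, h7, h8] at hp ⊢ <;> omega
      · simp only [h1, if_false] at hp ⊢
        simp only [Bool.forall_bool, colCount_succ, flipOf, Nat.bodd_succ] at hp ⊢
        by_cases h2 : Chip n lo hi (m + 1) <;> simp only [h2, if_true, if_false] <;>
        cases h3 : η m <;> cases h4 : η (m + 1) <;> cases h5 : η (m + 2) <;> cases h6 : η' m <;>
          cases h7 : η' (m + 1) <;> cases h8 : m.bodd <;>
          simp [h3, h4, h5, h6, h7, h8] at hp ⊢ <;> omega

/-- For each colour, the values in two adjacent columns interlace. -/
def Interlace (n : ℕ) (lo hi : ℕ → ℕ) (η η' : ℕ → Bool) : Prop :=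
  ∀ κ x, ((Finset.range n).filter fun i => hi i ≤ x ∧ η' i = κ).card ≤
      ((Finset.range n).filter fun i => lo i ≤ x ∧ η i = κ).card ∧
    ((Finset.range n).filter fun i => lo i ≤ x ∧ η i = κ).card ≤
      ((Finset.range n).filter fun i => hi i < x ∧ η' i = κ).card + 1

theorem exists_threshold (n : ℕ) (P : ℕ → Prop) (hP : ∀ i j, i ≤ j → j < n → P j → P i) :
    ∃ N ≤ n, ∀ i < n, (P i ↔ i < N) := by
  classical
  induction n with
  | zero => exact ⟨0, le_rfl, by simp⟩
  | succ n ih =>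
    obtain ⟨N, hN, h⟩ := ih fun i j hij hj => hP i j hij (by omega)
    by_cases hn : P n
    · exact ⟨n + 1, le_rfl, fun i hi => ⟨fun _ => hi, fun _ => hP i n (by omega) (by omega) hn⟩⟩
    · refine ⟨N, by omega, fun i hi => ?_⟩
      rcases Nat.lt_succ_iff_lt_or_eq.1 hi with hi | rfl
      · exact h i hi
      · exact ⟨fun h => absurd h hn, fun h => by omega⟩

theorem card_filter_threshold {n N : ℕ} (hN : N ≤ n) {P : ℕ → Prop} [DecidablePred P]
    (h : ∀ i < n, (P i ↔ i < N)) (η : ℕ → Bool) (κ : Bool) :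
    ((Finset.range n).filter fun i => P i ∧ η i = κ).card = colCount η κ N := by
  unfold colCount
  congr 1
  ext i
  simp only [Finset.mem_filter, Finset.mem_range]
  constructor
  · rintro ⟨a, b, c⟩; exact ⟨(h i a).1 b, c⟩
  · rintro ⟨a, c⟩; exact ⟨by omega, (h i (by omega)).2 a, c⟩

/-- A threshold `x` cuts sorted columns into initial segments, of length `N` in `lo` and of lengths
`N'` (values `≤ x`) and `N''` (values `< x`) in `hi`. Adding up the two colours in the interlacing
inequalities gives `N' ≤ N ≤ N'' + 2`, which amounts to `GapOK`. For suitable thresholds one of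
these bounds is attained, the upper one at a chip and the lower one elsewhere. Then it is attained
in each colour separately, and this is the balance at the place. -/
theorem interlace_iff {n : ℕ} {lo hi : ℕ → ℕ} (hlo : ∀ i j, i ≤ j → j < n → lo i ≤ lo j)
    (hhi : ∀ i j, i ≤ j → j < n → hi i ≤ hi j) (η η' : ℕ → Bool) :
    Interlace n lo hi η η' ↔ GapOK n lo hi ∧ Compat n lo hi (flipOf η) (flipOf η') := by
  rw [compat_iff_balanced]
  have tlo : ∀ x, ∃ N ≤ n, ∀ i < n, (lo i ≤ x ↔ i < N) := fun x =>
    exists_threshold n (fun i => lo i ≤ x) fun i j hij hj h => (hlo i j hij hj).trans h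
  have thi : ∀ x, ∃ N ≤ n, ∀ i < n, (hi i ≤ x ↔ i < N) := fun x =>
    exists_threshold n (fun i => hi i ≤ x) fun i j hij hj h => (hhi i j hij hj).trans h
  have thi' : ∀ x, ∃ N ≤ n, ∀ i < n, (hi i < x ↔ i < N) := fun x =>
    exists_threshold n (fun i => hi i < x) fun i j hij hj h => (hhi i j hij hj).trans_lt h
  constructor
  · intro H
    have H' : ∀ x N N' N'', N ≤ n → N' ≤ n → N'' ≤ n → (∀ i < n, (lo i ≤ x ↔ i < N)) →
        (∀ i < n, (hi i ≤ x ↔ i < N')) → (∀ i < n, (hi i < x ↔ i < N'')) →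
        ∀ κ, colCount η' κ N' ≤ colCount η κ N ∧ colCount η κ N ≤ colCount η' κ N'' + 1 := by
      intro x N N' N'' h1 h2 h3 h4 h5 h6 κ
      have := H κ x
      rwa [card_filter_threshold h1 h4, card_filter_threshold h2 h5,
        card_filter_threshold h3 h6] at this
    have G : GapOK n lo hi := by
      constructor
      · intro q hq
        obtain ⟨N, h1, h4⟩ := tlo (hi q)
        obtain ⟨N', h2, h5⟩ := thi (hi q)
        obtain ⟨N'', h3, h6⟩ := thi' (hi q)
        have h := H' _ _ _ _ h1 h2 h3 h4 h5 h6
        have := h true; have := h false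
        have := colCount_add η N; have := colCount_add η' N'
        have := (h5 q hq).1 le_rfl
        exact (h4 q hq).2 (by omega)
      · intro q hq
        obtain ⟨N, h1, h4⟩ := tlo (lo (q + 2))
        obtain ⟨N', h2, h5⟩ := thi (lo (q + 2))
        obtain ⟨N'', h3, h6⟩ := thi' (lo (q + 2))
        have h := H' _ _ _ _ h1 h2 h3 h4 h5 h6
        have := h true; have := h false
        have := colCount_add η N; have := colCount_add η' N''
        have := (h4 (q + 2) hq).1 le_rfl
        exact (h6 q (by omega)).2 (by omega)
    refine ⟨G, fun q hq => ?_⟩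
    unfold Balanced
    split_ifs with hc
    -- At a chip the threshold `lo (q + 1)` gives `q + 2 ≤ N` and `N'' ≤ q`, so the upper bounds of
    -- both colours are equalities.
    · obtain ⟨N, h1, h4⟩ := tlo (lo (q + 1))
      obtain ⟨N', h2, h5⟩ := thi (lo (q + 1))
      obtain ⟨N'', h3, h6⟩ := thi' (lo (q + 1))
      have h := H' _ _ _ _ h1 h2 h3 h4 h5 h6
      have e1 := (h4 (q + 1) hc.1).1 le_rfl
      have e2 : N'' ≤ q := by
        by_contra hlt
        have := (h6 q hq).2 (by omega)
        have := hc.2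
        omega
      have := h true; have := h false
      have := colCount_add η (q + 2); have := colCount_add η' q
      have := fun κ => colCount_mono η κ (show q + 2 ≤ N by omega)
      have m1 := this true; have m2 := this false
      have := fun κ => colCount_mono η' κ e2
      have m3 := this true; have m4 := this false
      rw [Bool.forall_bool]; omega
    -- Without a chip the threshold `hi q` gives `N = q + 1 ≤ N'`, so the lower bounds of both
    -- colours are equalities.
    · obtain ⟨N, h1, h4⟩ := tlo (hi q)
      obtain ⟨N', h2, h5⟩ := thi (hi q)
      obtain ⟨N'', h3, h6⟩ := thi' (hi q)
      have h := H' _ _ _ _ h1 h2 h3 h4 h5 h6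
      have e1 := (h5 q hq).1 le_rfl
      have e2 : N = q + 1 := by
        have a1 := (h4 q hq).1 (G.1 q hq)
        by_contra hne
        have a2 : q + 1 < n := by omega
        have a3 := (h4 (q + 1) a2).2 (by omega)
        exact hc ⟨a2, a3⟩
      subst e2
      have := h true; have := h false
      have := colCount_add η (q + 1); have := colCount_add η' (q + 1)
      have := fun κ => colCount_mono η' κ (show q + 1 ≤ N' by omega)
      have m1 := this true; have m2 := this false
      rw [Bool.forall_bool]; omega
  · rintro ⟨G, S⟩ κ x
    obtain ⟨N, h1, h4⟩ := tlo x
    obtain ⟨N', h2, h5⟩ := thi x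
    obtain ⟨N'', h3, h6⟩ := thi' x
    rw [card_filter_threshold h1 h4, card_filter_threshold h2 h5, card_filter_threshold h3 h6]
    constructor
    · rcases N' with _ | q
      · simp [colCount_zero]
      · have s := S q (by omega)
        unfold Balanced at s
        have e1 := (h5 q (by omega)).2 (by omega)
        split_ifs at s with hc
        · have e2 := (h4 (q + 1) hc.1).1 (hc.2.trans e1)
          have := s κ
          have := colCount_mono η κ (show q + 2 ≤ N by omega)
          have := colCount_succ η' κ q
          split_ifs at this <;> omega
        · have e2 := (h4 q (by omega)).1 ((G.1 q (by omega)).trans e1)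
          have := s κ
          have := colCount_mono η κ (show q + 1 ≤ N by omega)
          omega
    · rcases N with _ | q
      · simp [colCount_zero]
      · have s := S q (by omega)
        unfold Balanced at s
        have e1 := (h4 q (by omega)).2 (by omega)
        have key : colCount η κ (q + 1) ≤ colCount η' κ q + 1 := by
          split_ifs at s with hc
          · have := s κ
            have := colCount_mono η κ (show q + 1 ≤ q + 2 by omega)
            omega
          · have := s κ
            have := colCount_succ η' κ q
            split_ifs at this <;> omega
        by_cases hq : q ≤ N''
        · have := colCount_mono η' κ hq
          omega
        -- Here `N'' = r`, so `hi r` is at least `x` and hence at least `lo (r + 1)`. There is a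
        -- chip at `r`, and its balance is the required bound.
        · obtain ⟨r, rfl⟩ : ∃ r, q = r + 1 := ⟨q - 1, by omega⟩
          have e2 : r ≤ N'' := by
            rcases r with _ | r
            · omega
            · have := (h6 r (by omega)).1 ((G.2 r (by omega)).trans_le e1)
              omega
          have e3 : ¬ hi r < x := fun h => by
            have := (h6 r (by omega)).1 h
            omega
          have s' := S r (by omega)
          unfold Balanced at s'
          rw [if_pos ⟨by omega, by omega⟩] at s'
          have := s' κ
          have := colCount_mono η' κ e2
          simp only [Nat.add_assoc, Nat.reduceAdd] at *
          omega

/-! ### Inverted pairs form small closed loops -/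

/-- The strand `k` is out of order, or tied, with one of its neighbours. -/
def Inverted (n : ℕ) (v : ℕ → ℕ) (k : ℕ) : Prop :=
  (k + 1 < n ∧ v (k + 1) ≤ v k) ∨ ∃ j, j + 1 = k ∧ v k ≤ v j

open Classical in
/-- The colouring `f`, reset on the inverted strands. -/
noncomputable def resetFlip (n : ℕ) (v : ℕ → ℕ) (f : ℕ → Bool) (k : ℕ) : Bool :=
  if Inverted n v k then false else f k

/-- The cells that meet at a place are both inverted or both not inverted. -/
theorem inFlip_outFlip_cases {n : ℕ} {lo hi : ℕ → ℕ} (G : GapOK n lo hi) {q : ℕ} (hq : q < n)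
    (flo fhi : ℕ → Bool) :
    (inFlip n lo hi (resetFlip n lo flo) (resetFlip n hi fhi) q = false ∧
      outFlip n lo hi (resetFlip n lo flo) (resetFlip n hi fhi) q = false) ∨
    (inFlip n lo hi (resetFlip n lo flo) (resetFlip n hi fhi) q = inFlip n lo hi flo fhi q ∧
      outFlip n lo hi (resetFlip n lo flo) (resetFlip n hi fhi) q = outFlip n lo hi flo fhi q ∧
      (q + 1 < n → ¬ Inverted n lo (q + 1) ∨ ¬ Inverted n hi q) ∧
      (∀ r, r + 1 = q → ¬ Inverted n lo q ∨ ¬ Inverted n hi r)) := by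
  have g1 := G.1
  have g2 := G.2
  unfold outFlip resetFlip
  rcases q with _ | r
  · simp only [inFlip]
    have a1 := g1 0 hq
    have a2 := g1 1
    have a3 := g2 0
    by_cases hc : Chip n lo hi 0
    · have e : Inverted n lo 0 ↔ Inverted n lo 1 := by
        unfold Chip at hc; unfold Inverted; constructor
        · rintro (h | ⟨j, h, _⟩)
          · exact Or.inr ⟨0, rfl, h.2⟩
          · omega
        · rintro (h | ⟨j, h, h'⟩)
          · have := a3 h.1; simp only [Nat.add_assoc, Nat.reduceAdd, Nat.zero_add] at *; omega
          · obtain rfl : j = 0 := by omega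
            exact Or.inl ⟨hc.1, h'⟩
      by_cases h0 : Inverted n lo 0
      · left; simp [hc, h0, e.1 h0]
      · right; simp [hc, h0, mt e.2 h0]
    · have e1 : ¬ Inverted n lo 0 := by
        unfold Chip at hc; unfold Inverted
        rintro (h | ⟨j, h, _⟩)
        · apply hc; omega
        · omega
      have e2 : ¬ Inverted n hi 0 := by
        unfold Chip at hc; unfold Inverted
        rintro (h | ⟨j, h, _⟩)
        · apply hc; have := a2 h.1; simp only [Nat.add_assoc, Nat.reduceAdd, Nat.zero_add] at *; omega
        · omega
      right; simp [hc, e1, e2]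
  · simp only [inFlip]
    have a1 := g1 r (by omega)
    have a2 := g1 (r + 1) hq
    have a3 := g2 r
    have a4 := g2 (r + 1)
    have a5 := g1 (r + 2)
    have a6 : ∀ j, j + 1 = r → hi j < lo (r + 1) := by
      rintro j rfl; exact g2 j hq
    -- The strands that meet at the place `r + 1` are, in the order of the four cases: `hi r` and
    -- `lo (r + 2)`; `lo (r + 1)` and `lo (r + 2)`; `hi r` and `hi (r + 1)`; `lo (r + 1)` and `hi (r
    -- + 1)`. Two strands of the same column can only be inverted with each other. Two strands of
    -- different columns are both not inverted.
    by_cases hc : Chip n lo hi (r + 1) <;> by_cases hd : Chip n lo hi r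
    · have e1 : ¬ Inverted n hi r := by
        unfold Chip at hc hd; unfold Inverted
        rintro (h | ⟨j, h, h'⟩)
        · simp only [Nat.add_assoc, Nat.reduceAdd, Nat.zero_add] at *; omega
        · have := a6 j h; simp only [Nat.add_assoc, Nat.reduceAdd, Nat.zero_add] at *; omega
      have e2 : ¬ Inverted n lo (r + 2) := by
        unfold Chip at hc hd; unfold Inverted
        rintro (h | ⟨j, h, h'⟩)
        · have := a4 h.1; simp only [Nat.add_assoc, Nat.reduceAdd, Nat.zero_add] at *; omega
        · obtain rfl : j = r + 1 := by omega
          omega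
      right; simp only [hc, hd, e1, e2, if_true, if_false, true_and]
      refine ⟨fun _ => by simp, fun s hs => ?_⟩
      obtain rfl : s = r := by omega
      simp [e1]
    · have e : Inverted n lo (r + 1) ↔ Inverted n lo (r + 2) := by
        unfold Chip at hc hd; unfold Inverted; constructor
        · rintro (h | ⟨j, h, h'⟩)
          · exact Or.inr ⟨r + 1, rfl, h.2⟩
          · obtain rfl : j = r := by omega
            omega
        · rintro (h | ⟨j, h, h'⟩)
          · have := a4 h.1; simp only [Nat.add_assoc, Nat.reduceAdd, Nat.zero_add] at *; omega
          · obtain rfl : j = r + 1 := by omega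
            exact Or.inl ⟨hc.1, h'⟩
      by_cases h0 : Inverted n lo (r + 1)
      · left; simp [hc, hd, h0, e.1 h0]
      · right; simp only [hc, hd, h0, mt e.2 h0, if_true, if_false, true_and]
        exact ⟨fun _ => Or.inl not_false, fun _ _ => Or.inl (not_false)⟩
    · have e : Inverted n hi r ↔ Inverted n hi (r + 1) := by
        unfold Chip at hc hd; unfold Inverted; constructor
        · rintro (h | ⟨j, h, h'⟩)
          · exact Or.inr ⟨r, rfl, h.2⟩
          · have := a6 j h; omega
        · rintro (h | ⟨j, h, h'⟩)
          · exfalso; apply hc; have := a5 h.1; simp only [Nat.add_assoc, Nat.reduceAdd, Nat.zero_add] at *; omega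
          · obtain rfl : j = r := by omega
            exact Or.inl ⟨hd.1, h'⟩
      by_cases h0 : Inverted n hi r
      · left; simp [hc, hd, h0, e.1 h0]
      · right; simp only [hc, hd, h0, mt e.2 h0, if_true, if_false, true_and]
        exact ⟨fun _ => Or.inr (not_false), fun s hs => by obtain rfl : s = r := by omega
                                                           exact Or.inr h0⟩
    · have e1 : ¬ Inverted n lo (r + 1) := by
        unfold Chip at hc hd; unfold Inverted
        rintro (h | ⟨j, h, h'⟩)
        · apply hc; simp only [Nat.add_assoc, Nat.reduceAdd, Nat.zero_add] at *; omega
        · obtain rfl : j = r := by omega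
          apply hd; omega
      have e2 : ¬ Inverted n hi (r + 1) := by
        unfold Chip at hc hd; unfold Inverted
        rintro (h | ⟨j, h, h'⟩)
        · apply hc; have := a5 h.1; simp only [Nat.add_assoc, Nat.reduceAdd, Nat.zero_add] at *; omega
        · obtain rfl : j = r := by omega
          apply hd; omega
      right; simp only [hc, hd, e1, e2, if_false, true_and]
      exact ⟨fun _ => Or.inr not_false, fun _ _ => Or.inl not_false⟩

/-- At each place either both colours are reset or both are kept, so erasing the colours of inverted
strands cannot break the agreement. -/
theorem Compat.reset {n : ℕ} {lo hi : ℕ → ℕ} (G : GapOK n lo hi) {flo fhi : ℕ → Bool}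
    (h : Compat n lo hi flo fhi) :
    Compat n lo hi (resetFlip n lo flo) (resetFlip n hi fhi) := by
  intro q hq
  rcases inFlip_outFlip_cases G hq flo fhi with ⟨h1, h2⟩ | ⟨h1, h2, -⟩
  · rw [h1, h2]
  · rw [h1, h2, h q hq]

/-- `w` is the increasing rearrangement of the first `n` values of `v`. -/
def IsSorting (n : ℕ) (v w : ℕ → ℕ) : Prop :=
  (∀ i j, i ≤ j → j < n → w i ≤ w j) ∧
    ∀ x, ((Finset.range n).filter (v · ≤ x)).card = ((Finset.range n).filter (w · ≤ x)).card

theorem IsSorting.le_iff {n : ℕ} {v w : ℕ → ℕ} (h : IsSorting n v w) {k : ℕ} (hk : k < n) (x : ℕ) :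
    w k ≤ x ↔ k < ((Finset.range n).filter (v · ≤ x)).card := by
  obtain ⟨N, hN, hw⟩ := exists_threshold n (w · ≤ x) fun i j hij hj h' => (h.1 i j hij hj).trans h'
  have : (Finset.range n).filter (w · ≤ x) = Finset.range N := by
    ext i; simp only [Finset.mem_filter, Finset.mem_range]
    constructor
    · rintro ⟨a, b⟩; exact (hw i a).1 b
    · intro a; exact ⟨by omega, (hw i (by omega)).2 a⟩
  rw [h.2, this, Finset.card_range]
  exact hw k hk

/-- If everything below `k + 1` is at most `x` then the `k`-th sorted value is at most `x`. -/
theorem IsSorting.le_of {n : ℕ} {v w : ℕ → ℕ} (h : IsSorting n v w) {k : ℕ} (hk : k < n) {x : ℕ}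
    (hx : ∀ i ≤ k, v i ≤ x) : w k ≤ x := by
  rw [h.le_iff hk]
  refine lt_of_lt_of_le (Nat.lt_succ_self k) ?_
  rw [Nat.succ_eq_add_one]
  rw [← Finset.card_range (k + 1)]
  refine Finset.card_le_card fun i hi => ?_
  simp only [Finset.mem_filter, Finset.mem_range] at hi ⊢
  exact ⟨by omega, hx i (by omega)⟩

theorem IsSorting.lt_of {n : ℕ} {v w : ℕ → ℕ} (h : IsSorting n v w) {k : ℕ} (hk : k < n) {x : ℕ}
    (hx : ∀ i, k ≤ i → i < n → x < v i) : x < w k := by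
  rw [← not_le, h.le_iff hk, not_lt]
  rw [← Finset.card_range k]
  refine Finset.card_le_card fun i hi => ?_
  simp only [Finset.mem_filter, Finset.mem_range] at hi ⊢
  by_contra hlt
  have := hx i (by omega) hi.1
  omega

/-- Values that increase in steps of two. -/
def TwoStep (n : ℕ) (v : ℕ → ℕ) : Prop := ∀ q, q + 2 < n → v q < v (q + 2)

theorem TwoStep.lt {n : ℕ} {v : ℕ → ℕ} (h : TwoStep n v) (i d : ℕ) (hi : i + 2 * (d + 1) < n) :
    v i < v (i + 2 * (d + 1)) := by
  induction d with
  | zero => exact h i hi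
  | succ d ih => exact (ih (by omega)).trans (h _ (by omega))

/-- Below and above a strand, a bound for the two nearest values bounds all values. -/
theorem TwoStep.le_below {n : ℕ} {v : ℕ → ℕ} (h : TwoStep n v) {k x : ℕ} (hk : k < n)
    (h0 : v k ≤ x) (h1 : ∀ j, j + 1 = k → v j ≤ x) : ∀ i ≤ k, v i ≤ x := by
  intro i hi
  obtain ⟨d, hd⟩ : ∃ d, k = i + d := ⟨k - i, by omega⟩
  rcases Nat.even_or_odd' d with ⟨e, rfl | rfl⟩
  · rcases e with _ | e
    · simp at hd; rwa [← hd]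
    · have := h.lt i e (by omega); rw [hd] at h0; omega
  · have h1' := h1 (i + 2 * e) (by omega)
    rcases e with _ | e
    · simpa using h1'
    · have := h.lt i e (by omega); omega

theorem TwoStep.lt_above {n : ℕ} {v : ℕ → ℕ} (h : TwoStep n v) {k x : ℕ} 
    (h0 : x < v k) (h1 : k + 1 < n → x < v (k + 1)) : ∀ i, k ≤ i → i < n → x < v i := by
  intro i hi hn
  obtain ⟨d, rfl⟩ : ∃ d, i = k + d := ⟨i - k, by omega⟩
  rcases Nat.even_or_odd' d with ⟨e, rfl | rfl⟩
  · rcases e with _ | e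
    · simpa
    · have := h.lt k e (by omega); omega
  · have h1' := h1 (by omega)
    rcases e with _ | e
    · simpa using h1'
    · have := h.lt (k + 1) e (by omega)
      rw [show k + (2 * (e + 1) + 1) = k + 1 + 2 * (e + 1) by omega]; omega

theorem GapOK.twoStep_lo {n : ℕ} {lo hi : ℕ → ℕ} (G : GapOK n lo hi) : TwoStep n lo :=
  fun q hq => (G.1 q (by omega)).trans_lt (G.2 q hq)

theorem GapOK.twoStep_hi {n : ℕ} {lo hi : ℕ → ℕ} (G : GapOK n lo hi) : TwoStep n hi :=
  fun q hq => (G.2 q hq).trans_le (G.1 (q + 2) hq)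

/-- A strand in strict order with its two neighbours is, because values increase in steps of two,
above everything before it and below everything after it. Sorting leaves it in place. -/
theorem IsSorting.eq_of_not_inverted {n : ℕ} {v w : ℕ → ℕ} (hs : IsSorting n v w)
    (h : TwoStep n v) {k : ℕ} (hk : k < n) (hi : ¬ Inverted n v k) : w k = v k := by
  unfold Inverted at hi
  push Not at hi
  have below := h.le_below (x := v k) hk le_rfl fun j hj => (hi.2 j hj).le
  refine le_antisymm (hs.le_of hk below) ?_
  by_contra hlt
  rw [not_le] at hlt
  have := hs.lt_of (x := v k - 1) hk (h.lt_above (by omega) fun h' => by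
    have := hi.1 h'; omega)
  omega

/-- The value that is not inverted does not move. If the other value is on one side of it, then so
are all earlier values of its column (when it is smaller) or all later ones (when it is larger).
Therefore the sorted value is on the same side. -/
theorem chip_iff_of_not_inverted {n : ℕ} {lo hi lo' hi' : ℕ → ℕ} (G : GapOK n lo hi)
    (sl : IsSorting n lo lo') (sh : IsSorting n hi hi') {q : ℕ} (hq : q + 1 < n)
    (h : ¬ Inverted n lo (q + 1) ∨ ¬ Inverted n hi q) : Chip n lo' hi' q ↔ Chip n lo hi q := by
  unfold Chip
  simp only [hq, true_and]
  rcases h with h | h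
  · rw [sl.eq_of_not_inverted G.twoStep_lo hq h]
    constructor
    · intro h1
      by_contra h2
      have := sh.le_of (k := q) (x := lo (q + 1) - 1) (by omega)
        (G.twoStep_hi.le_below (by omega) (by omega) fun j hj => by
          subst hj; have := G.2 j (by omega); simp only [Nat.add_assoc, Nat.reduceAdd] at *; omega)
      omega
    · intro h1
      have h3 := G.1 (q + 1) hq
      by_contra h2
      obtain ⟨y, hy⟩ : ∃ y, lo (q + 1) = y + 1 := ⟨lo (q + 1) - 1, by omega⟩
      have := sh.lt_of (k := q) (x := y) (by omega)
        (G.twoStep_hi.lt_above (by omega) fun _ => by omega)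
      omega
  · rw [sh.eq_of_not_inverted G.twoStep_hi (by omega) h]
    constructor
    · intro h1
      by_contra h2
      have := sl.lt_of (k := q + 1) (x := hi q) (by omega)
        (G.twoStep_lo.lt_above (by omega) fun h' => G.2 q h')
      omega
    · intro h1
      exact sl.le_of hq (G.twoStep_lo.le_below hq h1 fun j hj => by
        obtain rfl : j = q := by omega
        exact G.1 j (by omega))

/-- Sorting the columns does not change the colourings that vanish on the inverted strands. -/
theorem flips_sorting {n : ℕ} {lo hi lo' hi' : ℕ → ℕ} (G : GapOK n lo hi)
    (sl : IsSorting n lo lo') (sh : IsSorting n hi hi') {flo fhi : ℕ → Bool}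
    (zl : ∀ k < n, Inverted n lo k → flo k = false) (zh : ∀ k < n, Inverted n hi k → fhi k = false)
    {q : ℕ} (hq : q < n) :
    inFlip n lo' hi' flo fhi q = inFlip n lo hi flo fhi q ∧
      outFlip n lo' hi' flo fhi q = outFlip n lo hi flo fhi q := by
  have key : ∀ r, r + 1 < n → (Chip n lo' hi' r ↔ Chip n lo hi r) ∨
      (flo (r + 1) = false ∧ fhi r = false) := by
    intro r hr
    by_cases h1 : Inverted n lo (r + 1)
    · by_cases h2 : Inverted n hi r
      · exact Or.inr ⟨zl _ hr h1, zh _ (by omega) h2⟩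
      · exact Or.inl (chip_iff_of_not_inverted G sl sh hr (Or.inr h2))
    · exact Or.inl (chip_iff_of_not_inverted G sl sh hr (Or.inl h1))
  constructor
  · rcases q with _ | r
    · rfl
    · simp only [inFlip]
      rcases key r hq with h | ⟨h, h'⟩
      · simp only [h]
      · simp [h, h']
  · unfold outFlip
    by_cases hq' : q + 1 < n
    · rcases key q hq' with h | ⟨h, h'⟩
      · simp only [h]
      · simp [h, h']
    · simp [Chip, hq']

theorem Compat.sort {n : ℕ} {lo hi lo' hi' : ℕ → ℕ} (G : GapOK n lo hi)
    (sl : IsSorting n lo lo') (sh : IsSorting n hi hi') {flo fhi : ℕ → Bool}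
    (h : Compat n lo hi flo fhi) :
    Compat n lo' hi' (resetFlip n lo flo) (resetFlip n hi fhi) := by
  intro q hq
  have := flips_sorting G sl sh (flo := resetFlip n lo flo) (fhi := resetFlip n hi fhi)
    (fun k _ hk => if_pos hk) (fun k _ hk => if_pos hk) hq
  rw [this.1, this.2]
  exact h.reset G q hq

/-- Sorting can change chips only between two inverted strands, and there the reset colours vanish.
At every other place the chips before and after sorting are the same. -/
theorem Compat.unsort {n : ℕ} {lo hi lo' hi' : ℕ → ℕ} (G : GapOK n lo hi)
    (sl : IsSorting n lo lo') (sh : IsSorting n hi hi') {flo fhi : ℕ → Bool}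
    (h : Compat n lo' hi' flo fhi) :
    Compat n lo hi (resetFlip n lo flo) (resetFlip n hi fhi) := by
  intro q hq
  rcases inFlip_outFlip_cases G hq flo fhi with ⟨h1, h2⟩ | ⟨h1, h2, h3, h4⟩
  · rw [h1, h2]
  · rw [h1, h2]
    have hin : inFlip n lo hi flo fhi q = inFlip n lo' hi' flo fhi q := by
      rcases q with _ | r
      · rfl
      · simp only [inFlip, chip_iff_of_not_inverted G sl sh hq (h4 r rfl)]
    have hout : outFlip n lo hi flo fhi q = outFlip n lo' hi' flo fhi q := by
      unfold outFlip
      by_cases hq' : q + 1 < n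
      · simp only [chip_iff_of_not_inverted G sl sh hq' (h3 hq')]
      · simp [Chip, hq']
    rw [hin, hout, h q hq]

/-! ### Path families and determinants -/

/-- Iterating a one-step recursion gives a sum over all sequences of states. -/
theorem transfer_sum {α K : Type*} [Fintype α] [CommSemiring K] (k : ℕ → α → α → K)
    (Ψ : ℕ → α → K) (L : ℕ) (hΨ : ∀ m < L, ∀ v', Ψ (m + 1) v' = ∑ v, k m v v' * Ψ m v) :
    ∀ v', Ψ L v' = ∑ V : Fin L → α,
      Ψ 0 (Fin.snoc (α := fun _ => α) V v' 0) * ∏ m : Fin L,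
        k m (Fin.snoc (α := fun _ => α) V v' m.castSucc)
          (Fin.snoc (α := fun _ => α) V v' m.succ) := by
  induction L with
  | zero => intro v'; simp [Fin.snoc]
  | succ L ih =>
    intro v'
    rw [hΨ L L.lt_succ_self]
    rw [← (Fin.snocEquiv (fun _ : Fin (L + 1) => α)).sum_comp, Fintype.sum_prod_type]
    refine Finset.sum_congr rfl fun v _ => ?_
    rw [ih (fun m hm => hΨ m (hm.trans L.lt_succ_self)) v, Finset.mul_sum]
    refine Finset.sum_congr rfl fun V _ => ?_
    rw [Fin.prod_univ_castSucc]
    have e1 : ∀ j : Fin (L + 1), Fin.snoc (α := fun _ => α)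
        ((Fin.snocEquiv (fun _ : Fin (L + 1) => α)) (v, V)) v' j.castSucc =
        Fin.snoc (α := fun _ => α) V v j := fun j => by
      rw [Fin.snoc_castSucc]; rfl
    have e2 : Fin.snoc (α := fun _ => α)
        ((Fin.snocEquiv (fun _ : Fin (L + 1) => α)) (v, V)) v' (Fin.last L).succ = v' := by
      rw [Fin.succ_last, Fin.snoc_last]
    have e3 : ∀ j : Fin L, Fin.snoc (α := fun _ => α)
        ((Fin.snocEquiv (fun _ : Fin (L + 1) => α)) (v, V)) v' j.castSucc.succ =
        Fin.snoc (α := fun _ => α) V v j.succ := fun j => by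
      rw [← e1, Fin.succ_castSucc]
    have e0 : Fin.snoc (α := fun _ => α)
        ((Fin.snocEquiv (fun _ : Fin (L + 1) => α)) (v, V)) v' 0 =
        Fin.snoc (α := fun _ => α) V v 0 := by
      rw [← e1, Fin.castSucc_zero]
    have e4 : Fin.snoc (α := fun _ => α) V v (Fin.last L) = v := Fin.snoc_last _ _
    simp only [e0, e1, e2, e3, e4, Fin.val_castSucc, Fin.val_last]
    ring

/-- Row operations: if the rows are sums over sets that increase along each class of rows, the
determinant does not change when every set is replaced by the new part of it. -/
theorem det_increasing_sums {ι α γ K : Type*} [Fintype ι] [DecidableEq ι] [LinearOrder ι]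
    [DecidableEq α] [DecidableEq γ] [CommRing K] (cls : ι → γ) (T : ι → Finset α)
    (hT : ∀ i i', i ≤ i' → cls i = cls i' → T i ⊆ T i') (r : γ → α → ι → K) :
    Matrix.det (Matrix.of fun i j => ∑ z ∈ T i, r (cls i) z j) =
      Matrix.det (Matrix.of fun i j => ∑ z ∈ (T i).filter fun z =>
        ∀ i' < i, cls i' = cls i → z ∉ T i', r (cls i) z j) := by
  classical
  set T' : ι → Finset α := fun i => (T i).filter fun z => ∀ i' < i, cls i' = cls i → z ∉ T i'
  set A : Matrix ι ι K := Matrix.of fun i i' => if i' ≤ i ∧ cls i' = cls i then 1 else 0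
  have hA : A.det = 1 := by
    rw [Matrix.det_of_isLowerTriangular]
    · refine Finset.prod_eq_one fun i _ => ?_
      simp [A]
    · intro i j hij
      have : i < j := hij
      simp [A, this.not_ge]
  have hmul : (Matrix.of fun i j => ∑ z ∈ T i, r (cls i) z j) =
      A * (Matrix.of fun i j => ∑ z ∈ T' i, r (cls i) z j) := by
    ext i j
    rw [Matrix.mul_apply]
    -- An element of `T i` is new in exactly one row of the class, the first one that contains it.
    have hU : T i = (Finset.univ.filter fun i' => i' ≤ i ∧ cls i' = cls i).biUnion T' := by
      ext z
      simp only [Finset.mem_biUnion, Finset.mem_filter, Finset.mem_univ, true_and, T']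
      constructor
      · intro hz
        have hne : (Finset.univ.filter fun i' => cls i' = cls i ∧ z ∈ T i').Nonempty :=
          ⟨i, by simp [hz]⟩
        obtain ⟨h1, h2⟩ := (Finset.mem_filter.1 (Finset.min'_mem _ hne)).2
        refine ⟨_, ⟨Finset.min'_le _ _ (by simp [hz]), h1⟩, h2, fun i' hi' hc hz' => ?_⟩
        exact absurd (Finset.min'_le _ i' (by simp [hz', hc, h1])) (not_le.2 hi')
      · rintro ⟨i', ⟨h1, h2⟩, h3, -⟩
        exact hT _ _ h1 h2 h3
    have hdis : ∀ x ∈ (Finset.univ.filter fun i' => i' ≤ i ∧ cls i' = cls i),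
        ∀ y ∈ (Finset.univ.filter fun i' => i' ≤ i ∧ cls i' = cls i), x ≠ y →
        Disjoint (T' x) (T' y) := by
      intro x hx y hy hxy
      simp only [Finset.mem_filter, Finset.mem_univ, true_and] at hx hy
      rw [Finset.disjoint_left]
      intro z hzx hzy
      simp only [T', Finset.mem_filter] at hzx hzy
      rcases lt_or_gt_of_ne hxy with h | h
      · exact hzy.2 x h (hx.2.trans hy.2.symm) hzx.1
      · exact hzx.2 y h (hy.2.trans hx.2.symm) hzy.1
    simp only [Matrix.of_apply, A]
    conv_lhs => rw [hU]
    rw [Finset.sum_biUnion hdis, Finset.sum_filter]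
    refine Finset.sum_congr rfl fun i' _ => ?_
    by_cases h : i' ≤ i ∧ cls i' = cls i
    · simp [h]
    · simp [h]
  rw [hmul, Matrix.det_mul, hA, one_mul]

theorem det_sum_rows {ι α K : Type*} [Fintype ι] [DecidableEq ι] [DecidableEq α] [CommRing K]
    (T : ι → Finset α) (r : ι → α → ι → K) :
    Matrix.det (Matrix.of fun i j => ∑ z ∈ T i, r i z j) =
      ∑ v ∈ Fintype.piFinset T, Matrix.det (Matrix.of fun i j => r i (v i) j) := by
  have := (Matrix.detRowAlternating (R := K) (n := ι)).toMultilinearMap.map_sum_finset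
    (fun i z => r i z) T
  simp only [AlternatingMap.coe_multilinearMap] at this
  have h : (Matrix.of fun i j => ∑ z ∈ T i, r i z j) = fun i => ∑ z ∈ T i, r i z := by
    ext i j; simp [Finset.sum_apply]
  rw [h]
  exact this

/-- One step of the path families: rows that belong to strands that are idle on both sides
correspond to each other, the other rows are sums over the possible previous values. -/
theorem det_path_step {ι α K : Type*} [Fintype ι] [DecidableEq ι] [LinearOrder ι] [Fintype α]
    [LinearOrder α] [CommRing K] (χ : ι → Bool) (v' : ι → α)
    (hv' : ∀ i i', i < i' → χ i = χ i' → v' i < v' i') (idle : ι → Prop) (u : ι → α)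
    (PL : α → Prop) (rL rR : α → Bool → ι → K) (w : ι → K)
    (h1 : ∀ i, idle i → rR (v' i) (χ i) = w i • rL (u i) (χ i))
    [DecidablePred PL]
    (h2 : ∀ i, ¬ idle i → rR (v' i) (χ i) =
      w i • ∑ z ∈ Finset.univ.filter (fun z => PL z ∧ z ≤ v' i), rL z (χ i))
    (good : (ι → α) → Prop) [DecidablePred good]
    (hgood : ∀ v, good v ↔ ∀ i, (idle i → v i = u i) ∧ (¬ idle i → PL (v i) ∧ v i ≤ v' i ∧
      ∀ i' < i, χ i' = χ i → ¬ idle i' → v' i' < v i)) :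
    Matrix.det (Matrix.of fun i j => rR (v' i) (χ i) j) = (∏ i, w i) *
      ∑ v : ι → α, if good v then Matrix.det (Matrix.of fun i j => rL (v i) (χ i) j) else 0 := by
  classical
  -- Every idle row is a class of its own, so the row operations only mix rows of equal colour that
  -- are not idle.
  set cls : ι → Bool × Option ι := fun i => (χ i, if idle i then some i else none) with hcls
  set T : ι → Finset α := fun i => if idle i then {u i} else
    Finset.univ.filter (fun z => PL z ∧ z ≤ v' i) with hTdef
  have hclseq : ∀ i i', cls i = cls i' ↔ i = i' ∨ (χ i = χ i' ∧ ¬ idle i ∧ ¬ idle i') := by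
    intro i i'
    simp only [hcls, Prod.mk.injEq]
    by_cases hi : idle i <;> by_cases hi' : idle i' <;> simp [hi, hi'] <;> grind
  have hT : ∀ i i', i ≤ i' → cls i = cls i' → T i ⊆ T i' := by
    intro i i' hii' hc
    rw [hclseq] at hc
    rcases hc with rfl | ⟨hc, hi, hi'⟩
    · exact subset_rfl
    · rcases hii'.eq_or_lt with rfl | hlt
      · exact subset_rfl
      · intro z hz
        simp only [hTdef, hi, hi', if_false, Finset.mem_filter, Finset.mem_univ, true_and] at hz ⊢
        exact ⟨hz.1, hz.2.trans (hv' i i' hlt hc).le⟩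
  have hrow : (Matrix.of fun i j => rR (v' i) (χ i) j) =
      Matrix.of fun i j => w i * (∑ z ∈ T i, rL z (cls i).1 j) := by
    ext i j
    simp only [Matrix.of_apply, hcls, hTdef]
    by_cases hi : idle i
    · rw [h1 i hi]; simp [hi]
    · rw [h2 i hi]; simp [hi, Finset.sum_apply]
  rw [hrow]
  rw [show (Matrix.of fun i j => w i * (∑ z ∈ T i, rL z (cls i).1 j)) = Matrix.of fun i j =>
    w i * (Matrix.of fun i j => ∑ z ∈ T i, rL z (cls i).1 j) i j from rfl]
  rw [Matrix.det_mul_column, det_increasing_sums cls T hT (fun c z j => rL z c.1 j),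
    det_sum_rows, ← Finset.sum_filter]
  congr 1
  refine Finset.sum_congr ?_ fun v _ => rfl
  ext v
  simp only [Fintype.mem_piFinset, Finset.mem_filter, Finset.mem_univ, true_and, hgood]
  refine forall_congr' fun i => ?_
  by_cases hi : idle i
  · have : ∀ i' < i, cls i' = cls i → v i ∉ T i' := by
      intro i' hlt hc
      rw [hclseq] at hc
      rcases hc with rfl | ⟨-, -, h⟩
      · exact absurd hlt (lt_irrefl _)
      · exact absurd hi h
    simp only [hi, hTdef, if_true, Finset.mem_singleton, not_true, false_imp_iff, and_true,
      true_imp_iff, and_iff_left_iff_imp]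
    exact fun _ => this
  · simp only [hi, hTdef, if_false, Finset.mem_filter, Finset.mem_univ, true_and, not_false_iff,
      true_imp_iff, false_imp_iff, and_assoc]
    refine and_congr_right fun hP => and_congr_right fun _ => ?_
    refine forall_congr' fun i' => forall_congr' fun hlt => ?_
    rw [hclseq]
    constructor
    · intro h hc hi'
      have := h (Or.inr ⟨hc, hi', hi⟩)
      simp only [hi', if_false, Finset.mem_filter, Finset.mem_univ, true_and, not_and, not_le] at this
      exact this hP
    · rintro h (rfl | ⟨hc, hi', -⟩)
      · exact absurd hlt (lt_irrefl _)
      · simp only [hi', if_false, Finset.mem_filter, Finset.mem_univ, true_and, not_and, not_le]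
        exact fun _ => h hc hi'

/-! ### Idle strands in a step of path families -/

/-- The vertices of two adjacent columns of a graph: `σ` is a set of strands, which may be idle on
the left or on the right side (at the heights `dL`, `dR`); the other vertices are given by the
predicates `RL`, `RR`. -/
structure GapData (σ α : Type*) [LinearOrder α] where
  IL : σ → Prop
  IR : σ → Prop
  dL : σ → α
  dR : σ → α
  RL : α → Prop
  RR : α → Prop
  injL : ∀ k k', IL k → IL k' → dL k = dL k' → k = k'
  injR : ∀ k k', IR k → IR k' → dR k = dR k' → k = k'
  disjR : ∀ k, IR k → ¬ RR (dR k)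
  le : ∀ k, IL k → IR k → dL k ≤ dR k
  lt : ∀ k k', IL k → IR k → IL k' → IR k' → dR k < dR k' → dR k < dL k'
  sep : ∀ k, IL k → IR k →
    (∀ z, (RL z ∨ ∃ k', IL k' ∧ ¬ IR k' ∧ z = dL k') → dR k < z) ∨
    (∀ y, (RR y ∨ ∃ k', IR k' ∧ ¬ IL k' ∧ y = dR k') → y < dR k)
  same : ∀ k, IL k → IR k → dL k = dR k ∨ ∀ k', IL k' ∧ IR k'

/-- A family of vertices of one column that contains all idle strands with their colours. -/
def AdmFam {ι σ α : Type*} (I : σ → Prop) (d : σ → α) (R : α → Prop) (col : σ → Bool)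
    (χ : ι → Bool) (v : ι → α) : Prop :=
  (∀ i, R (v i) ∨ ∃ k, I k ∧ v i = d k ∧ χ i = col k) ∧ ∀ k, I k → ∃ i, v i = d k ∧ χ i = col k

namespace GapData

variable {σ α : Type*} [LinearOrder α] (G : GapData σ α)

/-- The vertices of the left column that lie on edges of strands that are not idle. -/
def Live (z : α) : Prop := G.RL z ∨ ∃ k, G.IL k ∧ ¬ G.IR k ∧ z = G.dL k

/-- The vertex `y` of the right column belongs to a strand that is idle on both sides. -/
def IdleAt (y : α) : Prop := ∃ k, G.IL k ∧ G.IR k ∧ y = G.dR k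

/-- The edges between two columns. -/
def Edge (z y : α) : Prop :=
  (∃ k, G.IL k ∧ G.IR k ∧ y = G.dR k ∧ z = G.dL k) ∨ (¬ G.IdleAt y ∧ G.Live z ∧ z ≤ y)

theorem edge_idle {k : σ} (hl : G.IL k) (hr : G.IR k) (z : α) :
    G.Edge z (G.dR k) ↔ z = G.dL k := by
  constructor
  · rintro (⟨k', h1, h2, h3, h4⟩ | ⟨h, -⟩)
    · rw [h4, G.injR _ _ hr h2 h3]
    · exact absurd ⟨k, hl, hr, rfl⟩ h
  · rintro rfl
    exact Or.inl ⟨k, hl, hr, rfl, rfl⟩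

theorem edge_not_idle {y : α} (hy : ¬ G.IdleAt y) (z : α) :
    G.Edge z y ↔ G.Live z ∧ z ≤ y := by
  constructor
  · rintro (⟨k', h1, h2, h3, h4⟩ | ⟨-, h⟩)
    · exact absurd ⟨k', h1, h2, h3⟩ hy
    · exact h
  · exact fun h => Or.inr ⟨hy, h⟩

/-- A strand that is idle on both sides carries the same row on both sides, since `le`, `lt` and
`same` leave no room for another row of its colour. By `sep` no other row of its colour can pass it:
either all vertices that are live on the left lie beyond it, or the remaining vertices on the right
lie before it. Only the strands that are idle on the left alone impose further conditions. They are
kept apart, because in `GapData.det_step` the determinant enforces them by itself. -/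
theorem adm_iff_edge {ι : Type*} [LinearOrder ι] [Finite σ] [Finite ι]
    (hcard : Nat.card ι = Nat.card σ) {χ : ι → Bool} {colL colR : σ → Bool}
    (hcol : ∀ k, G.IL k → G.IR k → colL k = colR k) {v v' : ι → α}
    (hA : AdmFam G.IR G.dR G.RR colR χ v') (hv' : ∀ i i', i < i' → χ i = χ i' → v' i < v' i') :
    (AdmFam G.IL G.dL G.RL colL χ v ∧ (∀ i, v i ≤ v' i) ∧
        ∀ i i', i < i' → χ i = χ i' → v' i < v i') ↔
      ((∀ i, G.Edge (v i) (v' i)) ∧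
        ∀ i, ∀ i' < i, χ i' = χ i → ¬ G.IdleAt (v' i) → ¬ G.IdleAt (v' i') → v' i' < v i) ∧
      (∀ k, G.IL k → ¬ G.IR k → ∃ i, v i = G.dL k ∧ χ i = colL k) ∧
      ∀ i k, G.IL k → ¬ G.IR k → v i = G.dL k → ¬ G.IdleAt (v' i) → ¬ G.RL (v i) →
        χ i = colL k := by
  -- There are as many rows as strands, so the rows at the vertices of the idle strands are all the
  -- rows.
  have hall : (∀ k, G.IL k ∧ G.IR k) → ∀ i, G.IdleAt (v' i) := by
    intro h i
    choose f hf hf' using fun k => hA.2 k (h k).2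
    have hinj : Function.Injective f := fun k k' hk =>
      G.injR _ _ (h k).2 (h k').2 (by rw [← hf k, ← hf k', hk])
    have hb : Function.Bijective f := by
      rw [Nat.bijective_iff_injective_and_card]; exact ⟨hinj, hcard.symm⟩
    obtain ⟨k, rfl⟩ := hb.2 i
    exact ⟨k, (h k).1, (h k).2, hf k⟩
  have hcolR : ∀ i k, G.IR k → v' i = G.dR k → χ i = colR k := by
    intro i k hk hi
    rcases hA.1 i with h | ⟨k', h1, h2, h3⟩
    · exact absurd (hi ▸ h) (G.disjR k hk)
    · rw [G.injR k k' hk h1 (hi.symm.trans h2)]; exact h3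
  have hnon : ∀ i, ¬ G.IdleAt (v' i) → G.RR (v' i) ∨ ∃ k', G.IR k' ∧ ¬ G.IL k' ∧ v' i = G.dR k' := by
    intro i hi
    rcases hA.1 i with h | ⟨k', h1, h2, h3⟩
    · exact Or.inl h
    · exact Or.inr ⟨k', h1, fun h => hi ⟨k', h, h1, h2⟩, h2⟩
  constructor
  · rintro ⟨⟨ha, hb⟩, hle, hlt⟩
    have hvinj : ∀ i i', χ i = χ i' → v i = v i' → i = i' := by
      intro i i' hc he
      rcases lt_trichotomy i i' with h | h | h
      · exact absurd ((hle i).trans_lt (hlt i i' h hc)) (he ▸ lt_irrefl _)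
      · exact h
      · exact absurd ((hle i').trans_lt (hlt i' i h hc.symm)) (he ▸ lt_irrefl _)
    have hidle : ∀ i k, G.IL k → G.IR k → v' i = G.dR k → v i = G.dL k := by
      intro i k hl hr hi
      obtain ⟨i0, h0, hc0⟩ := hb k hl
      have hcc : χ i0 = χ i := by rw [hc0, hcol k hl hr, hcolR i k hr hi]
      rcases lt_trichotomy i0 i with h | h | h
      · exfalso
        have h1 : G.dL k ≤ v' i0 := h0 ▸ hle i0
        have h2 : v' i0 < G.dR k := hi ▸ hv' i0 i h hcc
        rcases G.same k hl hr with h3 | h3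
        · exact absurd (h1.trans_lt h2) (h3 ▸ lt_irrefl _)
        · obtain ⟨k3, h4, h5, h6⟩ := hall h3 i0
          rw [h6] at h1 h2
          exact absurd (G.lt k3 k h4 h5 hl hr h2) (not_lt.2 h1)
      · rw [← h, h0]
      · exfalso
        have := hlt i i0 h hcc.symm
        rw [hi, h0] at this
        exact absurd this (not_lt.2 (G.le k hl hr))
    refine ⟨⟨fun i => ?_, fun i i' h hc _ _ => hlt i' i h hc⟩, fun k hk _ => hb k hk, ?_⟩
    · by_cases hi : G.IdleAt (v' i)
      · obtain ⟨k, hl, hr, he⟩ := hi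
        exact Or.inl ⟨k, hl, hr, he, hidle i k hl hr he⟩
      · refine Or.inr ⟨hi, ?_, hle i⟩
        rcases ha i with h | ⟨k, h1, h2, h3⟩
        · exact Or.inl h
        · refine Or.inr ⟨k, h1, fun hr => hi ?_, h2⟩
          obtain ⟨i1, h4, h5⟩ := hA.2 k hr
          have : i = i1 := hvinj _ _ (by rw [h3, h5, hcol k h1 hr])
            (by rw [h2, hidle i1 k h1 hr h4])
          exact ⟨k, h1, hr, this ▸ h4⟩
    · intro i k hl hr hi _ hR
      rcases ha i with h | ⟨k', h1, h2, h3⟩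
      · exact absurd h hR
      · rw [G.injL k k' hl h1 (hi.symm.trans h2)]; exact h3
  · rintro ⟨⟨hE, hnew⟩, hs, hsc⟩
    have hid : ∀ i k, G.IL k → G.IR k → v' i = G.dR k → v i = G.dL k := by
      intro i k hl hr hi
      have := hE i
      rwa [hi, G.edge_idle hl hr] at this
    have hlive : ∀ i, ¬ G.IdleAt (v' i) → G.Live (v i) ∧ v i ≤ v' i := by
      intro i hi
      have := hE i
      rwa [G.edge_not_idle hi] at this
    refine ⟨⟨fun i => ?_, fun k hk => ?_⟩, fun i => ?_, fun i i' hii hc => ?_⟩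
    · by_cases hi : G.IdleAt (v' i)
      · obtain ⟨k, hl, hr, he⟩ := hi
        exact Or.inr ⟨k, hl, hid i k hl hr he, by rw [hcolR i k hr he, hcol k hl hr]⟩
      · by_cases hR : G.RL (v i)
        · exact Or.inl hR
        · rcases (hlive i hi).1 with h | ⟨k, h1, h2, h3⟩
          · exact Or.inl h
          · exact Or.inr ⟨k, h1, h3, hsc i k h1 h2 h3 hi hR⟩
    · by_cases hr : G.IR k
      · obtain ⟨i, h1, h2⟩ := hA.2 k hr
        exact ⟨i, hid i k hk hr h1, by rw [h2, hcol k hk hr]⟩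
      · exact hs k hk hr
    · by_cases hi : G.IdleAt (v' i)
      · obtain ⟨k, hl, hr, he⟩ := hi
        rw [he, hid i k hl hr he]; exact G.le k hl hr
      · exact (hlive i hi).2
    · have hvv := hv' i i' hii hc
      by_cases hi : G.IdleAt (v' i) <;> by_cases hi' : G.IdleAt (v' i')
      · obtain ⟨k, hl, hr, he⟩ := hi
        obtain ⟨k', hl', hr', he'⟩ := hi'
        rw [he, hid i' k' hl' hr' he']
        rw [he, he'] at hvv
        exact G.lt k k' hl hr hl' hr' hvv
      · obtain ⟨k, hl, hr, he⟩ := hi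
        rcases G.sep k hl hr with h | h
        · rw [he]; exact h _ (hlive i' hi').1
        · have := h _ (hnon i' hi')
          rw [he] at hvv
          exact absurd this hvv.asymm
      · obtain ⟨k, hl, hr, he⟩ := hi'
        rcases G.same k hl hr with h | h
        · rw [hid i' k hl hr he, h, ← he]; exact hvv
        · exact absurd (hall h i) hi
      · exact hnew i' i hii hc hi' hi

end GapData

open Classical in
-- The row operations of `det_path_step` produce all families that are joined to `v'` by edges and
-- whose new values do not overlap. A family that misses a strand idle only on the left has a zero
-- column by `h0`. A family that visits the vertex of such a strand in the wrong colour has a zero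
-- row by `h1`. What remains are the admissible families.
theorem GapData.det_step {ι α K : Type*} [Fintype ι] [LinearOrder ι] [Fintype α] [LinearOrder α]
    [CommRing K] (G : GapData ι α) {χ : ι → Bool} {colL colR : ι → Bool}
    (hcol : ∀ k, G.IL k → G.IR k → colL k = colR k) {v' : ι → α}
    (hA : AdmFam G.IR G.dR G.RR colR χ v') (hv' : ∀ i i', i < i' → χ i = χ i' → v' i < v' i')
    (rL rR : α → Bool → ι → K) (w : α → K)
    (hr : ∀ y κ, rR y κ = w y • ∑ z, if G.Edge z y then rL z κ else 0)
    (h0 : ∀ k, G.IL k → ¬ G.IR k → ∀ z κ, ¬ (z = G.dL k ∧ κ = colL k) → rL z κ k = 0)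
    (h1 : ∀ k, G.IL k → ¬ G.IR k → ∀ κ, κ ≠ colL k → rL (G.dL k) κ = 0) :
    Matrix.det (Matrix.of fun i j => rR (v' i) (χ i) j) = (∏ i, w (v' i)) *
      ∑ v : ι → α, if AdmFam G.IL G.dL G.RL colL χ v ∧ (∀ i, v i ≤ v' i) ∧
          ∀ i i', i < i' → χ i = χ i' → v' i < v i' then
        Matrix.det (Matrix.of fun i j => rL (v i) (χ i) j) else 0 := by
  set u : ι → α := fun i => if h : G.IdleAt (v' i) then G.dL h.choose else v' i with hu
  have hE : ∀ i, G.IdleAt (v' i) → ∀ z, G.Edge z (v' i) ↔ z = u i := by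
    intro i hi z
    obtain ⟨h2, h3, h4⟩ := hi.choose_spec
    conv_lhs => rw [h4]
    rw [G.edge_idle h2 h3]
    simp [hu, hi]
  rw [det_path_step χ v' hv' (fun i => G.IdleAt (v' i)) u G.Live rL rR (fun i => w (v' i)) ?_ ?_
    (fun v => (∀ i, G.Edge (v i) (v' i)) ∧
        ∀ i, ∀ i' < i, χ i' = χ i → ¬ G.IdleAt (v' i) → ¬ G.IdleAt (v' i') → v' i' < v i) ?_]
  · congr 1
    refine Finset.sum_congr rfl fun v _ => ?_
    simp only [G.adm_iff_edge rfl hcol hA hv']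
    by_cases hg : (∀ i, G.Edge (v i) (v' i)) ∧
        ∀ i, ∀ i' < i, χ i' = χ i → ¬ G.IdleAt (v' i) → ¬ G.IdleAt (v' i') → v' i' < v i
    · rw [if_pos hg]
      split_ifs with h2
      · rfl
      · have h3 : ¬ ((∀ k, G.IL k → ¬ G.IR k → ∃ i, v i = G.dL k ∧ χ i = colL k) ∧
          ∀ i k, G.IL k → ¬ G.IR k → v i = G.dL k → ¬ G.IdleAt (v' i) → ¬ G.RL (v i) →
          χ i = colL k) := fun h => h2 ⟨hg, h⟩
        rw [not_and_or] at h3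
        rcases h3 with h3 | h3
        · push Not at h3
          obtain ⟨k, hl, hk, hk'⟩ := h3
          exact Matrix.det_eq_zero_of_column_eq_zero k fun i =>
            h0 k hl hk _ _ fun h => hk' i h.1 h.2
        · push Not at h3
          obtain ⟨i, k, hl, hk, hv, -, -, hc⟩ := h3
          refine Matrix.det_eq_zero_of_row_eq_zero i fun j => ?_
          have := h1 k hl hk _ hc
          rw [Matrix.of_apply, hv, this]; rfl
    · rw [if_neg hg, if_neg fun h => hg h.1]
  · intro i hi
    rw [hr]
    simp only [hE i hi, Finset.sum_ite_eq', Finset.mem_univ, if_true]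
  · intro i hi
    rw [hr, Finset.sum_filter]
    refine congrArg _ (Finset.sum_congr rfl fun z _ => ?_)
    exact if_congr (G.edge_not_idle hi z) rfl rfl
  · intro v
    rw [← forall_and]
    refine forall_congr' fun i => ?_
    by_cases hi : G.IdleAt (v' i)
    · simp [hi, hE i hi]
    · simp only [hi, G.edge_not_idle hi, not_false_iff, true_imp_iff, false_imp_iff, true_and,
        and_assoc]

/-! ### Ribbon strands -/

/-- Combinatorial data of `n` ribbon strands in the columns `0, …, L`: the `k`-th strand is active in
the columns `a k ≤ m < b k`, elsewhere it is low (`typ m k = 0`) or high (`typ m k = 2`); active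
entries are at most `N`. -/
structure Strands where
  n : ℕ
  L : ℕ
  N : ℕ
  a : Fin n → ℕ
  b : Fin n → ℕ
  up : ℕ → Bool
  typ : ℕ → Fin n → ℕ
  a_pos : ∀ k, 0 < a k
  a_lt : ∀ k, a k < b k
  b_le : ∀ k, b k ≤ L
  typ_le : ∀ m k, typ m k ≤ 2
  active : ∀ m k, typ m k = 1 ↔ a k ≤ m ∧ m < b k
  right_le : ∀ m, up m = false → ∀ k, typ m k ≤ typ (m + 1) k
  right_lt : ∀ m, up m = false → ∀ k k', k < k' → typ (m + 1) k ≤ typ m k'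
  up_le : ∀ m, up m = true → ∀ k, typ (m + 1) k ≤ typ m k
  up_lt : ∀ m, up m = true → ∀ k k', k < k' → typ m k ≤ typ (m + 1) k'

namespace Strands

variable (S : Strands)

/-- A strict upper bound of the values of active strands. -/
def big : ℕ := S.n + S.L + S.N + 1

/-- The values of strands. -/
abbrev Val : Type := Fin (S.big + S.n)

/-- The strand `k` is idle in the column `m`. -/
def Idle (m : ℕ) (k : Fin S.n) : Prop := S.typ m k ≠ 1

/-- The value of an idle strand. -/
def idleVal (m : ℕ) (k : Fin S.n) : S.Val :=
  if S.typ m k = 0 then ⟨k, by omega⟩ else ⟨S.big + k, by omega⟩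

/-- The values of active strands in the column `m` lie above `base m`. -/
def base (m : ℕ) : ℕ := S.n + ((Finset.range m).filter fun i => S.up i = true).card

/-- The values of active strands in the column `m`. -/
def InRange (m : ℕ) (y : S.Val) : Prop := S.base m < y.1 ∧ y.1 ≤ S.base m + S.N

theorem base_le (m : ℕ) : S.base m ≤ S.n + m := by
  have := Finset.card_filter_le (Finset.range m) fun i => S.up i = true
  rw [Finset.card_range] at this
  unfold base; omega

theorem le_base (m : ℕ) : S.n ≤ S.base m := by unfold base; omega

theorem idleVal_val (m : ℕ) (k : Fin S.n) :
    (S.idleVal m k).1 = if S.typ m k = 0 then k.1 else S.big + k.1 := by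
  unfold idleVal; split_ifs <;> rfl

theorem idleVal_low {m : ℕ} {k : Fin S.n} (h : S.typ m k = 0) : (S.idleVal m k).1 = k := by
  simp [idleVal, h]

theorem idleVal_high {m : ℕ} {k : Fin S.n} (h : S.typ m k ≠ 0) :
    (S.idleVal m k).1 = S.big + k := by
  simp [idleVal, h]

theorem typ_mono {m : ℕ} {k k' : Fin S.n} (h : k ≤ k') : S.typ m k ≤ S.typ m k' := by
  rcases h.eq_or_lt with rfl | h
  · exact le_rfl
  cases hu : S.up m
  · exact (S.right_le m hu k).trans (S.right_lt m hu k k' h)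
  · exact (S.up_lt m hu k k' h).trans (S.up_le m hu k')

theorem idle_cases {m : ℕ} {k : Fin S.n} (h : S.Idle m k) : S.typ m k = 0 ∨ S.typ m k = 2 := by
  have := S.typ_le m k
  unfold Idle at h
  omega

theorem idleVal_inj {m : ℕ} {k k' : Fin S.n} (h : S.idleVal m k = S.idleVal m k') : k = k' := by
  have h' := congrArg Fin.val h
  have h1 := k.2
  have h2 := k'.2
  rw [idleVal_val, idleVal_val] at h'
  unfold big at h'
  ext
  split_ifs at h' <;> omega

theorem not_inRange_idleVal {m : ℕ} (hm : m ≤ S.L) (k : Fin S.n) :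
    ¬ S.InRange m (S.idleVal m k) := by
  have h1 := k.2
  have := S.base_le m
  have := S.le_base m
  unfold InRange
  by_cases h : S.typ m k = 0
  · rw [S.idleVal_low h]; omega
  · rw [S.idleVal_high h]; unfold big; omega

/-- The two columns `m` and `m + 1` if the step between them goes to the right. -/
def rightGap (m : ℕ) (hm : m < S.L) (hu : S.up m = false) : GapData (Fin S.n) S.Val where
  IL := S.Idle m
  IR := S.Idle (m + 1)
  dL := S.idleVal m
  dR := S.idleVal (m + 1)
  RL := S.InRange m
  RR := S.InRange (m + 1)
  injL k k' _ _ h := S.idleVal_inj h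
  injR k k' _ _ h := S.idleVal_inj h
  disjR k _ := S.not_inRange_idleVal hm k
  le k h h' := by
    have := S.right_le m hu k
    rw [Fin.le_def]
    rcases S.idle_cases h with h1 | h1 <;> rcases S.idle_cases h' with h2 | h2 <;>
      simp only [idleVal_val, h1, h2, if_true, OfNat.ofNat_ne_zero, if_false, le_refl] <;> omega
  lt k k' h1 h1' h2 h2' hlt := by
    have hkk : k < k' := by
      by_contra hc
      have := S.typ_mono (m := m + 1) (not_lt.1 hc)
      have hc' : k'.1 ≤ k.1 := not_lt.1 hc
      rw [Fin.lt_def] at hlt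
      have := k.2
      have := k'.2
      rcases S.idle_cases h1' with h3 | h3 <;> rcases S.idle_cases h2' with h4 | h4 <;>
        simp only [idleVal_val, h3, h4, if_true, OfNat.ofNat_ne_zero, if_false, big] at hlt <;> omega
    have := S.right_lt m hu k k' hkk
    rw [Fin.lt_def] at hlt ⊢
    have := k.2
    have := k'.2
    have hkk' : k.1 < k'.1 := hkk
    rcases S.idle_cases h1' with h3 | h3 <;> rcases S.idle_cases h2 with h4 | h4 <;>
      simp only [idleVal_val, h3, h4, if_true, OfNat.ofNat_ne_zero, if_false, big] at hlt ⊢ <;> omega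
  sep k hl hr := by
    have := k.2
    rcases S.idle_cases hr with h | h
    · left
      rintro z (hz | ⟨k', h1, h2, rfl⟩)
      · have := S.le_base m
        have := hz.1
        rw [Fin.lt_def, S.idleVal_low h]; omega
      · have h3 : S.typ (m + 1) k' = 1 := not_not.1 h2
        have := S.right_le m hu k'
        have h4 : S.typ m k' = 0 := by rcases S.idle_cases h1 with h | h <;> omega
        rw [Fin.lt_def, S.idleVal_low h, S.idleVal_low h4]
        by_contra hc
        have := S.typ_mono (m := m + 1) (Fin.le_def.2 (not_lt.1 hc))
        omega
    · right
      rintro y (hz | ⟨k', h1, h2, rfl⟩)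
      · have := S.base_le (m + 1)
        have := hz.2
        rw [Fin.lt_def, S.idleVal_high (by omega)]
        unfold big; omega
      · have h3 : S.typ m k' = 1 := not_not.1 h2
        have := S.right_le m hu k'
        have h4 : S.typ (m + 1) k' = 2 := by rcases S.idle_cases h1 with h | h <;> omega
        rw [Fin.lt_def, S.idleVal_high (by omega), S.idleVal_high (by omega)]
        by_contra hc
        have hkk : k ≤ k' := Fin.le_def.2 (by omega)
        rcases hkk.eq_or_lt with rfl | hkk
        · exact hl h3
        · have := S.right_lt m hu k k' hkk
          omega
  same k hl hr := by
    have := S.right_le m hu k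
    rcases S.idle_cases hl with h | h <;> rcases S.idle_cases hr with h' | h'
    · left; simp [idleVal, h, h']
    -- A jump from low to high in one step squeezes all other strands: by `right_lt` those before
    -- `k` are low on both sides and those after `k` are high on both sides.
    · right
      intro k'
      have := S.typ_le m k'
      have := S.typ_le (m + 1) k'
      rcases lt_trichotomy k' k with h1 | rfl | h1
      · have := S.right_lt m hu _ _ h1
        have := S.right_le m hu k'
        unfold Idle; omega
      · exact ⟨hl, hr⟩
      · have := S.right_lt m hu _ _ h1
        have := S.right_le m hu k'
        unfold Idle; omega
    · omega
    · left; simp [idleVal, h, h']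

/-- The two columns `m` and `m + 1` if the step between them goes up; the order of the values is
reversed. -/
def upGap (m : ℕ) (hm : m < S.L) (hu : S.up m = true) : GapData (Fin S.n) (S.Val)ᵒᵈ where
  IL := S.Idle m
  IR := S.Idle (m + 1)
  dL k := OrderDual.toDual (S.idleVal m k)
  dR k := OrderDual.toDual (S.idleVal (m + 1) k)
  RL y := S.InRange m (OrderDual.ofDual y)
  RR y := S.InRange (m + 1) (OrderDual.ofDual y)
  injL k k' _ _ h := S.idleVal_inj (OrderDual.toDual_inj.1 h)
  injR k k' _ _ h := S.idleVal_inj (OrderDual.toDual_inj.1 h)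
  disjR k _ := S.not_inRange_idleVal hm k
  le k h h' := by
    have := S.up_le m hu k
    rw [OrderDual.toDual_le_toDual, Fin.le_def]
    rcases S.idle_cases h with h1 | h1 <;> rcases S.idle_cases h' with h2 | h2 <;>
      simp only [idleVal_val, h1, h2, if_true, OfNat.ofNat_ne_zero, if_false, le_refl] <;> omega
  lt k k' h1 h1' h2 h2' hlt := by
    rw [OrderDual.toDual_lt_toDual, Fin.lt_def] at hlt ⊢
    have hkk : k' < k := by
      by_contra hc
      have := S.typ_mono (m := m + 1) (not_lt.1 hc)
      have hc' : k.1 ≤ k'.1 := not_lt.1 hc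
      have := k.2
      have := k'.2
      rcases S.idle_cases h1' with h3 | h3 <;> rcases S.idle_cases h2' with h4 | h4 <;>
        simp only [idleVal_val, h3, h4, if_true, OfNat.ofNat_ne_zero, if_false, big] at hlt <;> omega
    have := S.up_lt m hu k' k hkk
    have := k.2
    have := k'.2
    have hkk' : k'.1 < k.1 := hkk
    rcases S.idle_cases h1' with h3 | h3 <;> rcases S.idle_cases h2 with h4 | h4 <;>
      simp only [idleVal_val, h3, h4, if_true, OfNat.ofNat_ne_zero, if_false, big] at hlt ⊢ <;> omega
  sep k hl hr := by
    have := k.2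
    rcases S.idle_cases hr with h | h
    · right
      rintro z (hz | ⟨k', h1, h2, rfl⟩)
      · have := S.le_base (m + 1)
        have := hz.1
        rw [OrderDual.lt_toDual, Fin.lt_def, S.idleVal_low h]; omega
      · have h3 : S.typ m k' = 1 := not_not.1 h2
        have := S.up_le m hu k'
        have h4 : S.typ (m + 1) k' = 0 := by rcases S.idle_cases h1 with h | h <;> omega
        rw [OrderDual.toDual_lt_toDual, Fin.lt_def, S.idleVal_low h, S.idleVal_low h4]
        by_contra hc
        have hkk : k' ≤ k := Fin.le_def.2 (by omega)
        rcases hkk.eq_or_lt with rfl | hkk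
        · exact hl h3
        · have := S.up_lt m hu _ _ hkk
          omega
    · left
      rintro y (hz | ⟨k', h1, h2, rfl⟩)
      · have := S.base_le m
        have := hz.2
        rw [OrderDual.toDual_lt, Fin.lt_def, S.idleVal_high (by omega)]
        unfold big; omega
      · have h3 : S.typ (m + 1) k' = 1 := not_not.1 h2
        have := S.up_le m hu k'
        have h4 : S.typ m k' = 2 := by rcases S.idle_cases h1 with h | h <;> omega
        rw [OrderDual.toDual_lt_toDual, Fin.lt_def, S.idleVal_high (by omega),
          S.idleVal_high (by omega)]
        by_contra hc
        have := S.typ_mono (m := m + 1) (Fin.le_def.2 (show k.1 ≤ k'.1 by omega))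
        omega
  same k hl hr := by
    have := S.up_le m hu k
    rcases S.idle_cases hl with h | h <;> rcases S.idle_cases hr with h' | h'
    · left; simp [idleVal, h, h']
    · omega
    · right
      intro k'
      have := S.typ_le m k'
      have := S.typ_le (m + 1) k'
      rcases lt_trichotomy k' k with h1 | rfl | h1
      · have := S.up_lt m hu _ _ h1
        have := S.up_le m hu k'
        unfold Idle; omega
      · exact ⟨hl, hr⟩
      · have := S.up_lt m hu _ _ h1
        have := S.up_le m hu k'
        unfold Idle; omega
    · left; simp [idleVal, h, h']

end Strands

/-! ### Colour preserving permutations -/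

/-- The permutation `u` matches the colours `χ` with the colours `η` and is increasing on every
colour class. -/
def IsShuffle {n : ℕ} (χ η : Fin n → Bool) (u : Equiv.Perm (Fin n)) : Prop :=
  (∀ i, χ i = η (u i)) ∧ ∀ i i', i < i' → χ i = χ i' → u i < u i'

/-- The sign of the permutation that sorts a colouring. -/
def colSign {n : ℕ} (χ : Fin n → Bool) : ℤˣ := Equiv.Perm.sign (Tuple.sort χ)

/-- The stable sort of `χ` followed by `u` is a stable sort of `η`, and stable sorts are unique. -/
theorem IsShuffle.eq {n : ℕ} {χ η : Fin n → Bool} {u : Equiv.Perm (Fin n)} (h : IsShuffle χ η u) :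
    u = Tuple.sort η * (Tuple.sort χ)⁻¹ := by
  have hs := (Tuple.eq_sort_iff (f := χ) (σ := Tuple.sort χ)).1 rfl
  rw [eq_mul_inv_iff_mul_eq, Tuple.eq_sort_iff]
  have he : ∀ i, η ((u * Tuple.sort χ) i) = χ (Tuple.sort χ i) := fun i => (h.1 _).symm
  constructor
  · intro i j hij
    show η ((u * Tuple.sort χ) i) ≤ η ((u * Tuple.sort χ) j)
    rw [he, he]
    exact hs.1 hij
  · intro i j hij hc
    have hc' : η ((u * Tuple.sort χ) i) = η ((u * Tuple.sort χ) j) := hc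
    rw [he, he] at hc'
    exact h.2 _ _ (hs.2 i j hij hc') hc'

/-- Thanks to this factorization the signs in both determinant formulas depend on the two boundary
colourings separately, and they cancel in the end. -/
theorem IsShuffle.sign {n : ℕ} {χ η : Fin n → Bool} {u : Equiv.Perm (Fin n)}
    (h : IsShuffle χ η u) : Equiv.Perm.sign u = colSign χ * colSign η := by
  rw [h.eq, Equiv.Perm.sign_mul, Equiv.Perm.sign_inv, mul_comm]; rfl

/-- Colourings with the same number of rows of each colour have the same sorted form, so their
stable sorts can be composed. -/
theorem IsShuffle.exists {n : ℕ} {χ η : Fin n → Bool} (ρ : Equiv.Perm (Fin n))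
    (h : ∀ i, χ i = η (ρ i)) : ∃ u, IsShuffle χ η u := by
  have hs := (Tuple.eq_sort_iff (f := χ) (σ := Tuple.sort χ)).1 rfl
  have ht := (Tuple.eq_sort_iff (f := η) (σ := Tuple.sort η)).1 rfl
  have he : χ ∘ Tuple.sort χ = η ∘ Tuple.sort η := by
    have h1 : η ∘ (ρ * Tuple.sort χ : Equiv.Perm (Fin n)) = χ ∘ Tuple.sort χ := by
      funext i; exact (h _).symm
    rw [← h1, Tuple.comp_sort_eq_comp_iff_monotone.2]
    rw [h1]; exact hs.1
  have he' : ∀ i, η (Tuple.sort η i) = χ (Tuple.sort χ i) := fun i => (congrFun he i).symm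
  refine ⟨(Tuple.sort χ).symm.trans (Tuple.sort η), fun i => ?_, fun i i' hii hc => ?_⟩
  · rw [Equiv.trans_apply, he', Equiv.apply_symm_apply]
  · have h1 : (Tuple.sort χ).symm i < (Tuple.sort χ).symm i' := by
      rcases lt_trichotomy ((Tuple.sort χ).symm i) ((Tuple.sort χ).symm i') with h1 | h1 | h1
      · exact h1
      · exact absurd ((Tuple.sort χ).symm.injective h1) hii.ne
      · have := hs.2 _ _ h1 (by simp [hc])
        simp only [Equiv.apply_symm_apply] at this
        exact absurd this hii.asymm
    refine ht.2 _ _ h1 ?_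
    rw [he', he']; simpa using hc

theorem IsShuffle.refl {n : ℕ} (χ : Fin n → Bool) : IsShuffle χ χ 1 :=
  ⟨fun _ => rfl, fun _ _ h _ => h⟩

theorem IsShuffle.unique {n : ℕ} {χ η : Fin n → Bool} {u u' : Equiv.Perm (Fin n)}
    (h : IsShuffle χ η u) (h' : IsShuffle χ η u') : u = u' := h.eq.trans h'.eq.symm

/-! ### Chains of families -/

/-- The values are strictly increasing on every colour class. -/
def ColInc {n : ℕ} {α : Type*} [LT α] (χ : Fin n → Bool) (v : Fin n → α) : Prop :=
  ∀ i i', i < i' → χ i = χ i' → v i < v i'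

/-- Rows of the same colour interlace. -/
def ColGap {n : ℕ} {α : Type*} [LE α] [LT α] (χ : Fin n → Bool) (lo hi : Fin n → α) : Prop :=
  (∀ i, lo i ≤ hi i) ∧ ∀ i i', i < i' → χ i = χ i' → hi i < lo i'

theorem ite_congr_iff {α : Sort*} {p q : Prop} {dp : Decidable p} {dq : Decidable q} {a b : α}
    (h : p ↔ q) : ite p a b = ite q a b := by
  by_cases hp : p
  · rw [if_pos hp, if_pos (h.1 hp)]
  · rw [if_neg hp, if_neg fun hq => hp (h.2 hq)]

/-! ### Path generating functions and their determinants across one gap. -/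

namespace Strands

variable (S : Strands) {K : Type*} [CommRing K]

/-- The lower one of two adjacent columns. -/
def lo {α : Type*} (m : ℕ) (v v' : α) : α := if S.up m then v' else v

/-- The upper one of two adjacent columns. -/
def hi {α : Type*} (m : ℕ) (v v' : α) : α := if S.up m then v else v'

/-- The edges of the graph between the columns `m` and `m + 1`. -/
def Edge (m : ℕ) (z y : S.Val) : Prop :=
  (∃ k, S.Idle m k ∧ S.Idle (m + 1) k ∧ y = S.idleVal (m + 1) k ∧ z = S.idleVal m k) ∨
    ((¬ ∃ k, S.Idle m k ∧ S.Idle (m + 1) k ∧ y = S.idleVal (m + 1) k) ∧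
      (S.InRange m z ∨ ∃ k, S.Idle m k ∧ ¬ S.Idle (m + 1) k ∧ z = S.idleVal m k) ∧
      S.lo m z y ≤ S.hi m z y)

open Classical in
/-- The weight of a vertex. -/
noncomputable def wt (x : ℕ → K) (m : ℕ) (y : S.Val) : K :=
  if S.InRange m y then x (y.1 - S.base m) else 1

open Classical in
/-- The weighted number of paths from the source `j` to a vertex in the column `m`. -/
noncomputable def pathGF (x : ℕ → K) : ℕ → S.Val → Fin S.n → K
  | 0, y, j => if y = S.idleVal 0 j then 1 else 0
  | m + 1, y, j => S.wt x (m + 1) y * ∑ z, if S.Edge m z y then pathGF x m z j else 0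

theorem idle_of_lt {m : ℕ} {k : Fin S.n} (h : m < S.a k) : S.Idle m k := by
  unfold Idle; rw [Ne, S.active]; omega

theorem idle_of_ge {m : ℕ} {k : Fin S.n} (h : S.b k ≤ m) : S.Idle m k := by
  unfold Idle; rw [Ne, S.active]; omega

theorem idle_iff {m : ℕ} {k : Fin S.n} : S.Idle m k ↔ m < S.a k ∨ S.b k ≤ m := by
  unfold Idle; rw [Ne, S.active]; omega

theorem edge_idle {m : ℕ} {k : Fin S.n} (h : S.Idle m k) (h' : S.Idle (m + 1) k)
    (z : S.Val) : S.Edge m z (S.idleVal (m + 1) k) ↔ z = S.idleVal m k := by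
  constructor
  · rintro (⟨k', h1, h2, h3, h4⟩ | ⟨h1, -⟩)
    · rw [h4, S.idleVal_inj h3]
    · exact absurd ⟨k, h, h', rfl⟩ h1
  · rintro rfl
    exact Or.inl ⟨k, h, h', rfl, rfl⟩

/-- A strand that has not started has a single edge into its vertex, coming from its own vertex in
the column before. Going back along these edges leads to its source. -/
theorem pathGF_idle (x : ℕ → K) {m : ℕ} (hm : m ≤ S.L) {k : Fin S.n} (h : m < S.a k) (j : Fin S.n) :
    S.pathGF x m (S.idleVal m k) j = if j = k then 1 else 0 := by
  induction m with
  | zero =>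
    simp only [pathGF]
    exact if_congr ⟨fun h => (S.idleVal_inj h).symm, fun h => by rw [h]⟩ rfl rfl
  | succ m ih =>
    simp only [pathGF, S.edge_idle (S.idle_of_lt (by omega : m < S.a k)) (S.idle_of_lt h),
      Finset.sum_ite_eq', Finset.mem_univ, if_true, wt, S.not_inRange_idleVal hm, if_false, one_mul]
    exact ih (by omega) (by omega)

/-- A path can leave the vertices of an idle strand only in the gap where that strand becomes
active. So before the start of the strand `j`, the source `j` reaches no vertex but that of `j`. -/
theorem pathGF_before (x : ℕ → K) {m : ℕ} (hm : m ≤ S.L) {j : Fin S.n} (h : m < S.a j) {y : S.Val}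
    (hy : y ≠ S.idleVal m j) : S.pathGF x m y j = 0 := by
  induction m generalizing y with
  | zero => simp [pathGF, hy]
  | succ m ih =>
    simp only [pathGF]
    rw [Finset.sum_eq_zero, mul_zero]
    intro z _
    split_ifs with hE
    · refine ih (by omega) (by omega) ?_
      rintro rfl
      rcases hE with ⟨k', h1, h2, h3, h4⟩ | ⟨-, h1, -⟩
      · rw [S.idleVal_inj h4] at hy
        exact hy h3
      · rcases h1 with h1 | ⟨k', -, h2, h3⟩
        · exact S.not_inRange_idleVal (by omega) j h1
        · rw [← S.idleVal_inj h3] at h2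
          exact h2 (S.idle_of_lt h)
    · rfl

/-- The colour of an idle strand: the colour of its sink after its end, the colour of its source
before its start. -/
def idleCol (χ χ' : Fin S.n → Bool) (m : ℕ) (k : Fin S.n) : Bool := if S.b k ≤ m then χ k else χ' k

/-- Admissible families in the column `m`. -/
def Adm (χ χ' : Fin S.n → Bool) (m : ℕ) (v : Fin S.n → S.Val) : Prop :=
  AdmFam (S.Idle m) (S.idleVal m) (S.InRange m) (S.idleCol χ χ' m) χ v

/-- The rows of the determinants for path families. -/
noncomputable def pathRow (x : ℕ → K) (χ' : Fin S.n → Bool) (m : ℕ) (y : S.Val) (κ : Bool)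
    (j : Fin S.n) : K :=
  if κ = χ' j then S.pathGF x m y j else 0

open Classical in
theorem pathRow_succ (x : ℕ → K) (χ' : Fin S.n → Bool) (m : ℕ) (y : S.Val) (κ : Bool) :
    S.pathRow x χ' (m + 1) y κ =
      S.wt x (m + 1) y • ∑ z, if S.Edge m z y then S.pathRow x χ' m z κ else 0 := by
  funext j
  simp only [pathRow, pathGF, Pi.smul_apply, Finset.sum_apply, smul_eq_mul]
  split_ifs with h
  · congr 1
    refine Finset.sum_congr rfl fun z _ => ?_
    split_ifs <;> simp [h, pathRow]
  · rw [Finset.sum_eq_zero, mul_zero]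
    intro z _
    split_ifs <;> simp [h, pathRow]

/-- The active interval is not empty, so two adjacent idle columns are both before the start or both
after the end. -/
theorem idleCol_succ (χ χ' : Fin S.n → Bool) {m : ℕ} {k : Fin S.n} (h : S.Idle m k)
    (_h' : S.Idle (m + 1) k) : S.idleCol χ χ' m k = S.idleCol χ χ' (m + 1) k := by
  have h1 := S.a_lt k
  have h2 : (S.b k ≤ m) ↔ (S.b k ≤ m + 1) := by
    rw [idle_iff] at h; omega
  simp only [idleCol, h2]

open Classical in
-- A strand `k` that starts in this gap is still at the vertex reached from its source alone. Its
-- column is therefore supported at this vertex with the colour of the source, and its vertex gives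
-- a zero row in the other colour. These are the vanishing conditions that `GapData.det_step` asks
-- for.
theorem det_pathRow_succ (x : ℕ → K) (χ χ' : Fin S.n → Bool) {m : ℕ} (hm : m < S.L)
    {v' : Fin S.n → S.Val} (hA : S.Adm χ χ' (m + 1) v') (hv' : ColInc χ v') :
    Matrix.det (Matrix.of fun i j => S.pathRow x χ' (m + 1) (v' i) (χ i) j) =
      (∏ i, S.wt x (m + 1) (v' i)) * ∑ v : Fin S.n → S.Val,
        if S.Adm χ χ' m v ∧ ColGap χ (S.lo m v v') (S.hi m v v') then
          Matrix.det (Matrix.of fun i j => S.pathRow x χ' m (v i) (χ i) j) else 0 := by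
  have h0 : ∀ k, S.Idle m k → ¬ S.Idle (m + 1) k → ∀ z κ,
      ¬ (z = S.idleVal m k ∧ κ = S.idleCol χ χ' m k) → S.pathRow x χ' m z κ k = 0 := by
    intro k h1 h2 z κ h3
    rw [idle_iff] at h1 h2
    unfold pathRow
    split_ifs with h4
    · refine S.pathGF_before x hm.le (by omega) fun h5 => h3 ⟨h5, ?_⟩
      rw [idleCol, if_neg (by omega), h4]
    · rfl
  have h1 : ∀ k, S.Idle m k → ¬ S.Idle (m + 1) k → ∀ κ,
      κ ≠ S.idleCol χ χ' m k → S.pathRow x χ' m (S.idleVal m k) κ = 0 := by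
    intro k h1 h2 κ h3
    rw [idle_iff] at h1 h2
    rw [idleCol, if_neg (by omega)] at h3
    funext j
    unfold pathRow
    rw [S.pathGF_idle x hm.le (by omega)]
    split_ifs with h4 h5
    · rw [h5] at h4; exact absurd h4 h3
    · rfl
    · rfl
  cases hu : S.up m
  · have := (S.rightGap m hm hu).det_step (fun k h h' => S.idleCol_succ χ χ' h h') hA hv'
      (S.pathRow x χ' m) (S.pathRow x χ' (m + 1)) (S.wt x (m + 1)) (fun y κ => ?_) h0 h1
    · refine this.trans ?_
      simp only [lo, hi, hu, ColGap, Bool.false_eq_true, if_false]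
      exact congrArg _ (Finset.sum_congr rfl fun v _ => ite_congr_iff Iff.rfl)
    · rw [S.pathRow_succ]
      refine congrArg _ (Finset.sum_congr rfl fun z _ => ite_congr_iff ?_)
      simp only [Edge, lo, hi, hu]
      rfl
  -- For a step up the values are ordered in the opposite direction. Reversing the rows as well
  -- keeps the families increasing.
  · have := GapData.det_step (ι := (Fin S.n)ᵒᵈ) (S.upGap m hm hu) (χ := χ) (v' := v')
      (fun k h h' => S.idleCol_succ χ χ' h h') hA (fun i i' h hc => hv' i' i h hc.symm)
      (S.pathRow x χ' m) (S.pathRow x χ' (m + 1)) (S.wt x (m + 1)) (fun y κ => ?_) h0 h1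
    · refine this.trans ?_
      simp only [lo, hi, hu, ColGap]
      refine congrArg _ (Finset.sum_congr rfl fun v _ => ite_congr_iff ?_)
      refine and_congr Iff.rfl (and_congr Iff.rfl ?_)
      exact ⟨fun h i i' hi hc => h i' i hi hc.symm, fun h i i' hi hc => h i' i hi hc.symm⟩
    · refine (S.pathRow_succ x χ' m y κ).trans ?_
      refine congrArg _ (Finset.sum_congr rfl fun z _ => ite_congr_iff ?_)
      simp only [Edge, lo, hi, hu]
      rfl

end Strands

/-! ### The expansion of coloured path determinants into chains. -/

namespace Strands

variable (S : Strands) {K : Type*} [CommRing K]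

/-- Chains of admissible families whose rows have the colours `χ`; the colours of the sources are
given by `χ'`. -/
def IsChain (χ χ' : Fin S.n → Bool) (V : Fin (S.L + 1) → Fin S.n → S.Val) : Prop :=
  (∀ m : Fin (S.L + 1), S.Adm χ χ' m (V m) ∧ ColInc χ (V m)) ∧
    ∀ m : Fin S.L, ColGap χ (S.lo m (V m.castSucc) (V m.succ)) (S.hi m (V m.castSucc) (V m.succ))

/-- The weight of a chain. -/
noncomputable def chainWt (x : ℕ → K) (V : Fin (S.L + 1) → Fin S.n → S.Val) : K :=
  ∏ m : Fin (S.L + 1), ∏ i, S.wt x m (V m i)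

/-- In a column in which all strands are idle, an admissible family lists the idle values. -/
theorem exists_isShuffle_of_idle {χ χ' : Fin S.n → Bool} {m : ℕ} (hm : m ≤ S.L)
    (hI : ∀ k, S.Idle m k) {v : Fin S.n → S.Val} (hA : S.Adm χ χ' m v) (hv : ColInc χ v) :
    ∃ u : Equiv.Perm (Fin S.n), (∀ i, v i = S.idleVal m (u i)) ∧
      IsShuffle χ (S.idleCol χ χ' m) u := by
  choose f hf hf' using fun k => hA.2 k (hI k)
  have hinj : Function.Injective f := fun k k' hk => S.idleVal_inj (by rw [← hf k, ← hf k', hk])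
  have hb : Function.Bijective f := Finite.injective_iff_bijective.1 hinj
  have hu : ∀ i, f ((Equiv.ofBijective f hb).symm i) = i := fun i =>
    Equiv.ofBijective_apply_symm_apply f hb i
  have h1 : ∀ i, v i = S.idleVal m ((Equiv.ofBijective f hb).symm i) := fun i => by
    rw [← hf, hu]
  refine ⟨(Equiv.ofBijective f hb).symm, h1, fun i => ?_, fun i i' hi hc => ?_⟩
  · rw [← hf', hu]
  · have := hv i i' hi hc
    rw [h1, h1, Fin.lt_def, idleVal_val, idleVal_val] at this
    by_contra hlt
    have hle := S.typ_mono (m := m) (not_lt.1 hlt)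
    have hle' := Fin.le_def.1 (not_lt.1 hlt)
    have h2 := ((Equiv.ofBijective f hb).symm i).2
    have h3 := ((Equiv.ofBijective f hb).symm i').2
    have h4 := S.le_base 0
    have h5 : S.n < S.big := by unfold big; omega
    split_ifs at this <;> omega

theorem idleVal_strictMono {m : ℕ} : StrictMono (S.idleVal m) := by
  intro k k' h
  have hle := S.typ_mono (m := m) h.le
  rw [Fin.lt_def, idleVal_val, idleVal_val]
  have := k.2
  have h5 : S.n < S.big := by unfold big; omega
  have := Fin.lt_def.1 h
  split_ifs <;> omega

theorem adm_last (χ χ' : Fin S.n → Bool) : S.Adm χ χ' S.L (S.idleVal S.L) := by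
  have h : ∀ k, S.Idle S.L k ∧ χ k = S.idleCol χ χ' S.L k := fun k =>
    ⟨S.idle_of_ge (S.b_le k), by rw [idleCol, if_pos (S.b_le k)]⟩
  exact ⟨fun i => Or.inr ⟨i, (h i).1, rfl, (h i).2⟩, fun k _ => ⟨k, rfl, (h k).2⟩⟩

theorem eq_idleVal_last {χ χ' : Fin S.n → Bool} {v : Fin S.n → S.Val} (hA : S.Adm χ χ' S.L v)
    (hv : ColInc χ v) : v = S.idleVal S.L := by
  obtain ⟨u, h1, h2⟩ := S.exists_isShuffle_of_idle le_rfl (fun k => S.idle_of_ge (S.b_le k)) hA hv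
  have hc : S.idleCol χ χ' S.L = χ := by
    funext k; rw [idleCol, if_pos (S.b_le k)]
  rw [hc] at h2
  funext i
  rw [h1, h2.unique (IsShuffle.refl χ)]; rfl

/-- In the first column every strand is at its source, so an admissible family is a shuffle of the
sources and the matrix is a permutation matrix. -/
theorem det_pathRow_zero (x : ℕ → K) {χ χ' : Fin S.n → Bool} {v : Fin S.n → S.Val}
    (hA : S.Adm χ χ' 0 v) (hv : ColInc χ v) :
    Matrix.det (Matrix.of fun i j => S.pathRow x χ' 0 (v i) (χ i) j) =
      ((colSign χ * colSign χ' : ℤˣ) : ℤ) := by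
  obtain ⟨u, h1, h2⟩ := S.exists_isShuffle_of_idle (Nat.zero_le _)
    (fun k => S.idle_of_lt (S.a_pos k)) hA hv
  have hc : S.idleCol χ χ' 0 = χ' := by
    funext k
    have := S.a_pos k
    have := S.a_lt k
    rw [idleCol, if_neg (by omega)]
  rw [hc] at h2
  rw [← h2.sign, ← Matrix.det_permutation u]
  congr 1
  ext i j
  simp only [Matrix.of_apply, pathRow, h1, S.pathGF_idle x (Nat.zero_le _) (S.a_pos _),
    PEquiv.toMatrix_apply, Equiv.toPEquiv_apply, Option.mem_def, Option.some.injEq]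
  by_cases h : j = u i
  · rw [if_pos (by rw [h, h2.1 i]), if_pos h, if_pos h.symm]
  · rw [if_neg h, if_neg (Ne.symm h), ite_self]

open Classical in
/-- The Lindström–Gessel–Viennot lemma for coloured ribbon strands. -/
theorem det_eq_sum_chains (x : ℕ → K) (χ χ' : Fin S.n → Bool) :
    Matrix.det (Matrix.of fun i j => if χ i = χ' j then S.pathGF x S.L (S.idleVal S.L i) j else 0) =
      ((colSign χ * colSign χ' : ℤˣ) : ℤ) *
        ∑ V : Fin (S.L + 1) → Fin S.n → S.Val,
          if S.IsChain χ χ' V then S.chainWt x V else 0 := by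
  set Ψ : ℕ → (Fin S.n → S.Val) → K := fun m v => if S.Adm χ χ' m v ∧ ColInc χ v then
    Matrix.det (Matrix.of fun i j => S.pathRow x χ' m (v i) (χ i) j) else 0 with hΨ
  set k : ℕ → (Fin S.n → S.Val) → (Fin S.n → S.Val) → K := fun m v v' =>
    if (S.Adm χ χ' (m + 1) v' ∧ ColInc χ v') ∧ ColGap χ (S.lo m v v') (S.hi m v v') then
      ∏ i, S.wt x (m + 1) (v' i) else 0 with hk
  have hstep : ∀ m < S.L, ∀ v', Ψ (m + 1) v' = ∑ v, k m v v' * Ψ m v := by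
    intro m hm v'
    simp only [hΨ, hk]
    by_cases h : S.Adm χ χ' (m + 1) v' ∧ ColInc χ v'
    · rw [if_pos h, S.det_pathRow_succ x χ χ' hm h.1 h.2, Finset.mul_sum]
      refine Finset.sum_congr rfl fun v _ => ?_
      by_cases hg : ColGap χ (S.lo m v v') (S.hi m v v')
      -- Interlacing with the following column already forces the rows of one colour to increase,
      -- which is what allows the recursion to continue.
      · have hinc : ColInc χ v := by
          intro i i' hi hc
          have h1 := hg.1 i
          have h2 := hg.2 i i' hi hc
          have h3 := hg.1 i'
          cases hu : S.up m <;> simp only [Strands.lo, Strands.hi, hu, if_true, if_false, Bool.false_eq_true]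
            at h1 h2 h3
          · exact h1.trans_lt h2
          · exact h2.trans_le h3
        simp only [h, hg, hinc, and_true, if_true, true_and]
      · simp only [hg, and_false, if_false, mul_zero, zero_mul]
    · simp only [h, false_and, if_false, zero_mul, Finset.sum_const_zero]
  have hfin := transfer_sum k Ψ S.L hstep (S.idleVal S.L)
  have hL : Ψ S.L (S.idleVal S.L) = Matrix.det (Matrix.of fun i j =>
      if χ i = χ' j then S.pathGF x S.L (S.idleVal S.L i) j else 0) := by
    simp only [hΨ]
    rw [if_pos ⟨S.adm_last χ χ', fun i i' h _ => S.idleVal_strictMono h⟩]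
    rfl
  -- The last family is split off from the chain. It is forced, since all strands have ended in the
  -- last column.
  rw [← hL, hfin, Finset.mul_sum, ← (Fin.snocEquiv (fun _ : Fin (S.L + 1) =>
    (Fin S.n → S.Val))).sum_comp, Fintype.sum_prod_type,
    Finset.sum_eq_single (S.idleVal S.L)]
  · refine Finset.sum_congr rfl fun W _ => ?_
    set V : Fin (S.L + 1) → Fin S.n → S.Val := Fin.snoc (α := fun _ => Fin S.n → S.Val) W
      (S.idleVal S.L) with hV
    have he : (Fin.snocEquiv (fun _ : Fin (S.L + 1) => (Fin S.n → S.Val))) (S.idleVal S.L, W) = V :=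
      rfl
    rw [he]
    by_cases hc : S.IsChain χ χ' V
    · rw [if_pos hc]
      simp only [hΨ, hk]
      have h0 : S.Adm χ χ' 0 (V 0) ∧ ColInc χ (V 0) := hc.1 0
      rw [if_pos h0, S.det_pathRow_zero x h0.1 h0.2, chainWt, Fin.prod_univ_succ]
      congr 1
      have hw : ∏ i, S.wt x (0 : Fin (S.L + 1)) (V 0 i) = 1 := by
        refine Finset.prod_eq_one fun i _ => ?_
        obtain ⟨u, h1, -⟩ := S.exists_isShuffle_of_idle (Nat.zero_le _)
          (fun k => S.idle_of_lt (S.a_pos k)) h0.1 h0.2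
        rw [h1, wt]
        exact if_neg (S.not_inRange_idleVal (Nat.zero_le _) _)
      rw [hw, one_mul]
      refine Finset.prod_congr rfl fun m _ => ?_
      rw [if_pos ⟨hc.1 m.succ, hc.2 m⟩]
      rfl
    · rw [if_neg hc, mul_zero]
      by_contra hne
      refine hc ?_
      have hne := And.intro (left_ne_zero_of_mul hne) (right_ne_zero_of_mul hne)
      have h1 : S.Adm χ χ' 0 (V 0) ∧ ColInc χ (V 0) := by
        by_contra h
        exact hne.1 (if_neg h)
      have h2 : ∀ m : Fin S.L, (S.Adm χ χ' (m + 1) (V m.succ) ∧ ColInc χ (V m.succ)) ∧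
          ColGap χ (S.lo m (V m.castSucc) (V m.succ)) (S.hi m (V m.castSucc) (V m.succ)) := by
        intro m
        by_contra h
        exact hne.2 (Finset.prod_eq_zero (Finset.mem_univ m) (if_neg h))
      refine ⟨fun m => ?_, fun m => (h2 m).2⟩
      induction m using Fin.cases with
      | zero => exact h1
      | succ m => exact (h2 m).1
  · intro v _ hv
    refine Finset.sum_eq_zero fun W _ => ?_
    rw [if_neg, mul_zero]
    intro hc
    have := hc.1 (Fin.last _)
    rw [show (Fin.snocEquiv (fun _ : Fin (S.L + 1) => (Fin S.n → S.Val))) (v, W) (Fin.last _) = v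
      from Fin.snoc_last (α := fun _ => Fin S.n → S.Val) _ _] at this
    exact hv (S.eq_idleVal_last this.1 this.2)
  · intro h; exact absurd (Finset.mem_univ _) h

end Strands

/-! ### Sorting coloured families -/

/-- For each colour, the values in two adjacent columns interlace. -/
def InterlaceFin {n : ℕ} {α : Type*} [LinearOrder α] (lo hi : Fin n → α) (η η' : Fin n → Bool) :
    Prop :=
  ∀ κ x, (Finset.univ.filter fun i => hi i ≤ x ∧ η' i = κ).card ≤
      (Finset.univ.filter fun i => lo i ≤ x ∧ η i = κ).card ∧
    (Finset.univ.filter fun i => lo i ≤ x ∧ η i = κ).card ≤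
      (Finset.univ.filter fun i => hi i < x ∧ η' i = κ).card + 1

theorem card_filter_comp_perm {n : ℕ} (σ : Equiv.Perm (Fin n)) (p : Fin n → Prop)
    [DecidablePred p] : (Finset.univ.filter fun i => p (σ i)).card = (Finset.univ.filter p).card := by
  rw [← Fintype.card_subtype, ← Fintype.card_subtype]
  exact Fintype.card_congr (σ.subtypeEquiv fun _ => Iff.rfl)

/-- Only the multisets of coloured values enter, and this is what permits the rows of a column to be
rearranged. -/
theorem InterlaceFin.comp_iff {n : ℕ} {α : Type*} [LinearOrder α] {lo hi : Fin n → α}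
    {η η' : Fin n → Bool} (σ σ' : Equiv.Perm (Fin n)) :
    InterlaceFin (lo ∘ σ) (hi ∘ σ') (η ∘ σ) (η' ∘ σ') ↔ InterlaceFin lo hi η η' := by
  refine forall_congr' fun κ => forall_congr' fun x => ?_
  rw [← card_filter_comp_perm σ fun i => lo i ≤ x ∧ η i = κ,
    ← card_filter_comp_perm σ' fun i => hi i < x ∧ η' i = κ,
    ← card_filter_comp_perm σ' fun i => hi i ≤ x ∧ η' i = κ]
  rfl

/-- When the values of each colour increase with the row, matching every row with itself is the
sorted matching. Comparing row by row is then the same as counting the values below each threshold.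
-/
theorem colGap_iff_interlaceFin {n : ℕ} {α : Type*} [LinearOrder α] {χ : Fin n → Bool}
    {lo hi : Fin n → α} (hlo : ColInc χ lo) (hhi : ColInc χ hi) :
    ColGap χ lo hi ↔ InterlaceFin lo hi χ χ := by
  constructor
  · intro h κ x
    refine ⟨Finset.card_le_card fun i => ?_, ?_⟩
    · simp only [Finset.mem_filter, Finset.mem_univ, true_and]
      exact fun hi => ⟨(h.1 i).trans hi.1, hi.2⟩
    · by_cases hne : (Finset.univ.filter fun i => lo i ≤ x ∧ χ i = κ).Nonempty
      -- Every counted row `i` other than the last one `M` satisfies `hi i < lo M ≤ x`, so only one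
      -- row is lost.
      · set M := (Finset.univ.filter fun i => lo i ≤ x ∧ χ i = κ).max' hne with hM
        have hMm := Finset.max'_mem _ hne
        rw [← Finset.card_erase_add_one hMm]
        refine Nat.add_le_add_right (Finset.card_le_card fun i hi => ?_) 1
        rw [Finset.mem_erase] at hi
        have hlt : i < M := lt_of_le_of_ne (Finset.le_max' _ _ hi.2) hi.1
        simp only [Finset.mem_filter, Finset.mem_univ, true_and] at hi hMm ⊢
        exact ⟨(h.2 i M hlt (hi.2.2.trans hMm.2.symm)).trans_le hMm.1, hi.2.2⟩
      · rw [Finset.not_nonempty_iff_eq_empty.1 hne]; simp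
  · intro h
    refine ⟨fun i => ?_, fun i i' hii hc => ?_⟩
    · by_contra hlt
      have h1 := (h (χ i) (hi i)).1
      refine absurd h1 (not_le.2 (Finset.card_lt_card ?_))
      rw [Finset.ssubset_iff_of_subset]
      · exact ⟨i, by simp, by simpa using not_le.1 hlt⟩
      · intro j
        simp only [Finset.mem_filter, Finset.mem_univ, true_and]
        rintro ⟨h2, h3⟩
        refine ⟨?_, h3⟩
        rcases lt_trichotomy j i with h4 | rfl | h4
        · exact (hhi j i h4 h3).le
        · exact absurd h2 hlt
        · exact absurd ((hlo i j h4 h3.symm).le.trans h2) hlt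
    · by_contra hlt
      rw [not_lt] at hlt
      have h1 := (h (χ i') (lo i')).2
      -- If `hi i` were at least `lo i'`, then at the threshold `lo i'` both `i` and `i'` would be
      -- counted for `lo` and neither of them for `hi`, one more than the interlacing allows.
      have h2 : insert i' (insert i (Finset.univ.filter fun j => hi j < lo i' ∧ χ j = χ i')) ⊆
          Finset.univ.filter fun j => lo j ≤ lo i' ∧ χ j = χ i' := by
        intro j
        simp only [Finset.mem_insert, Finset.mem_filter, Finset.mem_univ, true_and]
        rintro (rfl | rfl | ⟨h3, h4⟩)
        · exact ⟨le_rfl, rfl⟩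
        · exact ⟨(hlo _ _ hii hc).le, hc⟩
        · refine ⟨?_, h4⟩
          rcases lt_trichotomy j i' with h5 | rfl | h5
          · exact (hlo _ _ h5 h4).le
          · exact le_rfl
          · have := (hhi _ _ hii hc).trans (hhi _ _ h5 h4.symm)
            exact absurd (h3.trans_le hlt) this.asymm
      have h3 := Finset.card_le_card h2
      rw [Finset.card_insert_of_notMem, Finset.card_insert_of_notMem] at h3
      · omega
      · simp [hlt]
      · have := (hlt.trans_lt (hhi _ _ hii hc)).le
        simp [this, hii.ne']

/-- Equal numbers of rows of each colour. -/
theorem InterlaceFin.exists_perm {n : ℕ} {α : Type*} [LinearOrder α] [Nonempty α]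
    {lo hi : Fin n → α}
    {η η' : Fin n → Bool} (h : InterlaceFin lo hi η η') : ∃ ρ : Equiv.Perm (Fin n), ∀ i, η i = η' (ρ i) := by
  have hx : ∃ x, (∀ i, lo i ≤ x) ∧ ∀ i, hi i ≤ x := by
    obtain ⟨x, hx⟩ := Finset.exists_le (Finset.univ.image lo ∪ Finset.univ.image hi)
    exact ⟨x, fun i => hx _ (by simp), fun i => hx _ (by simp)⟩
  obtain ⟨x, h1, h2⟩ := hx
  have hle : ∀ κ, (Finset.univ.filter fun i => η' i = κ).card ≤
      (Finset.univ.filter fun i => η i = κ).card := by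
    intro κ
    have := (h κ x).1
    simpa only [h1, h2, true_and] using this
  have hsum : ∀ ζ : Fin n → Bool, (Finset.univ.filter fun i => ζ i = true).card +
      (Finset.univ.filter fun i => ζ i = false).card = n := by
    intro ζ
    have := Finset.card_filter_add_card_filter_not (s := (Finset.univ : Finset (Fin n)))
      fun i => ζ i = true
    simpa using this
  have heq : ∀ κ, (Finset.univ.filter fun i => η i = κ).card =
      (Finset.univ.filter fun i => η' i = κ).card := by
    have := hsum η
    have := hsum η'
    have := hle true
    have := hle false
    intro κ
    cases κ <;> omega
  have he : ∀ κ, Nonempty ({i // η i = κ} ≃ {i // η' i = κ}) := fun κ => by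
    rw [← Fintype.card_eq, Fintype.card_subtype, Fintype.card_subtype, heq]
  exact ⟨Equiv.ofFiberEquiv fun κ => (he κ).some, fun i =>
    (Equiv.ofFiberEquiv_map (fun κ => (he κ).some) i).symm⟩

/-- Sorted coloured families. -/
def LexInc {n : ℕ} {α : Type*} [LinearOrder α] (w : Fin n → α) (η : Fin n → Bool) : Prop :=
  StrictMono fun i => toLex (w i, η i)

theorem LexInc.mono {n : ℕ} {α : Type*} [LinearOrder α] {w : Fin n → α} {η : Fin n → Bool}
    (h : LexInc w η) : Monotone w := by
  intro i j hij
  have := h.monotone hij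
  rw [Prod.Lex.le_iff] at this
  rcases this with h | ⟨h, -⟩
  · exact h.le
  · exact h.le

theorem LexInc.colInc {n : ℕ} {α : Type*} [LinearOrder α] {w : Fin n → α} {η : Fin n → Bool}
    (h : LexInc w η) : ColInc η w := by
  intro i j hij hc
  have := h hij
  rw [Prod.Lex.lt_iff] at this
  rcases this with h | ⟨-, h⟩
  · exact h
  · exact absurd hc h.ne

theorem ColInc.injective {n : ℕ} {α : Type*} [LinearOrder α] {w : Fin n → α} {η : Fin n → Bool}
    (h : ColInc η w) {i j : Fin n} (hw : w i = w j) (hη : η i = η j) : i = j := by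
  rcases lt_trichotomy i j with hij | hij | hij
  · exact absurd hw (h i j hij hη).ne
  · exact hij
  · exact absurd hw (h j i hij hη.symm).ne'

/-- The permutation that sorts a coloured family. -/
def lexSort {n : ℕ} {α : Type*} [LinearOrder α] (v : Fin n → α) (χ : Fin n → Bool) :
    Equiv.Perm (Fin n) := Tuple.sort fun i => toLex (v i, χ i)

/-- Rows of the same colour have different values, so the pairs of value and colour are distinct and
their sorted order is strict. Ties can occur only between different colours, and the colour decides
them. -/
theorem ColInc.lexInc_sort {n : ℕ} {α : Type*} [LinearOrder α] {v : Fin n → α} {χ : Fin n → Bool}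
    (h : ColInc χ v) : LexInc (v ∘ lexSort v χ) (χ ∘ lexSort v χ) := by
  have h1 := Tuple.monotone_sort fun i => toLex (v i, χ i)
  refine h1.strictMono_of_injective fun i j hij => (lexSort v χ).injective ?_
  have h2 : toLex (v (lexSort v χ i), χ (lexSort v χ i)) =
    toLex (v (lexSort v χ j), χ (lexSort v χ j)) := hij
  rw [toLex_inj, Prod.mk.injEq] at h2
  exact h.injective h2.1 h2.2

theorem LexInc.eq_lexSort {n : ℕ} {α : Type*} [LinearOrder α] {v : Fin n → α} {χ : Fin n → Bool}
    {σ : Equiv.Perm (Fin n)} (hσ : LexInc (v ∘ σ) (χ ∘ σ)) :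
    lexSort v χ = σ := by
  symm
  rw [lexSort, Tuple.eq_sort_iff]
  refine ⟨StrictMono.monotone hσ, fun i j hij he => ?_⟩
  exact absurd he (hσ hij).ne

theorem AdmFam.comp {ι σ α : Type*} {I : σ → Prop} {d : σ → α} {R : α → Prop} {col : σ → Bool}
    {χ : ι → Bool} {v : ι → α} (h : AdmFam I d R col χ v) (τ : Equiv.Perm ι) :
    AdmFam I d R col (χ ∘ τ) (v ∘ τ) := by
  refine ⟨fun i => h.1 (τ i), fun k hk => ?_⟩
  obtain ⟨i, h1, h2⟩ := h.2 k hk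
  exact ⟨τ.symm i, by simpa using h1, by simpa using h2⟩

/-! ### Sorted chains. -/

namespace Strands

variable (S : Strands) {K : Type*} [CommRing K]

/-- In a family that is ordered well enough, the idle strands are at their own places. -/
theorem eq_idleVal_of_adm {col η : Fin S.n → Bool} {m : ℕ} (hm : m ≤ S.L) {w : Fin S.n → S.Val}
    (hA : AdmFam (S.Idle m) (S.idleVal m) (S.InRange m) col η w) (hw : ColInc η w)
    (hord : ∀ k i, S.Idle m k → η i = col k → (k ≤ i → w k ≤ w i) ∧ (i ≤ k → w i ≤ w k)) :
    ∀ k, S.Idle m k → w k = S.idleVal m k ∧ η k = col k := by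
  have hbase := S.base_le m
  have hbase' := S.le_base m
  have hbig : S.n < S.big := by unfold big; omega
  -- Low idle strands are treated by increasing index: the smaller ones are already in place, so
  -- neither a smaller row can carry the value of `k`, nor can the row `k` carry one of their
  -- values.
  have hlow : ∀ N, ∀ k : Fin S.n, k.1 = N → S.typ m k = 0 →
      w k = S.idleVal m k ∧ η k = col k := by
    intro N
    induction N using Nat.strong_induction_on with
    | _ N ih =>
      intro k hkN hk
      have hI : S.Idle m k := by unfold Idle; omega
      obtain ⟨i, h1, h2⟩ := hA.2 k hI
      by_cases hik : i = k
      · subst hik; exact ⟨h1, h2⟩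
      exfalso
      rcases lt_or_gt_of_ne hik with hlt | hlt
      · have h0 : S.typ m i = 0 := by have := S.typ_mono (m := m) hlt.le; omega
        have := ih i (by rw [← hkN]; exact hlt) i rfl h0
        exact hlt.ne (S.idleVal_inj (this.1.symm.trans h1))
      · have hle := (hord k i hI h2).1 hlt.le
        have hv := hA.1 k
        rw [h1, Fin.le_def, S.idleVal_low hk] at hle
        have hkn := k.2
        rcases hv with hv | ⟨k', h3, h4, h5⟩
        · have := hv.1; omega
        · have h6 : S.typ m k' = 0 := by
            by_contra h
            rw [h4, S.idleVal_high h] at hle; omega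
          have hle' := hle
          rw [h4, S.idleVal_low h6] at hle'
          rcases hle'.eq_or_lt with h7 | h7
          · have h7 : k' = k := Fin.ext h7
            subst h7
            exact hlt.ne (hw.injective (h4.trans h1.symm) (h5.trans h2.symm))
          · obtain ⟨h8, h9⟩ := ih k' (by omega) k' rfl h6
            have := hw.injective (h4.trans h8.symm) (h5.trans h9.symm)
            rw [this] at h7; omega
  -- High idle strands are treated in the same way, starting from the largest index.
  have hhigh : ∀ N, ∀ k : Fin S.n, S.n - k.1 = N → S.typ m k = 2 →
      w k = S.idleVal m k ∧ η k = col k := by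
    intro N
    induction N using Nat.strong_induction_on with
    | _ N ih =>
      intro k hkN hk
      have hI : S.Idle m k := by unfold Idle; omega
      obtain ⟨i, h1, h2⟩ := hA.2 k hI
      by_cases hik : i = k
      · subst hik; exact ⟨h1, h2⟩
      exfalso
      have hkn := k.2
      have hin := i.2
      have hkk : S.typ m k ≠ 0 := by omega
      rcases lt_or_gt_of_ne hik with hlt | hlt
      · have hle := (hord k i hI h2).2 hlt.le
        have hv := hA.1 k
        rw [h1, Fin.le_def, S.idleVal_high hkk] at hle
        rcases hv with hv | ⟨k', h3, h4, h5⟩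
        · have := hv.2; unfold big at hle; omega
        · have hk'n := k'.2
          have h6 : S.typ m k' ≠ 0 := by
            intro h
            rw [h4, S.idleVal_low h] at hle; omega
          have hle' := hle
          rw [h4, S.idleVal_high h6] at hle'
          have hle' : k.1 ≤ k'.1 := by omega
          rcases hle'.eq_or_lt with h7 | h7
          · have h7 : k' = k := Fin.ext h7.symm
            subst h7
            exact hlt.ne (hw.injective (h1.trans h4.symm) (h2.trans h5.symm))
          · obtain ⟨h8, h9⟩ := ih (S.n - k'.1) (by omega) k' rfl
              ((S.idle_cases h3).resolve_left h6)
            have := hw.injective (h4.trans h8.symm) (h5.trans h9.symm)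
            rw [this] at h7; omega
      · have hlt' := Fin.lt_def.1 hlt
        have h0 : S.typ m i = 2 := by
          have := S.typ_mono (m := m) hlt.le
          have := S.typ_le m i
          omega
        have := ih (S.n - i.1) (by omega) i rfl h0
        exact hlt.ne' (S.idleVal_inj (this.1.symm.trans h1))
  intro k hk
  rcases S.idle_cases hk with h | h
  · exact hlow _ k rfl h
  · exact hhigh _ k rfl h

theorem LexInc.hord {n : ℕ} {α : Type*} [LinearOrder α] {w : Fin n → α} {η : Fin n → Bool}
    (h : LexInc w η) (k i : Fin n) : (k ≤ i → w k ≤ w i) ∧ (i ≤ k → w i ≤ w k) :=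
  ⟨fun h' => h.mono h', fun h' => h.mono h'⟩

/-- Chains of sorted coloured families. -/
def IsSortedChain (χ χ' : Fin S.n → Bool)
    (Q : Fin (S.L + 1) → (Fin S.n → S.Val) × (Fin S.n → Bool)) : Prop :=
  (∀ m : Fin (S.L + 1), AdmFam (S.Idle m) (S.idleVal m) (S.InRange m) (S.idleCol χ χ' m) (Q m).2
      (Q m).1 ∧ LexInc (Q m).1 (Q m).2) ∧
    ∀ m : Fin S.L, InterlaceFin (S.lo m (Q m.castSucc).1 (Q m.succ).1)
      (S.hi m (Q m.castSucc).1 (Q m.succ).1) (S.lo m (Q m.castSucc).2 (Q m.succ).2)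
      (S.hi m (Q m.castSucc).2 (Q m.succ).2)

/-- Sorting of a coloured family. -/
def sortFam (χ : Fin S.n → Bool) (v : Fin S.n → S.Val) : (Fin S.n → S.Val) × (Fin S.n → Bool) :=
  (v ∘ lexSort v χ, χ ∘ lexSort v χ)

open Classical in
/-- The family with row colours `χ` that has a given sorted rearrangement. -/
noncomputable def unsortFam (χ : Fin S.n → Bool) (q : (Fin S.n → S.Val) × (Fin S.n → Bool)) :
    Fin S.n → S.Val :=
  if h : ∃ u, IsShuffle χ q.2 u then q.1 ∘ h.choose else q.1

theorem unsortFam_eq {χ : Fin S.n → Bool} {q : (Fin S.n → S.Val) × (Fin S.n → Bool)}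
    {u : Equiv.Perm (Fin S.n)} (hu : IsShuffle χ q.2 u) : S.unsortFam χ q = q.1 ∘ u := by
  have h : ∃ u, IsShuffle χ q.2 u := ⟨u, hu⟩
  rw [unsortFam, dif_pos h, h.choose_spec.unique hu]

/-- Rows of one colour are increasing and sorting does not exchange them. Hence the sorted family
together with the row colours `χ` determines the original family. -/
theorem isShuffle_sort_symm {n : ℕ} {α : Type*} [LinearOrder α] {χ : Fin n → Bool} {v : Fin n → α}
    (h : ColInc χ v) : IsShuffle χ (χ ∘ lexSort v χ) (lexSort v χ).symm := by
  refine ⟨fun i => by simp, fun i i' hi hc => ?_⟩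
  by_contra hlt
  have := h.lexInc_sort.mono (not_lt.1 hlt)
  simp only [Function.comp_apply, Equiv.apply_symm_apply] at this
  exact absurd (h i i' hi hc) (not_lt.2 this)

theorem unsort_sort {χ : Fin S.n → Bool} {v : Fin S.n → S.Val} (h : ColInc χ v) :
    S.unsortFam χ (S.sortFam χ v) = v := by
  rw [S.unsortFam_eq (isShuffle_sort_symm h)]
  funext i; simp [sortFam]

theorem lexSort_comp {n : ℕ} {α : Type*} [LinearOrder α] {χ η : Fin n → Bool} {w : Fin n → α}
    (h : LexInc w η) {u : Equiv.Perm (Fin n)} (hu : IsShuffle χ η u) :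
    lexSort (w ∘ u) χ = u.symm := by
  apply LexInc.eq_lexSort
  have h1 : (w ∘ u) ∘ u.symm = w := by funext i; simp
  have h2 : χ ∘ u.symm = η := by funext i; simp [hu.1]
  rw [h1, h2]; exact h

theorem sort_unsort {χ : Fin S.n → Bool} {q : (Fin S.n → S.Val) × (Fin S.n → Bool)}
    (h : LexInc q.1 q.2) {u : Equiv.Perm (Fin S.n)} (hu : IsShuffle χ q.2 u) :
    S.sortFam χ (S.unsortFam χ q) = q := by
  rw [S.unsortFam_eq hu]
  unfold sortFam
  rw [lexSort_comp h hu]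
  ext i
  · simp
  · simp [hu.1]

theorem lo_comp_perm {β : Type*} (m : ℕ) (v v' : Fin S.n → β) (σ σ' : Equiv.Perm (Fin S.n)) :
    S.lo m (v ∘ σ) (v' ∘ σ') = S.lo m v v' ∘ ⇑(S.lo m σ σ') := by
  unfold lo; split_ifs <;> rfl

theorem hi_comp_perm {β : Type*} (m : ℕ) (v v' : Fin S.n → β) (σ σ' : Equiv.Perm (Fin S.n)) :
    S.hi m (v ∘ σ) (v' ∘ σ') = S.hi m v v' ∘ ⇑(S.hi m σ σ') := by
  unfold hi; split_ifs <;> rfl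

theorem lo_self {β : Type*} (m : ℕ) (v : β) : S.lo m v v = v := by
  unfold lo; split_ifs <;> rfl

theorem hi_self {β : Type*} (m : ℕ) (v : β) : S.hi m v v = v := by
  unfold hi; split_ifs <;> rfl

theorem lo_mem {β : Type*} {p : β → Prop} (m : ℕ) {v v' : β} (h : p v) (h' : p v') :
    p (S.lo m v v') := by
  unfold lo; split_ifs <;> assumption

theorem hi_mem {β : Type*} {p : β → Prop} (m : ℕ) {v v' : β} (h : p v) (h' : p v') :
    p (S.hi m v v') := by
  unfold hi; split_ifs <;> assumption

variable {S} in
theorem IsChain.sort {χ χ' : Fin S.n → Bool} {V : Fin (S.L + 1) → Fin S.n → S.Val}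
    (h : S.IsChain χ χ' V) : S.IsSortedChain χ χ' fun m => S.sortFam χ (V m) := by
  refine ⟨fun m => ⟨(h.1 m).1.comp (lexSort (V m) χ), (h.1 m).2.lexInc_sort⟩, fun m => ?_⟩
  have h1 := (h.2 m)
  rw [colGap_iff_interlaceFin (S.lo_mem m (h.1 _).2 (h.1 _).2) (S.hi_mem m (h.1 _).2 (h.1 _).2)] at h1
  simp only [sortFam, lo_comp_perm, hi_comp_perm, lo_self, hi_self]
  rw [InterlaceFin.comp_iff]
  exact h1

variable {S} in
-- In the last column the idle strands prescribe the colours, which are those of `χ`. Interlacing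
-- preserves the number of rows of each colour, and so this number is carried back to every column.
theorem IsSortedChain.exists_shuffle {χ χ' : Fin S.n → Bool}
    {Q : Fin (S.L + 1) → (Fin S.n → S.Val) × (Fin S.n → Bool)} (h : S.IsSortedChain χ χ' Q)
    (m : Fin (S.L + 1)) : ∃ u, IsShuffle χ (Q m).2 u := by
  have : ∃ ρ : Equiv.Perm (Fin S.n), ∀ i, χ i = (Q m).2 (ρ i) := by
    induction m using Fin.reverseInduction with
    | last =>
      refine ⟨1, fun k => ?_⟩
      have := (S.eq_idleVal_of_adm le_rfl (h.1 (Fin.last _)).1 (h.1 _).2.colInc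
        (fun k i _ _ => LexInc.hord (h.1 (Fin.last _)).2 k i) k (S.idle_of_ge (S.b_le k))).2
      exact ((if_pos (S.b_le k) : S.idleCol χ χ' S.L k = χ k).symm.trans this.symm)
    | cast m ih =>
      obtain ⟨ρ, hρ⟩ := ih
      have : Nonempty S.Val ∨ S.n = 0 := by
        rcases Nat.eq_zero_or_pos S.n with h | h
        · exact Or.inr h
        · exact Or.inl ⟨⟨0, by omega⟩⟩
      rcases this with hne | h0
      · obtain ⟨ρ', hρ'⟩ := (h.2 m).exists_perm
        unfold lo hi at hρ'
        split_ifs at hρ'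
        · exact ⟨ρ.trans ρ', fun i => by rw [hρ, hρ']; rfl⟩
        · refine ⟨ρ.trans ρ'.symm, fun i => ?_⟩
          rw [hρ, Equiv.trans_apply, hρ', Equiv.apply_symm_apply]
      · exact ⟨1, fun i => absurd i.2 (by omega)⟩
  obtain ⟨ρ, hρ⟩ := this
  exact IsShuffle.exists ρ hρ

variable {S} in
theorem IsSortedChain.unsort {χ χ' : Fin S.n → Bool}
    {Q : Fin (S.L + 1) → (Fin S.n → S.Val) × (Fin S.n → Bool)} (h : S.IsSortedChain χ χ' Q) :
    S.IsChain χ χ' fun m => S.unsortFam χ (Q m) := by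
  choose u hu using h.exists_shuffle
  have hχ : ∀ m, (Q m).2 ∘ u m = χ := fun m => by funext i; exact ((hu m).1 i).symm
  have hinc : ∀ m, ColInc χ ((Q m).1 ∘ u m) := fun m i i' hi hc =>
    (h.1 m).2.colInc _ _ ((hu m).2 i i' hi hc) (by rw [← (hu m).1, ← (hu m).1, hc])
  refine ⟨fun m => ?_, fun m => ?_⟩
  · simp only [S.unsortFam_eq (hu m)]
    refine ⟨?_, hinc m⟩
    have := (h.1 m).1.comp (u m)
    rw [hχ] at this
    exact this
  · simp only [S.unsortFam_eq (hu m.castSucc), S.unsortFam_eq (hu m.succ)]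
    rw [colGap_iff_interlaceFin (S.lo_mem m (hinc _) (hinc _)) (S.hi_mem m (hinc _) (hinc _)),
      lo_comp_perm, hi_comp_perm]
    have h1 := (InterlaceFin.comp_iff (S.lo m (u m.castSucc) (u m.succ))
      (S.hi m (u m.castSucc) (u m.succ))).2 (h.2 m)
    rw [← lo_comp_perm, ← hi_comp_perm, ← lo_comp_perm, ← hi_comp_perm, hχ, hχ, lo_self,
      hi_self, lo_comp_perm, hi_comp_perm] at h1
    exact h1

open Classical in
-- Sorting every column is a bijection, with inverse the shuffle that restores the row colours `χ`.
-- The weight of a column is a product over its rows and does not depend on their order.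
theorem sum_chains_eq_sum_sortedChains (x : ℕ → K) (χ χ' : Fin S.n → Bool)
    (P P' : (Fin (S.L + 1) → Fin S.n → S.Val) → Prop)
    (hP : ∀ V, S.IsChain χ χ' V → (P V ↔ P' fun m => (S.sortFam χ (V m)).1)) :
    (∑ V : Fin (S.L + 1) → Fin S.n → S.Val,
        if S.IsChain χ χ' V ∧ P V then S.chainWt x V else 0) =
      ∑ Q : Fin (S.L + 1) → (Fin S.n → S.Val) × (Fin S.n → Bool),
        if S.IsSortedChain χ χ' Q ∧ P' (fun m => (Q m).1) then
          S.chainWt x (fun m => (Q m).1) else 0 := by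
  rw [← Finset.sum_filter, ← Finset.sum_filter]
  have hsort : ∀ Q, S.IsSortedChain χ χ' Q →
      (fun m => S.sortFam χ (S.unsortFam χ (Q m))) = Q := by
    intro Q hQ
    funext m
    obtain ⟨u, hu⟩ := hQ.exists_shuffle m
    exact S.sort_unsort (hQ.1 m).2 hu
  refine Finset.sum_bij' (fun V _ m => S.sortFam χ (V m)) (fun Q _ m => S.unsortFam χ (Q m))
    ?_ ?_ ?_ ?_ ?_
  · intro V hV
    rw [Finset.mem_filter] at hV ⊢
    exact ⟨Finset.mem_univ _, hV.2.1.sort, (hP V hV.2.1).1 hV.2.2⟩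
  · intro Q hQ
    rw [Finset.mem_filter] at hQ ⊢
    refine ⟨Finset.mem_univ _, hQ.2.1.unsort, (hP _ hQ.2.1.unsort).2 ?_⟩
    have h1 := hsort Q hQ.2.1
    have h2 : (fun m => (S.sortFam χ (S.unsortFam χ (Q m))).1) = fun m => (Q m).1 := by
      funext m; rw [congrFun h1 m]
    rw [h2]; exact hQ.2.2
  · intro V hV
    rw [Finset.mem_filter] at hV
    funext m
    exact S.unsort_sort (hV.2.1.1 m).2
  · intro Q hQ
    rw [Finset.mem_filter] at hQ
    exact hsort Q hQ.2.1
  · intro V _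
    unfold chainWt
    refine Finset.prod_congr rfl fun m _ => ?_
    exact (Equiv.prod_comp (lexSort (V m) χ) fun i => S.wt x m (V m i)).symm

end Strands

/-! ### Recolouring -/

/-- Extension of a tuple of values by zeros. -/
def extend {n B : ℕ} (v : Fin n → Fin B) (k : ℕ) : ℕ := if h : k < n then (v ⟨k, h⟩).1 else 0

/-- Extension of a tuple of colours. -/
def extendCol {n : ℕ} (v : Fin n → Bool) (k : ℕ) : Bool := if h : k < n then v ⟨k, h⟩ else false

/-- The parity of a number as a colour. -/
def parCol {n : ℕ} (k : Fin n) : Bool := Nat.bodd k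

theorem extend_coe {n B : ℕ} (v : Fin n → Fin B) (k : Fin n) : extend v k = (v k).1 := by
  simp [extend]

theorem extendCol_coe {n : ℕ} (v : Fin n → Bool) (k : Fin n) : extendCol v k = v k := by
  simp [extendCol]

theorem card_range_filter {n : ℕ} (P : ℕ → Prop) (p : Fin n → Prop) [DecidablePred P]
    [DecidablePred p] (h : ∀ i : Fin n, P i ↔ p i) :
    ((Finset.range n).filter P).card = (Finset.univ.filter p).card := by
  symm
  refine Finset.card_bij (fun i _ => i.1) ?_ ?_ ?_
  · intro i hi
    simp only [Finset.mem_filter, Finset.mem_univ, true_and] at hi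
    simp [(h i).2 hi]
  · intro i _ j _ hij; exact Fin.ext hij
  · intro i hi
    simp only [Finset.mem_filter, Finset.mem_range] at hi
    exact ⟨⟨i, hi.1⟩, by simpa using (h ⟨i, hi.1⟩).1 hi.2, rfl⟩

theorem interlaceFin_iff {n B : ℕ} (hB : 0 < B) (lo hi : Fin n → Fin B) (η η' : Fin n → Bool) :
    InterlaceFin lo hi η η' ↔
      Interlace n (extend lo) (extend hi) (extendCol η) (extendCol η') := by
  have h1 : ∀ (v : Fin n → Fin B) (ζ : Fin n → Bool) κ x,
      ((Finset.range n).filter fun i => extend v i ≤ x ∧ extendCol ζ i = κ).card =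
      (Finset.univ.filter fun i => (v i).1 ≤ x ∧ ζ i = κ).card := fun v ζ κ x =>
    card_range_filter _ _ fun i => by rw [extend_coe, extendCol_coe]
  have h2 : ∀ (v : Fin n → Fin B) (ζ : Fin n → Bool) κ x,
      ((Finset.range n).filter fun i => extend v i < x ∧ extendCol ζ i = κ).card =
      (Finset.univ.filter fun i => (v i).1 < x ∧ ζ i = κ).card := fun v ζ κ x =>
    card_range_filter _ _ fun i => by rw [extend_coe, extendCol_coe]
  constructor
  · intro h κ x
    rw [h1, h1, h2]
    by_cases hx : x < B
    · exact h κ ⟨x, hx⟩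
    -- A threshold beyond all values counts the same rows `≤ x` as `B - 1`. The strict count can
    -- only grow.
    · have h3 := h κ ⟨B - 1, by omega⟩
      simp only [Fin.le_def, Fin.lt_def] at h3
      have h4 : ∀ (v : Fin n → Fin B) i, ((v i).1 ≤ x) ↔ ((v i).1 ≤ B - 1) := fun v i => by
        have := (v i).2; omega
      simp only [h4]
      refine ⟨h3.1, h3.2.trans (Nat.add_le_add_right (Finset.card_le_card fun i => ?_) 1)⟩
      simp only [Finset.mem_filter, Finset.mem_univ, true_and]
      exact fun hi => ⟨by omega, hi.2⟩
  · intro h κ x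
    have := h κ x.1
    rw [h1, h1, h2] at this
    exact this

/-- The agreement along lines is a linear condition over the field with two elements. -/
theorem Compat.xor {n : ℕ} {lo hi : ℕ → ℕ} {f f' g g' : ℕ → Bool} (h : Compat n lo hi f f')
    (h' : Compat n lo hi g g') :
    Compat n lo hi (fun k => xor (f k) (g k)) (fun k => xor (f' k) (g' k)) := by
  intro q hq
  have h1 := h q hq
  have h2 := h' q hq
  have e1 : inFlip n lo hi (fun k => Bool.xor (f k) (g k)) (fun k => Bool.xor (f' k) (g' k)) q =
      Bool.xor (inFlip n lo hi f f' q) (inFlip n lo hi g g' q) := by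
    rcases q with _ | q
    · rfl
    · simp only [inFlip]; split_ifs <;> rfl
  have e2 : outFlip n lo hi (fun k => Bool.xor (f k) (g k)) (fun k => Bool.xor (f' k) (g' k)) q =
      Bool.xor (outFlip n lo hi f f' q) (outFlip n lo hi g g' q) := by
    simp only [outFlip]; split_ifs <;> rfl
  rw [e1, e2, h1, h2]

theorem Compat.congr {n : ℕ} {lo hi : ℕ → ℕ} {f f' g g' : ℕ → Bool} (h : Compat n lo hi f f')
    (hf : ∀ k < n, f k = g k) (hf' : ∀ k < n, f' k = g' k) : Compat n lo hi g g' := by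
  intro q hq
  have h1 := h q hq
  have e1 : inFlip n lo hi f f' q = inFlip n lo hi g g' q := by
    rcases q with _ | q
    · exact hf _ hq
    · simp only [inFlip]; rw [hf _ hq, hf' _ (by omega)]
  have e2 : outFlip n lo hi f f' q = outFlip n lo hi g g' q := by
    simp only [outFlip]
    split_ifs with hc
    · exact hf _ hc.1
    · exact hf' _ hq
  rw [← e1, ← e2, h1]

/-! ### Planar colourings of chains. -/

namespace Strands

variable (S : Strands) {K : Type*} [CommRing K]

theorem big_pos : 0 < S.big + S.n := by unfold big; omega

/-- The boundary colours `φL` (at the sinks) and `φR` (at the sources) extend to a colouring that is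
constant along the lines of `V`. -/
def IsPlanar (V : Fin (S.L + 1) → Fin S.n → S.Val) (φL φR : Fin S.n → Bool) : Prop :=
  ∃ g : Fin (S.L + 1) → Fin S.n → Bool,
    (∀ m : Fin S.L, Compat S.n (extend (S.lo m (V m.castSucc) (V m.succ)))
      (extend (S.hi m (V m.castSucc) (V m.succ))) (extendCol (S.lo m (g m.castSucc) (g m.succ)))
      (extendCol (S.hi m (g m.castSucc) (g m.succ)))) ∧
    ∀ (m : Fin (S.L + 1)) k, S.Idle m k → g m k = S.idleCol φL φR m k

/-- Low idle values lie below all active ones and high idle values above them, and among themselves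
they are ordered by index. So an idle strand is in strict order with its neighbours, and resetting
inverted strands never touches the boundary colours. -/
theorem not_inverted_of_idle {col η : Fin S.n → Bool} {m : ℕ} (hm : m ≤ S.L) {w : Fin S.n → S.Val}
    (hA : AdmFam (S.Idle m) (S.idleVal m) (S.InRange m) col η w) (hw : ColInc η w)
    (hd : ∀ k, S.Idle m k → w k = S.idleVal m k ∧ η k = col k) {k : Fin S.n} (hk : S.Idle m k) :
    ¬ Inverted S.n (extend w) k := by
  have hbase := S.base_le m
  have hbase' := S.le_base m
  have hbig : S.n < S.big := by unfold big; omega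
  have hplace : ∀ i k', S.Idle m k' → w i = S.idleVal m k' → η i = col k' → i = k' := by
    intro i k' h1 h2 h3
    exact hw.injective (h2.trans (hd k' h1).1.symm) (h3.trans (hd k' h1).2.symm)
  have hkn := k.2
  rintro (⟨hk1, h⟩ | ⟨j, hj, h⟩)
  · set k1 : Fin S.n := ⟨k.1 + 1, hk1⟩ with hk1d
    rw [show k.1 + 1 = k1.1 from rfl, extend_coe, extend_coe, (hd k hk).1] at h
    have hlt : k < k1 := Fin.lt_def.2 (by simp [hk1d])
    rcases S.idle_cases hk with h0 | h0
    · rw [S.idleVal_low h0] at h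
      rcases hA.1 k1 with h2 | ⟨k', h2, h3, h4⟩
      · have := h2.1; omega
      · have h5 := hplace _ _ h2 h3 h4
        rw [h5] at hlt h3
        rw [h5, h3] at h
        by_cases h6 : S.typ m k' = 0
        · rw [S.idleVal_low h6] at h; exact absurd hlt (not_lt.2 (Fin.le_def.2 h))
        · rw [S.idleVal_high h6] at h; omega
    · have h1 := S.typ_mono (m := m) hlt.le
      have h2 := S.typ_le m k1
      have h3 : S.Idle m k1 := by unfold Idle; omega
      rw [(hd k1 h3).1] at h
      exact absurd (S.idleVal_strictMono (m := m) hlt) (not_lt.2 (Fin.le_def.2 h))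
  · set k1 : Fin S.n := ⟨j, by omega⟩ with hk1d
    rw [show j = k1.1 from rfl, extend_coe, extend_coe, (hd k hk).1] at h
    have hlt : k1 < k := Fin.lt_def.2 (by simp [hk1d]; omega)
    rcases S.idle_cases hk with h0 | h0
    · have h1 := S.typ_mono (m := m) hlt.le
      have h3 : S.Idle m k1 := by unfold Idle; omega
      rw [(hd k1 h3).1] at h
      exact absurd (S.idleVal_strictMono (m := m) hlt) (not_lt.2 (Fin.le_def.2 h))
    · rw [S.idleVal_high (by omega)] at h
      rcases hA.1 k1 with h2 | ⟨k', h2, h3, h4⟩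
      · have := h2.2; unfold big at h; omega
      · have h5 := hplace _ _ h2 h3 h4
        rw [h5] at hlt h3
        rw [h5, h3] at h
        have := Fin.lt_def.1 hlt
        by_cases h6 : S.typ m k' = 0
        · rw [S.idleVal_low h6] at h; omega
        · rw [S.idleVal_high h6] at h; omega

end Strands

/-! ### Point colours, row colours and translation of sorted chains. -/

namespace Strands

variable (S : Strands) {K : Type*} [CommRing K]

/-- The colours of rows that correspond to colours of points: strands of different parity that have
the same colour run in opposite directions. -/
def rowCol (φ : Fin S.n → Bool) (k : Fin S.n) : Bool := xor (parCol k) (φ k)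

theorem idleCol_rowCol (φL φR : Fin S.n → Bool) (m : ℕ) (k : Fin S.n) :
    S.idleCol (S.rowCol φL) (S.rowCol φR) m k = xor (parCol k) (S.idleCol φL φR m k) := by
  unfold idleCol rowCol; split_ifs <;> rfl

theorem idleCol_same (φ : Fin S.n → Bool) (m : ℕ) (k : Fin S.n) : S.idleCol φ φ m k = φ k := by
  unfold idleCol; split_ifs <;> rfl

theorem map_lo {β γ : Type*} (f : β → γ) (m : ℕ) (v v' : β) :
    f (S.lo m v v') = S.lo m (f v) (f v') := by unfold lo; split_ifs <;> rfl

theorem map_hi {β γ : Type*} (f : β → γ) (m : ℕ) (v v' : β) :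
    f (S.hi m v v') = S.hi m (f v) (f v') := by unfold hi; split_ifs <;> rfl

theorem map₂_lo {β β' γ : Type*} (f : β → β' → γ) (m : ℕ) (v v' : β) (w w' : β') :
    f (S.lo m v v') (S.lo m w w') = S.lo m (f v w) (f v' w') := by unfold lo; split_ifs <;> rfl

theorem map₂_hi {β β' γ : Type*} (f : β → β' → γ) (m : ℕ) (v v' : β) (w w' : β') :
    f (S.hi m v v') (S.hi m w w') = S.hi m (f v w) (f v' w') := by unfold hi; split_ifs <;> rfl

/-- The colouring `g`, reset on inverted strands. -/
noncomputable def resetCol (w : Fin S.n → S.Val) (g : Fin S.n → Bool) (k : Fin S.n) : Bool :=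
  resetFlip S.n (extend w) (extendCol g) k

theorem extendCol_resetCol (w : Fin S.n → S.Val) (g : Fin S.n → Bool) {k : ℕ} (hk : k < S.n) :
    resetFlip S.n (extend w) (extendCol g) k = extendCol (S.resetCol w g) k := by
  simp [extendCol, hk, resetCol]

theorem resetCol_of_not_inverted {w : Fin S.n → S.Val} {g : Fin S.n → Bool} {k : Fin S.n}
    (h : ¬ Inverted S.n (extend w) k) : S.resetCol w g k = g k := by
  rw [resetCol, resetFlip, if_neg h, extendCol_coe]

theorem flipOf_extendCol (η : Fin S.n → Bool) {k : ℕ} (hk : k < S.n) :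
    flipOf (extendCol η) k = extendCol (S.rowCol η) k := by
  simp [flipOf, extendCol, hk, rowCol, parCol, Bool.xor_comm]

/-- Facts about the columns of sorted chains. -/
theorem IsSortedChain.idle {χ χ' : Fin S.n → Bool}
    {Q : Fin (S.L + 1) → (Fin S.n → S.Val) × (Fin S.n → Bool)} (h : S.IsSortedChain χ χ' Q)
    (m : Fin (S.L + 1)) (k : Fin S.n) (hk : S.Idle m k) :
    (Q m).1 k = S.idleVal m k ∧ (Q m).2 k = S.idleCol χ χ' m k :=
  S.eq_idleVal_of_adm (Nat.lt_succ_iff.1 m.2) (h.1 m).1 (h.1 m).2.colInc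
    (fun k i _ _ => LexInc.hord (h.1 m).2 k i) k hk

variable {S} in
theorem IsSortedChain.not_inverted {χ χ' : Fin S.n → Bool}
    {Q : Fin (S.L + 1) → (Fin S.n → S.Val) × (Fin S.n → Bool)} (h : S.IsSortedChain χ χ' Q)
    (m : Fin (S.L + 1)) {k : Fin S.n} (hk : S.Idle m k) : ¬ Inverted S.n (extend (Q m).1) k :=
  S.not_inverted_of_idle (Nat.lt_succ_iff.1 m.2) (h.1 m).1 (h.1 m).2.colInc (h.idle S m) hk

theorem extend_mono {w : Fin S.n → S.Val} (h : Monotone w) (i j : ℕ) (hij : i ≤ j) (hj : j < S.n) :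
    extend w i ≤ extend w j := by
  have := h (show (⟨i, by omega⟩ : Fin S.n) ≤ ⟨j, hj⟩ from hij)
  rw [Fin.le_def] at this
  simpa [extend, hj, hij.trans_lt hj] using this

/-- The alternating colouring in `interlace_iff` is absorbed by passing from colours of rows to
colours of points. -/
theorem interlace_iff_gapOK {lo hi : Fin S.n → S.Val} (hlo : Monotone lo) (hhi : Monotone hi)
    (η η' : Fin S.n → Bool) : InterlaceFin lo hi η η' ↔ GapOK S.n (extend lo) (extend hi) ∧
      Compat S.n (extend lo) (extend hi) (extendCol (S.rowCol η)) (extendCol (S.rowCol η')) := by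
  rw [interlaceFin_iff S.big_pos, interlace_iff (S.extend_mono hlo) (S.extend_mono hhi)]
  refine and_congr Iff.rfl ⟨fun h => h.congr ?_ ?_, fun h => h.congr ?_ ?_⟩ <;>
  intro k hk <;> simp [S.flipOf_extendCol _ hk]

variable {S} in
theorem IsSortedChain.gap {χ χ' : Fin S.n → Bool}
    {Q : Fin (S.L + 1) → (Fin S.n → S.Val) × (Fin S.n → Bool)} (h : S.IsSortedChain χ χ' Q)
    (m : Fin S.L) : GapOK S.n (extend (S.lo m (Q m.castSucc).1 (Q m.succ).1))
        (extend (S.hi m (Q m.castSucc).1 (Q m.succ).1)) ∧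
      Compat S.n (extend (S.lo m (Q m.castSucc).1 (Q m.succ).1))
        (extend (S.hi m (Q m.castSucc).1 (Q m.succ).1))
        (extendCol (S.lo m (S.rowCol (Q m.castSucc).2) (S.rowCol (Q m.succ).2)))
        (extendCol (S.hi m (S.rowCol (Q m.castSucc).2) (S.rowCol (Q m.succ).2))) := by
  have := h.2 m
  rw [S.interlace_iff_gapOK (S.lo_mem m (h.1 _).2.mono (h.1 _).2.mono)
    (S.hi_mem m (h.1 _).2.mono (h.1 _).2.mono)] at this
  rw [S.map_lo S.rowCol, S.map_hi S.rowCol] at this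
  exact this

/-- A planar colouring that vanishes on inverted strands. -/
def IsResetColouring (V : Fin (S.L + 1) → Fin S.n → S.Val) (φL φR : Fin S.n → Bool)
    (g : Fin (S.L + 1) → Fin S.n → Bool) : Prop :=
  (∀ m : Fin S.L, Compat S.n (extend (S.lo m (V m.castSucc) (V m.succ)))
      (extend (S.hi m (V m.castSucc) (V m.succ))) (extendCol (S.lo m (g m.castSucc) (g m.succ)))
      (extendCol (S.hi m (g m.castSucc) (g m.succ)))) ∧
    (∀ (m : Fin (S.L + 1)) k, S.Idle m k → g m k = S.idleCol φL φR m k) ∧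
    ∀ (m : Fin (S.L + 1)) (k : Fin S.n), Inverted S.n (extend (V m)) k → g m k = false

theorem compat_resetCol {m : ℕ} {v v' : Fin S.n → S.Val} {g g' : Fin S.n → Bool}
    {lo' hi' : ℕ → ℕ}
    (h : Compat S.n lo' hi'
      (resetFlip S.n (extend (S.lo m v v')) (extendCol (S.lo m g g')))
      (resetFlip S.n (extend (S.hi m v v')) (extendCol (S.hi m g g')))) :
    Compat S.n lo' hi'
      (extendCol (S.lo m (S.resetCol v g) (S.resetCol v' g')))
      (extendCol (S.hi m (S.resetCol v g) (S.resetCol v' g'))) := by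
  refine h.congr (fun k hk => ?_) fun k hk => ?_
  · rw [S.extendCol_resetCol _ _ hk, S.map₂_lo S.resetCol]
  · rw [S.extendCol_resetCol _ _ hk, S.map₂_hi S.resetCol]

variable {S} in
-- Inverted strands form closed loops away from the idle strands, so their colours may be erased
-- without changing the boundary values.
theorem IsSortedChain.exists_reset {χ χ' : Fin S.n → Bool}
    {Q : Fin (S.L + 1) → (Fin S.n → S.Val) × (Fin S.n → Bool)} (h : S.IsSortedChain χ χ' Q)
    {φL φR : Fin S.n → Bool} (hP : S.IsPlanar (fun m => (Q m).1) φL φR) :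
    ∃ g, S.IsResetColouring (fun m => (Q m).1) φL φR g := by
  obtain ⟨g, hg, hg'⟩ := hP
  refine ⟨fun m => S.resetCol (Q m).1 (g m), fun m => ?_, fun m k hk => ?_, fun m k hk => ?_⟩
  · exact S.compat_resetCol ((hg m).reset (h.gap m).1)
  · dsimp only
    rw [S.resetCol_of_not_inverted (h.not_inverted m hk), hg' m k hk]
  · exact if_pos hk

/-- Translation of a sorted chain by a colouring. -/
def translate (g : Fin (S.L + 1) → Fin S.n → Bool)
    (Q : Fin (S.L + 1) → (Fin S.n → S.Val) × (Fin S.n → Bool)) (m : Fin (S.L + 1)) :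
    (Fin S.n → S.Val) × (Fin S.n → Bool) := ((Q m).1, fun k => xor ((Q m).2 k) (g m k))

variable {S} in
-- Adding a colouring that is constant along the lines preserves agreement along the lines, and the
-- inequalities `GapOK` do not see colours. The reset is needed for the order of the pairs: rows
-- with equal values are inverted, so their colours stay as they are and ties are still broken in
-- the same way.
theorem IsSortedChain.translate {χ χ' χ₁ χ₁' φL φR : Fin S.n → Bool}
    {Q : Fin (S.L + 1) → (Fin S.n → S.Val) × (Fin S.n → Bool)} (h : S.IsSortedChain χ χ' Q)
    {g : Fin (S.L + 1) → Fin S.n → Bool} (hg : S.IsResetColouring (fun m => (Q m).1) φL φR g)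
    (h1 : ∀ k, χ₁ k = xor (χ k) (φL k)) (h2 : ∀ k, χ₁' k = xor (χ' k) (φR k)) :
    S.IsSortedChain χ₁ χ₁' (S.translate g Q) := by
  have hc : ∀ (m : Fin (S.L + 1)) k, S.Idle m k →
      xor ((Q m).2 k) (g m k) = S.idleCol χ₁ χ₁' m k := by
    intro m k hk
    rw [(h.idle S m k hk).2, hg.2.1 m k hk]
    unfold idleCol
    split_ifs <;> simp [h1, h2]
  have hlex : ∀ m, LexInc (Q m).1 (fun k => xor ((Q m).2 k) (g m k)) := by
    intro m i j hij
    have h3 := (h.1 m).2 hij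
    rw [Prod.Lex.lt_iff] at h3 ⊢
    rcases h3 with h3 | ⟨h3, h4⟩
    · exact Or.inl h3
    · refine Or.inr ⟨h3, ?_⟩
      have h3' : (Q m).1 i = (Q m).1 j := h3
      have h4' : (Q m).2 i < (Q m).2 j := h4
      have hjn := j.2
      have hij' := Fin.lt_def.1 hij
      -- The values between two equal values of a sorted column are equal as well, so `i` is tied
      -- with the next row and `j` with the one before it.
      have hi : g m i = false := by
        refine hg.2.2 m i (Or.inl ⟨by omega, ?_⟩)
        rw [extend_coe]
        have := S.extend_mono (h.1 m).2.mono (i + 1) j (by omega) hjn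
        rwa [extend_coe, ← h3'] at this
      have hj : g m j = false := by
        refine hg.2.2 m j (Or.inr ⟨j - 1, by omega, ?_⟩)
        rw [extend_coe]
        have := S.extend_mono (h.1 m).2.mono i (j - 1) (by omega) (by omega)
        rwa [extend_coe, h3'] at this
      show xor ((Q m).2 i) (g m i) < xor ((Q m).2 j) (g m j)
      rw [hi, hj, Bool.xor_false, Bool.xor_false]
      exact h4'
  refine ⟨fun m => ⟨⟨fun i => ?_, fun k hk => ⟨k, (h.idle S m k hk).1, hc m k hk⟩⟩, hlex m⟩,
    fun m => ?_⟩
  · rcases (h.1 m).1.1 i with h3 | ⟨k, h3, h4, h5⟩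
    · exact Or.inl h3
    · have hik : i = k := (h.1 m).2.colInc.injective (h4.trans (h.idle S m k h3).1.symm)
        (h5.trans (h.idle S m k h3).2.symm)
      subst hik
      exact Or.inr ⟨i, h3, h4, hc m i h3⟩
  · have h3 := h.gap m
    have hmono : ∀ m, Monotone (S.translate g Q m).1 := fun m => (h.1 m).2.mono
    rw [S.interlace_iff_gapOK (S.lo_mem m (hmono _) (hmono _)) (S.hi_mem m (hmono _) (hmono _))]
    refine ⟨h3.1, (h3.2.xor (hg.1 m)).congr ?_ ?_⟩
    · intro k hk
      unfold lo
      split_ifs <;> simp [extendCol, hk, rowCol, Strands.translate]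
    · intro k hk
      unfold hi
      split_ifs <;> simp [extendCol, hk, rowCol, Strands.translate]

end Strands

/-! ### Recolouring of chains. -/

namespace Strands

variable (S : Strands) {K : Type*} [CommRing K]

theorem isSorting_sortFam {χ : Fin S.n → Bool} {v : Fin S.n → S.Val} (h : ColInc χ v) :
    IsSorting S.n (extend v) (extend (S.sortFam χ v).1) := by
  refine ⟨S.extend_mono h.lexInc_sort.mono, fun x => ?_⟩
  rw [card_range_filter _ (fun i => (v i).1 ≤ x) fun i => by rw [extend_coe],
    card_range_filter _ (fun i => ((S.sortFam χ v).1 i).1 ≤ x) fun i => by rw [extend_coe]]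
  exact (card_filter_comp_perm (lexSort v χ) fun i => (v i).1 ≤ x).symm

/-- Rows two apart have the same parity, hence the same colour in the alternating colouring. -/
theorem gapOK_of_colGap {lo hi : Fin S.n → S.Val} (h : ColGap parCol lo hi) :
    GapOK S.n (extend lo) (extend hi) := by
  refine ⟨fun q hq => ?_, fun q hq => ?_⟩
  · have := h.1 ⟨q, hq⟩
    simpa [extend, hq] using this
  · have := h.2 ⟨q, by omega⟩ ⟨q + 2, hq⟩ (Fin.lt_def.2 (by simp))
      (by simp [parCol])
    simpa [extend, hq, show q < S.n by omega] using this

variable {S} in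
theorem IsChain.idle_parCol {V : Fin (S.L + 1) → Fin S.n → S.Val} (h : S.IsChain parCol parCol V)
    (m : Fin (S.L + 1)) (k : Fin S.n) (hk : S.Idle m k) :
    V m k = S.idleVal m k ∧ parCol k = S.idleCol parCol parCol m k := by
  refine S.eq_idleVal_of_adm (Nat.lt_succ_iff.1 m.2) (h.1 m).1 (h.1 m).2 (fun k i _ hc => ?_) k hk
  rw [idleCol_same] at hc
  constructor
  · intro hi
    rcases hi.eq_or_lt with rfl | hi
    · exact le_rfl
    · exact ((h.1 m).2 k i hi hc.symm).le
  · intro hi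
    rcases hi.eq_or_lt with rfl | hi
    · exact le_rfl
    · exact ((h.1 m).2 i k hi hc).le

/-- Sorting changes only lines of inverted strands, which are small closed loops. A colouring reset
on the strands inverted in `V` is therefore constant along the lines before and after sorting, and
it keeps its values on idle strands. -/
theorem isPlanar_sort_iff {V : Fin (S.L + 1) → Fin S.n → S.Val} (h : S.IsChain parCol parCol V)
    (φL φR : Fin S.n → Bool) : S.IsPlanar V φL φR ↔
      S.IsPlanar (fun m => (S.sortFam parCol (V m)).1) φL φR := by
  have hsort : ∀ m, IsSorting S.n (extend (V m)) (extend (S.sortFam parCol (V m)).1) := fun m =>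
    S.isSorting_sortFam (h.1 m).2
  have hlo : ∀ m : Fin S.L, IsSorting S.n (extend (S.lo m (V m.castSucc) (V m.succ)))
      (extend (S.lo m (S.sortFam parCol (V m.castSucc)).1 (S.sortFam parCol (V m.succ)).1)) := by
    intro m
    unfold lo; split_ifs <;> exact hsort _
  have hhi : ∀ m : Fin S.L, IsSorting S.n (extend (S.hi m (V m.castSucc) (V m.succ)))
      (extend (S.hi m (S.sortFam parCol (V m.castSucc)).1 (S.sortFam parCol (V m.succ)).1)) := by
    intro m
    unfold hi; split_ifs <;> exact hsort _
  have hidle : ∀ (g : Fin (S.L + 1) → Fin S.n → Bool) (m : Fin (S.L + 1)) k, S.Idle m k →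
      S.resetCol (V m) (g m) k = g m k := fun g m k hk =>
    S.resetCol_of_not_inverted (S.not_inverted_of_idle (Nat.lt_succ_iff.1 m.2) (h.1 m).1 (h.1 m).2
      (h.idle_parCol m) hk)
  constructor
  · rintro ⟨g, hg, hg'⟩
    refine ⟨fun m => S.resetCol (V m) (g m), fun m => ?_, fun m k hk => ?_⟩
    · exact S.compat_resetCol ((hg m).sort (S.gapOK_of_colGap (h.2 m)) (hlo m) (hhi m))
    · exact (hidle g m k hk).trans (hg' m k hk)
  · rintro ⟨g, hg, hg'⟩
    refine ⟨fun m => S.resetCol (V m) (g m), fun m => ?_, fun m k hk => ?_⟩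
    · exact S.compat_resetCol ((hg m).unsort (S.gapOK_of_colGap (h.2 m)) (hlo m) (hhi m))
    · exact (hidle g m k hk).trans (hg' m k hk)

open Classical in
/-- A reset colouring, if there is one. -/
noncomputable def someReset (φL φR : Fin S.n → Bool) (V : Fin (S.L + 1) → Fin S.n → S.Val) :
    Fin (S.L + 1) → Fin S.n → Bool :=
  if h : ∃ g, S.IsResetColouring V φL φR g then h.choose else fun _ _ => false

theorem someReset_spec {φL φR : Fin S.n → Bool} {V : Fin (S.L + 1) → Fin S.n → S.Val}
    (h : ∃ g, S.IsResetColouring V φL φR g) :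
    S.IsResetColouring V φL φR (S.someReset φL φR V) := by
  rw [someReset, dif_pos h]; exact h.choose_spec

open Classical in
/-- Recolouring: chains that admit a planar colouring with given boundary colours correspond to
chains whose rows have the corresponding colours. -/
theorem sum_isPlanar (x : ℕ → K) (φL φR : Fin S.n → Bool) :
    (∑ V : Fin (S.L + 1) → Fin S.n → S.Val,
        if S.IsChain parCol parCol V ∧ S.IsPlanar V φL φR then S.chainWt x V else 0) =
      ∑ V : Fin (S.L + 1) → Fin S.n → S.Val,
        if S.IsChain (S.rowCol φL) (S.rowCol φR) V then S.chainWt x V else 0 := by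
  have h1 := S.sum_chains_eq_sum_sortedChains x (S.rowCol φL) (S.rowCol φR) (fun _ => True)
    (fun _ => True) fun _ _ => Iff.rfl
  simp only [and_true] at h1
  rw [h1, S.sum_chains_eq_sum_sortedChains x parCol parCol _ (fun V => S.IsPlanar V φL φR)
    fun V hV => S.isPlanar_sort_iff hV φL φR, ← Finset.sum_filter, ← Finset.sum_filter]
  set T : (Fin (S.L + 1) → (Fin S.n → S.Val) × (Fin S.n → Bool)) →
      (Fin (S.L + 1) → (Fin S.n → S.Val) × (Fin S.n → Bool)) := fun Q =>
    S.translate (S.someReset φL φR fun m => (Q m).1) Q with hT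
  -- The reset colouring is chosen from the values alone, and translation changes only the colours.
  -- Translating twice adds the same colouring twice.
  have hTT : ∀ Q, T (T Q) = Q := by
    intro Q
    funext m
    refine Prod.ext rfl ?_
    funext k
    simp [hT, translate]
  -- The colours of such a chain, taken relative to the alternating ones, are themselves a planar
  -- colouring with the required boundary values.
  have hback : ∀ Q, S.IsSortedChain (S.rowCol φL) (S.rowCol φR) Q →
      S.IsPlanar (fun m => (Q m).1) φL φR := by
    intro Q hQ
    refine ⟨fun m => S.rowCol (Q m).2, fun m => (hQ.gap m).2, fun m k hk => ?_⟩
    show xor (parCol k) ((Q m).2 k) = _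
    rw [(hQ.idle S m k hk).2, idleCol_rowCol]
    simp
  refine Finset.sum_bij' (fun Q _ => T Q) (fun Q _ => T Q) ?_ ?_ (fun Q _ => hTT Q)
    (fun Q _ => hTT Q) fun Q _ => rfl
  · intro Q hQ
    rw [Finset.mem_filter] at hQ ⊢
    exact ⟨Finset.mem_univ _, hQ.2.1.translate
      (S.someReset_spec (hQ.2.1.exists_reset hQ.2.2)) (fun _ => rfl) (fun _ => rfl)⟩
  · intro Q hQ
    rw [Finset.mem_filter] at hQ ⊢
    refine ⟨Finset.mem_univ _, hQ.2.translate
      (S.someReset_spec (hQ.2.exists_reset (hback Q hQ.2))) (fun k => ?_) (fun k => ?_),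
      hback Q hQ.2⟩ <;> simp [rowCol]

end Strands

/-! ### Words in adjacent transpositions -/

/-- Elements that satisfy the relations of the first `N` adjacent transpositions. -/
structure CoxeterLike {M : Type*} [Monoid M] (N : ℕ) (g : ℕ → M) : Prop where
  sq : ∀ i < N, g i * g i = 1
  braid : ∀ i, i + 1 < N → g (i + 1) * g i * g (i + 1) = g i * g (i + 1) * g i
  comm : ∀ i j, i + 1 < j → j < N → g i * g j = g j * g i

/-- The descending product `g k * g (k - 1) * ⋯` with `d` factors. -/
def descProd {M : Type*} [Monoid M] (g : ℕ → M) (k : ℕ) : ℕ → M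
  | 0 => 1
  | d + 1 => descProd g k d * g (k - d)

namespace CoxeterLike

variable {M : Type*} [Monoid M] {N : ℕ} {g : ℕ → M}

theorem descProd_comm (h : CoxeterLike N g) {k : ℕ} (hk : k < N) {i d : ℕ} (hi : i + d < k) :
    descProd g k d * g i = g i * descProd g k d := by
  induction d with
  | zero => simp [descProd]
  | succ d ih =>
    rw [descProd, mul_assoc, ← h.comm i (k - d) (by omega) (by omega), ← mul_assoc,
      ih (by omega), mul_assoc]

/-- The letter `i + 1` commutes with the factors below `i` until it meets the factors `i + 1` and
`i`. The braid relation turns it into `i`, which commutes with the remaining larger factors. -/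
theorem descProd_shift (h : CoxeterLike N g) {k : ℕ} (hk : k < N) {i d : ℕ} (hik : i < k)
    (hi : k < i + d) (hd : d ≤ k + 1) :
    descProd g k d * g (i + 1) = g i * descProd g k d := by
  induction d with
  | zero => omega
  | succ d ih =>
    rw [descProd]
    by_cases hc : k < i + d
    · rw [mul_assoc, h.comm (k - d) (i + 1) (by omega) (by omega), ← mul_assoc, ih hc (by omega),
        mul_assoc]
    · obtain ⟨e, rfl⟩ : ∃ e, d = e + 1 := ⟨d - 1, by omega⟩
      have e1 : k - (e + 1) = i := by omega
      have e2 : k - e = i + 1 := by omega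
      rw [descProd, e1, e2, mul_assoc, mul_assoc, ← mul_assoc (g (i + 1)), h.braid i (by omega),
        mul_assoc (g i), ← mul_assoc (descProd g k e), h.descProd_comm hk (by omega)]
      simp only [mul_assoc]

/-- Letters are appended one at a time. According to its position relative to the last factor of the
descending product, a letter passes to the left, extends the product, cancels its last factor, or
passes to the left lowered by one. -/
theorem exists_normalForm (h : CoxeterLike N g) {k : ℕ} (hk : k < N) (l : List ℕ)
    (hl : ∀ i ∈ l, i ≤ k) : ∃ l' : List ℕ, (∀ i ∈ l', i < k) ∧ ∃ d ≤ k + 1,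
      (l.map g).prod = (l'.map g).prod * descProd g k d := by
  induction l using List.reverseRecOn with
  | nil => exact ⟨[], by simp, 0, by omega, by simp [descProd]⟩
  | append_singleton l i ih =>
    obtain ⟨l', h1, d, h2, h3⟩ := ih fun j hj => hl j (by simp [hj])
    have hik : i ≤ k := hl i (by simp)
    rw [List.map_append, List.prod_append, h3, List.map_singleton, List.prod_singleton, mul_assoc]
    rcases lt_trichotomy (i + d) k with hc | hc | hc
    · refine ⟨l' ++ [i], ?_, d, h2, ?_⟩
      · intro j hj
        simp only [List.mem_append, List.mem_singleton] at hj
        rcases hj with hj | rfl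
        · exact h1 j hj
        · omega
      · rw [h.descProd_comm hk hc]; simp [mul_assoc]
    · refine ⟨l', h1, d + 1, by omega, ?_⟩
      rw [descProd, show k - d = i by omega]
    · by_cases hc' : i + d = k + 1
      · obtain ⟨e, rfl⟩ : ∃ e, d = e + 1 := ⟨d - 1, by omega⟩
        refine ⟨l', h1, e, by omega, ?_⟩
        rw [descProd, show k - e = i by omega, mul_assoc, h.sq i (by omega), mul_one]
      · obtain ⟨j, rfl⟩ : ∃ j, i = j + 1 := ⟨i - 1, by omega⟩
        refine ⟨l' ++ [j], ?_, d, h2, ?_⟩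
        · intro j' hj
          simp only [List.mem_append, List.mem_singleton] at hj
          rcases hj with hj | rfl
          · exact h1 j' hj
          · omega
        · rw [h.descProd_shift hk (by omega) (by omega) h2]; simp [mul_assoc]

theorem prod {M' : Type*} [Monoid M'] {g' : ℕ → M'} (h : CoxeterLike N g) (h' : CoxeterLike N g') :
    CoxeterLike N fun i => (g i, g' i) where
  sq i hi := Prod.ext (h.sq i hi) (h'.sq i hi)
  braid i hi := Prod.ext (h.braid i hi) (h'.braid i hi)
  comm i j hi hj := Prod.ext (h.comm i j hi hj) (h'.comm i j hi hj)

theorem mono (h : CoxeterLike N g) {N' : ℕ} (hN : N' ≤ N) : CoxeterLike N' g where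
  sq i hi := h.sq i (by omega)
  braid i hi := h.braid i (by omega)
  comm i j hi hj := h.comm i j hi (by omega)

end CoxeterLike

/-- Adjacent transpositions of `Fin n`, indexed by natural numbers. -/
def adjSwap (n : ℕ) (i : ℕ) : Equiv.Perm (Fin n) :=
  if h : i + 1 < n then Equiv.swap ⟨i, by omega⟩ ⟨i + 1, h⟩ else 1

theorem adjSwap_val {n : ℕ} {i : ℕ} (h : i + 1 < n) (x : Fin n) :
    (adjSwap n i x).1 = if x.1 = i then i + 1 else if x.1 = i + 1 then i else x.1 := by
  rw [adjSwap, dif_pos h, Equiv.swap_apply_def]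
  simp only [Fin.ext_iff]
  split_ifs <;> rfl

theorem adjSwap_mul_self (n i : ℕ) : adjSwap n i * adjSwap n i = 1 := by
  unfold adjSwap; split_ifs <;> simp

theorem coxeterLike_adjSwap (n : ℕ) : CoxeterLike (n - 1) (adjSwap n) where
  sq i _ := adjSwap_mul_self n i
  braid i hi := by
    ext x
    simp only [Equiv.Perm.mul_apply, adjSwap_val (show i + 1 < n by omega),
      adjSwap_val (show i + 1 + 1 < n by omega)]
    split_ifs <;> omega
  comm i j hi hj := by
    ext x
    simp only [Equiv.Perm.mul_apply, adjSwap_val (show i + 1 < n by omega),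
      adjSwap_val (show j + 1 < n by omega)]
    split_ifs <;> omega

theorem descProd_adjSwap_apply {n k d : ℕ} (hk : k + 1 < n) (hd : d ≤ k + 1) :
    (descProd (adjSwap n) k d ⟨k + 1 - d, by omega⟩).1 = k + 1 := by
  induction d with
  | zero => rfl
  | succ d ih =>
    rw [descProd, Equiv.Perm.mul_apply]
    have : adjSwap n (k - d) ⟨k + 1 - (d + 1), by omega⟩ = ⟨k + 1 - d, by omega⟩ := by
      ext
      rw [adjSwap_val (by omega)]
      simp only
      split_ifs <;> omega
    rw [this, ih (by omega)]

theorem prod_adjSwap_apply {n k : ℕ} (hk : k + 1 < n) (l : List ℕ) (hl : ∀ i ∈ l, i < k) :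
    (l.map (adjSwap n)).prod ⟨k + 1, hk⟩ = ⟨k + 1, hk⟩ := by
  induction l with
  | nil => rfl
  | cons i l ih =>
    have hi := hl i (by simp)
    rw [List.map_cons, List.prod_cons, Equiv.Perm.mul_apply, ih fun j hj => hl j (by simp [hj])]
    ext
    rw [adjSwap_val (by omega)]
    simp only
    split_ifs <;> omega

/-- A product over a word depends only on the permutation given by the word. -/
theorem CoxeterLike.prod_eq {M : Type*} [Monoid M] {n : ℕ} {g : ℕ → M} {N : ℕ} (hN : N ≤ n - 1)
    (h : CoxeterLike N g) (l₁ l₂ : List ℕ) (h₁ : ∀ i ∈ l₁, i < N) (h₂ : ∀ i ∈ l₂, i < N)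
    (he : (l₁.map (adjSwap n)).prod = (l₂.map (adjSwap n)).prod) :
    (l₁.map g).prod = (l₂.map g).prod := by
  induction N generalizing l₁ l₂ with
  | zero =>
    have e : ∀ l : List ℕ, (∀ i ∈ l, i < 0) → l = [] := fun l hl =>
      List.eq_nil_iff_forall_not_mem.2 fun i hi => by have := hl i hi; omega
    rw [e l₁ h₁, e l₂ h₂]
  | succ k ih =>
    -- Normal forms are computed in `M` and in the symmetric group simultaneously, so that the same
    -- `l'` and `d` serve both.
    have hP := h.prod ((coxeterLike_adjSwap n).mono hN)
    have key : ∀ l : List ℕ, (∀ i ∈ l, i < k + 1) → ∃ l' : List ℕ, (∀ i ∈ l', i < k) ∧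
        ∃ d ≤ k + 1, (l.map g).prod = (l'.map g).prod * descProd g k d ∧
        (l.map (adjSwap n)).prod = (l'.map (adjSwap n)).prod * descProd (adjSwap n) k d := by
      intro l hl
      obtain ⟨l', h1, d, h2, h3⟩ := hP.exists_normalForm (Nat.lt_succ_self k) l
        fun i hi => Nat.lt_succ_iff.1 (hl i hi)
      have e1 : ∀ l : List ℕ, (l.map fun i => (g i, adjSwap n i)).prod =
          ((l.map g).prod, (l.map (adjSwap n)).prod) := fun l => by
        induction l with
        | nil => rfl
        | cons i l ih => simp [ih]
      have e2 : ∀ d, descProd (fun i => (g i, adjSwap n i)) k d =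
          (descProd g k d, descProd (adjSwap n) k d) := fun d => by
        induction d with
        | zero => rfl
        | succ d ih => simp [descProd, ih]
      rw [e1, e1, e2, Prod.mk_mul_mk, Prod.mk.injEq] at h3
      exact ⟨l', h1, d, h2, h3⟩
    obtain ⟨l₁', a1, d₁, b1, c1, f1⟩ := key l₁ h₁
    obtain ⟨l₂', a2, d₂, b2, c2, f2⟩ := key l₂ h₂
    have hkn : k + 1 < n := by omega
    -- The number `d` is visible in the permutation: the point sent to `k + 1` is `k + 1 - d`.
    have hd : d₁ = d₂ := by
      have e : ∀ (l l' : List ℕ) (d : ℕ) (hd : d ≤ k + 1), (∀ i ∈ l', i < k) →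
          (l.map (adjSwap n)).prod = (l'.map (adjSwap n)).prod * descProd (adjSwap n) k d →
          (l.map (adjSwap n)).prod ⟨k + 1 - d, by omega⟩ = ⟨k + 1, hkn⟩ := by
        intro l l' d hd hl' hf
        rw [hf, Equiv.Perm.mul_apply, show descProd (adjSwap n) k d ⟨k + 1 - d, by omega⟩ =
          ⟨k + 1, hkn⟩ from Fin.ext (descProd_adjSwap_apply hkn hd)]
        exact prod_adjSwap_apply hkn l' hl'
      have e1 := e l₁ l₁' d₁ b1 a1 f1
      have e2 := e l₂ l₂' d₂ b2 a2 f2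
      rw [← he, ← e1] at e2
      have := congrArg Fin.val ((l₁.map (adjSwap n)).prod.injective e2)
      simp only at this
      omega
    subst hd
    rw [c1, c2, ih (by omega) (h.mono (Nat.le_succ k)) l₁' l₂' a1 a2]
    rw [f1, f2] at he
    exact mul_right_cancel he

/-- The same for words whose letters are bounded by their type. -/
theorem prod_eq_of_wordPerm_eq {M : Type*} [Monoid M] {n : ℕ} (g : Fin (n - 1) → M)
    (sq : ∀ i, g i * g i = 1)
    (braid : ∀ i j : Fin (n - 1), i.1 + 1 = j.1 → g j * g i * g j = g i * g j * g i)
    (comm : ∀ i j : Fin (n - 1), i.1 + 1 < j.1 → g i * g j = g j * g i)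
    {l₁ l₂ : List (Fin (n - 1))} (he : wordPerm l₁ = wordPerm l₂) :
    (l₁.map g).prod = (l₂.map g).prod := by
  set g' : ℕ → M := fun i => if h : i < n - 1 then g ⟨i, h⟩ else 1 with hg'
  have hg : CoxeterLike (n - 1) g' := by
    refine ⟨fun i hi => ?_, fun i hi => ?_, fun i j hi hj => ?_⟩
    · simp only [hg', hi, dif_pos, sq]
    · simp only [hg', hi, show i < n - 1 by omega, dif_pos]
      exact braid _ _ rfl
    · simp only [hg', hj, show i < n - 1 by omega, dif_pos]
      exact comm _ _ hi
  have e1 : ∀ l : List (Fin (n - 1)), (l.map g).prod = ((l.map Fin.val).map g').prod := by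
    intro l
    rw [List.map_map]
    congr 1
    refine List.map_congr_left fun i _ => ?_
    simp [hg', i.2]
  -- `wordPerm` multiplies in the reversed order. For involutions this is the inverse of the
  -- product.
  have e2 : ∀ l : List (Fin (n - 1)), ((l.map Fin.val).map (adjSwap n)).prod = (wordPerm l)⁻¹ := by
    intro l
    rw [wordPerm, List.prod_inv_reverse, ← List.map_reverse, List.reverse_reverse, List.map_map,
      List.map_map]
    congr 1
    refine List.map_congr_left fun i _ => ?_
    have := i.2
    simp [adjSwap, show i.1 + 1 < n by omega, lowPos, highPos]
  rw [e1, e1]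
  refine hg.prod_eq le_rfl _ _ ?_ ?_ (by rw [e2, e2, he])
  · intro i hi
    obtain ⟨j, -, rfl⟩ := List.mem_map.1 hi
    exact j.2
  · intro i hi
    obtain ⟨j, -, rfl⟩ := List.mem_map.1 hi
    exact j.2

/-! ### The Temperley–Lieb algebra -/

section TL

variable {n : ℕ}

theorem tlGen_sq (i : Fin (n - 1)) : tlGen i * tlGen i = (2 : ℂ) • tlGen i := by
  have := RingQuot.mkAlgHom_rel ℂ (TLRel.sq i)
  simpa [tlGen] using this

theorem tlGen_braid (i j : Fin (n - 1)) (h : i.val + 1 = j.val ∨ j.val + 1 = i.val) :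
    tlGen i * tlGen j * tlGen i = tlGen i := by
  have := RingQuot.mkAlgHom_rel ℂ (TLRel.braid i j h)
  simpa [tlGen] using this

theorem tlGen_comm (i j : Fin (n - 1)) (h : i.val + 1 < j.val ∨ j.val + 1 < i.val) :
    tlGen i * tlGen j = tlGen j * tlGen i := by
  have := RingQuot.mkAlgHom_rel ℂ (TLRel.comm i j h)
  simpa [tlGen] using this

/-- The product of the generators over a word. -/
noncomputable def tlProd (l : List (Fin (n - 1))) : TL n := (l.map tlGen).prod

/-- The product of the elements `t_i - 1` over a word. -/
noncomputable def thetaProd (l : List (Fin (n - 1))) : TL n := (l.map fun i => tlGen i - 1).prod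

/-- The elements `t_i - 1` satisfy the Coxeter relations: `t_i ^ 2 = 2 t_i` makes them involutions,
and after contracting `t_i t_j t_i` to `t_i` both sides of the braid relation become the same
expression, symmetric in `i` and `j`. -/
theorem thetaProd_eq {l l' : List (Fin (n - 1))} (h : wordPerm l = wordPerm l') :
    thetaProd l = thetaProd l' := by
  refine prod_eq_of_wordPerm_eq _ (fun i => ?_) (fun i j hij => ?_) (fun i j hij => ?_) h
  · have := tlGen_sq i
    have e : (tlGen i - 1) * (tlGen i - 1) = tlGen i * tlGen i - tlGen i - tlGen i + 1 := by
      simp only [sub_mul, mul_sub, one_mul, mul_one]; abel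
    rw [e, this, two_smul]; abel
  · have h1 := tlGen_braid i j (Or.inl hij)
    have h2 := tlGen_braid j i (Or.inr hij)
    have e : ∀ a b : TL n, (a - 1) * (b - 1) * (a - 1) =
        a * b * a - a * b - b * a - a * a + a + a + b - 1 := fun a b => by simp only [sub_mul, mul_sub, one_mul, mul_one]; abel
    rw [e, e, h1, h2, tlGen_sq, tlGen_sq, two_smul, two_smul]; abel
  · have := tlGen_comm i j (Or.inl hij)
    have e : ∀ a b : TL n, (a - 1) * (b - 1) = a * b - a - b + 1 := fun a b => by simp only [sub_mul, mul_sub, one_mul, mul_one]; abel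
    rw [e, e, this]; abel

/-- The span of the products over words with fewer than `k` letters. -/
noncomputable def shortSpan (n k : ℕ) : Submodule ℂ (TL n) :=
  Submodule.span ℂ {x | ∃ l : List (Fin (n - 1)), l.length < k ∧ x = tlProd l}

theorem tlProd_mem_shortSpan {l : List (Fin (n - 1))} {k : ℕ} (h : l.length < k) :
    tlProd l ∈ shortSpan n k := Submodule.subset_span ⟨l, h, rfl⟩

theorem shortSpan_mono {k k' : ℕ} (h : k ≤ k') : shortSpan n k ≤ shortSpan n k' :=
  Submodule.span_mono fun _ ⟨l, hl, hx⟩ => ⟨l, hl.trans_le h, hx⟩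

theorem tlGen_mul_mem {i : Fin (n - 1)} {k : ℕ} {x : TL n} (hx : x ∈ shortSpan n k) :
    tlGen i * x ∈ shortSpan n (k + 1) := by
  induction hx using Submodule.span_induction with
  | mem x h =>
    obtain ⟨l, hl, rfl⟩ := h
    exact tlProd_mem_shortSpan (l := i :: l) (by simpa using hl)
  | zero => simp
  | add x y _ _ hx hy => rw [mul_add]; exact add_mem hx hy
  | smul c x _ hx => rw [mul_smul_comm]; exact Submodule.smul_mem _ _ hx

/-- When the product is expanded, each choice of `-1` drops a letter, so the full word is the only
term of maximal length. -/
theorem thetaProd_sub_mem (l : List (Fin (n - 1))) :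
    thetaProd l - tlProd l ∈ shortSpan n l.length := by
  induction l with
  | nil => simp [thetaProd, tlProd]
  | cons i l ih =>
    have e : thetaProd (i :: l) - tlProd (i :: l) =
        tlGen i * (thetaProd l - tlProd l) - (thetaProd l - tlProd l) - tlProd l := by
      simp only [thetaProd, tlProd, List.map_cons, List.prod_cons]
      simp only [sub_mul, mul_sub, one_mul]; abel
    rw [e, List.length_cons]
    exact sub_mem (sub_mem (tlGen_mul_mem ih) (shortSpan_mono (Nat.le_succ _) ih))
      (tlProd_mem_shortSpan (Nat.lt_succ_self _))

theorem tlProd_append (l l' : List (Fin (n - 1))) : tlProd (l ++ l') = tlProd l * tlProd l' := by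
  simp [tlProd]

/-- Both words have the same `thetaProd`, of which each is the leading term up to shorter products.
-/
theorem tlProd_sub_mem {l l' : List (Fin (n - 1))} (h : wordPerm l = wordPerm l')
    (hl : l'.length ≤ l.length) : tlProd l - tlProd l' ∈ shortSpan n l.length := by
  have h1 := thetaProd_sub_mem l
  have h2 := shortSpan_mono hl (thetaProd_sub_mem l')
  rw [thetaProd_eq h] at h1
  have := sub_mem h2 h1
  simpa using this

/-- The products over words lie in the span of the basis elements. -/
theorem tlProd_mem_span (l : List (Fin (n - 1))) :
    tlProd l ∈ Submodule.span ℂ (Set.range (tlBasisElement (n := n))) := by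
  induction hk : l.length using Nat.strong_induction_on generalizing l with
  | _ k ih =>
    have hshort : shortSpan n k ≤ Submodule.span ℂ (Set.range (tlBasisElement (n := n))) := by
      refine Submodule.span_le.2 ?_
      rintro _ ⟨l', hl', rfl⟩
      exact ih _ hl' l' rfl
    subst hk
    have key : ∀ l', wordPerm l = wordPerm l' → l'.length ≤ l.length →
        tlProd l' ∈ Submodule.span ℂ (Set.range (tlBasisElement (n := n))) →
        tlProd l ∈ Submodule.span ℂ (Set.range (tlBasisElement (n := n))) := by
      intro l' h1 h2 h3
      have := add_mem (hshort (tlProd_sub_mem h1 h2)) h3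
      simpa using this
    set l₀ := reducedWord (wordPerm l) with hl₀
    have hl₀s : IsReducedWord l₀ (wordPerm l) := (exists_reducedWord (wordPerm l)).choose_spec
    have hle : l₀.length ≤ l.length := hl₀s.2 l rfl
    by_cases hav : Avoids321 (wordPerm l)
    · exact key l₀ hl₀s.1.symm hle (Submodule.subset_span ⟨⟨_, hav⟩, rfl⟩)
    · unfold Avoids321 at hav
      push Not at hav
      obtain ⟨l', hl', i, j, hij, a, b, hab⟩ := hav
      -- Contracting the pattern `i j i` shortens the word by two letters, and the induction
      -- hypothesis applies to the result.
      refine key l' hl'.1.symm (hl'.2 l rfl) ?_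
      have e : tlProd l' = tlProd (a ++ [i] ++ b) := by
        rw [← hab]
        simp only [tlProd_append]
        congr 2
        simp only [tlProd, List.map_cons, List.map_nil, List.prod_cons, List.prod_nil, mul_one]
        rw [← mul_assoc]; exact tlGen_braid i j hij
      rw [e]
      have hlen : l'.length = (a ++ [i] ++ b).length + 2 := by rw [← hab]; simp; omega
      have := hl'.2 l rfl
      exact ih _ (by omega) _ rfl

theorem tlTheta_eq (w : Equiv.Perm (Fin n)) : tlTheta w = thetaProd (reducedWord w) := rfl

theorem wordPerm_reducedWord (w : Equiv.Perm (Fin n)) : wordPerm (reducedWord w) = w :=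
  (exists_reducedWord w).choose_spec.1

/-- The coefficients `f_u(w)` are the coefficients of `θ(w)`. -/
theorem tlCoeff_spec (w : Equiv.Perm (Fin n)) :
    Finsupp.linearCombination ℂ tlBasisElement (tlCoeff w) = tlTheta w := by
  refine Classical.epsilon_spec (p := fun f : AvoidingPerm n →₀ ℂ =>
    Finsupp.linearCombination ℂ tlBasisElement f = tlTheta w) ?_
  have hmem : tlTheta w ∈ Submodule.span ℂ (Set.range (tlBasisElement (n := n))) := by
    have h1 := thetaProd_sub_mem (reducedWord w)
    have h2 : shortSpan n (reducedWord w).length ≤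
        Submodule.span ℂ (Set.range (tlBasisElement (n := n))) := by
      refine Submodule.span_le.2 ?_
      rintro _ ⟨l', -, rfl⟩
      exact tlProd_mem_span l'
    have := add_mem (h2 h1) (tlProd_mem_span (reducedWord w))
    rw [sub_add_cancel] at this
    exact this
  exact (Finsupp.mem_span_range_iff_exists_finsupp.1 hmem).imp fun f hf => by
    rw [Finsupp.linearCombination_apply]; exact hf

/-! ### The representation on colourings -/

/-- The adjacent transposition of a generator. -/
def genSwap (i : Fin (n - 1)) : Equiv.Perm (Fin n) := Equiv.swap (lowPos i) (highPos i)

/-- The action of a transposition on functions of colourings. -/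
def swapEnd (i : Fin (n - 1)) : Module.End ℂ ((Fin n → Bool) → ℂ) where
  toFun G χ := G (χ ∘ genSwap i)
  map_add' _ _ := rfl
  map_smul' _ _ := rfl

theorem swapEnd_apply (i : Fin (n - 1)) (G : (Fin n → Bool) → ℂ) (χ : Fin n → Bool) :
    swapEnd i G χ = G (χ ∘ genSwap i) := rfl

theorem genSwap_mul_self (i : Fin (n - 1)) : genSwap i * genSwap i = 1 := Equiv.swap_mul_self _ _

theorem comp_genSwap_genSwap (χ : Fin n → Bool) (i : Fin (n - 1)) :
    (χ ∘ genSwap i) ∘ genSwap i = χ := by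
  funext k; simp [genSwap]

theorem lowPos_ne_highPos (i : Fin (n - 1)) : lowPos i ≠ highPos i := by
  simp [lowPos, highPos, Fin.ext_iff]

theorem genSwap_val (i : Fin (n - 1)) (x : Fin n) : (genSwap i x).1 =
    if x.1 = i.1 then i.1 + 1 else if x.1 = i.1 + 1 then i.1 else x.1 := by
  rw [genSwap, Equiv.swap_apply_def]
  simp only [Fin.ext_iff, lowPos, highPos]
  split_ifs <;> rfl

theorem comp_swap_of_eq {χ : Fin n → Bool} {a b : Fin n} (h : χ a = χ b) :
    χ ∘ Equiv.swap a b = χ := by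
  funext k
  simp only [Function.comp_apply, Equiv.swap_apply_def]
  split_ifs with h1 h2
  · rw [h1, h]
  · rw [h2, h]
  · rfl

theorem genSwap_eq_adjSwap (i : Fin (n - 1)) : genSwap i = adjSwap n i := by
  have := i.2
  rw [adjSwap, dif_pos (by omega)]; rfl

theorem comp_genSwap_braid (χ : Fin n → Bool) {i j : Fin (n - 1)} (h : i.val + 1 = j.val) :
    ((χ ∘ genSwap i) ∘ genSwap j) ∘ genSwap i = ((χ ∘ genSwap j) ∘ genSwap i) ∘ genSwap j := by
  have hm : genSwap i * genSwap j * genSwap i = genSwap j * genSwap i * genSwap j := by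
    simp only [genSwap_eq_adjSwap, ← h]
    exact ((coxeterLike_adjSwap n).braid i.1 (by omega)).symm
  exact congrArg (fun σ : Equiv.Perm (Fin n) => χ ∘ σ) hm

theorem comp_genSwap_comm (χ : Fin n → Bool) {i j : Fin (n - 1)} (h : i.val + 1 < j.val) :
    (χ ∘ genSwap i) ∘ genSwap j = (χ ∘ genSwap j) ∘ genSwap i := by
  have hm : genSwap i * genSwap j = genSwap j * genSwap i := by
    simp only [genSwap_eq_adjSwap]
    exact (coxeterLike_adjSwap n).comm i.1 j.1 h j.2
  exact congrArg (fun σ : Equiv.Perm (Fin n) => χ ∘ σ) hm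

theorem comp_genSwap_of_eq {χ : Fin n → Bool} {i : Fin (n - 1)}
    (h : χ (lowPos i) = χ (highPos i)) : χ ∘ genSwap i = χ := comp_swap_of_eq h

/-- With only two colours, two of three adjacent positions have equal colours. The transposition of
these positions fixes `χ` and pairs the six terms with opposite signs. This is the relation that
lets the symmetric group action factor through `TL_n(2)`. -/
theorem antisymmetrizer_eq_zero (i j : Fin (n - 1)) (h : i.val + 1 = j.val)
    (G : (Fin n → Bool) → ℂ) (χ : Fin n → Bool) :
    G χ - G (χ ∘ genSwap i) - G (χ ∘ genSwap j) + G ((χ ∘ genSwap i) ∘ genSwap j) +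
      G ((χ ∘ genSwap j) ∘ genSwap i) - G (((χ ∘ genSwap i) ∘ genSwap j) ∘ genSwap i) = 0 := by
  have hij : highPos i = lowPos j := by simp [highPos, lowPos, h]
  have hb := comp_genSwap_braid χ h
  by_cases h1 : χ (lowPos i) = χ (highPos i)
  · rw [comp_genSwap_of_eq h1]; ring
  by_cases h2 : χ (lowPos j) = χ (highPos j)
  · rw [hb, comp_genSwap_of_eq h2]; ring
  have h3 : χ (lowPos i) = χ (highPos j) := by
    rw [hij] at h1
    revert h1 h2
    cases χ (lowPos i) <;> cases χ (lowPos j) <;> cases χ (highPos j) <;> simp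
  have hc : ((χ ∘ genSwap i) ∘ genSwap j) ∘ genSwap i = χ := by
    have hm : genSwap i * genSwap j * genSwap i = Equiv.swap (highPos j) (lowPos i) := by
      have h4 : highPos j ≠ lowPos i := by simp [lowPos, highPos, Fin.ext_iff]; omega
      have := Equiv.swap_mul_swap_mul_swap (lowPos_ne_highPos j).symm h4
      unfold genSwap
      rw [hij, Equiv.swap_comm (highPos j) (lowPos i), ← this, Equiv.swap_comm (lowPos j) (lowPos i),
        Equiv.swap_comm (highPos j) (lowPos j)]
    exact (congrArg (fun σ : Equiv.Perm (Fin n) => χ ∘ σ) hm).trans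
      (comp_swap_of_eq h3.symm)
  have hd : (χ ∘ genSwap i) ∘ genSwap j = χ ∘ genSwap i := by
    conv_rhs => rw [← hc]
    rw [comp_genSwap_genSwap]
  have he : (χ ∘ genSwap j) ∘ genSwap i = χ ∘ genSwap j := by
    conv_rhs => rw [← hc, hb]
    rw [comp_genSwap_genSwap]
  rw [hc, hd, he]; ring

/-- The representation of `TL_n(2)` on functions of colourings. -/
noncomputable def tlRep (n : ℕ) : TL n →ₐ[ℂ] Module.End ℂ ((Fin n → Bool) → ℂ) :=
  RingQuot.liftAlgHom ℂ ⟨FreeAlgebra.lift ℂ fun i => 1 - swapEnd i, by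
    intro x y h
    induction h with
    | sq i =>
      simp only [map_mul, map_smul, FreeAlgebra.lift_ι_apply]
      refine LinearMap.ext fun G => funext fun χ => ?_
      simp only [Module.End.mul_apply, LinearMap.sub_apply, Module.End.one_apply, Pi.sub_apply,
        swapEnd_apply, LinearMap.smul_apply, Pi.smul_apply, comp_genSwap_genSwap, smul_eq_mul,
        map_sub]
      ring
    | braid i j h =>
      simp only [map_mul, FreeAlgebra.lift_ι_apply]
      refine LinearMap.ext fun G => funext fun χ => ?_
      simp only [Module.End.mul_apply, LinearMap.sub_apply, Module.End.one_apply, Pi.sub_apply,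
        swapEnd_apply, comp_genSwap_genSwap, map_sub]
      rcases h with h | h
      · linear_combination antisymmetrizer_eq_zero i j h G χ
      · rw [← comp_genSwap_braid χ h]
        linear_combination antisymmetrizer_eq_zero j i h G χ
    | comm i j h =>
      simp only [map_mul, FreeAlgebra.lift_ι_apply]
      refine LinearMap.ext fun G => funext fun χ => ?_
      have hb : (χ ∘ genSwap i) ∘ genSwap j = (χ ∘ genSwap j) ∘ genSwap i := by
        rcases h with h | h
        · exact comp_genSwap_comm χ h
        · exact (comp_genSwap_comm χ h).symm
      simp only [Module.End.mul_apply, LinearMap.sub_apply, Module.End.one_apply, Pi.sub_apply,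
        swapEnd_apply, map_sub, hb]
      ring⟩

theorem tlRep_tlGen (i : Fin (n - 1)) : tlRep n (tlGen i) = 1 - swapEnd i := by
  rw [tlRep, tlGen, RingQuot.liftAlgHom_mkAlgHom_apply, FreeAlgebra.lift_ι_apply]

theorem wordPerm_cons (i : Fin (n - 1)) (l : List (Fin (n - 1))) :
    wordPerm (i :: l) = wordPerm l * genSwap i := by
  simp [wordPerm, genSwap]

theorem sign_wordPerm (l : List (Fin (n - 1))) :
    Equiv.Perm.sign (wordPerm l) = (-1) ^ l.length := by
  induction l with
  | nil => simp [wordPerm]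
  | cons i l ih =>
    rw [wordPerm_cons, Equiv.Perm.sign_mul, ih, genSwap,
      Equiv.Perm.sign_swap (lowPos_ne_highPos i), List.length_cons, pow_succ]

/-- Each factor `t_i - 1` acts as minus an adjacent transposition. -/
theorem tlRep_thetaProd (l : List (Fin (n - 1))) (G : (Fin n → Bool) → ℂ) (χ : Fin n → Bool) :
    tlRep n (thetaProd l) G χ =
      ((Equiv.Perm.sign (wordPerm l) : ℤ) : ℂ) * G (χ ∘ (wordPerm l).symm) := by
  induction l generalizing χ with
  | nil => simp [thetaProd, wordPerm]; rfl
  | cons i l ih =>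
    have e : thetaProd (i :: l) = (tlGen i - 1) * thetaProd l := by simp [thetaProd]
    have e2 : tlRep n (tlGen i - 1) = - swapEnd i := by
      rw [map_sub, tlRep_tlGen, map_one]; abel
    rw [e, map_mul, Module.End.mul_apply, e2, LinearMap.neg_apply, Pi.neg_apply, swapEnd_apply, ih,
      sign_wordPerm, sign_wordPerm, List.length_cons, pow_succ]
    have e3 : (χ ∘ genSwap i) ∘ (wordPerm l).symm = χ ∘ (wordPerm (i :: l)).symm := by
      funext k
      rw [wordPerm_cons]
      simp only [Function.comp_apply, ← Equiv.Perm.inv_def, mul_inv_rev, Equiv.Perm.mul_apply]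
      simp [genSwap]
    rw [e3]
    push_cast
    ring

end TL

/-! ### Colourings of diagrams as matrix entries of the representation. -/

section TL

variable {n : ℕ}

/-- Passage between colours of points and colours of rows. -/
def toggle (f : Fin n → Bool) (k : Fin n) : Bool := xor (parCol k) (f k)

theorem toggle_toggle (f : Fin n → Bool) : toggle (toggle f) = f := by
  funext k; simp [toggle]

/-- The colouring `f` with new colour `b` at the two positions of a generator. -/
def recolour (f : Fin n → Bool) (i : Fin (n - 1)) (b : Bool) (k : Fin n) : Bool :=
  if k = lowPos i ∨ k = highPos i then b else f k

/-- Number of colourings of the diagram of a word with given boundary colours. -/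
def colourings : List (Fin (n - 1)) → (Fin n → Bool) → (Fin n → Bool) → ℕ
  | [], f, f' => if f = f' then 1 else 0
  | i :: l, f, f' => if f (lowPos i) = f (highPos i) then
      colourings l (recolour f i true) f' + colourings l (recolour f i false) f' else 0

/-- The transposition of two adjacent rows of different colours preserves the order within each
colour, so it is a shuffle, and its sign is `-1`. -/
theorem colSign_comp_genSwap {χ : Fin n → Bool} {i : Fin (n - 1)}
    (h : χ (lowPos i) ≠ χ (highPos i)) : colSign (χ ∘ genSwap i) = - colSign χ := by
  have hs : IsShuffle (χ ∘ genSwap i) χ (genSwap i) := by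
    refine ⟨fun _ => rfl, fun a b hab hc => ?_⟩
    have hv := genSwap_val i
    have hab' := Fin.lt_def.1 hab
    rw [Fin.lt_def, hv, hv]
    by_cases h1 : a.1 = i.1 ∧ b.1 = i.1 + 1
    · exfalso
      have ha : a = lowPos i := Fin.ext h1.1
      have hb : b = highPos i := Fin.ext h1.2
      rw [ha, hb] at hc
      simp only [Function.comp_apply, genSwap, Equiv.swap_apply_left, Equiv.swap_apply_right] at hc
      exact h hc.symm
    · split_ifs <;> omega
  have h1 := hs.sign
  rw [genSwap, Equiv.Perm.sign_swap (lowPos_ne_highPos i)] at h1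
  have h2 : colSign χ * colSign χ = 1 := Int.units_mul_self _
  calc colSign (χ ∘ genSwap i) = colSign (χ ∘ genSwap i) * colSign χ * colSign χ := by
        rw [mul_assoc, h2, mul_one]
    _ = _ := by rw [← genSwap.eq_1] at *; rw [← h1, neg_one_mul]

/-- The matrix entries of the representation. -/
noncomputable def tlEntry (x : TL n) (χ χ' : Fin n → Bool) : ℂ :=
  tlRep n x (Pi.single χ' 1) χ

theorem tlEntry_cons (i : Fin (n - 1)) (l : List (Fin (n - 1))) (χ χ' : Fin n → Bool) :
    tlEntry (tlProd (i :: l)) χ χ' =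
      tlEntry (tlProd l) χ χ' - tlEntry (tlProd l) (χ ∘ genSwap i) χ' := by
  have e : tlProd (i :: l) = tlGen i * tlProd l := by simp [tlProd]
  rw [tlEntry, e, map_mul, tlRep_tlGen]
  rfl

theorem tlEntry_nil (χ χ' : Fin n → Bool) :
    tlEntry (tlProd ([] : List (Fin (n - 1)))) χ χ' = if χ = χ' then 1 else 0 := by
  have e : tlProd ([] : List (Fin (n - 1))) = 1 := by simp [tlProd]
  rw [tlEntry, e, map_one, Module.End.one_apply, Pi.single_apply]

/-- Adjacent points of equal colour belong to rows of different colours. Exchanging these rows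
reverses the colours of both points. -/
theorem toggle_comp_genSwap {f : Fin n → Bool} {i : Fin (n - 1)}
    (h : f (lowPos i) = f (highPos i)) :
    toggle f ∘ genSwap i = toggle (recolour f i (!f (lowPos i))) := by
  funext k
  simp only [Function.comp_apply, toggle, recolour, genSwap, Equiv.swap_apply_def, parCol]
  by_cases h1 : k = lowPos i
  · simp only [h1, if_true, true_or, ← h]
    simp [lowPos, highPos]
  · by_cases h2 : k = highPos i
    · simp only [h2, (lowPos_ne_highPos i).symm, if_false, if_true, or_true]
      simp [lowPos, highPos]
    · simp [h1, h2]

/-- The operator `1 - s_i` kills the entries in which the rows `i` and `i + 1` have equal colours,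
that is, in which the points joined on the left of the generator have different colours. Otherwise
its two terms correspond to the two colours of the arc on the right, and the sign of the second term
is the change of `colSign`. -/
theorem tlEntry_eq_colourings (l : List (Fin (n - 1))) (f f' : Fin n → Bool) :
    tlEntry (tlProd l) (toggle f) (toggle f') =
      (((colSign (toggle f) * colSign (toggle f') : ℤˣ) : ℤ) : ℂ) * colourings l f f' := by
  induction l generalizing f with
  | nil =>
    have hinj : toggle f = toggle f' ↔ f = f' :=
      ⟨fun h => by rw [← toggle_toggle f, h, toggle_toggle], fun h => by rw [h]⟩
    rw [tlEntry_nil]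
    simp only [hinj, colourings]
    split_ifs with h
    · rw [h, Int.units_mul_self]; simp
    · simp
  | cons i l ih =>
    rw [tlEntry_cons, colourings]
    have hpar : parCol (lowPos i) = !parCol (highPos i) := by simp [parCol, lowPos, highPos]
    by_cases h : f (lowPos i) = f (highPos i)
    · have hne : toggle f (lowPos i) ≠ toggle f (highPos i) := by
        simp [toggle, hpar, h]
      have hself : recolour f i (f (lowPos i)) = f := by
        funext k
        simp only [recolour]
        split_ifs with hk
        · rcases hk with rfl | rfl
          · rfl
          · exact h
        · rfl
      -- The two choices for the new arc are regrouped as the old colour, which gives `f` back, and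
      -- the opposite one.
      have hsum : colourings l (recolour f i true) f' + colourings l (recolour f i false) f' =
          colourings l f f' + colourings l (recolour f i (!f (lowPos i))) f' := by
        conv_rhs => rw [← hself]
        cases hb : f (lowPos i)
        · simp only [recolour, hb]
          rw [add_comm]
          congr 2
          funext k
          split_ifs <;> simp_all
        · simp only [recolour, hb]
          congr 2
          funext k
          split_ifs <;> simp_all
      rw [if_pos h, hsum, ih, toggle_comp_genSwap h, ih, ← toggle_comp_genSwap h,
        colSign_comp_genSwap hne]
      push_cast
      ring
    · have he : toggle f (lowPos i) = toggle f (highPos i) := by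
        simp only [toggle, hpar]
        revert h
        cases f (lowPos i) <;> cases f (highPos i) <;> simp
      rw [if_neg h, comp_genSwap_of_eq he]
      simp

/-- A colouring of the diagram of a word is the same thing as a sequence of colourings. -/
def Colourable : List (Fin (n - 1)) → (Fin n → Bool) → (Fin n → Bool) → Prop
  | [], f, f' => f = f'
  | i :: l, f, f' => f (lowPos i) = f (highPos i) ∧ ∃ b, Colourable l (recolour f i b) f'

theorem colourings_ne_zero_iff (l : List (Fin (n - 1))) (f f' : Fin n → Bool) :
    colourings l f f' ≠ 0 ↔ Colourable l f f' := by
  induction l generalizing f with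
  | nil => simp [colourings, Colourable]
  | cons i l ih =>
    simp only [colourings, Colourable, Bool.exists_bool, ← ih]
    by_cases h : f (lowPos i) = f (highPos i)
    · simp only [h, if_true, true_and]; omega
    · simp [h]

/-- A colouring of the diagram with boundary `h`, `h'` can be added to every other colouring and
subtracted again, which matches the colourings for the two boundaries. It follows that all non-zero
counts agree. -/
theorem colourings_add (l : List (Fin (n - 1))) (f f' h h' : Fin n → Bool)
    (hc : Colourable l h h') :
    colourings l (fun k => xor (f k) (h k)) (fun k => xor (f' k) (h' k)) = colourings l f f' := by
  induction l generalizing f h with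
  | nil =>
    have hc : h = h' := hc
    subst hc
    simp only [colourings]
    have : ((fun k => xor (f k) (h k)) = fun k => xor (f' k) (h k)) ↔ f = f' := by
      rw [funext_iff, funext_iff]
      refine forall_congr' fun k => ?_
      cases f k <;> cases f' k <;> cases h k <;> simp
    simp only [this]
  | cons i l ih =>
    obtain ⟨h1, b, h2⟩ := hc
    simp only [colourings]
    have e1 : (xor (f (lowPos i)) (h (lowPos i)) = xor (f (highPos i)) (h (highPos i))) ↔
        f (lowPos i) = f (highPos i) := by
      rw [h1]; cases f (lowPos i) <;> cases f (highPos i) <;> cases h (highPos i) <;> simp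
    simp only [e1]
    have e2 : ∀ c, recolour (fun k => xor (f k) (h k)) i c =
        fun k => xor (recolour f i (xor c b) k) (recolour h i b k) := by
      intro c
      funext k
      simp only [recolour]
      split_ifs
      · cases c <;> cases b <;> rfl
      · rfl
    rw [e2, e2, ih _ _ h2, ih _ _ h2]
    cases b <;> simp [add_comm]

/-- The number of colourings with given boundary colours is `0` or does not depend on them. -/
theorem colourings_eq (l : List (Fin (n - 1))) {f f' h h' : Fin n → Bool}
    (hf : Colourable l f f') (hh : Colourable l h h') : colourings l f f' = colourings l h h' := by
  have h1 := colourings_add l (fun _ => false) (fun _ => false) f f' hf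
  have h2 := colourings_add l (fun _ => false) (fun _ => false) h h' hh
  simp only [Bool.false_xor] at h1 h2
  exact h1.trans h2.symm

/-! ### Distances of colourings -/

/-- The difference of the numbers of rows of colour `κ` above a given row. -/
def countDiff (χ χ' : Fin n → Bool) (κ : Bool) (p : ℕ) : ℤ :=
  (colCount (extendCol χ) κ p : ℤ) - colCount (extendCol χ') κ p

/-- The number of adjacent transpositions that are needed in order to pass from `χ` to `χ'`. -/
def colDist (χ χ' : Fin n → Bool) : ℕ :=
  ∑ p ∈ Finset.range (n + 1), (countDiff χ χ' true p).natAbs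

theorem countDiff_natAbs (χ χ' : Fin n → Bool) (κ : Bool) (p : ℕ) :
    (countDiff χ χ' κ p).natAbs = (countDiff χ χ' true p).natAbs := by
  have h1 := colCount_add (extendCol χ) p
  have h2 := colCount_add (extendCol χ') p
  cases κ
  · unfold countDiff; omega
  · rfl

theorem colCount_comp_genSwap (χ : Fin n → Bool) (i : Fin (n - 1)) (κ : Bool) (p : ℕ) :
    (colCount (extendCol (χ ∘ genSwap i)) κ p : ℤ) = colCount (extendCol χ) κ p +
      if p = i.1 + 1 then (if χ (highPos i) = κ then 1 else 0) - (if χ (lowPos i) = κ then 1 else 0)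
      else 0 := by
  have hi := i.2
  have hlow : extendCol χ i.1 = χ (lowPos i) := by
    rw [← extendCol_coe χ (lowPos i)]; rfl
  have hhigh : extendCol χ (i.1 + 1) = χ (highPos i) := by
    rw [← extendCol_coe χ (highPos i)]; rfl
  have hlow' : extendCol (χ ∘ genSwap i) i.1 = χ (highPos i) := by
    have := extendCol_coe (χ ∘ genSwap i) (lowPos i)
    rw [Function.comp_apply, genSwap, Equiv.swap_apply_left] at this
    exact this
  have hhigh' : extendCol (χ ∘ genSwap i) (i.1 + 1) = χ (lowPos i) := by
    have := extendCol_coe (χ ∘ genSwap i) (highPos i)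
    rw [Function.comp_apply, genSwap, Equiv.swap_apply_right] at this
    exact this
  have hother : ∀ p, p ≠ i.1 → p ≠ i.1 + 1 → extendCol (χ ∘ genSwap i) p = extendCol χ p := by
    intro p h1 h2
    unfold extendCol
    split_ifs with h
    · rw [Function.comp_apply]
      congr 1
      ext
      rw [genSwap_val]
      simp [h1, h2]
    · rfl
  induction p with
  | zero => simp [colCount_zero]
  | succ p ih =>
    rw [colCount_succ, colCount_succ]
    by_cases h1 : p = i.1
    · subst h1
      rw [hlow, hlow']
      simp at ih
      push_cast
      simp [ih]
    · by_cases h2 : p = i.1 + 1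
      · subst h2
        rw [hhigh, hhigh']
        simp at ih
        push_cast
        simp [ih]
        ring
      · rw [hother p h1 h2]
        have h3 : ¬ (p + 1 = i.1 + 1) := by omega
        simp only [h2, if_false, add_zero, h3] at ih ⊢
        push_cast
        rw [ih]

theorem colDist_comp_genSwap (χ χ' : Fin n → Bool) (i : Fin (n - 1)) (κ : Bool) :
    (colDist (χ ∘ genSwap i) χ' : ℤ) = colDist χ χ' -
      (countDiff χ χ' κ (i.1 + 1)).natAbs + (countDiff χ χ' κ (i.1 + 1) +
        ((if χ (highPos i) = κ then 1 else 0) - (if χ (lowPos i) = κ then 1 else 0))).natAbs := by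
  have hi := i.2
  have hmem : i.1 + 1 ∈ Finset.range (n + 1) := by simp; omega
  have e : ∀ ζ, colDist ζ χ' = ∑ p ∈ Finset.range (n + 1), (countDiff ζ χ' κ p).natAbs := fun ζ =>
    Finset.sum_congr rfl fun p _ => (countDiff_natAbs _ _ κ p).symm
  rw [e, e, ← Finset.add_sum_erase _ _ hmem, ← Finset.add_sum_erase _ _ hmem]
  have h1 : ∀ p ∈ (Finset.range (n + 1)).erase (i.1 + 1),
      (countDiff (χ ∘ genSwap i) χ' κ p).natAbs = (countDiff χ χ' κ p).natAbs := by
    intro p hp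
    have := (Finset.mem_erase.1 hp).1
    rw [countDiff, colCount_comp_genSwap, if_neg this, add_zero]; rfl
  rw [Finset.sum_congr rfl h1]
  have h2 : countDiff (χ ∘ genSwap i) χ' κ (i.1 + 1) = countDiff χ χ' κ (i.1 + 1) +
        ((if χ (highPos i) = κ then 1 else 0) - (if χ (lowPos i) = κ then 1 else 0)) := by
    rw [countDiff, colCount_comp_genSwap, if_pos rfl, countDiff]; ring
  rw [h2]
  push_cast
  ring

theorem colDist_le_comp_genSwap (χ χ' : Fin n → Bool) (i : Fin (n - 1)) :
    colDist χ χ' ≤ colDist (χ ∘ genSwap i) χ' + 1 := by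
  have := colDist_comp_genSwap χ χ' i true
  split_ifs at this <;> omega

theorem countDiff_last {χ χ' : Fin n → Bool} {u : Equiv.Perm (Fin n)} (h : ∀ i, χ i = χ' (u i))
    (κ : Bool) : countDiff χ χ' κ n = 0 := by
  have e : ∀ ζ : Fin n → Bool, colCount (extendCol ζ) κ n =
      (Finset.univ.filter fun i => ζ i = κ).card := fun ζ =>
    card_range_filter _ _ fun i => by rw [extendCol_coe]
  rw [countDiff, e, e, ← card_filter_comp_perm u fun i => χ' i = κ]
  simp only [h, sub_self]

/-- Let `χ` be ahead of `χ'` in the colour `κ` after `p` rows, with `p` minimal. The row before `p`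
has the colour `κ`. The surplus has vanished after all rows, so a row of colour `κ` must somewhere
be followed by one of the other colour while the surplus is still positive. Exchanging these two
rows reduces the distance by one. -/
theorem exists_colDist_lt {χ χ' : Fin n → Bool} (hlast : ∀ κ, countDiff χ χ' κ n = 0)
    (hd : colDist χ χ' ≠ 0) : ∃ i : Fin (n - 1), χ (lowPos i) ≠ χ (highPos i) ∧
      colDist (χ ∘ genSwap i) χ' + 1 = colDist χ χ' := by
  classical
  obtain ⟨κ, hκ⟩ : ∃ κ, ∃ p, p ≤ n ∧ 0 < countDiff χ χ' κ p := by
    obtain ⟨p, hp, hne⟩ := Finset.exists_ne_zero_of_sum_ne_zero hd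
    have hp' : p ≤ n := Nat.lt_succ_iff.1 (Finset.mem_range.1 hp)
    have h1 := colCount_add (extendCol χ) p
    have h2 := colCount_add (extendCol χ') p
    rcases lt_trichotomy (countDiff χ χ' true p) 0 with h | h | h
    · exact ⟨false, p, hp', by unfold countDiff at h ⊢; omega⟩
    · simp [h] at hne
    · exact ⟨true, p, hp', h⟩
  obtain ⟨hpn, hp⟩ := Nat.find_spec hκ
  have hmin := fun m => Nat.find_min hκ (m := m)
  set p := Nat.find hκ
  have hsucc : ∀ m, countDiff χ χ' κ (m + 1) = countDiff χ χ' κ m +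
      ((if extendCol χ m = κ then 1 else 0) - (if extendCol χ' m = κ then 1 else 0)) := by
    intro m
    unfold countDiff
    rw [colCount_succ, colCount_succ]
    push_cast
    ring
  obtain ⟨r, hr⟩ : ∃ r, p = r + 1 := by
    refine ⟨p - 1, ?_⟩
    have : p ≠ 0 := fun h0 => by rw [h0] at hp; simp [countDiff, colCount_zero] at hp
    omega
  have hχr : extendCol χ r = κ := by
    by_contra hc
    have h1 := hmin r (by omega)
    have h2 := hsucc r
    rw [← hr, if_neg hc] at h2
    refine h1 ⟨by omega, ?_⟩
    split_ifs at h2 <;> omega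
  -- Otherwise all rows from `r` on would have the colour `κ` with positive surplus up to the very
  -- end.
  have hex : ∃ q, r ≤ q ∧ q + 1 < n ∧ extendCol χ q = κ ∧ extendCol χ (q + 1) ≠ κ ∧
      0 < countDiff χ χ' κ (q + 1) := by
    by_contra hno
    push Not at hno
    have : ∀ d, r + d < n → extendCol χ (r + d) = κ ∧ 0 < countDiff χ χ' κ (r + d + 1) := by
      intro d
      induction d with
      | zero => intro _; exact ⟨hχr, by rw [add_zero, ← hr]; exact hp⟩
      | succ d ih =>
        intro hdn
        obtain ⟨h1, h2⟩ := ih (by omega)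
        have h3 : extendCol χ (r + d + 1) = κ := by
          by_contra hc
          exact absurd h2 (not_lt.2 (hno (r + d) (by omega) (by omega) h1 hc))
        refine ⟨h3, ?_⟩
        have h4 := hsucc (r + d + 1)
        rw [if_pos h3] at h4
        rw [← add_assoc]
        split_ifs at h4 <;> omega
    have h1 := (this (n - 1 - r) (by omega)).2
    rw [show r + (n - 1 - r) + 1 = n by omega, hlast] at h1
    omega
  obtain ⟨q, -, hqn, h1, h2, h3⟩ := hex
  refine ⟨⟨q, by omega⟩, ?_, ?_⟩
  · rw [← extendCol_coe χ (lowPos _), ← extendCol_coe χ (highPos _)]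
    simp only [lowPos, highPos]
    rw [h1]; exact h2.symm
  · have h4 := colDist_comp_genSwap χ χ' ⟨q, by omega⟩ κ
    rw [← extendCol_coe χ (lowPos _), ← extendCol_coe χ (highPos _)] at h4
    simp only [lowPos, highPos, h1, h2, if_true, if_false] at h4
    omega

theorem colDist_self (χ : Fin n → Bool) : colDist χ χ = 0 := by
  simp [colDist, countDiff]

theorem eq_of_colDist_eq_zero {χ χ' : Fin n → Bool} (h : colDist χ χ' = 0) : χ = χ' := by
  have h0 : ∀ p ≤ n, countDiff χ χ' true p = 0 := by
    intro p hp
    have := (Finset.sum_eq_zero_iff.1 h) p (by simp; omega)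
    omega
  funext k
  have h1 := h0 k.1 k.2.le
  have h2 := h0 (k.1 + 1) k.2
  unfold countDiff at h1 h2
  rw [colCount_succ, colCount_succ, extendCol_coe, extendCol_coe] at h2
  revert h2
  cases χ k <;> cases χ' k <;> simp <;> omega

/-- A word that passes from `χ` to `χ'` has at least `colDist χ χ'` letters. -/
theorem colDist_le_length {χ χ' : Fin n → Bool} (l : List (Fin (n - 1)))
    (h : ∀ k, χ k = χ' (wordPerm l k)) : colDist χ χ' ≤ l.length := by
  induction l generalizing χ with
  | nil =>
    have : χ = χ' := funext h
    rw [this, colDist_self]; exact Nat.zero_le _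
  | cons i l ih =>
    have h1 := colDist_le_comp_genSwap χ χ' i
    have h2 : colDist (χ ∘ genSwap i) χ' ≤ l.length := ih fun k => by
      rw [Function.comp_apply, h, wordPerm_cons, Equiv.Perm.mul_apply]
      simp [genSwap]
    rw [List.length_cons]; omega

theorem IsShuffle.comp_genSwap {χ χ' : Fin n → Bool} {u : Equiv.Perm (Fin n)} {i : Fin (n - 1)}
    (hne : χ (lowPos i) ≠ χ (highPos i)) (h : IsShuffle χ χ' u) :
    IsShuffle (χ ∘ genSwap i) χ' (u * genSwap i) := by
  refine ⟨fun k => h.1 _, fun a b hab hc => h.2 _ _ ?_ hc⟩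
  have hv := genSwap_val i
  have hab' := Fin.lt_def.1 hab
  rw [Fin.lt_def, hv, hv]
  by_cases h1 : a.1 = i.1 ∧ b.1 = i.1 + 1
  · exfalso
    have ha : a = lowPos i := Fin.ext h1.1
    have hb : b = highPos i := Fin.ext h1.2
    rw [ha, hb] at hc
    simp only [Function.comp_apply, genSwap, Equiv.swap_apply_left, Equiv.swap_apply_right] at hc
    exact hne hc.symm
  · split_ifs <;> omega

/-- A shortest word that passes from `χ` to `χ'` gives the colour increasing permutation. -/
theorem isShuffle_of_length_le {χ χ' : Fin n → Bool} (l : List (Fin (n - 1)))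
    (h : ∀ k, χ k = χ' (wordPerm l k)) (hl : l.length ≤ colDist χ χ') :
    IsShuffle χ χ' (wordPerm l) := by
  induction l generalizing χ with
  | nil =>
    have : χ = χ' := funext h
    rw [this]; exact IsShuffle.refl χ'
  | cons i l ih =>
    have h1 := colDist_le_comp_genSwap χ χ' i
    have h3 : ∀ k, (χ ∘ genSwap i) k = χ' (wordPerm l k) := fun k => by
      rw [Function.comp_apply, h, wordPerm_cons, Equiv.Perm.mul_apply]
      simp [genSwap]
    have h2 := colDist_le_length l h3
    rw [List.length_cons] at hl
    have hne : χ (lowPos i) ≠ χ (highPos i) := by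
      intro hc
      rw [comp_genSwap_of_eq hc] at h2
      omega
    have hs := ih h3 (by omega)
    have hne' : (χ ∘ genSwap i) (lowPos i) ≠ (χ ∘ genSwap i) (highPos i) := by
      simp only [Function.comp_apply, genSwap, Equiv.swap_apply_left, Equiv.swap_apply_right]
      exact hne.symm
    have := hs.comp_genSwap hne'
    rwa [comp_genSwap_genSwap, ← wordPerm_cons] at this

theorem IsShuffle.exists_word {χ χ' : Fin n → Bool} {u : Equiv.Perm (Fin n)}
    (h : IsShuffle χ χ' u) : ∃ l, wordPerm l = u ∧ l.length = colDist χ χ' := by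
  induction hd : colDist χ χ' generalizing χ u with
  | zero =>
    have := eq_of_colDist_eq_zero hd
    subst this
    refine ⟨[], ?_, rfl⟩
    rw [h.unique (IsShuffle.refl χ)]; rfl
  | succ d ih =>
    obtain ⟨i, hne, hi⟩ := exists_colDist_lt (countDiff_last h.1) (by omega)
    obtain ⟨l, h1, h2⟩ := ih (h.comp_genSwap hne) (by omega)
    refine ⟨i :: l, ?_, by simp [h2]⟩
    rw [wordPerm_cons, h1, mul_assoc, genSwap_mul_self, mul_one]

/-- Each factor `1 - s_i` either leaves the colouring alone or exchanges two rows. A word that is no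
longer than the distance has no letter to waste, so only the product of all transpositions can reach
`χ'`. -/
theorem tlEntry_of_length_le {χ χ' : Fin n → Bool} (l : List (Fin (n - 1)))
    (hl : l.length ≤ colDist χ χ') : tlEntry (tlProd l) χ χ' =
      if ∀ k, χ k = χ' (wordPerm l k) then ((Equiv.Perm.sign (wordPerm l) : ℤ) : ℂ) else 0 := by
  induction l generalizing χ with
  | nil =>
    rw [tlEntry_nil]
    have e : (∀ k, χ k = χ' (wordPerm ([] : List (Fin (n - 1))) k)) ↔ χ = χ' :=
      ⟨fun h => funext h, fun h k => by rw [h]; rfl⟩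
    simp only [e]
    split_ifs <;> simp [wordPerm]
  | cons i l ih =>
    have h1 := colDist_le_comp_genSwap χ χ' i
    rw [List.length_cons] at hl
    rw [tlEntry_cons, ih (by omega), ih (by omega), if_neg, zero_sub]
    · have e : (∀ k, (χ ∘ genSwap i) k = χ' (wordPerm l k)) ↔
          ∀ k, χ k = χ' (wordPerm (i :: l) k) := by
        rw [wordPerm_cons]
        constructor
        · intro h k
          rw [Equiv.Perm.mul_apply, ← h]
          simp [genSwap]
        · intro h k
          rw [Function.comp_apply, h, Equiv.Perm.mul_apply]
          simp [genSwap]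
      simp only [e, sign_wordPerm, List.length_cons, pow_succ]
      split_ifs <;> simp
    · intro h
      have := colDist_le_length l h
      omega

end TL

/-! ### Inversions and decreasing triples. -/

section TL

variable {n : ℕ}

/-- The inversions of a permutation. -/
def inversions (w : Equiv.Perm (Fin n)) : Finset (Fin n × Fin n) :=
  Finset.univ.filter fun p => p.1 < p.2 ∧ w p.2 < w p.1

theorem mem_inversions {w : Equiv.Perm (Fin n)} {p : Fin n × Fin n} :
    p ∈ inversions w ↔ p.1 < p.2 ∧ w p.2 < w p.1 := by simp [inversions]

theorem genSwap_lt {i : Fin (n - 1)} {a b : Fin n} (h : a < b)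
    (hne : ¬ (a = lowPos i ∧ b = highPos i)) : genSwap i a < genSwap i b := by
  have hv := genSwap_val i
  have hab' := Fin.lt_def.1 h
  rw [Fin.lt_def, hv, hv]
  have h1 : ¬ (a.1 = i.1 ∧ b.1 = i.1 + 1) := fun h1 => hne ⟨Fin.ext h1.1, Fin.ext h1.2⟩
  split_ifs <;> omega

theorem genSwap_genSwap (i : Fin (n - 1)) (a : Fin n) : genSwap i (genSwap i a) = a := by
  simp [genSwap]

/-- Apart from the pair that it exchanges, an adjacent transposition preserves the order of every
pair of positions, so it carries inversions to inversions. -/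
theorem card_inversions_erase (w : Equiv.Perm (Fin n)) (i : Fin (n - 1)) :
    ((inversions (w * genSwap i)).erase (lowPos i, highPos i)).card ≤
      ((inversions w).erase (lowPos i, highPos i)).card := by
  refine Finset.card_le_card_of_injOn (fun p => (genSwap i p.1, genSwap i p.2)) ?_ ?_
  · intro p hp
    rw [Finset.mem_coe, Finset.mem_erase, mem_inversions] at hp ⊢
    obtain ⟨h1, h2, h3⟩ := hp
    have hlt := genSwap_lt (i := i) h2 fun h => h1 (Prod.ext h.1 h.2)
    refine ⟨fun h => ?_, hlt, h3⟩
    have e1 := congrArg (genSwap i) (congrArg Prod.fst h)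
    have e2 := congrArg (genSwap i) (congrArg Prod.snd h)
    simp only [genSwap_genSwap] at e1 e2
    rw [e1, e2] at h2
    simp only [genSwap, Equiv.swap_apply_left, Equiv.swap_apply_right] at h2
    have := Fin.lt_def.1 h2
    simp [lowPos, highPos] at this
  · intro p _ q _ h
    rw [Prod.mk.injEq] at h
    exact Prod.ext ((genSwap i).injective h.1) ((genSwap i).injective h.2)

theorem inversions_mul_le (w : Equiv.Perm (Fin n)) (i : Fin (n - 1)) :
    (inversions (w * genSwap i)).card ≤ (inversions w).card + 1 := by
  have h1 := card_inversions_erase w i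
  have h2 := Finset.card_erase_le (s := inversions w) (a := (lowPos i, highPos i))
  have h3 := Finset.pred_card_le_card_erase (s := inversions (w * genSwap i))
    (a := (lowPos i, highPos i))
  omega

theorem inversions_mul_lt {w : Equiv.Perm (Fin n)} {i : Fin (n - 1)}
    (h : w (highPos i) < w (lowPos i)) :
    (inversions (w * genSwap i)).card + 1 = (inversions w).card := by
  have hlt : lowPos i < highPos i := by simp [lowPos, highPos, Fin.lt_def]
  have hmem : (lowPos i, highPos i) ∈ inversions w := mem_inversions.2 ⟨hlt, h⟩
  have h1 := card_inversions_erase w i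
  have h2 := card_inversions_erase (w * genSwap i) i
  rw [mul_assoc, genSwap_mul_self, mul_one] at h2
  have hnot : (lowPos i, highPos i) ∉ inversions (w * genSwap i) := by
    rw [mem_inversions]
    simp only [Equiv.Perm.mul_apply, genSwap, Equiv.swap_apply_left, Equiv.swap_apply_right]
    exact fun h' => h'.2.asymm h
  have h3 := Finset.card_erase_add_one hmem
  rw [Finset.erase_eq_of_notMem hnot] at h1 h2
  omega

theorem inversions_one : (inversions (1 : Equiv.Perm (Fin n))).card = 0 := by
  rw [Finset.card_eq_zero, Finset.eq_empty_iff_forall_notMem]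
  intro p hp
  rw [mem_inversions] at hp
  exact hp.1.asymm hp.2

theorem card_inversions_le (l : List (Fin (n - 1))) :
    (inversions (wordPerm l)).card ≤ l.length := by
  induction l with
  | nil => exact inversions_one.le
  | cons i l ih =>
    rw [wordPerm_cons, List.length_cons]
    exact (inversions_mul_le _ _).trans (Nat.add_le_add_right ih 1)

theorem exists_word_length_eq (w : Equiv.Perm (Fin n)) :
    ∃ l, wordPerm l = w ∧ l.length = (inversions w).card := by
  induction hk : (inversions w).card generalizing w with
  | zero =>
    refine ⟨[], ?_, rfl⟩
    have hmono : StrictMono w := by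
      intro a b hab
      rcases lt_trichotomy (w a) (w b) with h | h | h
      · exact h
      · exact absurd (w.injective h) hab.ne
      · have : (a, b) ∈ inversions w := mem_inversions.2 ⟨hab, h⟩
        rw [Finset.card_eq_zero.1 hk] at this
        exact absurd this (Finset.notMem_empty _)
    have h1 := Subsingleton.elim (hmono.orderIsoOfSurjective _ w.surjective) (OrderIso.refl _)
    ext k
    have h2 := congrArg (fun e : Fin n ≃o Fin n => e k) h1
    exact congrArg Fin.val h2.symm
  | succ k ih =>
    have hex : ∃ i : Fin (n - 1), w (highPos i) < w (lowPos i) := by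
      by_contra hno
      push Not at hno
      have hmono : ∀ d (a b : Fin n), b.1 = a.1 + d → w a ≤ w b := by
        intro d
        induction d with
        | zero => intro a b h; rw [Fin.ext (h : b.1 = a.1)]
        | succ d ihd =>
          intro a b h
          have hb := b.2
          have h1 := ihd a ⟨a.1 + d, by omega⟩ rfl
          have h2 := hno ⟨a.1 + d, by omega⟩
          have e : highPos (⟨a.1 + d, by omega⟩ : Fin (n - 1)) = b := Fin.ext (by simp [highPos]; omega)
          rw [e] at h2
          exact h1.trans h2
      have hne : (inversions w).Nonempty := by
        rw [← Finset.card_pos, hk]; exact Nat.succ_pos _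
      obtain ⟨p, hp⟩ := hne
      rw [mem_inversions] at hp
      have h1 := Fin.lt_def.1 hp.1
      exact absurd (hmono (p.2.1 - p.1.1) p.1 p.2 (by omega)) (not_le.2 hp.2)
    obtain ⟨i, hi⟩ := hex
    have h1 := inversions_mul_lt hi
    obtain ⟨l, h2, h3⟩ := ih (w * genSwap i) (by omega)
    refine ⟨i :: l, ?_, by simp [h3]⟩
    rw [wordPerm_cons, h2, mul_assoc, genSwap_mul_self, mul_one]

/-- A decreasing triple gives a shortest word that contains `s_i s_j s_i`. -/
theorem exists_word_of_decreasing (w : Equiv.Perm (Fin n)) (a b c : Fin n) (hab : a < b)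
    (hbc : b < c) (h1 : w b < w a) (h2 : w c < w b) :
    ∃ l, wordPerm l = w ∧ l.length = (inversions w).card ∧ ∃ i j : Fin (n - 1),
      i.val + 1 = j.val ∧ [i, j, i] <:+: l := by
  induction hN : (inversions w).card + (c.1 - a.1) using Nat.strong_induction_on
    generalizing w a b c with
  | _ N ih =>
    have hab' := Fin.lt_def.1 hab
    have hbc' := Fin.lt_def.1 hbc
    have hc := c.2
    have step : ∀ (i : Fin (n - 1)), w (highPos i) < w (lowPos i) → ∀ a' b' c' : Fin n,
        a' < b' → b' < c' → (w * genSwap i) b' < (w * genSwap i) a' →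
        (w * genSwap i) c' < (w * genSwap i) b' → c'.1 - a'.1 ≤ c.1 - a.1 →
        ∃ l, wordPerm l = w ∧ l.length = (inversions w).card ∧ ∃ i j : Fin (n - 1),
          i.val + 1 = j.val ∧ [i, j, i] <:+: l := by
      intro i hi a' b' c' h3 h4 h5 h6 h7
      have h8 := inversions_mul_lt hi
      obtain ⟨l, e1, e2, i', j', e3, e4⟩ := ih _ (by omega) (w * genSwap i) a' b' c' h3 h4 h5 h6 rfl
      refine ⟨i :: l, ?_, by simp [e2]; omega, i', j', e3, e4.trans (List.suffix_cons i l).isInfix⟩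
      rw [wordPerm_cons, e1, mul_assoc, genSwap_mul_self, mul_one]
    have hfix : ∀ (i : Fin (n - 1)) (x : Fin n), x.1 ≠ i.1 → x.1 ≠ i.1 + 1 → genSwap i x = x := by
      intro i x h3 h4
      ext; rw [genSwap_val, if_neg h3, if_neg h4]
    -- If `a` and `b` are not adjacent, let `x` be the neighbour of `a`. Either there is a descent
    -- at `a`, `x`, which is split off as a first letter, or `x` replaces `a` in a narrower triple.
    -- The same is done afterwards between `b` and `c`.
    by_cases hxa : a.1 + 1 < b.1
    · set x : Fin n := ⟨a.1 + 1, by omega⟩ with hx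
      rcases lt_trichotomy (w x) (w b) with h3 | h3 | h3
      · have el : lowPos (⟨a.1, by omega⟩ : Fin (n - 1)) = a := Fin.ext rfl
        have eh : highPos (⟨a.1, by omega⟩ : Fin (n - 1)) = x := Fin.ext rfl
        refine step ⟨a.1, by omega⟩ (by rw [el, eh]; exact h3.trans h1) x b c
          (Fin.lt_def.2 hxa) hbc ?_ ?_ (by simp only [hx]; omega)
        · rw [Equiv.Perm.mul_apply, Equiv.Perm.mul_apply, hfix _ b (by simp; omega) (by simp; omega)]
          have : genSwap (⟨a.1, by omega⟩ : Fin (n - 1)) x = a := by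
            rw [genSwap, el, eh, Equiv.swap_apply_right]
          rw [this]; exact h1
        · rw [Equiv.Perm.mul_apply, Equiv.Perm.mul_apply, hfix _ b (by simp; omega) (by simp; omega),
            hfix _ c (by simp; omega) (by simp; omega)]
          exact h2
      · have := congrArg Fin.val (w.injective h3)
        simp only [hx] at this; omega
      · exact ih _ (by simp only [hx]; omega) w x b c (Fin.lt_def.2 hxa) hbc h3 h2 rfl
    by_cases hxc : b.1 + 1 < c.1
    · set x : Fin n := ⟨c.1 - 1, by omega⟩ with hx
      have hbx : b < x := Fin.lt_def.2 (by simp only [hx]; omega)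
      rcases lt_trichotomy (w x) (w b) with h3 | h3 | h3
      · exact ih _ (by simp only [hx]; omega) w a b x hab hbx h1 h3 rfl
      · have := congrArg Fin.val (w.injective h3)
        simp only [hx] at this; omega
      · have el : lowPos (⟨c.1 - 1, by omega⟩ : Fin (n - 1)) = x := Fin.ext rfl
        have eh : highPos (⟨c.1 - 1, by omega⟩ : Fin (n - 1)) = c :=
          Fin.ext (by simp only [highPos]; omega)
        refine step ⟨c.1 - 1, by omega⟩ (by rw [el, eh]; exact h2.trans h3) a b x
          hab hbx ?_ ?_ (by simp only [hx]; omega)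
        · rw [Equiv.Perm.mul_apply, Equiv.Perm.mul_apply, hfix _ b (by simp; omega) (by simp; omega),
            hfix _ a (by simp; omega) (by simp; omega)]
          exact h1
        · rw [Equiv.Perm.mul_apply, Equiv.Perm.mul_apply, hfix _ b (by simp; omega) (by simp; omega)]
          have : genSwap (⟨c.1 - 1, by omega⟩ : Fin (n - 1)) x = c := by
            rw [genSwap, el, eh, Equiv.swap_apply_left]
          rw [this]; exact h2
    -- Now the triple occupies three consecutive positions, and three descents can be split off in
    -- the order `i`, `j`, `i`.
    set i : Fin (n - 1) := ⟨a.1, by omega⟩ with hi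
    set j : Fin (n - 1) := ⟨b.1, by omega⟩ with hj
    have ei : lowPos i = a := rfl
    have ei' : highPos i = b := Fin.ext (by simp only [highPos, hi]; omega)
    have ej : lowPos j = b := rfl
    have ej' : highPos j = c := Fin.ext (by simp only [highPos, hj]; omega)
    have sia : genSwap i a = b := by rw [genSwap, ei, ei', Equiv.swap_apply_left]
    have sib : genSwap i b = a := by rw [genSwap, ei, ei', Equiv.swap_apply_right]
    have sic : genSwap i c = c := hfix _ _ (by simp only [hi]; omega) (by simp only [hi]; omega)
    have sja : genSwap j a = a := hfix _ _ (by simp only [hj]; omega) (by simp only [hj]; omega)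
    have sjb : genSwap j b = c := by rw [genSwap, ej, ej', Equiv.swap_apply_left]
    have d1 := inversions_mul_lt (w := w) (i := i) (by rw [ei, ei']; exact h1)
    have d2 := inversions_mul_lt (w := w * genSwap i) (i := j) (by
      rw [ej, ej', Equiv.Perm.mul_apply, Equiv.Perm.mul_apply, sib, sic]; exact h2.trans h1)
    have d3 := inversions_mul_lt (w := w * genSwap i * genSwap j) (i := i) (by
      rw [ei, ei']
      simp only [Equiv.Perm.mul_apply]
      rw [sja, sjb, sia, sic]; exact h2)
    obtain ⟨l, e1, e2⟩ := exists_word_length_eq (w * genSwap i * genSwap j * genSwap i)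
    refine ⟨i :: j :: i :: l, ?_, by simp [e2]; omega, i, j, by simp only [hi, hj]; omega,
      ⟨[], l, rfl⟩⟩
    rw [wordPerm_cons, wordPerm_cons, wordPerm_cons, e1]
    simp only [mul_assoc, genSwap_mul_self, mul_one]

/-- There is no decreasing subsequence of length three. -/
def NoDecreasing (u : Equiv.Perm (Fin n)) : Prop :=
  ∀ a b c : Fin n, a < b → b < c → ¬ (u b < u a ∧ u c < u b)

/-- No word of a permutation is shorter than its number of inversions, so the word supplied by
`exists_word_of_decreasing` is reduced. -/
theorem Avoids321.noDecreasing {u : Equiv.Perm (Fin n)} (hu : Avoids321 u) : NoDecreasing u := by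
  intro a b c hab hbc ⟨h1, h2⟩
  obtain ⟨l, e1, e2, i, j, hij, hl⟩ := exists_word_of_decreasing u a b c hab hbc h1 h2
  refine hu l ⟨e1, fun l' hl' => ?_⟩ i j (Or.inl hij) hl
  rw [e2, ← hl']; exact card_inversions_le l'

/-- A `321`-avoiding permutation is increasing on the two classes of some colouring. -/
theorem Avoids321.exists_isShuffle {u : Equiv.Perm (Fin n)} (hu : Avoids321 u) :
    ∃ χ χ', IsShuffle χ χ' u := by
  classical
  have hno := hu.noDecreasing
  -- A position is marked if a smaller value comes later. A decreasing pair of equal marks would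
  -- consist of two marked positions, and the second one would extend it to a decreasing triple.
  set χ : Fin n → Bool := fun a => decide (∃ c, a < c ∧ u c < u a) with hχ
  refine ⟨χ, χ ∘ u.symm, fun i => by simp, fun a b hab hc => ?_⟩
  by_contra hlt
  have hlt' : u b < u a := lt_of_le_of_ne (not_lt.1 hlt) fun h => hab.ne' (u.injective h)
  have ha : χ a = true := by simp only [hχ, decide_eq_true_eq]; exact ⟨b, hab, hlt'⟩
  rw [ha] at hc
  have hb := hc.symm
  simp only [hχ, decide_eq_true_eq] at hb
  obtain ⟨c, h1, h2⟩ := hb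
  exact hno a b c hab h1 ⟨hlt', h2⟩

end TL

/-! ### Sums of immanants as complementary minors. -/

section TL

variable {n : ℕ}

theorem length_reducedWord_le {u : Equiv.Perm (Fin n)} {l : List (Fin (n - 1))}
    (h : wordPerm l = u) : (reducedWord u).length ≤ l.length :=
  (exists_reducedWord u).choose_spec.2 l h

/-- Exchanges that reduce the distance give a word of the permutation of this length, and no word
leading from `χ` to `χ'` can be shorter. -/
theorem IsShuffle.length_reducedWord {χ χ' : Fin n → Bool} {u : Equiv.Perm (Fin n)}
    (h : IsShuffle χ χ' u) : (reducedWord u).length = colDist χ χ' := by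
  obtain ⟨l, h1, h2⟩ := h.exists_word
  refine le_antisymm (h2 ▸ length_reducedWord_le h1) (colDist_le_length _ fun k => ?_)
  rw [wordPerm_reducedWord]; exact h.1 k

theorem tlEntry_toggle (l : List (Fin (n - 1))) (χ χ' : Fin n → Bool) :
    tlEntry (tlProd l) χ χ' =
      (((colSign χ * colSign χ' : ℤˣ) : ℤ) : ℂ) * colourings l (toggle χ) (toggle χ') := by
  have := tlEntry_eq_colourings l (toggle χ) (toggle χ')
  rwa [toggle_toggle, toggle_toggle] at this

theorem intUnit_cast_mul_self (ε : ℤˣ) : ((ε : ℤ) : ℂ) * ((ε : ℤ) : ℂ) = 1 := by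
  rcases Int.units_eq_one_or ε with h | h <;> simp [h]

theorem intUnit_cast_ne_zero (ε : ℤˣ) : ((ε : ℤ) : ℂ) ≠ 0 := by
  rcases Int.units_eq_one_or ε with h | h <;> simp [h]

/-- The matrix entry is a single sign, because the word is as short as possible, and it is also a
sign times the number of colourings. -/
theorem IsShuffle.colourings_eq_one {χ χ' : Fin n → Bool} {u : Equiv.Perm (Fin n)}
    (h : IsShuffle χ χ' u) : colourings (reducedWord u) (toggle χ) (toggle χ') = 1 := by
  have h1 := tlEntry_toggle (reducedWord u) χ χ'
  rw [tlEntry_of_length_le _ h.length_reducedWord.le, wordPerm_reducedWord, if_pos h.1, h.sign] at h1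
  have h2 := mul_left_cancel₀ (intUnit_cast_ne_zero _) ((mul_one _).trans h1)
  exact_mod_cast h2.symm

open Classical in
-- The number of colourings does not depend on the boundary colours as long as it is non-zero, and
-- it is `1` for the colours that the permutation shuffles. In other words, the diagram of a basis
-- element has no closed loops.
theorem Avoids321.colourings_eq {u : Equiv.Perm (Fin n)} (hu : Avoids321 u) (f f' : Fin n → Bool) :
    colourings (reducedWord u) f f' = if Colourable (reducedWord u) f f' then 1 else 0 := by
  obtain ⟨χ, χ', h⟩ := hu.exists_isShuffle
  split_ifs with hc
  · have h1 := h.colourings_eq_one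
    rw [← h1]
    exact RibbonTL.colourings_eq _ hc ((colourings_ne_zero_iff _ _ _).1 (h1 ▸ one_ne_zero))
  · by_contra h0
    exact hc ((colourings_ne_zero_iff _ _ _).1 h0)

/-- This is the triangularity behind the linear independence. If the diagram of a word of length at
most the distance is colourable, its matrix entry is non-zero, so the word leads from `χ` to `χ'` in
the fewest steps. Its permutation is then the shuffle. -/
theorem IsShuffle.unique_of_colourable {χ χ' : Fin n → Bool} {u v : Equiv.Perm (Fin n)}
    (hs : IsShuffle χ χ' u) (hlen : (reducedWord v).length ≤ (reducedWord u).length)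
    (h2 : Colourable (reducedWord v) (toggle χ) (toggle χ')) : u = v := by
  have h3 : (colourings (reducedWord v) (toggle χ) (toggle χ') : ℂ) ≠ 0 :=
    Nat.cast_ne_zero.2 ((colourings_ne_zero_iff _ _ _).2 h2)
  rw [hs.length_reducedWord] at hlen
  have h4 := tlEntry_toggle (reducedWord v) χ χ'
  rw [tlEntry_of_length_le _ hlen] at h4
  have h5 : ∀ k, χ k = χ' (wordPerm (reducedWord v) k) := by
    by_contra h5
    rw [if_neg h5] at h4
    exact mul_ne_zero (intUnit_cast_ne_zero _) h3 h4.symm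
  have h6 := isShuffle_of_length_le _ h5 hlen
  rw [wordPerm_reducedWord] at h6
  exact hs.unique h6

/-- A `321`-avoiding permutation is determined by the colourable boundary data of its diagram. -/
theorem Avoids321.eq_of_colourable {u v : Equiv.Perm (Fin n)} (hu : Avoids321 u) (hv : Avoids321 v)
    (h : ∀ f f', Colourable (reducedWord u) f f' ↔ Colourable (reducedWord v) f f') : u = v := by
  wlog hlen : (reducedWord v).length ≤ (reducedWord u).length generalizing u v
  · exact (this hv hu (fun f f' => (h f f').symm) (le_of_not_ge hlen)).symm
  obtain ⟨χ, χ', hs⟩ := hu.exists_isShuffle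
  exact hs.unique_of_colourable hlen
    ((h _ _).1 ((colourings_ne_zero_iff _ _ _).1 (hs.colourings_eq_one ▸ one_ne_zero)))

open Classical in
-- One matrix entry of `θ(w)` is computed twice: as that of a signed permutation, and through the
-- expansion in the basis, whose entries are signs or zero. Only the equation that defines the
-- coefficients is used.
theorem sum_tlCoeff_colourable (w : Equiv.Perm (Fin n)) (χ χ' : Fin n → Bool) :
    (∑ u : AvoidingPerm n,
      tlCoeff w u * if Colourable (reducedWord u.1) (toggle χ) (toggle χ') then 1 else 0) =
      (((colSign χ * colSign χ' : ℤˣ) : ℤ) : ℂ) *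
        if ∀ k, χ k = χ' (w k) then ((Equiv.Perm.sign w : ℤ) : ℂ) else 0 := by
  have h1 : tlEntry (tlTheta w) χ χ' =
      ∑ u : AvoidingPerm n, tlCoeff w u * tlEntry (tlProd (reducedWord u.1)) χ χ' := by
    rw [← tlCoeff_spec, Finsupp.linearCombination_apply, Finsupp.sum_fintype _ _ (by simp), tlEntry,
      map_sum, LinearMap.sum_apply, Finset.sum_apply]
    refine Finset.sum_congr rfl fun u _ => ?_
    rw [map_smul]; rfl
  have h2 : tlEntry (tlTheta w) χ χ' =
      if ∀ k, χ k = χ' (w k) then ((Equiv.Perm.sign w : ℤ) : ℂ) else 0 := by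
    rw [tlTheta_eq, tlEntry, tlRep_thetaProd, wordPerm_reducedWord, Pi.single_apply, mul_ite, mul_one,
      mul_zero]
    refine ite_congr_iff ⟨fun h k => ?_, fun h => funext fun k => ?_⟩
    · rw [← h]; simp
    · simp [h]
  rw [← h2, h1, Finset.mul_sum]
  refine Finset.sum_congr rfl fun u _ => ?_
  rw [tlEntry_toggle, u.2.colourings_eq, mul_left_comm, ← mul_assoc (((colSign χ * colSign χ' : ℤˣ) : ℤ) : ℂ),
    intUnit_cast_mul_self, one_mul, Nat.cast_ite, Nat.cast_one, Nat.cast_zero]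

open Classical in
/-- The immanants of the matchings that are compatible with given boundary colours add up to
a product of complementary minors. -/
theorem sum_tlImmanant_colourable {A : Type*} [CommRing A] [Algebra ℂ A]
    (X : Matrix (Fin n) (Fin n) A) (χ χ' : Fin n → Bool) :
    (∑ u : AvoidingPerm n,
      if Colourable (reducedWord u.1) (toggle χ) (toggle χ') then tlImmanant u X else 0) =
      (((colSign χ * colSign χ' : ℤˣ) : ℤ) : A) *
        Matrix.det (Matrix.of fun i j => if χ i = χ' j then X i j else 0) := by
  have h1 : ∀ u : AvoidingPerm n,
      (if Colourable (reducedWord u.1) (toggle χ) (toggle χ') then tlImmanant u X else 0) =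
      ∑ w : Equiv.Perm (Fin n), (tlCoeff w u *
        if Colourable (reducedWord u.1) (toggle χ) (toggle χ') then 1 else 0) • ∏ i, X i (w i) := by
    intro u
    split_ifs
    · simp [tlImmanant]
    · simp
  rw [Finset.sum_congr rfl fun u _ => h1 u, Finset.sum_comm, ← Matrix.det_transpose,
    Matrix.det_apply, Finset.mul_sum]
  refine Finset.sum_congr rfl fun w _ => ?_
  rw [← Finset.sum_smul, sum_tlCoeff_colourable]
  -- A term of the determinant survives if and only if `w` respects the colours, which is the
  -- condition found for the coefficients.
  have h2 : ∏ i, (Matrix.of fun i j => if χ i = χ' j then X i j else 0).transpose (w i) i =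
      if ∀ k, χ k = χ' (w k) then ∏ i, X i (w i) else 0 := by
    simp only [Matrix.transpose_apply, Matrix.of_apply]
    rw [Finset.prod_ite_zero]
    exact ite_congr_iff (by simp)
  rw [h2, Algebra.smul_def]
  split_ifs
  · rw [map_mul, map_intCast, map_intCast, Units.smul_def, zsmul_eq_mul, mul_assoc]
  · simp

end TL

/-! ### Words with proportional products. -/

section TL

variable {n : ℕ}

/-- Two words have the same product in the Temperley–Lieb algebra up to a non-zero scalar. -/
def SameDiagram (l l' : List (Fin (n - 1))) : Prop := ∃ c : ℂ, c ≠ 0 ∧ tlProd l = c • tlProd l'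

theorem SameDiagram.refl (l : List (Fin (n - 1))) : SameDiagram l l := ⟨1, one_ne_zero, by simp⟩

theorem SameDiagram.trans {l l' l'' : List (Fin (n - 1))} (h : SameDiagram l l')
    (h' : SameDiagram l' l'') : SameDiagram l l'' := by
  obtain ⟨c, hc, e⟩ := h
  obtain ⟨c', hc', e'⟩ := h'
  exact ⟨c * c', mul_ne_zero hc hc', by rw [e, e', smul_smul]⟩

theorem SameDiagram.symm {l l' : List (Fin (n - 1))} (h : SameDiagram l l') :
    SameDiagram l' l := by
  obtain ⟨c, hc, e⟩ := h
  exact ⟨c⁻¹, inv_ne_zero hc, by rw [e, smul_smul, inv_mul_cancel₀ hc, one_smul]⟩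

theorem tlProd_cons (i : Fin (n - 1)) (l : List (Fin (n - 1))) :
    tlProd (i :: l) = tlGen i * tlProd l := by simp [tlProd]

theorem SameDiagram.cons {l l' : List (Fin (n - 1))} (i : Fin (n - 1)) (h : SameDiagram l l') :
    SameDiagram (i :: l) (i :: l') := by
  obtain ⟨c, hc, e⟩ := h
  exact ⟨c, hc, by rw [tlProd_cons, e, mul_smul_comm, tlProd_cons]⟩

theorem sameDiagram_sq (i : Fin (n - 1)) (l : List (Fin (n - 1))) :
    SameDiagram (i :: i :: l) (i :: l) :=
  ⟨2, two_ne_zero, by simp only [tlProd_cons]; rw [← mul_assoc, tlGen_sq, smul_mul_assoc]⟩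

theorem sameDiagram_braid {i j : Fin (n - 1)} (h : i.val + 1 = j.val ∨ j.val + 1 = i.val)
    (l : List (Fin (n - 1))) : SameDiagram (i :: j :: i :: l) (i :: l) :=
  ⟨1, one_ne_zero, by
    simp only [tlProd_cons]; rw [← mul_assoc, ← mul_assoc, tlGen_braid i j h, one_smul]⟩

theorem sameDiagram_comm {i j : Fin (n - 1)} (h : i.val + 1 < j.val ∨ j.val + 1 < i.val)
    (l : List (Fin (n - 1))) : SameDiagram (i :: j :: l) (j :: i :: l) :=
  ⟨1, one_ne_zero, by
    simp only [tlProd_cons]; rw [← mul_assoc, tlGen_comm i j h, mul_assoc, one_smul]⟩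

/-- A non-zero factor does not affect which matrix entries vanish, and these entries are, up to
sign, the numbers of colourings. -/
theorem SameDiagram.colourable_iff {l l' : List (Fin (n - 1))} (h : SameDiagram l l')
    (f f' : Fin n → Bool) : Colourable l f f' ↔ Colourable l' f f' := by
  obtain ⟨c, hc, e⟩ := h
  have h1 : tlEntry (tlProd l) (toggle f) (toggle f') =
      c * tlEntry (tlProd l') (toggle f) (toggle f') := by
    rw [e, tlEntry, map_smul]; rfl
  rw [tlEntry_eq_colourings, tlEntry_eq_colourings, mul_left_comm] at h1
  have h2 := mul_left_cancel₀ (intUnit_cast_ne_zero _) h1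
  rw [← colourings_ne_zero_iff, ← colourings_ne_zero_iff, ← Nat.cast_ne_zero (R := ℂ), h2,
    mul_ne_zero_iff, Nat.cast_ne_zero]
  exact and_iff_right hc

/-! ### Reduced words -/

/-- The word has as many letters as its permutation has inversions. -/
def Tight (l : List (Fin (n - 1))) : Prop := (inversions (wordPerm l)).card = l.length

theorem lowPos_lt_highPos (i : Fin (n - 1)) : lowPos i < highPos i := by
  simp [lowPos, highPos, Fin.lt_def]

theorem inversions_mul_of_lt {w : Equiv.Perm (Fin n)} {i : Fin (n - 1)}
    (h : w (lowPos i) < w (highPos i)) :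
    (inversions (w * genSwap i)).card = (inversions w).card + 1 := by
  have := inversions_mul_lt (w := w * genSwap i) (i := i) (by simpa [genSwap] using h)
  rw [mul_assoc, genSwap_mul_self, mul_one] at this
  exact this.symm

theorem descent_or_lt (w : Equiv.Perm (Fin n)) (i : Fin (n - 1)) :
    w (highPos i) < w (lowPos i) ∨ w (lowPos i) < w (highPos i) :=
  lt_or_gt_of_ne fun h => lowPos_ne_highPos i (w.injective h).symm

theorem Tight.tail {i : Fin (n - 1)} {l : List (Fin (n - 1))} (h : Tight (i :: l)) :
    Tight l ∧ wordPerm (i :: l) (highPos i) < wordPerm (i :: l) (lowPos i) := by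
  have h1 := card_inversions_le l
  have h2 := inversions_mul_le (wordPerm l) i
  rw [Tight, wordPerm_cons, List.length_cons] at h
  refine ⟨by rw [Tight]; omega, ?_⟩
  rw [wordPerm_cons]
  refine (descent_or_lt _ i).resolve_right fun h3 => ?_
  have h4 := inversions_mul_of_lt h3
  rw [mul_assoc, genSwap_mul_self, mul_one] at h4
  omega

/-- A tight word that starts with a given descent. -/
theorem exists_tight_of_descent {w : Equiv.Perm (Fin n)} {i : Fin (n - 1)}
    (h : w (highPos i) < w (lowPos i)) : ∃ l, wordPerm (i :: l) = w ∧ Tight (i :: l) ∧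
      wordPerm l = w * genSwap i ∧ Tight l := by
  obtain ⟨l, h1, h2⟩ := exists_word_length_eq (w * genSwap i)
  have h3 : wordPerm (i :: l) = w := by
    rw [wordPerm_cons, h1, mul_assoc, genSwap_mul_self, mul_one]
  refine ⟨l, h3, ?_, h1, by rw [Tight, h1, h2]⟩
  rw [Tight, h3, List.length_cons, h2]
  exact (inversions_mul_lt h).symm

/-- A decreasing subsequence that survives the multiplication by a transposition. -/
theorem NoDecreasing.pair_of_mul {w : Equiv.Perm (Fin n)} {i : Fin (n - 1)}
    (h : NoDecreasing (w * genSwap i)) {a b c : Fin n} (hab : a < b) (hbc : b < c)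
    (h1 : w b < w a) (h2 : w c < w b) :
    (a = lowPos i ∧ b = highPos i) ∨ (b = lowPos i ∧ c = highPos i) := by
  by_contra hne
  push Not at hne
  refine h (genSwap i a) (genSwap i b) (genSwap i c)
    (genSwap_lt hab fun h => hne.1 h.1 h.2) (genSwap_lt hbc fun h => hne.2 h.1 h.2) ?_
  simp only [Equiv.Perm.mul_apply, genSwap_genSwap]
  exact ⟨h1, h2⟩

theorem NoDecreasing.mul {w : Equiv.Perm (Fin n)} {i : Fin (n - 1)} (h : NoDecreasing w)
    (hi : w (highPos i) < w (lowPos i)) : NoDecreasing (w * genSwap i) := by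
  intro a b c hab hbc ⟨h1, h2⟩
  have e : w * genSwap i * genSwap i = w := by rw [mul_assoc, genSwap_mul_self, mul_one]
  rw [← e] at h
  have elo : (w * genSwap i) (lowPos i) = w (highPos i) := by simp [genSwap]
  have ehi : (w * genSwap i) (highPos i) = w (lowPos i) := by simp [genSwap]
  rcases h.pair_of_mul hab hbc h1 h2 with ⟨ha, hb⟩ | ⟨ha, hb⟩
  · rw [ha, hb, elo, ehi] at h1; exact h1.asymm hi
  · rw [ha, hb, elo, ehi] at h2; exact h2.asymm hi

theorem genSwap_of_ne {i : Fin (n - 1)} {a : Fin n} (h1 : a.1 ≠ i.1) (h2 : a.1 ≠ i.1 + 1) :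
    genSwap i a = a := Fin.ext (by rw [genSwap_val, if_neg h1, if_neg h2])

/-- The first letters `i` and `j` of the two words are descents of the same permutation.
Neighbouring descents would make a decreasing triple, so unequal first letters commute. Both words
can then be compared with words that begin with `i j` and `j i` and continue alike: for such
permutations commutations suffice. -/
theorem sameDiagram_of_wordPerm_eq {l l' : List (Fin (n - 1))} (hl : Tight l) (hl' : Tight l')
    (h : wordPerm l = wordPerm l') (hno : NoDecreasing (wordPerm l)) : SameDiagram l l' := by
  induction hk : l.length generalizing l l' with
  | zero =>
    have h0 : l'.length = 0 := by rw [← hl', ← h, hl, hk]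
    rw [List.length_eq_zero_iff.1 hk, List.length_eq_zero_iff.1 h0]
    exact SameDiagram.refl _
  | succ k ih =>
    have h0 : l'.length = k + 1 := by rw [← hl', ← h, hl, hk]
    obtain ⟨i, l1, rfl⟩ := List.exists_cons_of_length_eq_add_one hk
    obtain ⟨j, l1', rfl⟩ := List.exists_cons_of_length_eq_add_one h0
    have d1 := hl.tail
    have d2 := hl'.tail
    have p1 : wordPerm l1 = wordPerm (i :: l1) * genSwap i := by
      rw [wordPerm_cons, mul_assoc, genSwap_mul_self, mul_one]
    have p2 : wordPerm l1' = wordPerm (i :: l1) * genSwap j := by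
      rw [h, wordPerm_cons, mul_assoc, genSwap_mul_self, mul_one]
    rw [← h] at d2
    set w := wordPerm (i :: l1) with hw
    have n1 := hno.mul d1.2
    have n2 := hno.mul d2.2
    rw [← p1] at n1
    rw [← p2] at n2
    have hk1 : l1.length = k := by simpa using hk
    have hk2 : l1'.length = k := by simpa using h0
    have adj : ∀ i j : Fin (n - 1), w (highPos i) < w (lowPos i) → w (highPos j) < w (lowPos j) →
        i.1 + 1 ≠ j.1 := by
      intro i j hi hj hij
      have e : lowPos j = highPos i := Fin.ext hij.symm
      refine hno (lowPos i) (highPos i) (highPos j) (lowPos_lt_highPos i) ?_ ⟨hi, ?_⟩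
      · rw [← e]; exact lowPos_lt_highPos j
      · rw [← e]; exact hj
    by_cases hij : i = j
    · subst hij
      exact (ih d1.1 d2.1 (p1.trans p2.symm) n1 hk1).cons i
    · have hne : i.1 ≠ j.1 := fun h => hij (Fin.ext h)
      have a1 := adj i j d1.2 d2.2
      have a2 := adj j i d2.2 d1.2
      have hfar : i.1 + 1 < j.1 ∨ j.1 + 1 < i.1 := by omega
      have fix : ∀ i j : Fin (n - 1), i.1 + 1 < j.1 ∨ j.1 + 1 < i.1 →
          w (highPos j) < w (lowPos j) →
          (w * genSwap i) (highPos j) < (w * genSwap i) (lowPos j) := by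
        intro i j hfar hj
        rw [Equiv.Perm.mul_apply, Equiv.Perm.mul_apply,
          genSwap_of_ne (a := highPos j) (by simp only [highPos]; omega)
            (by simp only [highPos]; omega),
          genSwap_of_ne (a := lowPos j) (by simp only [lowPos]; omega)
            (by simp only [lowPos]; omega)]
        exact hj
      -- After the letter `i` is removed, `j` is still a descent. The common continuation `l2` links
      -- the two words.
      obtain ⟨l2, q1, q2, q3, q4⟩ := exists_tight_of_descent (fix i j hfar d2.2)
      have hcomm : genSwap i * genSwap j = genSwap j * genSwap i := by
        simp only [genSwap_eq_adjSwap]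
        rcases hfar with hf | hf
        · exact (coxeterLike_adjSwap n).comm i.1 j.1 hf j.2
        · exact ((coxeterLike_adjSwap n).comm j.1 i.1 hf i.2).symm
      have r1 : wordPerm (i :: l2) = wordPerm l1' := by
        rw [wordPerm_cons, q3, p2, mul_assoc w, hcomm, mul_assoc, mul_assoc, genSwap_mul_self,
          mul_one]
      have hlen : l2.length + 1 = l1.length := by
        rw [← d1.1, p1, ← q1, q2]; rfl
      have s1 := (ih d1.1 q2 (p1.trans q1.symm) n1 hk1).cons i
      have t2 : Tight (i :: l2) := by
        rw [Tight, r1, d2.1, hk2, ← hk1, ← hlen]; rfl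
      have s2 := (ih d2.1 t2 r1.symm n2 hk2).cons j
      exact s1.trans ((sameDiagram_comm hfar l2).trans s2.symm)

end TL

/-! ### Every word has the diagram of a basis element. -/

section TL

variable {n : ℕ}

/-- No shorter word has the same diagram. -/
def Shortest (l : List (Fin (n - 1))) : Prop := ∀ l', SameDiagram l l' → l.length ≤ l'.length

theorem Shortest.tail {i : Fin (n - 1)} {l : List (Fin (n - 1))} (h : Shortest (i :: l)) :
    Shortest l := fun l' hl' => by simpa using h _ (hl'.cons i)

theorem Shortest.of_sameDiagram {l l' : List (Fin (n - 1))} (h : Shortest l)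
    (hs : SameDiagram l l') (hl : l'.length = l.length) : Shortest l' :=
  fun _ hl'' => hl.trans_le (h _ (hs.trans hl''))

/-- A map on an interval that increases at every step is increasing. -/
theorem le_of_steps {w : Equiv.Perm (Fin n)} {p q : ℕ} (hpq : p ≤ q) (hq : q < n)
    (h : ∀ j : Fin (n - 1), p ≤ j.1 → j.1 < q → ¬ w (highPos j) < w (lowPos j)) :
    w ⟨p, hpq.trans_lt hq⟩ ≤ w ⟨q, hq⟩ := by
  induction q, hpq using Nat.le_induction with
  | base => exact le_rfl
  | succ q hpq ih =>
    refine (ih (by omega) fun j h1 h2 => h j h1 (by omega)).trans ?_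
    exact not_lt.1 (h ⟨q, by omega⟩ hpq (Nat.lt_succ_self q))

/-- A defect would allow a contraction `t_i t_i = 2 t_i` or `t_i t_j t_i = t_i`, hence a shorter
word with the same diagram. By induction the tail `l1` is already reduced without decreasing
triples, so it may be rewritten to begin with any of its descents. -/
theorem Shortest.tight {l : List (Fin (n - 1))} (h : Shortest l) :
    Tight l ∧ NoDecreasing (wordPerm l) := by
  induction hk : l.length using Nat.strong_induction_on generalizing l with
  | _ k ih =>
  rcases l with _ | ⟨i, l1⟩
  · refine ⟨inversions_one, fun a b c hab _ ⟨h1, _⟩ => ?_⟩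
    exact h1.asymm hab
  simp only [List.length_cons] at hk
  obtain ⟨t1, n1⟩ := ih l1.length (by omega) h.tail rfl
  set u1 := wordPerm l1 with hu1
  have hlow : ∀ j : Fin (n - 1), (lowPos j).1 = j.1 := fun _ => rfl
  have hhigh : ∀ j : Fin (n - 1), (highPos j).1 = j.1 + 1 := fun _ => rfl
  -- If `i` were a descent of the tail, the tail could begin with `i`, and the letter `i` would
  -- occur twice in a row.
  have hi : u1 (lowPos i) < u1 (highPos i) := by
    refine (descent_or_lt u1 i).resolve_left fun hd => ?_
    obtain ⟨l2, q1, q2, -, -⟩ := exists_tight_of_descent hd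
    have s := ((sameDiagram_of_wordPerm_eq t1 q2 q1.symm n1).cons i).trans (sameDiagram_sq i l2)
    have h1 := h _ s
    have h2 : (i :: l2).length = l1.length := by rw [← q2, q1, ← t1]
    simp only [List.length_cons] at h1 h2
    omega
  have t : Tight (i :: l1) := by
    rw [Tight, wordPerm_cons, inversions_mul_of_lt hi, t1]; rfl
  refine ⟨t, fun a b c hab hbc ⟨h1, h2⟩ => ?_⟩
  have e1 : wordPerm (i :: l1) * genSwap i = u1 := by
    rw [wordPerm_cons, mul_assoc, genSwap_mul_self, mul_one]
  have hpair := (show NoDecreasing (wordPerm (i :: l1) * genSwap i) from e1 ▸ n1).pair_of_mul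
    hab hbc h1 h2
  have elo : wordPerm (i :: l1) (lowPos i) = u1 (highPos i) := by
    rw [wordPerm_cons]; simp [genSwap, hu1]
  have ehi : wordPerm (i :: l1) (highPos i) = u1 (lowPos i) := by
    rw [wordPerm_cons]; simp [genSwap, hu1]
  have eother : ∀ x : Fin n, x ≠ lowPos i → x ≠ highPos i → wordPerm (i :: l1) x = u1 x := by
    intro x hx hx'
    rw [wordPerm_cons, Equiv.Perm.mul_apply,
      genSwap_of_ne (fun e => hx (Fin.ext e)) (fun e => hx' (Fin.ext e))]
  have hlt := lowPos_lt_highPos i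
  -- A descent `j` far from `i` can be moved to the front. The rest of the word is shortest again
  -- and so has no decreasing triple. Then the triple must contain the pair of `j` as well as the
  -- pair of `i` as consecutive members, which is impossible for distant pairs.
  have hfar : ∀ j : Fin (n - 1), u1 (highPos j) < u1 (lowPos j) →
      i.1 + 1 < j.1 ∨ j.1 + 1 < i.1 → False := by
    intro j hj hf
    obtain ⟨l2, q1, q2, q3, q4⟩ := exists_tight_of_descent hj
    have s := ((sameDiagram_of_wordPerm_eq t1 q2 q1.symm n1).cons i).trans (sameDiagram_comm hf l2)
    have hl : (j :: l2).length = l1.length := by rw [← q2, q1, ← t1]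
    simp only [List.length_cons] at hl
    have hsh : Shortest (i :: l2) := (h.of_sameDiagram s (by simp; omega)).tail
    have hn := (ih (i :: l2).length (by simp; omega) hsh rfl).2
    have e2 : wordPerm (i :: l2) = wordPerm (i :: l1) * genSwap j := by
      have hcomm : genSwap i * genSwap j = genSwap j * genSwap i := by
        simp only [genSwap_eq_adjSwap]
        rcases hf with hf | hf
        · exact (coxeterLike_adjSwap n).comm i.1 j.1 hf j.2
        · exact ((coxeterLike_adjSwap n).comm j.1 i.1 hf i.2).symm
      rw [wordPerm_cons, wordPerm_cons, q3, mul_assoc, mul_assoc, hcomm]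
    rw [e2] at hn
    rcases hn.pair_of_mul hab hbc h1 h2 with ⟨x1, x2⟩ | ⟨x1, x2⟩ <;>
    rcases hpair with ⟨y1, y2⟩ | ⟨y1, y2⟩ <;>
    · have z1 := congrArg Fin.val x1
      have z2 := congrArg Fin.val x2
      have z3 := congrArg Fin.val y1
      have z4 := congrArg Fin.val y2
      simp only [hlow, hhigh] at z1 z2 z3 z4
      omega
  -- If the tail could begin with `j i` for a neighbour `j` of `i`, the whole word would begin with
  -- `i j i`.
  have hnear : ∀ j : Fin (n - 1), (i.1 + 1 = j.1 ∨ j.1 + 1 = i.1) →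
      u1 (highPos j) < u1 (lowPos j) → (u1 * genSwap j) (highPos i) <
        (u1 * genSwap j) (lowPos i) → False := by
    intro j hij hj hd
    obtain ⟨l2, q1, q2, q3, q4⟩ := exists_tight_of_descent hj
    rw [← q3] at hd
    obtain ⟨l3, r1, r2, -, -⟩ := exists_tight_of_descent hd
    have s1 := sameDiagram_of_wordPerm_eq t1 q2 q1.symm n1
    have s2 := sameDiagram_of_wordPerm_eq q4 r2 r1.symm (q3 ▸ n1.mul hj)
    have s := ((s1.trans (s2.cons j)).cons i).trans (sameDiagram_braid hij l3)
    have k1 := h _ s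
    have k2 : (j :: l2).length = l1.length := by rw [← q2, q1, ← t1]
    have k3 : (i :: l3).length = l2.length := by rw [← r2, r1, ← q4]
    simp only [List.length_cons] at k1 k2 k3
    omega
  have bi := i.2
  rcases hpair with ⟨x1, x2⟩ | ⟨x1, x2⟩
  · subst x1 x2
    have hc1 : (highPos i).1 < c.1 := hbc
    rw [hhigh] at hc1
    have hcn := c.2
    rw [elo, ehi] at h1
    rw [ehi, eother c (fun e => by rw [e] at hbc; exact hbc.asymm hlt)
      (fun e => by rw [e] at hbc; exact lt_irrefl _ hbc)] at h2
    -- Without distant descents the values of the tail increase from the position `i + 2` up to `c`.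
    -- So the third member of the triple may be taken at `i + 2`, and this yields the forbidden
    -- descents at `i + 1` and then at `i`.
    have hmono := le_of_steps (w := u1) (p := i.1 + 2) (q := c.1) (by omega) c.2
      fun j hj1 hj2 hd => hfar j hd (Or.inl (by omega))
    set j : Fin (n - 1) := ⟨i.1 + 1, by omega⟩ with hj
    have eh : highPos j = ⟨i.1 + 2, by omega⟩ := rfl
    have el : lowPos j = highPos i := rfl
    have hd : u1 (highPos j) < u1 (lowPos i) := by rw [eh]; exact hmono.trans_lt h2
    refine hnear j (Or.inl rfl) (by rw [el]; exact hd.trans hi) ?_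
    have g1 : genSwap j (highPos i) = highPos j := by rw [← el]; simp [genSwap]
    have g2 : genSwap j (lowPos i) = lowPos i :=
      genSwap_of_ne (by rw [hlow, hj]; simp) (by rw [hlow, hj]; simp; omega)
    rw [Equiv.Perm.mul_apply, Equiv.Perm.mul_apply, g1, g2]
    exact hd
  · subst x1 x2
    have hc1 : a.1 < (lowPos i).1 := hab
    rw [hlow] at hc1
    rw [elo, ehi] at h2
    rw [elo, eother a (fun e => by rw [e] at hab; exact lt_irrefl _ hab)
      (fun e => by rw [e] at hab; exact hab.asymm hlt)] at h1
    have hmono := le_of_steps (w := u1) (p := a.1) (q := i.1 - 1) (by omega) (by omega)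
      fun j hj1 hj2 hd => hfar j hd (Or.inr (by omega))
    set j : Fin (n - 1) := ⟨i.1 - 1, by omega⟩ with hj
    have el : lowPos j = ⟨i.1 - 1, by omega⟩ := rfl
    have eh : highPos j = lowPos i := Fin.ext (by simp only [highPos, lowPos, hj]; omega)
    have hd : u1 (highPos i) < u1 (lowPos j) := by rw [el]; exact h1.trans_le hmono
    refine hnear j (Or.inr (by simp only [hj]; omega)) (by rw [eh]; exact hi.trans hd) ?_
    have g1 : genSwap j (lowPos i) = lowPos j := by rw [← eh]; simp [genSwap]
    have g2 : genSwap j (highPos i) = highPos i :=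
      genSwap_of_ne (by rw [hhigh, hj]; simp; omega) (by rw [hhigh, hj]; simp; omega)
    rw [Equiv.Perm.mul_apply, Equiv.Perm.mul_apply, g1, g2]
    exact hd

theorem sameDiagram_append {l l' : List (Fin (n - 1))} (p : List (Fin (n - 1)))
    (h : SameDiagram l l') : SameDiagram (p ++ l) (p ++ l') := by
  induction p with
  | nil => exact h
  | cons i p ih => exact ih.cons i

theorem IsReducedWord.tight {l : List (Fin (n - 1))} {u : Equiv.Perm (Fin n)}
    (h : IsReducedWord l u) : Tight l := by
  obtain ⟨l', h1, h2⟩ := exists_word_length_eq u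
  have := card_inversions_le l
  have := h.2 l' h1
  rw [h.1] at *
  rw [Tight, h.1]; omega

/-- The diagram of every word is the diagram of a basis element, up to closed loops. -/
theorem exists_sameDiagram_reducedWord (l : List (Fin (n - 1))) :
    ∃ u : AvoidingPerm n, SameDiagram l (reducedWord u.1) := by
  classical
  have hex : ∃ k, ∃ l', SameDiagram l l' ∧ l'.length = k := ⟨_, l, SameDiagram.refl l, rfl⟩
  obtain ⟨l', hs, hl⟩ := Nat.find_spec hex
  have hsh : Shortest l' := fun l'' h => hl ▸ Nat.find_min' hex ⟨l'', hs.trans h, rfl⟩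
  obtain ⟨ht, hno⟩ := hsh.tight
  have key : ∀ l'', IsReducedWord l'' (wordPerm l') → SameDiagram l' l'' := fun l'' h =>
    sameDiagram_of_wordPerm_eq ht h.tight h.1.symm hno
  -- A reduced word with the pattern `i j i` would have the same diagram as `l'` and the same
  -- length, but it could be contracted.
  refine ⟨⟨wordPerm l', fun l'' hr i j hij ⟨p, q, hpq⟩ => ?_⟩,
    hs.trans (key _ (exists_reducedWord _).choose_spec)⟩
  have s := key l'' hr
  have e : l'' = p ++ (i :: j :: i :: q) := by rw [← hpq]; simp
  have s2 := hsh _ (s.trans (e ▸ sameDiagram_append p (sameDiagram_braid hij q)))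
  have hlen : l''.length = l'.length := by rw [← hr.tight, hr.1, ht]
  rw [← hlen, e] at s2
  simp at s2

open Classical in
/-- The indicator functions of the boundary colourings of the basis elements are linearly
independent. -/
theorem eq_zero_of_sum_colourable {A : Type*} [AddCommGroup A] (c : AvoidingPerm n → A)
    (h : ∀ f f', (∑ u : AvoidingPerm n, if Colourable (reducedWord u.1) f f' then c u else 0) = 0)
    (u : AvoidingPerm n) : c u = 0 := by
  by_contra hu
  have hne : (Finset.univ.filter fun u => c u ≠ 0).Nonempty := ⟨u, by simpa using hu⟩
  -- Take a longest basis element with non-zero coefficient, and boundary colours that it shuffles.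
  -- No other element of the support is colourable there.
  obtain ⟨v, hv, hmax⟩ := Finset.exists_max_image _
    (fun u : AvoidingPerm n => (reducedWord u.1).length) hne
  simp only [Finset.mem_filter, Finset.mem_univ, true_and] at hv hmax
  obtain ⟨χ, χ', hs⟩ := v.2.exists_isShuffle
  have h1 := h (toggle χ) (toggle χ')
  rw [Finset.sum_eq_single v, if_pos] at h1
  · exact hv h1
  · exact (colourings_ne_zero_iff _ _ _).1 (hs.colourings_eq_one ▸ one_ne_zero)
  · intro w _ hwv
    by_cases hw : c w = 0
    · rw [hw, ite_self]
    · refine if_neg fun hc => hwv ?_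
      exact (Subtype.ext (hs.unique_of_colourable (hmax w hw) hc)).symm
  · intro hv'; exact absurd (Finset.mem_univ v) hv'

end TL

/-! ### Matchings through their invariant two-colourings. -/

/-- Joined points have the same colour in all colourings that are constant along the lines. -/
theorem comap_eqvGen_le_ker_iff {α β : Type*} (r : α → α → Prop) (b : β → α) (φ : β → Bool) :
    Setoid.comap b (Relation.EqvGen.setoid r) ≤ Setoid.ker φ ↔
      ∃ c : α → Bool, (∀ x y, r x y → c x = c y) ∧ ∀ p, c (b p) = φ p := by
  classical
  constructor
  · intro h
    refine ⟨fun x => decide (∃ p, Relation.EqvGen r (b p) x ∧ φ p = true), fun x y hxy => ?_,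
      fun p => ?_⟩
    · refine decide_eq_decide.2 ⟨fun ⟨p, h1, h2⟩ => ⟨p, h1.trans _ _ _ (.rel _ _ hxy), h2⟩,
        fun ⟨p, h1, h2⟩ => ⟨p, h1.trans _ _ _ ((Relation.EqvGen.rel _ _ hxy).symm), h2⟩⟩
    · rw [Bool.eq_iff_iff, decide_eq_true_iff]
      refine ⟨fun ⟨q, h1, h2⟩ => ?_, fun h1 => ⟨p, .refl _, h1⟩⟩
      have : φ q = φ p := h h1
      rw [← this, h2]
  · rintro ⟨c, h1, h2⟩ p q hpq
    have hpq : Relation.EqvGen r (b p) (b q) := hpq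
    have key : ∀ x y, Relation.EqvGen r x y → c x = c y := by
      intro x y h
      induction h with
      | rel x y h => exact h1 x y h
      | refl x => rfl
      | symm x y _ ih => exact ih.symm
      | trans x y z _ _ ih ih' => exact ih.trans ih'
    have := key _ _ hpq
    rw [h2, h2] at this
    exact this

/-- An equivalence relation is determined by its invariant two-colourings. -/
theorem setoid_eq_of_le_ker_iff {β : Type*} {M M' : Setoid β}
    (h : ∀ φ : β → Bool, M ≤ Setoid.ker φ ↔ M' ≤ Setoid.ker φ) : M = M' := by
  classical
  have key : ∀ M M' : Setoid β, (∀ φ : β → Bool, M' ≤ Setoid.ker φ → M ≤ Setoid.ker φ) →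
      M ≤ M' := by
    intro M M' h x y hxy
    have h1 := h (fun z => decide (M' x z)) (fun y z hyz => decide_eq_decide.2
      ⟨fun h => M'.trans h hyz, fun h => M'.trans h (M'.symm hyz)⟩)
    have h2 : decide (M' x x) = decide (M' x y) := h1 hxy
    rw [decide_eq_decide] at h2
    exact h2.1 (M'.refl x)
  exact le_antisymm (key M M' fun φ => (h φ).2) (key M' M fun φ => (h φ).1)

section TL

variable {n : ℕ}

/-- The diagram is cut after its first letter. The only freedom there is the colour of the arc on
the right of that letter. -/
theorem exists_colouring_iff (l : List (Fin (n - 1))) (f f' : Fin n → Bool) :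
    (∃ c : ℕ × Fin n → Bool, (∀ x y, DiagramLine l x y → c x = c y) ∧ (∀ k, c (0, k) = f k) ∧
      ∀ k, c (l.length, k) = f' k) ↔ Colourable l f f' := by
  induction l generalizing f with
  | nil =>
    constructor
    · rintro ⟨c, -, h1, h2⟩
      exact funext fun k => (h1 k).symm.trans (h2 k)
    · intro h
      have h : f = f' := h
      refine ⟨fun x => f x.2, fun x y hxy => ?_, fun k => rfl, fun k => by rw [h]⟩
      cases hxy with
      | strand m hm => simp at hm
      | left m hm => simp at hm
      | right m hm => simp at hm
  | cons i l ih =>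
    simp only [Colourable, ← ih]
    constructor
    · rintro ⟨c, h1, h2, h3⟩
      refine ⟨?_, c (1, lowPos i), fun x => c (x.1 + 1, x.2), fun x y hxy => ?_, fun k => ?_, h3⟩
      · rw [← h2, ← h2]; exact h1 _ _ (.left 0 (by simp))
      · cases hxy with
        | strand m hm j hl hh => exact h1 _ _ (.strand (m + 1) (by simpa using hm) j hl hh)
        | left m hm => exact h1 _ _ (.left (m + 1) (by simpa using hm))
        | right m hm => exact h1 _ _ (.right (m + 1) (by simpa using hm))
      · unfold recolour
        split_ifs with hk
        · rcases hk with hk | hk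
          · rw [hk]
          · rw [hk]; exact (h1 _ _ (.right 0 (by simp))).symm
        · push Not at hk
          rw [← h2]
          exact (h1 _ _ (.strand 0 (by simp) k hk.1 hk.2)).symm
    · rintro ⟨h0, b, c, h1, h2, h3⟩
      refine ⟨fun x => if x.1 = 0 then f x.2 else c (x.1 - 1, x.2), fun x y hxy => ?_,
        fun k => by simp, fun k => by simpa using h3 k⟩
      cases hxy with
      | strand m hm j hl hh =>
        rcases m with _ | m
        · simp only [if_true, Nat.zero_add, one_ne_zero, if_false, Nat.sub_self, h2, recolour]
          rw [if_neg]
          rintro (h | h)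
          · exact hl h
          · exact hh h
        · simpa using h1 _ _ (.strand m (by simpa using hm) j hl hh)
      | left m hm =>
        rcases m with _ | m
        · exact h0
        · simpa using h1 _ _ (.left m (by simpa using hm))
      | right m hm =>
        rcases m with _ | m
        · simp [h2, recolour]
        · simpa using h1 _ _ (.right m (by simpa using hm))

theorem tlMatching_le_ker_iff (u : AvoidingPerm n) (f f' : Fin n → Bool) :
    tlMatching u ≤ Setoid.ker (Sum.elim f f') ↔ Colourable (reducedWord u.1) f f' := by
  rw [tlMatching, comap_eqvGen_le_ker_iff, ← exists_colouring_iff]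
  simp only [Sum.forall, diagramBoundary, Sum.elim_inl, Sum.elim_inr]

/-- An equivalence relation is determined by the two-colourings that are constant on its classes. So
matchings may be compared through boundary colours, which is the only information that the minors
provide. -/
theorem eq_tlMatching_iff {M : Setoid (Fin n ⊕ Fin n)} (u : AvoidingPerm n) :
    M = tlMatching u ↔ ∀ f f' : Fin n → Bool,
      M ≤ Setoid.ker (Sum.elim f f') ↔ Colourable (reducedWord u.1) f f' := by
  simp only [← tlMatching_le_ker_iff]
  refine ⟨fun h f f' => by rw [h], fun h => setoid_eq_of_le_ker_iff fun φ => ?_⟩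
  rw [← Sum.elim_comp_inl_inr φ]
  exact h _ _

end TL

/-! ### The lines between two columns as a word in the generators. -/

section TL

variable {n : ℕ}

theorem colourable_append (l l' : List (Fin (n - 1))) (f f'' : Fin n → Bool) :
    Colourable (l ++ l') f f'' ↔ ∃ f', Colourable l f f' ∧ Colourable l' f' f'' := by
  induction l generalizing f with
  | nil => exact ⟨fun h => ⟨f, rfl, h⟩, fun ⟨f', h1, h2⟩ => by
      have h1 : f = f' := h1
      rw [h1]; exact h2⟩
  | cons i l ih =>
    simp only [List.cons_append, Colourable, ih]
    exact ⟨fun ⟨h, b, f', h1, h2⟩ => ⟨f', ⟨h, b, h1⟩, h2⟩,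
      fun ⟨f', ⟨h, b, h1⟩, h2⟩ => ⟨h, b, f', h1, h2⟩⟩

theorem colourable_singleton_symm {i : Fin (n - 1)} {f f' : Fin n → Bool}
    (h : Colourable [i] f f') : Colourable [i] f' f := by
  obtain ⟨h0, b, h1⟩ := h
  have h1 : recolour f i b = f' := h1
  subst h1
  refine ⟨by simp [recolour], f (lowPos i), funext fun k => ?_⟩
  by_cases hk : k = lowPos i
  · simp [recolour, hk]
  · by_cases hk' : k = highPos i
    · simp [recolour, hk', h0]
    · simp [recolour, hk, hk']

theorem colourable_reverse (l : List (Fin (n - 1))) (f f' : Fin n → Bool) :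
    Colourable l.reverse f' f ↔ Colourable l f f' := by
  have key : ∀ l : List (Fin (n - 1)), ∀ f f', Colourable l f f' → Colourable l.reverse f' f := by
    intro l
    induction l with
    | nil => exact fun f f' h => Eq.symm h
    | cons i l ih =>
      intro f f' ⟨h, b, h1⟩
      rw [List.reverse_cons, colourable_append]
      exact ⟨_, ih _ _ h1, colourable_singleton_symm ⟨h, b, rfl⟩⟩
  refine ⟨fun h => ?_, key l f f'⟩
  have := key _ _ _ h
  rwa [List.reverse_reverse] at this

/-- The chips between two adjacent columns, from top to bottom. -/
def chipWord (n : ℕ) (lo hi : ℕ → ℕ) : List (Fin (n - 1)) :=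
  (List.finRange (n - 1)).filter fun q => Chip n lo hi q

theorem extendCol_recolour (f : Fin n → Bool) (i : Fin (n - 1)) (b : Bool) (k : ℕ) :
    extendCol (recolour f i b) k = if k = i.1 ∨ k = i.1 + 1 then b else extendCol f k := by
  have := i.2
  unfold extendCol recolour
  by_cases hk : k < n
  · simp only [dif_pos hk, Fin.ext_iff, lowPos, highPos]
  · rw [dif_neg hk, dif_neg hk, if_neg (by omega)]

theorem extendCol_lowPos (f : Fin n → Bool) (i : Fin (n - 1)) :
    f (lowPos i) = extendCol f i.1 := (extendCol_coe f (lowPos i)).symm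

theorem extendCol_highPos (f : Fin n → Bool) (i : Fin (n - 1)) :
    f (highPos i) = extendCol f (i.1 + 1) := (extendCol_coe f (highPos i)).symm

/-- The chips below a given place. -/
theorem colourable_chips_drop (lo hi : ℕ → ℕ) (f' : Fin n → Bool) (d : ℕ) : ∀ p, p + d = n - 1 →
    ∀ f : Fin n → Bool,
    Colourable (((List.finRange (n - 1)).drop p).filter fun q => Chip n lo hi q) f f' ↔
      (∀ q < p, extendCol f q = extendCol f' q) ∧
      extendCol f p = outFlip n lo hi (extendCol f) (extendCol f') p ∧
      ∀ q, p ≤ q → q + 1 < n → inFlip n lo hi (extendCol f) (extendCol f') (q + 1) =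
        outFlip n lo hi (extendCol f) (extendCol f') (q + 1) := by
  induction d with
  | zero =>
    intro p hp f
    have e : (List.finRange (n - 1)).drop p = [] := by
      rw [List.drop_eq_nil_iff, List.length_finRange]; omega
    rw [e]
    have hno : ¬ Chip n lo hi p := fun h => by have := h.1; omega
    rw [outFlip, if_neg hno]
    constructor
    · intro h
      have h : f = f' := h
      subst h
      exact ⟨fun _ _ => rfl, rfl, fun q h1 h2 => by omega⟩
    · rintro ⟨h1, h2, -⟩
      show f = f'
      funext k
      rw [← extendCol_coe f k, ← extendCol_coe f' k]
      rcases lt_or_ge k.1 p with h | h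
      · exact h1 _ h
      · have : k.1 = p := by omega
        rw [this]; exact h2
  | succ d ih =>
    intro p hp f
    have hp' : p < n - 1 := by omega
    have e : (List.finRange (n - 1)).drop p =
        (⟨p, hp'⟩ : Fin (n - 1)) :: (List.finRange (n - 1)).drop (p + 1) := by
      rw [List.drop_eq_getElem_cons (by simpa using hp')]
      simp
    rw [e, List.filter_cons]
    by_cases hc : Chip n lo hi p
    · rw [if_pos (by simpa using hc), Colourable, extendCol_lowPos f, extendCol_highPos f]
      simp only [ih (p + 1) (by omega), extendCol_recolour]
      have e1 : outFlip n lo hi (extendCol f) (extendCol f') p = extendCol f (p + 1) := by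
        rw [outFlip, if_pos hc]
      have e2 : inFlip n lo hi (extendCol f) (extendCol f') (p + 1) = extendCol f' p := by
        rw [inFlip, if_pos hc]
      have e3 : ∀ b q, p < q → outFlip n lo hi (extendCol (recolour f ⟨p, hp'⟩ b)) (extendCol f') q =
          outFlip n lo hi (extendCol f) (extendCol f') q := by
        intro b q hq
        simp only [outFlip, extendCol_recolour]
        rw [if_neg (c := q + 1 = p ∨ q + 1 = p + 1) (by omega)]
      have e4 : ∀ b q, p < q →
          inFlip n lo hi (extendCol (recolour f ⟨p, hp'⟩ b)) (extendCol f') (q + 1) =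
          inFlip n lo hi (extendCol f) (extendCol f') (q + 1) := by
        intro b q hq
        simp only [inFlip, extendCol_recolour]
        rw [if_neg (c := q + 1 = p ∨ q + 1 = p + 1) (by omega)]
      rw [e1]
      constructor
      · rintro ⟨h0, b, h1, h2, h3⟩
        have hb := h1 p (by omega)
        rw [if_pos (Or.inl rfl)] at hb
        rw [if_pos (Or.inr trivial), e3 b _ (by omega)] at h2
        refine ⟨fun q hq => ?_, h0, fun q h4 h5 => ?_⟩
        · have := h1 q (by omega)
          rwa [if_neg (by omega)] at this
        · rcases h4.eq_or_lt with rfl | h4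
          · rw [e2, ← hb, h2]
          · have := h3 q (by omega) h5
            rwa [e3 b _ (by omega), e4 b _ (by omega)] at this
      · rintro ⟨h1, h0, h3⟩
        -- No later chip touches the strand `p`, so the new arc must have the final colour `f' p`.
        refine ⟨h0, extendCol f' p, fun q hq => ?_, ?_, fun q h4 h5 => ?_⟩
        · split_ifs with h
          · rw [show q = p by omega]
          · exact h1 q (by omega)
        · rw [if_pos (Or.inr trivial), e3 _ _ (by omega), ← e2]
          exact h3 p le_rfl (by omega)
        · rw [e3 _ _ (by omega), e4 _ _ (by omega)]
          exact h3 q (by omega) h5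
    · rw [if_neg (by simpa using hc), ih (p + 1) (by omega)]
      have e1 : outFlip n lo hi (extendCol f) (extendCol f') p = extendCol f' p := by
        rw [outFlip, if_neg hc]
      have e2 : inFlip n lo hi (extendCol f) (extendCol f') (p + 1) = extendCol f (p + 1) := by
        rw [inFlip, if_neg hc]
      rw [e1]
      constructor
      · rintro ⟨h1, h2, h3⟩
        refine ⟨fun q hq => h1 q (by omega), h1 p (by omega), fun q h4 h5 => ?_⟩
        rcases h4.eq_or_lt with rfl | h4
        · rw [e2, h2]
        · exact h3 q h4 h5
      · rintro ⟨h1, h2, h3⟩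
        refine ⟨fun q hq => ?_, ?_, fun q h4 h5 => h3 q (by omega) h5⟩
        · rcases (Nat.lt_succ_iff.1 hq).eq_or_lt with rfl | h
          · exact h2
          · exact h1 q h
        · rw [← e2]; exact h3 p le_rfl (by omega)

/-- A chip joins its two strands on the side of `lo` and on the side of `hi`, like a generator.
Consecutive chips share a strand in between, so composing the generators from top to bottom
reproduces the lines. -/
theorem compat_iff_colourable (lo hi : ℕ → ℕ) (f f' : Fin n → Bool) :
    Compat n lo hi (extendCol f) (extendCol f') ↔ Colourable (chipWord n lo hi) f f' := by
  have h := colourable_chips_drop lo hi f' (n - 1) 0 (by omega) f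
  rw [List.drop_zero] at h
  rw [chipWord, h]
  rcases Nat.eq_zero_or_pos n with h0 | h0
  · subst h0
    refine ⟨fun _ => ⟨fun q hq => absurd hq (by omega), ?_, fun q _ h => absurd h (by omega)⟩,
      fun _ q hq => absurd hq (by omega)⟩
    rw [outFlip, if_neg fun h => by have := h.1; omega]
    simp [extendCol]
  · constructor
    · intro hc
      exact ⟨fun q hq => absurd hq (by omega), hc 0 h0, fun q _ hq => hc _ hq⟩
    · rintro ⟨-, h1, h2⟩ q hq
      rcases q with _ | q
      · exact h1
      · exact h2 q (Nat.zero_le _) hq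

end TL

/-! ### The word of a chain. -/

namespace Strands

variable (S : Strands)

/-- The word of the gap between the columns `m` and `m + 1`, read from right to left. -/
def gapWord (V : Fin (S.L + 1) → Fin S.n → S.Val) (m : Fin S.L) : List (Fin (S.n - 1)) :=
  if S.up m then chipWord S.n (extend (V m.succ)) (extend (V m.castSucc))
  else (chipWord S.n (extend (V m.castSucc)) (extend (V m.succ))).reverse

theorem compat_iff_gapWord (V : Fin (S.L + 1) → Fin S.n → S.Val) (m : Fin S.L)
    (f f' : Fin S.n → Bool) :
    Compat S.n (extend (S.lo m (V m.castSucc) (V m.succ)))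
      (extend (S.hi m (V m.castSucc) (V m.succ))) (extendCol (S.lo m f f'))
      (extendCol (S.hi m f f')) ↔ Colourable (S.gapWord V m) f' f := by
  unfold lo hi gapWord
  split_ifs
  · exact compat_iff_colourable _ _ _ _
  · rw [colourable_reverse]; exact compat_iff_colourable _ _ _ _

/-- The word of the first `M` gaps. -/
def prefixWord (V : Fin (S.L + 1) → Fin S.n → S.Val) : ℕ → List (Fin (S.n - 1))
  | 0 => []
  | M + 1 => (if h : M < S.L then S.gapWord V ⟨M, h⟩ else []) ++ prefixWord V M

theorem colourable_prefixWord (V : Fin (S.L + 1) → Fin S.n → S.Val) (φR : Fin S.n → Bool) (M : ℕ)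
    (hM : M ≤ S.L) (f : Fin S.n → Bool) : Colourable (S.prefixWord V M) f φR ↔
      ∃ g : ℕ → Fin S.n → Bool, g M = f ∧ g 0 = φR ∧
        ∀ m : Fin S.L, m.1 < M → Colourable (S.gapWord V m) (g (m + 1)) (g m) := by
  induction M generalizing f with
  | zero =>
    exact ⟨fun h => ⟨fun _ => f, rfl, h, fun m hm => absurd hm (by omega)⟩,
      fun ⟨g, h1, h2, _⟩ => h1.symm.trans h2⟩
  | succ M ih =>
    rw [prefixWord, dif_pos (by omega), colourable_append]
    constructor
    · rintro ⟨f', h1, h2⟩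
      obtain ⟨g, g1, g2, g3⟩ := (ih (by omega) _).1 h2
      refine ⟨Function.update g (M + 1) f, by simp, ?_, fun m hm => ?_⟩
      · rw [Function.update_of_ne (by omega)]; exact g2
      · rw [Function.update_of_ne (a := m.1) (by omega)]
        rcases (Nat.lt_succ_iff.1 hm).eq_or_lt with h | h
        · obtain ⟨m, hm'⟩ := m
          have h : m = M := h
          subst h
          rw [Function.update_self, g1]; exact h1
        · rw [Function.update_of_ne (by omega)]; exact g3 m h
    · rintro ⟨g, g1, g2, g3⟩
      refine ⟨g M, ?_, (ih (by omega) _).2 ⟨g, rfl, g2, fun m hm => g3 m (by omega)⟩⟩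
      rw [← g1]
      exact g3 ⟨M, by omega⟩ (Nat.lt_succ_self M)

end Strands

/-! ### Alternating chains in terms of local inequalities. -/

namespace Strands

variable (S : Strands)

/-- The values of the idle strands are prescribed, those of the active strands lie in the range. -/
def Proper (m : ℕ) (v : Fin S.n → S.Val) : Prop :=
  ∀ k, (S.Idle m k → v k = S.idleVal m k) ∧ (¬ S.Idle m k → S.InRange m (v k))

variable {S}

/-- The three types occupy disjoint bands of values: low ones lie below `n`, active ones between `n`
and `big`, high ones from `big` on. In the outer bands the values follow the index. -/
theorem Proper.lt {m m' : ℕ} (hm : m ≤ S.L) (_ : m' ≤ S.L) {v v' : Fin S.n → S.Val}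
    (h : S.Proper m v) (h' : S.Proper m' v') {k k' : Fin S.n}
    (ht : S.typ m k < S.typ m' k' ∨ (S.typ m k = S.typ m' k' ∧ S.typ m k ≠ 1 ∧ k < k')) :
    v k < v' k' := by
  have b1 := S.base_le m
  have b2 := S.le_base m
  have b1' := S.base_le m'
  have b2' := S.le_base m'
  have l1 := S.typ_le m k
  have l2 := S.typ_le m' k'
  have hk := k.2
  have hk' := k'.2
  have key : ∀ {m : ℕ} {v : Fin S.n → S.Val} (h : S.Proper m v) (k : Fin S.n),
      (S.typ m k = 0 ∧ (v k).1 = k) ∨ (S.typ m k = 1 ∧ S.InRange m (v k)) ∨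
        (S.typ m k = 2 ∧ (v k).1 = S.big + k) := by
    intro m v h k
    by_cases hI : S.Idle m k
    · rw [(h k).1 hI]
      rcases S.idle_cases hI with h0 | h0
      · exact Or.inl ⟨h0, S.idleVal_low h0⟩
      · exact Or.inr (Or.inr ⟨h0, S.idleVal_high (by omega)⟩)
    · exact Or.inr (Or.inl ⟨not_not.1 hI, (h k).2 hI⟩)
  have e : S.big = S.n + S.L + S.N + 1 := rfl
  rw [Fin.lt_def] at ht ⊢
  unfold InRange at key
  rcases key h k with ⟨t, e1⟩ | ⟨t, e1⟩ | ⟨t, e1⟩ <;>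
  rcases key h' k' with ⟨t', e1'⟩ | ⟨t', e1'⟩ | ⟨t', e1'⟩ <;> omega

variable (S) in
/-- The types in the lower column of a gap. -/
def typLo (m : ℕ) : Fin S.n → ℕ := S.lo m (S.typ m) (S.typ (m + 1))

variable (S) in
/-- The types in the upper column of a gap. -/
def typHi (m : ℕ) : Fin S.n → ℕ := S.hi m (S.typ m) (S.typ (m + 1))

theorem typLo_le_typHi (m : ℕ) (k : Fin S.n) : S.typLo m k ≤ S.typHi m k := by
  unfold typLo typHi lo hi
  split_ifs with h
  · exact S.up_le m h k
  · exact S.right_le m (by simpa using h) k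

theorem typHi_le_typLo (m : ℕ) {k k' : Fin S.n} (hk : k < k') : S.typHi m k ≤ S.typLo m k' := by
  unfold typLo typHi lo hi
  split_ifs with h
  · exact S.up_lt m h k k' hk
  · exact S.right_lt m (by simpa using h) k k' hk

/-- Unless both strands are active, the inequality is decided by the bands of their types. Thus only
pairs of active cells impose conditions on a chain. -/
theorem Proper.hi_lt_lo {m : ℕ} (hm : m < S.L) {v v' : Fin S.n → S.Val} (h : S.Proper m v)
    (h' : S.Proper (m + 1) v') {k k' : Fin S.n} (hk : k < k')
    (ht : ¬ (S.typHi m k = 1 ∧ S.typLo m k' = 1)) : S.hi m v v' k < S.lo m v v' k' := by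
  have h1 := S.typHi_le_typLo m hk
  unfold typLo typHi at *
  unfold lo hi at *
  split_ifs at *
  · exact h.lt (m' := m + 1) hm.le hm h' (by omega)
  · exact h'.lt (m := m + 1) hm hm.le h (by omega)

theorem Proper.lo_le_hi {m : ℕ} (hm : m < S.L) {v v' : Fin S.n → S.Val} (h : S.Proper m v)
    (h' : S.Proper (m + 1) v') {k : Fin S.n} (ht : ¬ (S.typHi m k = 1 ∧ S.typLo m k = 1)) :
    S.lo m v v' k ≤ S.hi m v v' k := by
  have h1 := S.typLo_le_typHi m k
  have key : ∀ {m m' : ℕ} {v v' : Fin S.n → S.Val}, m ≤ S.L → m' ≤ S.L → S.Proper m v →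
      S.Proper m' v' → S.typ m k ≤ S.typ m' k → ¬ (S.typ m' k = 1 ∧ S.typ m k = 1) →
      v k ≤ v' k := by
    intro m m' v v' hm hm' h h' hle hne
    rcases hle.lt_or_eq with hlt | heq
    · exact (h.lt hm hm' h' (Or.inl hlt)).le
    · have hI : S.Idle m k := by unfold Idle; omega
      have hI' : S.Idle m' k := by unfold Idle; omega
      rw [(h k).1 hI, (h' k).1 hI', idleVal, idleVal, heq]
  unfold typLo typHi at *
  unfold lo hi at *
  split_ifs at *
  · exact key hm hm.le h' h h1 ht
  · exact key hm.le hm h h' h1 ht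

/-- Equal parity means an even distance, and steps of two are chained with the inequalities `lo k ≤
hi k`. -/
theorem ColGap.of_adjacent {α : Type*} [Preorder α] {n : ℕ} {lo hi : Fin n → α}
    (h1 : ∀ k, lo k ≤ hi k) (h2 : ∀ k k' : Fin n, k.1 + 2 = k'.1 → hi k < lo k') :
    ColGap parCol lo hi := by
  refine ⟨h1, ?_⟩
  have key : ∀ d, ∀ k k' : Fin n, k.1 + 2 * d + 2 = k'.1 → hi k < lo k' := by
    intro d
    induction d with
    | zero => exact fun k k' h => h2 k k' (by omega)
    | succ d ih =>
      intro k k' h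
      have hk' := k'.2
      exact (ih k ⟨k.1 + 2 * d + 2, by omega⟩ rfl).trans_le
        ((h1 _).trans (h2 _ k' (by simp only; omega)).le)
  intro k k' hkk hc
  have hlt := Fin.lt_def.1 hkk
  simp only [parCol] at hc
  have h3 := Nat.bodd_add_div2 k.1
  have h4 := Nat.bodd_add_div2 k'.1
  rw [hc] at h3
  exact key (Nat.div2 k'.1 - Nat.div2 k.1 - 1) k k' (by omega)

theorem ColGap.colInc {α : Type*} [Preorder α] {n : ℕ} {χ : Fin n → Bool} {lo hi : Fin n → α}
    (h : ColGap χ lo hi) : ColInc χ lo ∧ ColInc χ hi :=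
  ⟨fun i i' h1 h2 => (h.1 i).trans_lt (h.2 i i' h1 h2),
    fun i i' h1 h2 => (h.2 i i' h1 h2).trans_le (h.1 i')⟩

/-- Chains with alternating row colours. -/
theorem isChain_parCol_iff (V : Fin (S.L + 1) → Fin S.n → S.Val) :
    S.IsChain parCol parCol V ↔ (∀ m : Fin (S.L + 1), S.Proper m (V m)) ∧
      ∀ m : Fin S.L, (∀ k, S.typHi m k = 1 → S.typLo m k = 1 →
        S.lo m (V m.castSucc) (V m.succ) k ≤ S.hi m (V m.castSucc) (V m.succ) k) ∧
      ∀ k k' : Fin S.n, k.1 + 2 = k'.1 → S.typHi m k = 1 → S.typLo m k' = 1 →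
        S.hi m (V m.castSucc) (V m.succ) k < S.lo m (V m.castSucc) (V m.succ) k' := by
  constructor
  · intro h
    refine ⟨fun m k => ⟨fun hI => (h.idle_parCol m k hI).1, fun hI => ?_⟩, fun m =>
      ⟨fun k _ _ => (h.2 m).1 k, fun k k' hk _ _ => (h.2 m).2 k k' (Fin.lt_def.2 (by omega)) ?_⟩⟩
    · refine ((h.1 m).1.1 k).resolve_right fun ⟨k', h1, h2, h3⟩ => hI ?_
      obtain ⟨h4, h5⟩ := h.idle_parCol m k' h1
      have e1 := h2.trans h4.symm
      have e2 := h3.trans h5.symm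
      rcases lt_trichotomy k k' with hlt | heq | hlt
      · exact absurd e1 ((h.1 m).2 _ _ hlt e2).ne
      · rw [heq]; exact h1
      · exact absurd e1 ((h.1 m).2 _ _ hlt e2.symm).ne'
    · simp [parCol, ← hk]
  · rintro ⟨hP, hg⟩
    have hgap : ∀ m : Fin S.L, ColGap parCol (S.lo m (V m.castSucc) (V m.succ))
        (S.hi m (V m.castSucc) (V m.succ)) := by
      intro m
      refine ColGap.of_adjacent (fun k => ?_) fun k k' hk => ?_
      · by_cases ht : S.typHi m k = 1 ∧ S.typLo m k = 1
        · exact (hg m).1 k ht.1 ht.2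
        · exact (hP m.castSucc).lo_le_hi m.2 (hP m.succ) ht
      · by_cases ht : S.typHi m k = 1 ∧ S.typLo m k' = 1
        · exact (hg m).2 k k' hk ht.1 ht.2
        · exact (hP m.castSucc).hi_lt_lo m.2 (hP m.succ) (Fin.lt_def.2 (by omega)) ht
    refine ⟨fun m => ⟨⟨fun k => ?_, fun k hI => ⟨k, ((hP m) k).1 hI, (idleCol_same S _ _ _).symm⟩⟩,
      ?_⟩, hgap⟩
    · by_cases hI : S.Idle m k
      · exact Or.inr ⟨k, hI, ((hP m) k).1 hI, (idleCol_same S _ _ _).symm⟩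
      · exact Or.inl (((hP m) k).2 hI)
    · have key : ∀ m : Fin S.L, ColInc parCol (V m.castSucc) ∧ ColInc parCol (V m.succ) := by
        intro m
        have := ColGap.colInc (hgap m)
        unfold lo hi at this
        split_ifs at this
        · exact this.symm
        · exact this
      rcases Nat.eq_zero_or_pos m.1 with h0 | h0
      · rcases Nat.eq_zero_or_pos S.L with hL | hL
        · intro i
          have := S.a_lt i
          have := S.b_le i
          omega
        · have : m = (⟨0, hL⟩ : Fin S.L).castSucc := Fin.ext h0
          rw [this]; exact (key _).1
      · have hm := m.2
        have : m = (⟨m.1 - 1, by omega⟩ : Fin S.L).succ := Fin.ext (by simp; omega)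
        rw [this]; exact (key _).2

theorem not_chip_of_lt {n B : ℕ} {lo hi : Fin n → Fin B} {q : ℕ}
    (h : ∀ k k' : Fin n, k.1 = q → k'.1 = q + 1 → hi k < lo k') :
    ¬ Chip n (extend lo) (extend hi) q := by
  rintro ⟨h1, h2⟩
  have h3 := h ⟨q, by omega⟩ ⟨q + 1, h1⟩ rfl rfl
  rw [Fin.lt_def] at h3
  simp only [extend, h1, show q < n by omega, dif_pos] at h2
  omega

/-- Colours are constant along idle strands. -/
theorem eq_of_compat_of_idle {V : Fin (S.L + 1) → Fin S.n → S.Val}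
    (hP : ∀ m : Fin (S.L + 1), S.Proper m (V m)) (m : Fin S.L) {f f' : Fin S.n → Bool}
    (hc : Compat S.n (extend (S.lo m (V m.castSucc) (V m.succ)))
      (extend (S.hi m (V m.castSucc) (V m.succ))) (extendCol (S.lo m f f'))
      (extendCol (S.hi m f f'))) {k : Fin S.n} (h1 : S.Idle m k) (h2 : S.Idle (m + 1) k) :
    f k = f' k := by
  have t1 : S.typLo m k ≠ 1 := by unfold typLo lo; split_ifs <;> assumption
  have t2 : S.typHi m k ≠ 1 := by unfold typHi hi; split_ifs <;> assumption
  have hk := hc k.1 k.2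
  have c1 : ¬ Chip S.n (extend (S.lo m (V m.castSucc) (V m.succ)))
      (extend (S.hi m (V m.castSucc) (V m.succ))) k := not_chip_of_lt fun i i' hi hi' =>
    (hP m.castSucc).hi_lt_lo m.2 (hP m.succ) (Fin.lt_def.2 (by omega)) fun h => by
      rw [Fin.ext hi] at h; exact t2 h.1
  have e1 : inFlip S.n (extend (S.lo m (V m.castSucc) (V m.succ)))
      (extend (S.hi m (V m.castSucc) (V m.succ))) (extendCol (S.lo m f f'))
      (extendCol (S.hi m f f')) k = extendCol (S.lo m f f') k := by
    rcases hq : k.1 with _ | q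
    · rfl
    · rw [inFlip, if_neg]
      refine not_chip_of_lt fun i i' hi hi' =>
        (hP m.castSucc).hi_lt_lo m.2 (hP m.succ) (Fin.lt_def.2 (by omega)) fun h => ?_
      rw [show i' = k from Fin.ext (by omega)] at h
      exact t1 h.2
  rw [e1, outFlip, if_neg c1, extendCol_coe, extendCol_coe] at hk
  unfold lo hi at hk
  split_ifs at hk
  · exact hk.symm
  · exact hk

/-- The planar boundary colourings of a chain are those of the diagram of a word. -/
theorem isPlanar_iff_colourable {V : Fin (S.L + 1) → Fin S.n → S.Val}
    (hV : S.IsChain parCol parCol V) (φL φR : Fin S.n → Bool) :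
    S.IsPlanar V φL φR ↔ Colourable (S.prefixWord V S.L) φL φR := by
  have hP := ((isChain_parCol_iff V).1 hV).1
  rw [S.colourable_prefixWord V φR S.L le_rfl]
  simp only [← compat_iff_gapWord]
  constructor
  · rintro ⟨g, h1, h2⟩
    have e : ∀ m (hm : m < S.L + 1), (if h : m < S.L + 1 then g ⟨m, h⟩ else g 0) = g ⟨m, hm⟩ :=
      fun m hm => dif_pos hm
    refine ⟨fun m => if h : m < S.L + 1 then g ⟨m, h⟩ else g 0, ?_, ?_, fun m _ => ?_⟩
    · funext k
      simp only [e S.L (Nat.lt_succ_self _)]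
      rw [h2 _ _ (S.idle_of_ge (S.b_le k)), idleCol, if_pos (S.b_le k)]
    · funext k
      simp only [e 0 (Nat.succ_pos _)]
      have h3 := S.a_pos k
      have h4 := S.a_lt k
      rw [h2 _ _ (S.idle_of_lt h3), idleCol, if_neg (by simp only; omega)]
    · simp only [e m.1 (by omega), e (m.1 + 1) (by omega)]
      exact h1 m
  · rintro ⟨g, g1, g2, g3⟩
    refine ⟨fun m => g m, fun m => g3 m m.2, fun m k hI => ?_⟩
    have step : ∀ m : Fin S.L, S.Idle m k → S.Idle (m + 1) k → g m k = g (m + 1) k :=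
      fun m => eq_of_compat_of_idle hP m (g3 m m.2)
    rw [idleCol]
    split_ifs with hb
    · have key : ∀ d m, m + d = S.L → S.b k ≤ m → g m k = φL k := by
        intro d
        induction d with
        | zero => intro m hm _; rw [← g1, ← hm]; rfl
        | succ d ih =>
          intro m hm hb
          rw [step ⟨m, by omega⟩ (S.idle_of_ge hb) (S.idle_of_ge (by simp only; omega))]
          exact ih (m + 1) (by omega) (by omega)
      exact key (S.L - m) m (by omega) hb
    · have ha : m.1 < S.a k := (S.idle_iff.1 hI).resolve_right hb
      have key : ∀ m, m ≤ S.L → m < S.a k → g m k = φR k := by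
        intro m
        induction m with
        | zero => intro _ _; rw [g2]
        | succ m ih =>
          intro hm ha
          rw [← step ⟨m, by omega⟩ (S.idle_of_lt (by simp only; omega)) (S.idle_of_lt ha)]
          exact ih (by omega) (by omega)
      exact key m (by omega) ha

end Strands

/-! ### Immanants of path matrices. -/

namespace Strands

variable {S : Strands} {K : Type*} [CommRing K] [Algebra ℂ K]

/-- The boundary colourings of a chain are those of exactly one basis element. -/
theorem existsUnique_planar {V : Fin (S.L + 1) → Fin S.n → S.Val}
    (hV : S.IsChain parCol parCol V) : ∃ u : AvoidingPerm S.n, ∀ v : AvoidingPerm S.n,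
      (∀ f f', S.IsPlanar V f f' ↔ Colourable (reducedWord v.1) f f') ↔ v = u := by
  obtain ⟨u, hu⟩ := exists_sameDiagram_reducedWord (S.prefixWord V S.L)
  have h : ∀ f f', S.IsPlanar V f f' ↔ Colourable (reducedWord u.1) f f' := fun f f' =>
    (isPlanar_iff_colourable hV f f').trans (hu.colourable_iff f f')
  refine ⟨u, fun v => ⟨fun hv => Subtype.ext (v.2.eq_of_colourable u.2 fun f f' => ?_), ?_⟩⟩
  · rw [← hv, h]
  · rintro rfl; exact h

open Classical in
/-- The immanant of the matrix of path generating functions is the weighted number of the chains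
with a given diagram. -/
theorem tlImmanant_pathGF (x : ℕ → K) (u : AvoidingPerm S.n) :
    tlImmanant u (Matrix.of fun i j => S.pathGF x S.L (S.idleVal S.L i) j) =
      ∑ V : Fin (S.L + 1) → Fin S.n → S.Val, if S.IsChain parCol parCol V ∧
        ∀ f f', S.IsPlanar V f f' ↔ Colourable (reducedWord u.1) f f' then S.chainWt x V else 0 := by
  rw [← sub_eq_zero]
  -- By linear independence it suffices to compare, for each pair of boundary colours, the sums over
  -- all basis elements that are colourable with them.
  refine eq_zero_of_sum_colourable (fun u : AvoidingPerm S.n =>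
    tlImmanant u (Matrix.of fun i j => S.pathGF x S.L (S.idleVal S.L i) j) -
      ∑ V : Fin (S.L + 1) → Fin S.n → S.Val, if S.IsChain parCol parCol V ∧
        ∀ f f', S.IsPlanar V f f' ↔ Colourable (reducedWord u.1) f f' then S.chainWt x V else 0)
    (fun f f' => ?_) u
  have h1 := sum_tlImmanant_colourable
    (Matrix.of fun i j => S.pathGF x S.L (S.idleVal S.L i) j) (toggle f) (toggle f')
  have h2 := S.det_eq_sum_chains x (toggle f) (toggle f')
  have h3 := S.sum_isPlanar x f f'
  -- The complementary minors and the chain expansion come with the same sign, whose square is one.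
  have hsign : ∀ ε : ℤˣ, ∀ y : K, ((ε : ℤ) : K) * (((ε : ℤ) : K) * y) = y := by
    intro ε y
    rcases Int.units_eq_one_or ε with h | h <;> simp [h]
  simp only [Matrix.of_apply, toggle_toggle] at h1
  rw [h2, hsign] at h1
  have h4 : ∀ u : AvoidingPerm S.n, (if Colourable (reducedWord u.1) f f' then
      ∑ V : Fin (S.L + 1) → Fin S.n → S.Val, (if S.IsChain parCol parCol V ∧
        ∀ f f', S.IsPlanar V f f' ↔ Colourable (reducedWord u.1) f f' then S.chainWt x V else 0)
      else 0) = ∑ V : Fin (S.L + 1) → Fin S.n → S.Val, if (S.IsChain parCol parCol V ∧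
        S.IsPlanar V f f') ∧ ∀ f f', S.IsPlanar V f f' ↔ Colourable (reducedWord u.1) f f' then
          S.chainWt x V else 0 := by
    intro u
    split_ifs with hc
    · refine Finset.sum_congr rfl fun V _ => ite_congr_iff ?_
      exact ⟨fun h => ⟨⟨h.1, (h.2 _ _).2 hc⟩, h.2⟩, fun h => ⟨h.1.1, h.2⟩⟩
    · exact (Finset.sum_eq_zero fun V _ => if_neg fun h => hc ((h.2 _ _).1 h.1.2)).symm
  have h5 : ∀ u : AvoidingPerm S.n, (if Colourable (reducedWord u.1) f f' then
      tlImmanant u (Matrix.of fun i j => S.pathGF x S.L (S.idleVal S.L i) j) -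
      ∑ V : Fin (S.L + 1) → Fin S.n → S.Val, (if S.IsChain parCol parCol V ∧
        ∀ f f', S.IsPlanar V f f' ↔ Colourable (reducedWord u.1) f f' then S.chainWt x V else 0)
      else 0) = (if Colourable (reducedWord u.1) f f' then
        tlImmanant u (Matrix.of fun i j => S.pathGF x S.L (S.idleVal S.L i) j) else 0) -
      ∑ V : Fin (S.L + 1) → Fin S.n → S.Val, if (S.IsChain parCol parCol V ∧
        S.IsPlanar V f f') ∧ ∀ f f', S.IsPlanar V f f' ↔ Colourable (reducedWord u.1) f f' then
          S.chainWt x V else 0 := by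
    intro u
    rw [← h4]
    split_ifs <;> simp
  rw [Finset.sum_congr rfl fun u _ => h5 u, Finset.sum_sub_distrib, sub_eq_zero, h1,
    Finset.sum_comm]
  refine h3.symm.trans (Finset.sum_congr rfl fun V _ => ?_)
  -- A chain that admits the boundary colours is counted once, for the only basis element that has
  -- its boundary colourings.
  by_cases hV : S.IsChain parCol parCol V ∧ S.IsPlanar V f f'
  · obtain ⟨v, hv⟩ := existsUnique_planar hV.1
    simp only [hV, hv]
    simp
  · rw [if_neg hV]
    exact (Finset.sum_eq_zero fun u _ => if_neg fun h => hV h.1).symm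

end Strands

/-! ### Generating functions of single ribbons -/

/-- Neighbouring entries of a ribbon: strictly decreasing for a step upwards, weakly increasing for
a step to the right. -/
def StepRel (up : Bool) {α : Type*} [LinearOrder α] (e e' : α) : Prop :=
  if up = true then e' < e else e ≤ e'

open Classical in
/-- The generating function of the fillings of a ribbon with `d + 1` boxes that starts in the
column `a`, by the last entry. Entries are counted from zero. -/
noncomputable def entryGF {K : Type*} [CommRing K] (x : ℕ → K) (up : ℕ → Bool) {N : ℕ} (a : ℕ) :
    ℕ → Fin N → K
  | 0, e => x (e + 1)
  | d + 1, e => x (e + 1) * ∑ e', if StepRel (up (a + d)) e' e then entryGF x up a d e' else 0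

open Classical in
theorem sum_entryGF {K : Type*} [CommRing K] (x : ℕ → K) (up : ℕ → Bool) {N : ℕ} (a d : ℕ) :
    ∑ e : Fin N, entryGF x up a d e = ∑ V : Fin (d + 1) → Fin N,
      if ∀ m : Fin d, StepRel (up (a + m)) (V m.castSucc) (V m.succ) then
        ∏ i, x (V i + 1) else 0 := by
  have h := transfer_sum (fun m (e' e : Fin N) => if StepRel (up (a + m)) e' e then x (e + 1) else 0)
    (entryGF x up a) d fun m _ e => by
      rw [entryGF, Finset.mul_sum]
      refine Finset.sum_congr rfl fun e' _ => ?_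
      split_ifs <;> simp
  rw [← (Fin.snocEquiv (fun _ : Fin (d + 1) => Fin N)).sum_comp, Fintype.sum_prod_type]
  refine Finset.sum_congr rfl fun e _ => ?_
  rw [h]
  refine Finset.sum_congr rfl fun W _ => ?_
  change _ = if ∀ m : Fin d, StepRel (up (a + m)) (Fin.snoc (α := fun _ => Fin N) W e m.castSucc)
    (Fin.snoc (α := fun _ => Fin N) W e m.succ) then
    ∏ i, x ((Fin.snoc (α := fun _ => Fin N) W e i : Fin N) + 1) else 0
  rw [Finset.prod_ite_zero, mul_ite, mul_zero, Fin.prod_univ_succ]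
  exact ite_congr_iff (by simp)

namespace Strands

variable (S : Strands) {K : Type*} [CommRing K]

/-- The value of an entry in the column `m`. -/
def entryVal {m : ℕ} (hm : m ≤ S.L) (e : Fin S.N) : S.Val :=
  ⟨S.base m + e + 1, by have := S.base_le m; have := e.2; unfold big; omega⟩

theorem inRange_entryVal {m : ℕ} (hm : m ≤ S.L) (e : Fin S.N) : S.InRange m (S.entryVal hm e) := by
  have := e.2
  unfold InRange entryVal
  simp only; omega

theorem exists_entryVal {m : ℕ} (hm : m ≤ S.L) {y : S.Val} (h : S.InRange m y) :
    ∃ e, y = S.entryVal hm e := by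
  unfold InRange at h
  exact ⟨⟨y.1 - S.base m - 1, by omega⟩, Fin.ext (by simp only [entryVal]; omega)⟩

theorem entryVal_injective {m : ℕ} (hm : m ≤ S.L) : Function.Injective (S.entryVal hm) := by
  intro e e' h
  have := congrArg Fin.val h
  simp only [entryVal] at this
  exact Fin.ext (by omega)

theorem wt_entryVal (x : ℕ → K) {m : ℕ} (hm : m ≤ S.L) (e : Fin S.N) :
    S.wt x m (S.entryVal hm e) = x (e + 1) := by
  rw [wt, if_pos (S.inRange_entryVal hm e)]
  congr 1
  simp only [entryVal]; omega

theorem base_succ (m : ℕ) : S.base (m + 1) = S.base m + if S.up m = true then 1 else 0 := by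
  unfold base
  rw [Finset.range_add_one, Finset.filter_insert]
  split_ifs
  · rw [Finset.card_insert_of_notMem (by simp)]; omega
  · rfl

theorem lo_le_hi_entryVal {m : ℕ} (hm : m + 1 ≤ S.L) (e e' : Fin S.N) :
    S.lo m (S.entryVal (m := m) (by omega) e) (S.entryVal hm e') ≤
      S.hi m (S.entryVal (m := m) (by omega) e) (S.entryVal hm e') ↔ StepRel (S.up m) e e' := by
  have h := S.base_succ m
  unfold lo hi StepRel
  split_ifs at *
  · rw [Fin.le_def, Fin.lt_def]; simp only [entryVal]; omega
  · rw [Fin.le_def, Fin.le_def]; simp only [entryVal]; omega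

/-- A strand with given end points, all of whose values are idle or in range, is weakly monotone at
every gap. -/
theorem lo_le_hi_of_typ {m : ℕ} (hm : m < S.L) {z y : S.Val} {t t' : ℕ}
    (hz : (t = 1 ∧ S.InRange m z) ∨ ∃ k, S.typ m k = t ∧ t ≠ 1 ∧ z = S.idleVal m k)
    (hy : (t' = 1 ∧ S.InRange (m + 1) y) ∨
      ∃ k, S.typ (m + 1) k = t' ∧ t' ≠ 1 ∧ y = S.idleVal (m + 1) k)
    (h : S.lo m t t' < S.hi m t t') : S.lo m z y ≤ S.hi m z y := by
  have key : ∀ {m : ℕ} {z : S.Val} {t : ℕ}, (t = 1 ∧ S.InRange m z) ∨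
      (∃ k, S.typ m k = t ∧ t ≠ 1 ∧ z = S.idleVal m k) → (t = 0 ∧ z.1 < S.n) ∨
        (t = 1 ∧ S.InRange m z) ∨ (t = 2 ∧ S.big ≤ z.1) := by
    rintro m z t (h | ⟨k, h1, h2, rfl⟩)
    · exact Or.inr (Or.inl h)
    · have := S.typ_le m k
      have := k.2
      by_cases h0 : S.typ m k = 0
      · exact Or.inl ⟨by omega, by rw [S.idleVal_low h0]; omega⟩
      · exact Or.inr (Or.inr ⟨by omega, by rw [S.idleVal_high h0]; omega⟩)
  have b1 := S.base_le m
  have b2 := S.le_base m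
  have b1' := S.base_le (m + 1)
  have b2' := S.le_base (m + 1)
  have e : S.big = S.n + S.L + S.N + 1 := rfl
  have hz := key hz
  have hy := key hy
  unfold InRange at hz hy
  unfold lo hi at *
  split_ifs at * <;> rw [Fin.le_def] <;> omega

theorem lo_typ_le (m : ℕ) (k : Fin S.n) :
    S.lo m (S.typ m k) (S.typ (m + 1) k) ≤ S.hi m (S.typ m k) (S.typ (m + 1) k) := by
  unfold lo hi
  split_ifs with h
  · exact S.up_le m h k
  · exact S.right_le m (by simpa using h) k

theorem lo_hi_typ_end {m : ℕ} {i : Fin S.n} (h1 : S.typ m i = 1) (h2 : S.typ (m + 1) i ≠ 1) :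
    S.lo m 1 (S.typ (m + 1) i) < S.hi m 1 (S.typ (m + 1) i) := by
  have h := S.lo_typ_le m i
  rw [h1] at h
  unfold lo hi at *
  split_ifs at * <;> omega

theorem lo_hi_typ_start {m : ℕ} {j : Fin S.n} (h1 : S.typ m j ≠ 1) (h2 : S.typ (m + 1) j = 1) :
    S.lo m (S.typ m j) 1 < S.hi m (S.typ m j) 1 := by
  have h := S.lo_typ_le m j
  rw [h2] at h
  unfold lo hi at *
  split_ifs at * <;> omega

theorem not_inRange_and_idle {m : ℕ} (hm : m ≤ S.L) {y : S.Val} (h : S.InRange m y) (k : Fin S.n) :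
    y ≠ S.idleVal m k := by
  rintro rfl
  exact S.not_inRange_idleVal hm k h

theorem sum_inRange {m : ℕ} (hm : m ≤ S.L) (F : S.Val → K) (hF : ∀ y, ¬ S.InRange m y → F y = 0) :
    ∑ y, F y = ∑ e, F (S.entryVal hm e) := by
  refine (Fintype.sum_of_injective (S.entryVal hm) (S.entryVal_injective hm) _ F (fun y hy => ?_)
    fun _ => rfl).symm
  refine hF y fun h => hy ?_
  obtain ⟨e, rfl⟩ := S.exists_entryVal hm h
  exact ⟨e, rfl⟩

/-- Before its end, a path of the source `j` that leaves an idle value belongs to `j`. -/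
theorem pathGF_idleVal_eq_zero (x : ℕ → K) {m : ℕ} (hm : m < S.L) {j k : Fin S.n}
    (hk : S.Idle m k) (hk' : ¬ S.Idle (m + 1) k) (hj : S.a j ≤ m) :
    S.pathGF x m (S.idleVal m k) j = 0 := by
  have h1 := S.idle_iff.1 hk
  have h2 := mt S.idle_iff.2 hk'
  rw [S.pathGF_idle x hm.le (by omega), if_neg]
  rintro rfl
  omega

open Classical in
-- From the column `a j` on, a path of the source `j` that ends at an entry value has run through
-- entry values only: the idle vertices with further outgoing edges belong to strands that start
-- later, and `j` does not reach them. So the recursion for paths becomes that for fillings of a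
-- ribbon.
theorem pathGF_entryVal (x : ℕ → K) (j : Fin S.n) (d : ℕ) (hd : S.a j + d ≤ S.L) (e : Fin S.N) :
    S.pathGF x (S.a j + d) (S.entryVal hd e) j = entryGF x S.up (S.a j) d e := by
  have ha := S.a_pos j
  have hnot : ∀ {m} (hm : m + 1 ≤ S.L) (e : Fin S.N), ¬ ∃ k, S.Idle m k ∧ S.Idle (m + 1) k ∧
      S.entryVal hm e = S.idleVal (m + 1) k := fun hm e ⟨k, _, _, h⟩ =>
    S.not_inRange_and_idle hm (S.inRange_entryVal hm e) k h
  have hedge : ∀ {m} (hm : m + 1 ≤ S.L) (e : Fin S.N) (z : S.Val), S.Edge m z (S.entryVal hm e) ↔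
      (S.InRange m z ∨ ∃ k, S.Idle m k ∧ ¬ S.Idle (m + 1) k ∧ z = S.idleVal m k) ∧
        S.lo m z (S.entryVal hm e) ≤ S.hi m z (S.entryVal hm e) := by
    intro m hm e z
    constructor
    · rintro (⟨k, h1, h2, h3, -⟩ | ⟨-, h⟩)
      · exact absurd ⟨k, h1, h2, h3⟩ (hnot hm e)
      · exact h
    · exact fun h => Or.inr ⟨hnot hm e, h⟩
  induction d generalizing e with
  | zero =>
    obtain ⟨m, hm⟩ : ∃ m, S.a j = m + 1 := ⟨S.a j - 1, by omega⟩
    have hm' : m + 1 ≤ S.L := by omega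
    have key : S.pathGF x (m + 1) (S.entryVal hm' e) j = x (e + 1) := by
      rw [pathGF, S.wt_entryVal, Finset.sum_eq_single (S.idleVal m j)]
      · rw [if_pos, S.pathGF_idle x (by omega) (by omega), if_pos rfl, mul_one]
        have h1 : S.Idle m j := S.idle_of_lt (by omega)
        have h2 : S.typ (m + 1) j = 1 := (S.active _ _).2 ⟨by omega, hm ▸ S.a_lt j⟩
        refine (hedge hm' e _).2 ⟨Or.inr ⟨j, h1, fun h => h h2, rfl⟩, ?_⟩
        exact S.lo_le_hi_of_typ (by omega) (Or.inr ⟨j, rfl, h1, rfl⟩)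
          (Or.inl ⟨rfl, S.inRange_entryVal hm' e⟩) (S.lo_hi_typ_start h1 h2)
      · intro z _ hz
        rw [S.pathGF_before x (by omega) (by omega) hz, ite_self]
      · intro h; exact absurd (Finset.mem_univ _) h
    rw [entryGF, ← key]
    congr 1
    exact Fin.ext (by simp only [entryVal, Nat.add_zero, hm])
  | succ d ih =>
    have hm : S.a j + d + 1 ≤ S.L := hd
    change S.pathGF x (S.a j + d + 1) (S.entryVal hm e) j = _
    rw [pathGF, S.wt_entryVal, entryGF]
    congr 1
    rw [S.sum_inRange (m := S.a j + d) (by omega)]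
    · refine Finset.sum_congr rfl fun e' _ => ?_
      rw [ih (by omega)]
      refine ite_congr_iff ?_
      rw [hedge, S.lo_le_hi_entryVal]
      exact and_iff_right (Or.inl (S.inRange_entryVal _ _))
    · intro z hz
      split_ifs with hE
      · obtain ⟨k, h1, h2, rfl⟩ := ((hedge hm e z).1 hE).1.resolve_left hz
        exact S.pathGF_idleVal_eq_zero x (by omega) h1 h2 (by omega)
      · rfl

/-- The generating function of the paths from the source `j` to the sink `i`. -/
theorem pathGF_last (x : ℕ → K) (i j : Fin S.n) : S.pathGF x S.L (S.idleVal S.L i) j =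
    if S.a j < S.b i then ∑ e, entryGF x S.up (N := S.N) (S.a j) (S.b i - S.a j - 1) e
    else if S.a j = S.b i then 1 else 0 := by
  have hb := S.b_le i
  have hab := S.a_lt i
  have h0 : ∀ d, S.b i + d ≤ S.L → S.pathGF x (S.b i + d) (S.idleVal (S.b i + d) i) j =
      S.pathGF x (S.b i) (S.idleVal (S.b i) i) j := by
    intro d
    induction d with
    | zero => intro _; rfl
    | succ d ih =>
      intro hd
      rw [← ih (by omega)]
      change S.pathGF x (S.b i + d + 1) (S.idleVal (S.b i + d + 1) i) j = _
      simp only [pathGF, S.edge_idle (S.idle_of_ge (by omega : S.b i ≤ S.b i + d))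
        (S.idle_of_ge (by omega : S.b i ≤ S.b i + d + 1)), Finset.sum_ite_eq', Finset.mem_univ,
        if_true, wt, S.not_inRange_idleVal (m := S.b i + d + 1) hd, if_false, one_mul]
  have h1 := h0 (S.L - S.b i) (by omega)
  rw [show S.b i + (S.L - S.b i) = S.L by omega] at h1
  rw [h1]
  obtain ⟨m, hm⟩ : ∃ m, S.b i = m + 1 := ⟨S.b i - 1, by omega⟩
  have ht1 : S.typ m i = 1 := (S.active _ _).2 (by omega)
  have ht2 : S.Idle (m + 1) i := S.idle_of_ge (by omega)
  have hnot : ¬ ∃ k, S.Idle m k ∧ S.Idle (m + 1) k ∧ S.idleVal (m + 1) i = S.idleVal (m + 1) k := by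
    rintro ⟨k, h1, -, h3⟩
    rw [← S.idleVal_inj h3] at h1
    exact h1 ht1
  have hedge : ∀ z : S.Val, S.Edge m z (S.idleVal (m + 1) i) ↔
      (S.InRange m z ∨ ∃ k, S.Idle m k ∧ ¬ S.Idle (m + 1) k ∧ z = S.idleVal m k) := by
    intro z
    constructor
    · rintro (⟨k, h1, h2, h3, -⟩ | ⟨-, h, -⟩)
      · exact absurd ⟨k, h1, h2, h3⟩ hnot
      · exact h
    · intro h
      refine Or.inr ⟨hnot, h, ?_⟩
      have hlt := S.lo_hi_typ_end ht1 ht2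
      rcases h with h | ⟨k, h1, h2, rfl⟩
      · exact S.lo_le_hi_of_typ (by omega) (Or.inl ⟨rfl, h⟩) (Or.inr ⟨i, rfl, ht2, rfl⟩) hlt
      · refine S.lo_le_hi_of_typ (by omega) (Or.inr ⟨k, rfl, h1, rfl⟩) (Or.inr ⟨i, rfl, ht2, rfl⟩) ?_
        have h3 := S.lo_hi_typ_start h1 (not_not.1 h2)
        unfold lo hi at *
        split_ifs at * <;> omega
  rw [hm]
  have hw : S.wt x (m + 1) (S.idleVal (m + 1) i) = 1 := by
    rw [wt, if_neg (S.not_inRange_idleVal (by omega) _)]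
  rcases lt_trichotomy (S.a j) (m + 1) with h | h | h
  · rw [if_pos h, pathGF, hw, one_mul, S.sum_inRange (m := m) (by omega)]
    · obtain ⟨d, rfl⟩ : ∃ d, m = S.a j + d := ⟨m - S.a j, by omega⟩
      rw [show S.a j + d + 1 - S.a j - 1 = d by omega]
      refine Finset.sum_congr rfl fun e _ => ?_
      rw [if_pos ((hedge _).2 (Or.inl (S.inRange_entryVal _ e))), S.pathGF_entryVal]
    · intro z hz
      split_ifs with hE
      · obtain ⟨k, h1, h2, rfl⟩ := ((hedge z).1 hE).resolve_left hz
        exact S.pathGF_idleVal_eq_zero x (by omega) h1 h2 (by omega)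
      · rfl
  · rw [if_neg (by omega), if_pos h, pathGF, hw, one_mul, Finset.sum_eq_single (S.idleVal m j)]
    · rw [if_pos, S.pathGF_idle x (by omega) (by omega), if_pos rfl]
      refine (hedge _).2 (Or.inr ⟨j, S.idle_of_lt (by omega), fun h' => ?_, rfl⟩)
      exact h' ((S.active _ _).2 ⟨h.le, h ▸ S.a_lt j⟩)
    · intro z _ hz
      rw [S.pathGF_before x (by omega) (by omega) hz, ite_self]
    · intro h; exact absurd (Finset.mem_univ _) h
  · rw [if_neg (by omega), if_neg (by omega), S.pathGF_before x (by omega) h]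
    intro h'
    rw [S.idleVal_inj h'] at hab
    rw [S.idleVal_inj h'] at hm
    omega

end Strands

/-! ### Truncation of power series -/

/-- Two power series agree in all monomials in the first `N` variables. -/
def TruncEq (N : ℕ) (f g : MvPowerSeries ℕ+ ℂ) : Prop :=
  ∀ d : ℕ+ →₀ ℕ, (∀ p ∈ d.support, (p : ℕ) ≤ N) →
    MvPowerSeries.coeff d f = MvPowerSeries.coeff d g

namespace TruncEq

variable {N : ℕ} {f g f' g' : MvPowerSeries ℕ+ ℂ}

theorem refl (N : ℕ) (f : MvPowerSeries ℕ+ ℂ) : TruncEq N f f := fun _ _ => rfl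

theorem symm (h : TruncEq N f g) : TruncEq N g f := fun d hd => (h d hd).symm

theorem trans {k : MvPowerSeries ℕ+ ℂ} (h : TruncEq N f g) (h' : TruncEq N g k) : TruncEq N f k :=
  fun d hd => (h d hd).trans (h' d hd)

/-- Every factor of a monomial in the first `N` variables is again such a monomial. -/
theorem mul (h : TruncEq N f g) (h' : TruncEq N f' g') : TruncEq N (f * f') (g * g') := by
  classical
  intro d hd
  rw [MvPowerSeries.coeff_mul, MvPowerSeries.coeff_mul]
  refine Finset.sum_congr rfl fun q hq => ?_
  rw [Finset.HasAntidiagonal.mem_antidiagonal] at hq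
  rw [h q.1 fun p hp => hd p ?_, h' q.2 fun p hp => hd p ?_]
  · rw [Finsupp.mem_support_iff] at hp ⊢
    rw [← hq, Finsupp.add_apply]; omega
  · rw [Finsupp.mem_support_iff] at hp ⊢
    rw [← hq, Finsupp.add_apply]; omega

theorem prod {ι : Type*} (s : Finset ι) {f g : ι → MvPowerSeries ℕ+ ℂ}
    (h : ∀ i ∈ s, TruncEq N (f i) (g i)) : TruncEq N (∏ i ∈ s, f i) (∏ i ∈ s, g i) := by
  classical
  induction s using Finset.induction_on with
  | empty => exact refl N 1
  | insert a s ha ih =>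
    rw [Finset.prod_insert ha, Finset.prod_insert ha]
    exact (h a (Finset.mem_insert_self _ _)).mul
      (ih fun i hi => h i (Finset.mem_insert_of_mem hi))

theorem sum {ι : Type*} (s : Finset ι) {f g : ι → MvPowerSeries ℕ+ ℂ}
    (h : ∀ i ∈ s, TruncEq N (f i) (g i)) : TruncEq N (∑ i ∈ s, f i) (∑ i ∈ s, g i) := by
  intro d hd
  rw [map_sum, map_sum]
  exact Finset.sum_congr rfl fun i hi => h i hi d hd

theorem smul (c : ℂ) (h : TruncEq N f g) : TruncEq N (c • f) (c • g) := by
  intro d hd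
  rw [map_smul, map_smul, h d hd]

theorem tlImmanant {n : ℕ} {X Y : Matrix (Fin n) (Fin n) (MvPowerSeries ℕ+ ℂ)}
    (h : ∀ i j, TruncEq N (X i j) (Y i j)) (u : AvoidingPerm n) :
    TruncEq N (tlImmanant u X) (tlImmanant u Y) :=
  sum _ fun _ _ => (prod _ fun _ _ => h _ _).smul _

end TruncEq

/-- A monomial involves finitely many variables, and the sum of their numbers bounds each of them.
-/
theorem eq_of_truncEq {f g : MvPowerSeries ℕ+ ℂ} (h : ∀ N, TruncEq N f g) : f = g := by
  refine MvPowerSeries.ext fun d => h (∑ p ∈ d.support, (p : ℕ)) d fun p hp => ?_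
  exact Finset.single_le_sum (f := fun p : ℕ+ => (p : ℕ)) (fun _ _ => Nat.zero_le _) hp

/-- The variable with a given number. -/
noncomputable def seriesVar (e : ℕ) : MvPowerSeries ℕ+ ℂ := MvPowerSeries.X e.toPNat'

theorem prod_X {ι : Type*} (s : Finset ι) (f : ι → ℕ+) :
    ∏ p ∈ s, (MvPowerSeries.X (f p) : MvPowerSeries ℕ+ ℂ) =
      MvPowerSeries.monomial (∑ p ∈ s, Finsupp.single (f p) 1) 1 := by
  classical
  induction s using Finset.induction_on with
  | empty => rw [Finset.prod_empty, Finset.sum_empty, MvPowerSeries.monomial_zero_one]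
  | insert a s ha ih =>
    rw [Finset.prod_insert ha, Finset.sum_insert ha, ih, MvPowerSeries.X,
      MvPowerSeries.monomial_mul_monomial, one_mul]

theorem Tableau.entry_le_of_weight_eq {D : Finset (ℤ × ℤ)} {T : Tableau D} {N : ℕ}
    (h : ∀ p ∈ T.weight.support, (p : ℕ) ≤ N) (p : D) : (T.entry p : ℕ) ≤ N := by
  refine h _ ?_
  rw [Finsupp.mem_support_iff, Tableau.weight, Finsupp.finsetSum_apply]
  intro h0
  have := (Finset.sum_eq_zero_iff.mp h0) p (Finset.mem_univ p)
  simp at this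

open Classical in
/-- The truncation of a weighted sum of tableaux, in terms of a parametrization of the tableaux with
entries up to `N`. -/
theorem weightSum_truncEq {D : Finset (ℤ × ℤ)} {𝒮 : Set (Tableau D)} {N : ℕ} {ι : Type*} [Fintype ι]
    {P : ι → Prop} (Φ : ∀ i, P i → Tableau D)
    (hinj : ∀ i j (hi : P i) (hj : P j), Φ i hi = Φ j hj → i = j)
    (hmem : ∀ i (hi : P i), Φ i hi ∈ 𝒮)
    (hsurj : ∀ T ∈ 𝒮, (∀ p, (T.entry p : ℕ) ≤ N) → ∃ i hi, Φ i hi = T)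
    {w : ι → MvPowerSeries ℕ+ ℂ}
    (hw : ∀ i (hi : P i), w i = ∏ p : D, seriesVar ((Φ i hi).entry p)) :
    TruncEq N (weightSum 𝒮) (∑ i, if P i then w i else 0) := by
  intro d hd
  have h1 : ∀ i, MvPowerSeries.coeff d (if P i then w i else 0) =
      if ∃ hi : P i, (Φ i hi).weight = d then 1 else 0 := by
    intro i
    by_cases hi : P i
    · have e : w i = MvPowerSeries.monomial (Φ i hi).weight 1 := by
        rw [hw i hi, Tableau.weight, ← prod_X]
        simp only [seriesVar, PNat.coe_toPNat']
      rw [if_pos hi, e, MvPowerSeries.coeff_monomial]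
      exact ite_congr_iff ⟨fun h => ⟨hi, h.symm⟩, fun ⟨_, h⟩ => h.symm⟩
    · rw [if_neg hi, if_neg fun h => hi h.1]; simp
  rw [map_sum, Finset.sum_congr rfl fun i _ => h1 i, Finset.sum_boole]
  change (({T : Tableau D | T ∈ 𝒮 ∧ T.weight = d}.ncard : ℕ) : ℂ) = _
  congr 1
  rw [← Set.ncard_coe_finset]
  symm
  refine Set.ncard_congr (fun i hi => Φ i (Finset.mem_filter.1 hi).2.choose) ?_ ?_ ?_
  · intro i hi
    exact ⟨hmem _ _, (Finset.mem_filter.1 hi).2.choose_spec⟩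
  · intro i j hi hj h
    exact hinj _ _ _ _ h
  · rintro T ⟨hT, hTd⟩
    obtain ⟨i, hi, rfl⟩ := hsurj T hT (Tableau.entry_le_of_weight_eq (hTd ▸ hd))
    exact ⟨i, Finset.mem_filter.2 ⟨Finset.mem_univ _, hi, hTd⟩, rfl⟩

/-! ### Schur functions of ribbons as sums over sequences of entries. -/

namespace InfiniteRibbon

variable (R : InfiniteRibbon)

/-- The step from the box of content `c` to the next box goes upwards. -/
def stepUp (c : ℤ) : Bool := decide ((R.box (c + 1)).1 < (R.box c).1)

theorem box_succ (c : ℤ) :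
    R.box (c + 1) = if R.stepUp c = true then R.box c + (-1, 0) else R.box c + (0, 1) := by
  have h := R.step (c + 1)
  rw [add_sub_cancel_right] at h
  unfold stepUp
  rcases h with h | h
  · rw [if_neg, h]; simp [h]
  · rw [if_pos, h]; simp [h]

theorem box_succ_up {c : ℤ} (h : R.stepUp c = true) : R.box (c + 1) = R.box c + (-1, 0) := by
  rw [box_succ, if_pos h]

theorem box_succ_right {c : ℤ} (h : R.stepUp c = false) : R.box (c + 1) = R.box c + (0, 1) := by
  rw [box_succ, if_neg (by simp [h])]

theorem box_mono {c c' : ℤ} (h : c ≤ c') :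
    (R.box c').1 ≤ (R.box c).1 ∧ (R.box c).2 ≤ (R.box c').2 := by
  induction c', h using Int.leInduction with
  | base => exact ⟨le_rfl, le_rfl⟩
  | succ c' _ ih =>
    rw [R.box_succ c']
    split_ifs <;> simp only [Prod.fst_add, Prod.snd_add] <;> omega

theorem mem_segment {A B : ℤ} {p : ℤ × ℤ} :
    p ∈ R.segment A B ↔ ∃ c, A ≤ c ∧ c < B ∧ R.box c = p := by
  simp [segment, and_assoc]

/-- The place of a cell in a ribbon that starts with content `A`. -/
def ribbonIndex (d : ℕ) (A : ℤ) (p : ℤ × ℤ) : Fin (d + 1) := Fin.ofNat (d + 1) (p.2 - p.1 - A).toNat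

theorem ribbonIndex_box (d : ℕ) (A : ℤ) (i : Fin (d + 1)) :
    ribbonIndex d A (R.box (A + i)) = i := by
  unfold ribbonIndex
  rw [R.content]
  refine Fin.ext ?_
  have := i.2
  simp only [Fin.val_ofNat]
  rw [show (A + (i.1 : ℤ) - A).toNat = i.1 by omega, Nat.mod_eq_of_lt this]

/-- The sequences of entries that define tableaux of ribbon shape. -/
def RibbonSeq {N : ℕ} (A : ℤ) (d : ℕ) (V : Fin (d + 1) → Fin N) : Prop :=
  ∀ m : Fin d, StepRel (R.stepUp (A + m)) (V m.castSucc) (V m.succ)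

variable {R}

/-- Row numbers never increase along the ribbon, so two boxes of the same row are linked by steps to
the right alone, each of which is a weak inequality. -/
theorem RibbonSeq.row {N : ℕ} {A : ℤ} {d : ℕ} {V : Fin (d + 1) → Fin N} (h : R.RibbonSeq A d V)
    {i j : Fin (d + 1)} (hij : i ≤ j) (he : (R.box (A + i)).1 = (R.box (A + j)).1) : V i ≤ V j := by
  induction j using Fin.induction with
  | zero => rw [Fin.le_zero_iff.1 hij]
  | succ j ih =>
    rcases hij.eq_or_lt with rfl | hlt
    · exact le_rfl
    · have hlt' := Fin.lt_def.1 hlt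
      rw [Fin.val_succ] at hlt'
      have hle : i ≤ j.castSucc := Fin.le_def.2 (by rw [Fin.val_castSucc]; omega)
      have h1 := (R.box_mono (show A + (i : ℤ) ≤ A + (j : ℤ) by omega)).1
      have h2 := (R.box_mono (show A + (j : ℤ) ≤ A + (j : ℤ) + 1 by omega)).1
      rw [Fin.val_succ, Nat.cast_add, Nat.cast_one, ← add_assoc] at he
      have h3 := h j
      have hr : R.stepUp (A + j) = false := by
        rw [stepUp, decide_eq_false_iff_not]; omega
      rw [StepRel, hr, if_neg (by simp)] at h3
      refine (ih hle ?_).trans h3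
      rw [Fin.val_castSucc]; omega

/-- Likewise two boxes of one column are linked by steps up alone, each of which is strict. -/
theorem RibbonSeq.col {N : ℕ} {A : ℤ} {d : ℕ} {V : Fin (d + 1) → Fin N} (h : R.RibbonSeq A d V)
    {i j : Fin (d + 1)} (hij : i < j) (he : (R.box (A + i)).2 = (R.box (A + j)).2) : V j < V i := by
  induction j using Fin.induction with
  | zero => exact absurd hij (Fin.not_lt_zero i)
  | succ j ih =>
    have hlt' := Fin.lt_def.1 hij
    rw [Fin.val_succ] at hlt'
    have h1 := (R.box_mono (show A + (i : ℤ) ≤ A + (j : ℤ) by omega)).2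
    have h2 := (R.box_mono (show A + (j : ℤ) ≤ A + (j : ℤ) + 1 by omega)).2
    rw [Fin.val_succ, Nat.cast_add, Nat.cast_one, ← add_assoc] at he
    have h3 := h j
    have hr : R.stepUp (A + j) = true := by
      by_contra hr
      rw [R.box_succ_right (by simpa using hr)] at h2 he
      simp only [Prod.snd_add] at h2 he
      omega
    rw [StepRel, if_pos hr] at h3
    rcases (Nat.lt_succ_iff.1 hlt').eq_or_lt with heq | hlt
    · rw [show i = j.castSucc from Fin.ext heq]; exact h3
    · refine h3.trans (ih (Fin.lt_def.2 hlt) ?_)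
      rw [Fin.val_castSucc]; omega

theorem exists_index_of_mem_segment {A B : ℤ} {d : ℕ} (hB : B = A + d + 1) {p : ℤ × ℤ}
    (hp : p ∈ R.segment A B) : ∃ i : Fin (d + 1), p = R.box (A + i) := by
  obtain ⟨c, h1, h2, rfl⟩ := R.mem_segment.1 hp
  exact ⟨⟨(c - A).toNat, by omega⟩, by congr 1; simp only; omega⟩

theorem box_mem_segment {A B : ℤ} {d : ℕ} (hB : B = A + d + 1) (i : Fin (d + 1)) :
    R.box (A + i) ∈ R.segment A B := by
  have := i.2
  exact R.mem_segment.2 ⟨_, by omega, by omega, rfl⟩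

/-- The tableau of ribbon shape with given entries. -/
def RibbonSeq.tableau {N : ℕ} {A B : ℤ} {d : ℕ} (hB : B = A + d + 1) {V : Fin (d + 1) → Fin N}
    (h : R.RibbonSeq A d V) : Tableau (R.segment A B) where
  entry p := Nat.succPNat (V (ribbonIndex d A p))
  row_weak := by
    rintro ⟨p, hp⟩ ⟨q, hq⟩ h1 h2
    obtain ⟨i, rfl⟩ := exists_index_of_mem_segment hB hp
    obtain ⟨j, rfl⟩ := exists_index_of_mem_segment hB hq
    simp only at h1 h2
    rw [ribbonIndex_box, ribbonIndex_box, Nat.succPNat_le_succPNat]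
    refine h.row ?_ h1
    by_contra hc
    exact absurd (R.box_mono (show A + (j : ℤ) ≤ A + (i : ℤ) by omega)).2 (by omega)
  col_strict := by
    rintro ⟨p, hp⟩ ⟨q, hq⟩ h1 h2
    obtain ⟨i, rfl⟩ := exists_index_of_mem_segment hB hp
    obtain ⟨j, rfl⟩ := exists_index_of_mem_segment hB hq
    simp only at h1 h2
    rw [ribbonIndex_box, ribbonIndex_box, Nat.succPNat_lt_succPNat]
    refine h.col ?_ h1.symm
    by_contra hc
    exact absurd (R.box_mono (show A + (i : ℤ) ≤ A + (j : ℤ) by omega)).1 (by omega)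

theorem RibbonSeq.entry_box {N : ℕ} {A B : ℤ} {d : ℕ} (hB : B = A + d + 1)
    {V : Fin (d + 1) → Fin N} (h : R.RibbonSeq A d V) (i : Fin (d + 1)) :
    ((h.tableau hB).entry ⟨R.box (A + i), box_mem_segment hB i⟩ : ℕ) = V i + 1 := by
  simp only [tableau, ribbonIndex_box, Nat.succPNat_coe, Nat.succ_eq_add_one]

open Classical in
/-- The Schur function of a ribbon as a sum over sequences of entries. -/
theorem schur_segment_truncEq (N : ℕ) {A B : ℤ} {d : ℕ} (hB : B = A + d + 1) :
    TruncEq N (schur (R.segment A B)) (∑ V : Fin (d + 1) → Fin N,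
      if R.RibbonSeq A d V then ∏ i, seriesVar (V i + 1) else 0) := by
  refine weightSum_truncEq (fun V hV => RibbonSeq.tableau hB hV) ?_ (fun _ _ => Set.mem_univ _) ?_ ?_
  · intro V W hV hW h
    funext i
    have h1 := hV.entry_box hB i
    rw [h, hW.entry_box hB i] at h1
    exact Fin.ext (by omega)
  · intro T _ hT
    have hpos : ∀ p, 0 < (T.entry p : ℕ) := fun p => (T.entry p).pos
    have hN : ∀ p, (T.entry p : ℕ) - 1 < N := fun p => by have := hT p; have := hpos p; omega
    refine ⟨fun i => ⟨_, hN ⟨R.box (A + i), box_mem_segment hB i⟩⟩, fun m => ?_, ?_⟩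
    · have e : R.box (A + (m.succ : Fin (d + 1))) = R.box (A + m + 1) := by
        rw [Fin.val_succ, Nat.cast_add, Nat.cast_one, ← add_assoc]
      have p1 := hpos ⟨R.box (A + m.castSucc), box_mem_segment hB m.castSucc⟩
      have p2 := hpos ⟨R.box (A + m.succ), box_mem_segment hB m.succ⟩
      unfold StepRel
      split_ifs with hu
      · rw [R.box_succ_up hu] at e
        have := T.col_strict ⟨R.box (A + m.succ), box_mem_segment hB m.succ⟩
          ⟨R.box (A + m.castSucc), box_mem_segment hB m.castSucc⟩ (by simp only [e]; simp) (by simp only [e]; simp)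
        rw [← PNat.coe_lt_coe] at this
        rw [Fin.lt_def]
        simp only
        omega
      · rw [R.box_succ_right (by simpa using hu)] at e
        have := T.row_weak ⟨R.box (A + m.castSucc), box_mem_segment hB m.castSucc⟩
          ⟨R.box (A + m.succ), box_mem_segment hB m.succ⟩ (by simp only [e]; simp) (by simp only [e]; simp)
        rw [← PNat.coe_le_coe] at this
        rw [Fin.le_def]
        simp only
        omega
    · refine Tableau.ext (funext fun p => ?_)
      obtain ⟨i, hi⟩ := exists_index_of_mem_segment hB p.2
      obtain rfl : p = ⟨R.box (A + i), box_mem_segment hB i⟩ := Subtype.ext hi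
      have h1 := hpos ⟨R.box (A + i), box_mem_segment hB i⟩
      refine PNat.coe_inj.1 ?_
      refine (RibbonSeq.entry_box hB _ i).trans ?_
      simp only; omega
  · intro V hV
    refine Fintype.prod_bijective (fun i => ⟨R.box (A + i), box_mem_segment hB i⟩) ⟨?_, ?_⟩ _ _ ?_
    · intro i j hij
      have h : R.box (A + i) = R.box (A + j) := congrArg Subtype.val hij
      rw [← R.ribbonIndex_box d A i, ← R.ribbonIndex_box d A j, h]
    · intro p
      obtain ⟨i, hi⟩ := exists_index_of_mem_segment hB p.2
      exact ⟨i, Subtype.ext hi.symm⟩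
    · intro i
      rw [RibbonSeq.entry_box]

end InfiniteRibbon

/-! ### The strands of a skew shape -/

open Classical in
/-- The position of a cell relative to `lam / mu`: `0` on the side of `mu`, `1` in `lam / mu`, and `2`
outside of `lam`. -/
noncomputable def zone (lam mu : YoungDiagram) (p : ℤ × ℤ) : ℕ :=
  if p.1 < 0 ∨ p.2 < 0 ∨ (p.1.toNat, p.2.toNat) ∈ mu then 0
  else if (p.1.toNat, p.2.toNat) ∈ lam then 1 else 2

theorem zone_le_two (lam mu : YoungDiagram) (p : ℤ × ℤ) : zone lam mu p ≤ 2 := by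
  unfold zone; split_ifs <;> omega

/-- Young diagrams are closed under moving up and to the left. All monotonicity requirements on
`Strands.typ` are instances of this. -/
theorem zone_mono (lam mu : YoungDiagram) {p q : ℤ × ℤ} (h1 : p.1 ≤ q.1) (h2 : p.2 ≤ q.2) :
    zone lam mu p ≤ zone lam mu q := by
  have key : ∀ ν : YoungDiagram, (q.1.toNat, q.2.toNat) ∈ ν → (p.1.toNat, p.2.toNat) ∈ ν :=
    fun ν h => ν.up_left_mem (Int.toNat_le_toNat h1) (Int.toNat_le_toNat h2) h
  unfold zone
  by_cases hq : q.1 < 0 ∨ q.2 < 0 ∨ (q.1.toNat, q.2.toNat) ∈ mu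
  · have hp : p.1 < 0 ∨ p.2 < 0 ∨ (p.1.toNat, p.2.toNat) ∈ mu := by
      rcases hq with h | h | h
      · left; omega
      · right; left; omega
      · exact Or.inr (Or.inr (key mu h))
    rw [if_pos hq, if_pos hp]
  · rw [if_neg hq]
    by_cases hl : (q.1.toNat, q.2.toNat) ∈ lam
    · rw [if_pos hl, if_pos (key lam hl)]
      split_ifs <;> omega
    · rw [if_neg hl]
      split_ifs <;> omega

theorem zone_eq_one_iff (lam mu : YoungDiagram) (p : ℤ × ℤ) :
    zone lam mu p = 1 ↔ p ∈ skewCells lam mu := by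
  unfold zone skewCells
  rw [Finset.mem_image]
  constructor
  · intro h
    split_ifs at h with h1 h2
    swap
    · omega
    push Not at h1
    refine ⟨(p.1.toNat, p.2.toNat), ?_, Prod.ext (Int.toNat_of_nonneg h1.1)
      (Int.toNat_of_nonneg h1.2.1)⟩
    rw [Finset.mem_sdiff, YoungDiagram.mem_cells, YoungDiagram.mem_cells]
    exact ⟨h2, h1.2.2⟩
  · rintro ⟨q, hq, rfl⟩
    rw [Finset.mem_sdiff, YoungDiagram.mem_cells, YoungDiagram.mem_cells] at hq
    simp only [Int.toNat_natCast]
    rw [if_neg, if_pos hq.1]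
    rintro (h | h | h)
    · omega
    · omega
    · exact hq.2 h

namespace InfiniteRibbon

variable (R : InfiniteRibbon) (D : Finset (ℤ × ℤ))

theorem copyIndex_box_add (c k : ℤ) : R.copyIndex (R.box c + (k, k)) = k := by
  have h := R.content c
  unfold copyIndex
  simp only [Prod.fst_add, Prod.snd_add]
  rw [show (R.box c).2 + k - ((R.box c).1 + k) = c by omega]
  omega

theorem box_add_copyIndex (p : ℤ × ℤ) :
    R.box (p.2 - p.1) + (R.copyIndex p, R.copyIndex p) = p := by
  have h := R.content (p.2 - p.1)
  unfold copyIndex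
  refine Prod.ext ?_ ?_ <;> simp only [Prod.fst_add, Prod.snd_add] <;> omega

theorem mem_ribbonContents (k : Fin (R.numRibbons D)) (c : ℤ) :
    c ∈ R.ribbonContents D k ↔ R.box c + (R.copyOf D k, R.copyOf D k) ∈ D := by
  unfold ribbonContents
  simp only [Finset.mem_image, Finset.mem_filter]
  constructor
  · rintro ⟨p, ⟨h1, h2⟩, rfl⟩
    rw [← h2, R.box_add_copyIndex]; exact h1
  · intro h
    refine ⟨_, ⟨h, R.copyIndex_box_add _ _⟩, ?_⟩
    have := R.content c
    simp only [Prod.fst_add, Prod.snd_add]; omega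

/-- Compatibility fills the interval between the smallest and the largest content. -/
theorem mem_ribbon_iff (hD : R.Compatible D) (k : Fin (R.numRibbons D)) (c : ℤ) :
    R.box c + (R.copyOf D k, R.copyOf D k) ∈ D ↔ R.endingTuple D k ≤ c ∧ c < R.startingTuple D k := by
  rw [← mem_ribbonContents]
  constructor
  · intro h
    exact ⟨Finset.min'_le _ _ h, Int.lt_add_one_of_le (Finset.le_max' _ _ h)⟩
  · rintro ⟨h1, h2⟩
    have e1 := (R.mem_ribbonContents D k _).1 (Finset.min'_mem _ (R.ribbonContents_nonempty D k))
    have e2 := (R.mem_ribbonContents D k _).1 (Finset.max'_mem _ (R.ribbonContents_nonempty D k))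
    exact (R.mem_ribbonContents D k c).2 ((hD (R.copyOf D k)).out e1 e2
      ⟨h1, Int.le_of_lt_add_one h2⟩)

theorem endingTuple_lt_startingTuple (k : Fin (R.numRibbons D)) :
    R.endingTuple D k < R.startingTuple D k :=
  Int.lt_add_one_of_le (Finset.min'_le_max' _ _)

theorem copyOf_strictMono : StrictMono (R.copyOf D) :=
  ((R.copies D).orderEmbOfFin rfl).strictMono

variable {D}

/-- The strands of the skew shape `lam / mu`, where the column `m` belongs to the content `c₀ + m`. -/
noncomputable def strands (lam mu : YoungDiagram) (hcomp : R.Compatible (skewCells lam mu)) (c₀ : ℤ)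
    (L N : ℕ) (h₀ : ∀ k, c₀ < R.endingTuple (skewCells lam mu) k)
    (hL : ∀ k, R.startingTuple (skewCells lam mu) k ≤ c₀ + L) : Strands where
  n := R.numRibbons (skewCells lam mu)
  L := L
  N := N
  a k := (R.endingTuple (skewCells lam mu) k - c₀).toNat
  b k := (R.startingTuple (skewCells lam mu) k - c₀).toNat
  up m := R.stepUp (c₀ + m)
  typ m k := zone lam mu (R.box (c₀ + m) +
    (R.copyOf (skewCells lam mu) k, R.copyOf (skewCells lam mu) k))
  a_pos k := by have := h₀ k; omega
  a_lt k := by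
    have := h₀ k
    have := R.endingTuple_lt_startingTuple (skewCells lam mu) k
    omega
  b_le k := by have := hL k; omega
  typ_le _ _ := zone_le_two _ _ _
  active m k := by
    have := h₀ k
    have := R.endingTuple_lt_startingTuple (skewCells lam mu) k
    rw [zone_eq_one_iff, R.mem_ribbon_iff _ hcomp]
    omega
  right_le m h k := by
    rw [Nat.cast_add, Nat.cast_one, ← add_assoc, R.box_succ_right h]
    refine zone_mono _ _ ?_ ?_ <;> simp only [Prod.fst_add, Prod.snd_add] <;> omega
  -- A later strand lies on a copy shifted by at least `(1, 1)`, which outweighs the step to the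
  -- right.
  right_lt m h k k' hk := by
    have := R.copyOf_strictMono (skewCells lam mu) hk
    rw [Nat.cast_add, Nat.cast_one, ← add_assoc, R.box_succ_right h]
    refine zone_mono _ _ ?_ ?_ <;> simp only [Prod.fst_add, Prod.snd_add] <;> omega
  up_le m h k := by
    rw [Nat.cast_add, Nat.cast_one, ← add_assoc, R.box_succ_up h]
    refine zone_mono _ _ ?_ ?_ <;> simp only [Prod.fst_add, Prod.snd_add] <;> omega
  up_lt m h k k' hk := by
    have := R.copyOf_strictMono (skewCells lam mu) hk
    rw [Nat.cast_add, Nat.cast_one, ← add_assoc, R.box_succ_up h]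
    refine zone_mono _ _ ?_ ?_ <;> simp only [Prod.fst_add, Prod.snd_add] <;> omega

end InfiniteRibbon

/-! ### Positions in the shuffle diagram. -/

namespace InfiniteRibbon

variable (R : InfiniteRibbon)

/-- For `k = 2m` and `k = 2m + 1` the placement of the red and of the blue cells becomes one
formula, so that the ribbon number `k` replaces the distinction of colours. -/
theorem mem_shuffleShape {n : ℕ} {a b : Fin n → ℤ} {p : ℤ × ℤ} :
    p ∈ R.shuffleShape a b ↔ ∃ k c, a k ≤ c ∧ c < b k ∧ p = R.shufflePos k c := by
  simp only [shuffleShape, shuffleDiagram, shape, Finset.mem_union, Finset.mem_image,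
    Finset.mem_biUnion, Finset.mem_univ, true_and, Finset.mem_Ico]
  constructor
  · rintro (⟨q, ⟨m, c, ⟨h1, h2⟩, rfl⟩, rfl⟩ | ⟨q, ⟨m, c, ⟨h1, h2⟩, rfl⟩, rfl⟩)
    · refine ⟨⟨2 * m.val, by omega⟩, c, h1, h2, ?_⟩
      simp only [shufflePos]
      refine Prod.ext ?_ ?_ <;> simp only [Prod.fst_add, Prod.snd_add] <;> push_cast <;> ring
    · refine ⟨⟨2 * m.val + 1, by omega⟩, c, h1, h2, ?_⟩
      simp only [shufflePos]
      refine Prod.ext ?_ ?_ <;> simp only [Prod.fst_add, Prod.snd_add] <;> push_cast <;> ring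
  · rintro ⟨⟨k, hk⟩, c, h1, h2, rfl⟩
    rcases Nat.even_or_odd' k with ⟨m, hm | hm⟩
    · subst hm
      refine Or.inl ⟨R.box c + ((m : ℤ), (m : ℤ)), ⟨⟨m, by omega⟩, c, ⟨h1, h2⟩, rfl⟩, ?_⟩
      simp only [shufflePos]
      refine Prod.ext ?_ ?_ <;> simp only [Prod.fst_add, Prod.snd_add] <;> push_cast <;> ring
    · subst hm
      refine Or.inr ⟨R.box c + ((m : ℤ), (m : ℤ)), ⟨⟨m, by omega⟩, c, ⟨h1, h2⟩, rfl⟩, ?_⟩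
      simp only [shufflePos]
      refine Prod.ext ?_ ?_ <;> simp only [Prod.fst_add, Prod.snd_add] <;> push_cast <;> ring

theorem shufflePos_inj {k k' : ℕ} {c c' : ℤ} (h : R.shufflePos k c = R.shufflePos k' c') :
    k = k' ∧ c = c' := by
  have h1 := R.content c
  have h2 := R.content c'
  simp only [shufflePos, Prod.mk.injEq] at h
  obtain rfl : c = c' := by omega
  exact ⟨by omega, rfl⟩

end InfiniteRibbon

namespace Strands

variable {S : Strands} {R : InfiniteRibbon} {c₀ : ℤ}

variable (S R c₀) in
/-- The columns of `S` are the contents of `R`, starting with `c₀`. -/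
def OnRibbon : Prop := ∀ m, S.up m = R.stepUp (c₀ + m)

variable (S c₀) in
/-- The contents of the first boxes of the ribbons. -/
def firstContent (k : Fin S.n) : ℤ := c₀ + S.a k

variable (S c₀) in
/-- The contents after the last boxes of the ribbons. -/
def lastContent (k : Fin S.n) : ℤ := c₀ + S.b k

variable (S R c₀) in
/-- The shuffle diagram of the strands. -/
noncomputable abbrev cells : Finset (ℤ × ℤ) := R.shuffleShape (S.firstContent c₀) (S.lastContent c₀)

variable (S R c₀) in
/-- The position of the strand `k` in the column `m`. -/
def cellPos (m : ℕ) (k : Fin S.n) : ℤ × ℤ := R.shufflePos k (c₀ + m)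

theorem cellPos_inj {m m' : ℕ} {k k' : Fin S.n} (h : S.cellPos R c₀ m k = S.cellPos R c₀ m' k') :
    m = m' ∧ k = k' := by
  obtain ⟨h1, h2⟩ := R.shufflePos_inj h
  exact ⟨by omega, Fin.ext h1⟩

theorem cellPos_mem {m : ℕ} {k : Fin S.n} : S.cellPos R c₀ m k ∈ S.cells R c₀ ↔ S.typ m k = 1 := by
  rw [R.mem_shuffleShape, S.active]
  constructor
  · rintro ⟨k', c, h1, h2, h3⟩
    obtain ⟨h4, h5⟩ := R.shufflePos_inj h3
    obtain rfl := Fin.ext h4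
    unfold firstContent at h1
    unfold lastContent at h2
    omega
  · rintro ⟨h1, h2⟩
    refine ⟨k, c₀ + m, ?_, ?_, rfl⟩
    · unfold firstContent; omega
    · unfold lastContent; omega

theorem exists_cellPos {p : ℤ × ℤ} (hp : p ∈ S.cells R c₀) :
    ∃ m k, m < S.L ∧ S.typ m k = 1 ∧ p = S.cellPos R c₀ m k := by
  obtain ⟨k, c, h1, h2, rfl⟩ := R.mem_shuffleShape.1 hp
  unfold firstContent at h1
  unfold lastContent at h2
  have h3 := S.b_le k
  have e : c = c₀ + ((c - c₀).toNat : ℤ) := by omega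
  refine ⟨(c - c₀).toNat, k, by omega, (S.active _ _).2 ⟨by omega, by omega⟩, ?_⟩
  unfold cellPos
  rw [← e]

theorem lt_of_active {m : ℕ} {k : Fin S.n} (h : S.typ m k = 1) : m < S.L :=
  ((S.active m k).1 h).2.trans_le (S.b_le k)

theorem cellPos_succ_up (hR : S.OnRibbon R c₀) {m : ℕ} (h : S.up m = true) (k : Fin S.n) :
    S.cellPos R c₀ (m + 1) k = S.cellPos R c₀ m k + (-2, 0) := by
  rw [hR] at h
  unfold cellPos InfiniteRibbon.shufflePos
  rw [Nat.cast_add, Nat.cast_one, ← add_assoc, R.box_succ_up h]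
  refine Prod.ext ?_ ?_ <;> simp only [Prod.fst_add, Prod.snd_add] <;> omega

theorem cellPos_succ_right (hR : S.OnRibbon R c₀) {m : ℕ} (h : S.up m = false) (k : Fin S.n) :
    S.cellPos R c₀ (m + 1) k = S.cellPos R c₀ m k + (0, 2) := by
  rw [hR] at h
  unfold cellPos InfiniteRibbon.shufflePos
  rw [Nat.cast_add, Nat.cast_one, ← add_assoc, R.box_succ_right h]
  refine Prod.ext ?_ ?_ <;> simp only [Prod.fst_add, Prod.snd_add] <;> omega

theorem cellPos_of_val {m : ℕ} {k k' : Fin S.n} {d : ℕ} (h : k'.1 = k.1 + d) :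
    S.cellPos R c₀ m k' = S.cellPos R c₀ m k + ((d : ℤ), (d : ℤ)) := by
  unfold cellPos InfiniteRibbon.shufflePos
  rw [h]
  refine Prod.ext ?_ ?_ <;> simp only [Prod.fst_add, Prod.snd_add] <;> push_cast <;> ring

theorem cellPos_content (m : ℕ) (k : Fin S.n) :
    (S.cellPos R c₀ m k).2 - (S.cellPos R c₀ m k).1 = 2 * (c₀ + m) := by
  have := R.content (c₀ + m)
  unfold cellPos InfiniteRibbon.shufflePos
  simp only; omega

theorem cellPos_same {m : ℕ} {k k' : Fin S.n}
    (h : (S.cellPos R c₀ m k).1 = (S.cellPos R c₀ m k').1) : k = k' := by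
  simp only [cellPos, InfiniteRibbon.shufflePos] at h
  exact Fin.ext (by omega)

/-- Functions that increase along neighbouring cells of a row increase along the row. -/
theorem row_induction (hR : S.OnRibbon R c₀) {g : ℕ → Fin S.n → ℕ} {Q : ℕ → Fin S.n → Prop}
    (h1 : ∀ m k, S.up m = false → Q m k → Q (m + 1) k → g m k ≤ g (m + 1) k)
    (h2 : ∀ m k k', k.1 + 2 = k'.1 → S.up m = true → Q m k → Q (m + 1) k' → g m k ≤ g (m + 1) k')
    {d : ℕ} : ∀ {m : ℕ} {k k' : Fin S.n},
    (S.cellPos R c₀ m k).1 = (S.cellPos R c₀ (m + d) k').1 →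
    (∀ m' j, m ≤ m' → m' ≤ m + d → (S.cellPos R c₀ m k).1 = (S.cellPos R c₀ m' j).1 → Q m' j) →
    g m k ≤ g (m + d) k' := by
  induction d with
  | zero => intro m k k' he _; rw [cellPos_same he]; exact le_rfl
  | succ d ih =>
    intro m k k' he hQ
    have h0 := hQ m k le_rfl (by omega) rfl
    have e' : m + (d + 1) = m + 1 + d := by omega
    rw [e'] at he ⊢
    cases hu : S.up m
    · have e := cellPos_succ_right hR hu k
      have e1 : (S.cellPos R c₀ (m + 1) k).1 = (S.cellPos R c₀ m k).1 := by rw [e]; simp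
      refine (h1 m k hu h0 (hQ _ _ (by omega) (by omega) e1.symm)).trans
        (ih (e1.trans he) fun m' j hm hm' hj => hQ m' j (by omega) (by omega) (e1.symm.trans hj))
    · have e := cellPos_succ_up hR hu k
      have hlt : k.1 + 2 ≤ k'.1 := by
        have h3 := (R.box_mono (show c₀ + ((m + 1 : ℕ) : ℤ) ≤ c₀ + ((m + 1 + d : ℕ) : ℤ) by
          push_cast; omega)).1
        have h4 := congrArg Prod.fst e
        simp only [cellPos, InfiniteRibbon.shufflePos, Prod.fst_add] at he h4
        omega
      have hk' := k'.2
      -- After a step up, the strand two further on is back in the row that was left.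
      set j : Fin S.n := ⟨k.1 + 2, by omega⟩ with hj
      have e1 : (S.cellPos R c₀ (m + 1) j).1 = (S.cellPos R c₀ m k).1 := by
        rw [cellPos_of_val (k := k) (d := 2) rfl, e]; simp
      refine (h2 m k j rfl hu h0 (hQ _ _ (by omega) (by omega) e1.symm)).trans
        (ih (e1.trans he) fun m' j hm hm' hj => hQ m' j (by omega) (by omega) (e1.symm.trans hj))

theorem cellPos_same_col {m : ℕ} {k k' : Fin S.n}
    (h : (S.cellPos R c₀ m k).2 = (S.cellPos R c₀ m k').2) : k = k' := by
  simp only [cellPos, InfiniteRibbon.shufflePos] at h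
  exact Fin.ext (by omega)

/-- Functions that increase along neighbouring cells of a column increase along the column. -/
theorem col_induction (hR : S.OnRibbon R c₀) {g : ℕ → Fin S.n → ℕ} {Q : ℕ → Fin S.n → Prop}
    (h1 : ∀ m k, S.up m = true → Q m k → Q (m + 1) k → g (m + 1) k ≤ g m k)
    (h2 : ∀ m k k', k.1 + 2 = k'.1 → S.up m = false → Q m k' → Q (m + 1) k → g (m + 1) k ≤ g m k')
    {d : ℕ} : ∀ {m : ℕ} {k k' : Fin S.n},
    (S.cellPos R c₀ (m + d) k').2 = (S.cellPos R c₀ m k).2 →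
    (∀ m' j, m ≤ m' → m' ≤ m + d → (S.cellPos R c₀ m' j).2 = (S.cellPos R c₀ m k).2 → Q m' j) →
    g (m + d) k' ≤ g m k := by
  induction d with
  | zero => intro m k k' he _; rw [cellPos_same_col he]; exact le_rfl
  | succ d ih =>
    intro m k k' he hQ
    have h0 := hQ m k le_rfl (by omega) rfl
    have e' : m + (d + 1) = m + 1 + d := by omega
    rw [e'] at he ⊢
    cases hu : S.up m
    · have e := cellPos_succ_right hR hu k
      have hlt : k'.1 + 2 ≤ k.1 := by
        have h3 := (R.box_mono (show c₀ + ((m + 1 : ℕ) : ℤ) ≤ c₀ + ((m + 1 + d : ℕ) : ℤ) by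
          push_cast; omega)).2
        have h4 := congrArg Prod.snd e
        simp only [cellPos, InfiniteRibbon.shufflePos, Prod.snd_add] at he h4
        omega
      have hk := k.2
      set j : Fin S.n := ⟨k.1 - 2, by omega⟩ with hj
      have hjk : j.1 + 2 = k.1 := by simp only [hj]; omega
      have e1 : (S.cellPos R c₀ (m + 1) j).2 = (S.cellPos R c₀ m k).2 := by
        have e2 := congrArg Prod.snd e
        rw [cellPos_of_val (k := j) (k' := k) (m := m + 1) (d := 2) hjk.symm] at e2
        simp only [Prod.snd_add] at e2
        push_cast at e2
        omega
      exact (ih (he.trans e1.symm)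
        fun m' j' hm hm' hj' => hQ m' j' (by omega) (by omega) (hj'.trans e1)).trans
        (h2 m j k hjk hu h0 (hQ _ _ (by omega) (by omega) e1))
    · have e := cellPos_succ_up hR hu k
      have e1 : (S.cellPos R c₀ (m + 1) k).2 = (S.cellPos R c₀ m k).2 := by rw [e]; simp
      exact (ih (he.trans e1.symm)
        fun m' j' hm hm' hj' => hQ m' j' (by omega) (by omega) (hj'.trans e1)).trans
        (h1 m k hu h0 (hQ _ _ (by omega) (by omega) e1))

theorem typ_row (hR : S.OnRibbon R c₀) {m d : ℕ} {k k' : Fin S.n}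
    (h : (S.cellPos R c₀ m k).1 = (S.cellPos R c₀ (m + d) k').1) :
    S.typ m k ≤ S.typ (m + d) k' :=
  row_induction hR (Q := fun _ _ => True) (fun m k hu _ _ => S.right_le m hu k)
    (fun m k k' hk hu _ _ => S.up_lt m hu k k' (Fin.lt_def.2 (by omega))) h fun _ _ _ _ _ => trivial

theorem typ_col (hR : S.OnRibbon R c₀) {m d : ℕ} {k k' : Fin S.n}
    (h : (S.cellPos R c₀ (m + d) k').2 = (S.cellPos R c₀ m k).2) :
    S.typ (m + d) k' ≤ S.typ m k :=
  col_induction hR (Q := fun _ _ => True) (fun m k hu _ _ => S.up_le m hu k)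
    (fun m k k' hk hu _ _ => S.right_lt m hu k k' (Fin.lt_def.2 (by omega))) h
    fun _ _ _ _ _ => trivial

/-- The cells between two cells of a row belong to the diagram. -/
theorem active_row (hR : S.OnRibbon R c₀) {m d : ℕ} {k k' : Fin S.n} (hk : S.typ m k = 1)
    (hk' : S.typ (m + d) k' = 1) (h : (S.cellPos R c₀ m k).1 = (S.cellPos R c₀ (m + d) k').1)
    (m' : ℕ) (j : Fin S.n) (h1 : m ≤ m') (h2 : m' ≤ m + d)
    (h3 : (S.cellPos R c₀ m k).1 = (S.cellPos R c₀ m' j).1) : S.typ m' j = 1 := by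
  obtain ⟨d1, rfl⟩ : ∃ d1, m' = m + d1 := ⟨m' - m, by omega⟩
  obtain ⟨d2, rfl⟩ : ∃ d2, d = d1 + d2 := ⟨d - d1, by omega⟩
  rw [← add_assoc] at h hk'
  have e1 := typ_row hR h3
  have e2 := typ_row hR (h3.symm.trans h)
  omega

theorem active_col (hR : S.OnRibbon R c₀) {m d : ℕ} {k k' : Fin S.n} (hk : S.typ m k = 1)
    (hk' : S.typ (m + d) k' = 1) (h : (S.cellPos R c₀ (m + d) k').2 = (S.cellPos R c₀ m k).2)
    (m' : ℕ) (j : Fin S.n) (h1 : m ≤ m') (h2 : m' ≤ m + d)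
    (h3 : (S.cellPos R c₀ m' j).2 = (S.cellPos R c₀ m k).2) : S.typ m' j = 1 := by
  obtain ⟨d1, rfl⟩ : ∃ d1, m' = m + d1 := ⟨m' - m, by omega⟩
  obtain ⟨d2, rfl⟩ : ∃ d2, d = d1 + d2 := ⟨d - d1, by omega⟩
  rw [← add_assoc] at h hk'
  have e1 := typ_col hR h3
  have e2 := typ_col hR (h.trans h3.symm)
  omega

end Strands

namespace Strands

variable {S : Strands} {R : InfiniteRibbon} {c₀ : ℤ}

/-! ### Chains and shuffle tableaux -/

/-- The entry of the strand `k` in the column `m`. -/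
def ent (V : Fin (S.L + 1) → Fin S.n → S.Val) (m : ℕ) (k : Fin S.n) : ℕ :=
  (V (Fin.ofNat (S.L + 1) m) k).1 - S.base m

theorem ofNat_castSucc (m : Fin S.L) : Fin.ofNat (S.L + 1) m.1 = m.castSucc :=
  Fin.ext (Nat.mod_eq_of_lt (by omega))

theorem ofNat_succ (m : Fin S.L) : Fin.ofNat (S.L + 1) (m.1 + 1) = m.succ :=
  Fin.ext (Nat.mod_eq_of_lt (by omega))

theorem ofNat_coe (m : Fin (S.L + 1)) : Fin.ofNat (S.L + 1) m.1 = m :=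
  Fin.ext (Nat.mod_eq_of_lt m.2)

theorem IsChain.proper {V : Fin (S.L + 1) → Fin S.n → S.Val} (hV : S.IsChain parCol parCol V)
    (m : Fin (S.L + 1)) : S.Proper m (V m) := ((isChain_parCol_iff V).1 hV).1 m

theorem IsChain.ent_spec {V : Fin (S.L + 1) → Fin S.n → S.Val} (hV : S.IsChain parCol parCol V)
    {m : ℕ} {k : Fin S.n} (hk : S.typ m k = 1) : 0 < ent V m k ∧ ent V m k ≤ S.N ∧
      (V (Fin.ofNat (S.L + 1) m) k).1 = S.base m + ent V m k := by
  have hm := lt_of_active hk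
  have h := (hV.proper (⟨m, hm⟩ : Fin S.L).castSucc k).2 fun h => h hk
  rw [← ofNat_castSucc] at h
  unfold InRange at h
  simp only [Fin.val_ofNat, Nat.mod_eq_of_lt (show m < S.L + 1 by omega)] at h
  unfold ent
  omega

theorem IsChain.gap {V : Fin (S.L + 1) → Fin S.n → S.Val} (hV : S.IsChain parCol parCol V) {m : ℕ}
    (hm : m < S.L) : ColGap parCol
      (S.lo m (V (Fin.ofNat (S.L + 1) m)) (V (Fin.ofNat (S.L + 1) (m + 1))))
      (S.hi m (V (Fin.ofNat (S.L + 1) m)) (V (Fin.ofNat (S.L + 1) (m + 1)))) := by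
  have h := hV.2 ⟨m, hm⟩
  rwa [← ofNat_castSucc, ← ofNat_succ] at h

/-- Neighbours in a row are consecutive boxes of one ribbon if the step goes to the right, and boxes
of ribbons two apart if it goes up. Both inequalities are part of `ColGap`, and in the second case
the growth of `base` turns a strict inequality of values into a weak one of entries. -/
theorem IsChain.ent_row {V : Fin (S.L + 1) → Fin S.n → S.Val} (hV : S.IsChain parCol parCol V)
    (hR : S.OnRibbon R c₀) {m d : ℕ} {k k' : Fin S.n} (hk : S.typ m k = 1)
    (hk' : S.typ (m + d) k' = 1) (h : (S.cellPos R c₀ m k).1 = (S.cellPos R c₀ (m + d) k').1) :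
    ent V m k ≤ ent V (m + d) k' := by
  refine row_induction hR (Q := fun m k => S.typ m k = 1) (fun m k hu h1 h2 => ?_)
    (fun m k k' hkk hu h1 h2 => ?_) h (active_row hR hk hk' h)
  · have e1 := (hV.ent_spec h1).2.2
    have e2 := (hV.ent_spec h2).2.2
    have g := (hV.gap (lt_of_active h1)).1 k
    have hb := S.base_succ m
    simp only [lo, hi, hu, Bool.false_eq_true, if_false] at g hb
    rw [Fin.le_def] at g
    omega
  · have e1 := (hV.ent_spec h1).2.2
    have e2 := (hV.ent_spec h2).2.2
    have g := (hV.gap (lt_of_active h1)).2 k k' (Fin.lt_def.2 (by omega)) (by simp [parCol, ← hkk])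
    have hb := S.base_succ m
    simp only [lo, hi, hu, if_true] at g hb
    rw [Fin.lt_def] at g
    omega

/-- Each single step in a column is strict, so the number `d` of steps may be added. In this form
the claim is a weak inequality for the entry plus the column number, as required by `col_induction`.
-/
theorem IsChain.ent_col {V : Fin (S.L + 1) → Fin S.n → S.Val} (hV : S.IsChain parCol parCol V)
    (hR : S.OnRibbon R c₀) {m d : ℕ} {k k' : Fin S.n} (hk : S.typ m k = 1)
    (hk' : S.typ (m + d) k' = 1) (h : (S.cellPos R c₀ (m + d) k').2 = (S.cellPos R c₀ m k).2) :
    ent V (m + d) k' + d ≤ ent V m k := by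
  have key := col_induction hR (g := fun m k => ent V m k + m) (Q := fun m k => S.typ m k = 1)
    (fun m k hu h1 h2 => ?_) (fun m k k' hkk hu h1 h2 => ?_) h (active_col hR hk hk' h)
  · omega
  · have e1 := (hV.ent_spec h1).2.2
    have e2 := (hV.ent_spec h2).2.2
    have g := (hV.gap (lt_of_active h1)).1 k
    have hb := S.base_succ m
    simp only [lo, hi, hu, if_true] at g hb
    rw [Fin.le_def] at g
    omega
  · have e1 := (hV.ent_spec h1).2.2
    have e2 := (hV.ent_spec h2).2.2
    have g := (hV.gap (lt_of_active h1)).2 k k' (Fin.lt_def.2 (by omega)) (by simp [parCol, ← hkk])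
    have hb := S.base_succ m
    simp only [lo, hi, hu, Bool.false_eq_true, if_false] at g hb
    rw [Fin.lt_def] at g
    omega

variable (R c₀) in
/-- The entry of a chain at a cell of the shuffle diagram. -/
noncomputable def cellEnt (V : Fin (S.L + 1) → Fin S.n → S.Val) (p : ℤ × ℤ) : ℕ :=
  extend (V (Fin.ofNat (S.L + 1) ((p.2 - p.1) / 2 - c₀).toNat))
    (p.1 + 1 - 2 * (R.box ((p.2 - p.1) / 2)).1).toNat - S.base ((p.2 - p.1) / 2 - c₀).toNat

theorem cellEnt_cellPos (V : Fin (S.L + 1) → Fin S.n → S.Val) (m : ℕ) (k : Fin S.n) :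
    cellEnt R c₀ V (S.cellPos R c₀ m k) = ent V m k := by
  have h := cellPos_content (S := S) (R := R) (c₀ := c₀) m k
  have h1 : ((S.cellPos R c₀ m k).2 - (S.cellPos R c₀ m k).1) / 2 = c₀ + m := by omega
  have h2 : (S.cellPos R c₀ m k).1 + 1 - 2 * (R.box (c₀ + m)).1 = k.1 := by
    simp only [cellPos, InfiniteRibbon.shufflePos]; omega
  unfold cellEnt ent
  rw [h1, h2, show (c₀ + (m : ℤ) - c₀).toNat = m by omega, Int.toNat_natCast, extend_coe]

/-- The shuffle tableau of a chain. -/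
noncomputable def IsChain.tableau {V : Fin (S.L + 1) → Fin S.n → S.Val}
    (hV : S.IsChain parCol parCol V) (hR : S.OnRibbon R c₀) : Tableau (S.cells R c₀) where
  entry p := (cellEnt R c₀ V p).toPNat'
  row_weak := by
    rintro ⟨p, hp⟩ ⟨q, hq⟩ h1 h2
    obtain ⟨m, k, -, hk, rfl⟩ := exists_cellPos hp
    obtain ⟨m', k', -, hk', rfl⟩ := exists_cellPos hq
    have e1 := cellPos_content (S := S) (R := R) (c₀ := c₀) m k
    have e2 := cellPos_content (S := S) (R := R) (c₀ := c₀) m' k'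
    simp only at h1 h2
    obtain ⟨d, rfl⟩ : ∃ d, m' = m + d := ⟨m' - m, by omega⟩
    rw [← PNat.coe_le_coe, cellEnt_cellPos, cellEnt_cellPos,
      Nat.toPNat'_coe, Nat.toPNat'_coe, if_pos (hV.ent_spec hk).1, if_pos (hV.ent_spec hk').1]
    exact hV.ent_row hR hk hk' h1
  col_strict := by
    rintro ⟨p, hp⟩ ⟨q, hq⟩ h1 h2
    obtain ⟨m, k, -, hk, rfl⟩ := exists_cellPos hp
    obtain ⟨m', k', -, hk', rfl⟩ := exists_cellPos hq
    have e1 := cellPos_content (S := S) (R := R) (c₀ := c₀) m k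
    have e2 := cellPos_content (S := S) (R := R) (c₀ := c₀) m' k'
    simp only at h1 h2
    obtain ⟨d, rfl⟩ : ∃ d, m = m' + d := ⟨m - m', by omega⟩
    rw [← PNat.coe_lt_coe, cellEnt_cellPos, cellEnt_cellPos,
      Nat.toPNat'_coe, Nat.toPNat'_coe, if_pos (hV.ent_spec hk).1, if_pos (hV.ent_spec hk').1]
    have := hV.ent_col hR hk' hk h1
    have hd : d ≠ 0 := by rintro rfl; omega
    omega

theorem IsChain.tableau_entry {V : Fin (S.L + 1) → Fin S.n → S.Val}
    (hV : S.IsChain parCol parCol V) (hR : S.OnRibbon R c₀) {m : ℕ} {k : Fin S.n}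
    (hk : S.typ m k = 1) :
    (((hV.tableau hR).entry ⟨S.cellPos R c₀ m k, cellPos_mem.2 hk⟩ : ℕ+) : ℕ) = ent V m k := by
  simp only [tableau]
  rw [cellEnt_cellPos, Nat.toPNat'_coe, if_pos (hV.ent_spec hk).1]

theorem IsChain.tableau_injective {V W : Fin (S.L + 1) → Fin S.n → S.Val}
    (hV : S.IsChain parCol parCol V) (hW : S.IsChain parCol parCol W) (hR : S.OnRibbon R c₀)
    (h : hV.tableau hR = hW.tableau hR) : V = W := by
  funext m k
  by_cases hk : S.Idle m k
  · rw [(hV.proper m k).1 hk, (hW.proper m k).1 hk]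
  · have hk := not_not.1 hk
    have e := hV.tableau_entry hR hk
    rw [h, hW.tableau_entry hR hk] at e
    have e1 := (hV.ent_spec hk).2.2
    have e2 := (hW.ent_spec hk).2.2
    rw [ofNat_coe] at e1 e2
    exact Fin.ext (by omega)

/-- The chain of a shuffle tableau with entries up to `N`. -/
noncomputable def chainOf (T : Tableau (S.cells R c₀)) (hT : ∀ p, (T.entry p : ℕ) ≤ S.N)
    (m : Fin (S.L + 1)) (k : Fin S.n) : S.Val :=
  if h : S.typ m k = 1 then S.entryVal (Nat.lt_succ_iff.1 m.2)
    ⟨T.entry ⟨S.cellPos R c₀ m k, cellPos_mem.2 h⟩ - 1, by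
      have := hT ⟨S.cellPos R c₀ m k, cellPos_mem.2 h⟩
      have := (T.entry ⟨S.cellPos R c₀ m k, cellPos_mem.2 h⟩).pos
      omega⟩
  else S.idleVal m k

theorem chainOf_val (T : Tableau (S.cells R c₀)) (hT : ∀ p, (T.entry p : ℕ) ≤ S.N)
    {m : Fin (S.L + 1)} {k : Fin S.n} (h : S.typ m k = 1) : (chainOf T hT m k).1 =
      S.base m + T.entry ⟨S.cellPos R c₀ m k, cellPos_mem.2 h⟩ := by
  have := (T.entry ⟨S.cellPos R c₀ m k, cellPos_mem.2 h⟩).pos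
  rw [chainOf, dif_pos h]
  simp only [entryVal]
  omega

/-- By `isChain_parCol_iff` only inequalities between active strands remain, and each of them
compares two cells at distance two in a row or a column of the shuffle diagram. -/
theorem isChain_chainOf (hR : S.OnRibbon R c₀) (T : Tableau (S.cells R c₀))
    (hT : ∀ p, (T.entry p : ℕ) ≤ S.N) : S.IsChain parCol parCol (chainOf T hT) := by
  refine (isChain_parCol_iff _).2 ⟨fun m k => ⟨fun h => by rw [chainOf, dif_neg h], fun h => ?_⟩,
    fun m => ?_⟩
  · rw [chainOf, dif_pos (not_not.1 h)]; exact S.inRange_entryVal _ _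
  · have hb := S.base_succ m
    have row : ∀ {m m' : ℕ} {k k' : Fin S.n} (h : S.typ m k = 1) (h' : S.typ m' k' = 1),
        S.cellPos R c₀ m' k' = S.cellPos R c₀ m k + (0, 2) →
        (T.entry ⟨S.cellPos R c₀ m k, cellPos_mem.2 h⟩ : ℕ) ≤
          T.entry ⟨S.cellPos R c₀ m' k', cellPos_mem.2 h'⟩ := by
      intro m m' k k' h h' e
      refine PNat.coe_le_coe _ _ |>.2 (T.row_weak _ _ ?_ ?_)
      · show (S.cellPos R c₀ m k).1 = (S.cellPos R c₀ m' k').1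
        rw [e]; simp
      · show (S.cellPos R c₀ m k).2 < (S.cellPos R c₀ m' k').2
        rw [e]; simp
    have col : ∀ {m m' : ℕ} {k k' : Fin S.n} (h : S.typ m k = 1) (h' : S.typ m' k' = 1),
        S.cellPos R c₀ m' k' = S.cellPos R c₀ m k + (-2, 0) →
        (T.entry ⟨S.cellPos R c₀ m' k', cellPos_mem.2 h'⟩ : ℕ) <
          T.entry ⟨S.cellPos R c₀ m k, cellPos_mem.2 h⟩ := by
      intro m m' k k' h h' e
      refine PNat.coe_lt_coe _ _ |>.2 (T.col_strict _ _ ?_ ?_)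
      · show (S.cellPos R c₀ m' k').2 = (S.cellPos R c₀ m k).2
        rw [e]; simp
      · show (S.cellPos R c₀ m' k').1 < (S.cellPos R c₀ m k).1
        rw [e]; simp
    cases hu : S.up m
    · have hu' : ¬ S.up m = true := by simp [hu]
      simp only [typHi, typLo, lo, hi, if_neg hu', add_zero] at hb ⊢
      refine ⟨fun k h1 h2 => ?_, fun k k' hk h1 h2 => ?_⟩
      · rw [Fin.le_def, chainOf_val T hT (m := m.succ) h1, chainOf_val T hT (m := m.castSucc) h2]
        have := row (m := m) (m' := m + 1) h2 h1 (cellPos_succ_right hR hu k)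
        simp only [Fin.val_succ, Fin.val_castSucc]
        omega
      · rw [Fin.lt_def, chainOf_val T hT (m := m.succ) h1, chainOf_val T hT (m := m.castSucc) h2]
        have := col (m := m) (m' := m + 1) h2 h1 (by
          rw [cellPos_succ_right hR hu k, cellPos_of_val hk.symm]
          refine Prod.ext ?_ ?_ <;> simp)
        simp only [Fin.val_succ, Fin.val_castSucc]
        omega
    · simp only [typHi, typLo, lo, hi, hu, if_true] at hb ⊢
      refine ⟨fun k h1 h2 => ?_, fun k k' hk h1 h2 => ?_⟩
      · rw [Fin.le_def, chainOf_val T hT (m := m.succ) h2, chainOf_val T hT (m := m.castSucc) h1]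
        have := col (m := m) (m' := m + 1) h1 h2 (cellPos_succ_up hR hu k)
        simp only [Fin.val_succ, Fin.val_castSucc]
        omega
      · rw [Fin.lt_def, chainOf_val T hT (m := m.succ) h2, chainOf_val T hT (m := m.castSucc) h1]
        have := row (m := m) (m' := m + 1) h1 h2 (by
          rw [cellPos_of_val hk.symm, cellPos_succ_up hR hu k]
          refine Prod.ext ?_ ?_ <;> simp)
        simp only [Fin.val_succ, Fin.val_castSucc]
        omega

theorem tableau_chainOf (hR : S.OnRibbon R c₀) (T : Tableau (S.cells R c₀))
    (hT : ∀ p, (T.entry p : ℕ) ≤ S.N) : (isChain_chainOf hR T hT).tableau hR = T := by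
  refine Tableau.ext (funext fun p => PNat.coe_inj.1 ?_)
  obtain ⟨m, k, hm, hk, hp⟩ := exists_cellPos p.2
  obtain rfl : p = ⟨S.cellPos R c₀ m k, cellPos_mem.2 hk⟩ := Subtype.ext hp
  have h1 := ((isChain_chainOf hR T hT).ent_spec hk).2.2
  have h2 := chainOf_val T hT (m := (⟨m, hm⟩ : Fin S.L).castSucc) hk
  rw [show Fin.ofNat (S.L + 1) m = (⟨m, hm⟩ : Fin S.L).castSucc from
    ofNat_castSucc (⟨m, hm⟩ : Fin S.L)] at h1
  refine ((isChain_chainOf hR T hT).tableau_entry hR hk).trans ?_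
  exact Nat.add_left_cancel (h1.symm.trans h2)

/-- Idle vertices have weight one, so the weight of a chain reduces to a product over the cells. -/
theorem IsChain.chainWt_eq {V : Fin (S.L + 1) → Fin S.n → S.Val} (hV : S.IsChain parCol parCol V)
    (hR : S.OnRibbon R c₀) : S.chainWt seriesVar V =
      ∏ p : S.cells R c₀, seriesVar ((hV.tableau hR).entry p) := by
  choose e1 e2 h1 h2 h3 using fun p : S.cells R c₀ => exists_cellPos p.2
  rw [chainWt, ← Fintype.prod_prod_type']
  symm
  refine Fintype.prod_of_injective
    (fun p => ((⟨e1 p, (h1 p).trans (Nat.lt_succ_self _)⟩ : Fin (S.L + 1)), e2 p)) ?_ _ _ ?_ ?_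
  · intro p q hpq
    simp only [Prod.mk.injEq, Fin.mk.injEq] at hpq
    refine Subtype.ext ?_
    rw [h3 p, h3 q, hpq.1, hpq.2]
  · rintro ⟨m, k⟩ hmk
    refine if_neg fun hr => hmk ?_
    have hk : S.typ m k = 1 := by
      by_contra hk
      rw [(hV.proper m k).1 hk] at hr
      exact S.not_inRange_idleVal (Nat.lt_succ_iff.1 m.2) k hr
    refine ⟨⟨_, cellPos_mem.2 hk⟩, ?_⟩
    have := cellPos_inj (h3 ⟨_, cellPos_mem.2 hk⟩)
    exact Prod.ext (Fin.ext this.1.symm) this.2.symm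
  · intro p
    have hs := hV.ent_spec (h2 p)
    have hp : p = ⟨S.cellPos R c₀ (e1 p) (e2 p), cellPos_mem.2 (h2 p)⟩ := Subtype.ext (h3 p)
    have he := hV.tableau_entry hR (h2 p)
    rw [← hp] at he
    have ho : Fin.ofNat (S.L + 1) (e1 p) = ⟨e1 p, (h1 p).trans (Nat.lt_succ_self _)⟩ :=
      Fin.ext (Nat.mod_eq_of_lt ((h1 p).trans (Nat.lt_succ_self _)))
    rw [ho] at hs
    rw [he, wt, if_pos]
    · congr 1
      simp only
      omega
    · unfold InRange
      simp only
      omega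

end Strands

namespace Strands

variable {S : Strands} {R : InfiniteRibbon} {c₀ : ℤ}

/-! ### Lines of shuffle tableaux -/

variable (S R c₀) in
/-- The place with number `k` between the columns `m` and `m + 1`. -/
def plc (m : ℕ) (k : Fin S.n) : ℤ × ℤ := R.placeAfter k (c₀ + m)

theorem plc_up (hR : S.OnRibbon R c₀) {m : ℕ} (h : S.up m = true) (k : Fin S.n) :
    S.plc R c₀ m k = S.cellPos R c₀ m k + (-1, 0) := by
  rw [hR, InfiniteRibbon.stepUp, decide_eq_true_iff] at h
  rw [plc, InfiniteRibbon.placeAfter, if_pos h]; rfl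

theorem plc_right (hR : S.OnRibbon R c₀) {m : ℕ} (h : S.up m = false) (k : Fin S.n) :
    S.plc R c₀ m k = S.cellPos R c₀ m k + (0, 1) := by
  rw [hR, InfiniteRibbon.stepUp, decide_eq_false_iff_not] at h
  rw [plc, InfiniteRibbon.placeAfter, if_neg h]; rfl

theorem placeBefore_eq_plc (hR : S.OnRibbon R c₀) (m : ℕ) (k : Fin S.n) :
    R.placeBefore k (c₀ + (m + 1 : ℕ)) = S.plc R c₀ m k := by
  have e : c₀ + ((m + 1 : ℕ) : ℤ) - 1 = c₀ + m := by push_cast; omega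
  have hm := hR m
  rw [InfiniteRibbon.stepUp] at hm
  rw [InfiniteRibbon.placeBefore, e]
  change (if _ then S.cellPos R c₀ (m + 1) k + (1, 0) else S.cellPos R c₀ (m + 1) k + (0, -1)) = _
  have e' : c₀ + ((m + 1 : ℕ) : ℤ) = c₀ + m + 1 := by push_cast; omega
  rw [e']
  cases hu : S.up m
  · rw [hu, eq_comm, decide_eq_false_iff_not] at hm
    rw [if_neg hm, cellPos_succ_right hR hu, plc_right hR hu, add_assoc]; rfl
  · rw [hu, eq_comm, decide_eq_true_iff] at hm
    rw [if_pos hm, cellPos_succ_up hR hu, plc_up hR hu, add_assoc]; rfl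

variable (S R c₀) in
/-- The cells of the strands `j` and `k = j + 1` next to the places `(x, y)` and `(x + 1, y + 1)`. -/
def PairAt (m : ℕ) (j k : Fin S.n) (x y : ℤ) : Prop :=
  j.1 + 1 = k.1 ∧ S.typHi m j = 1 ∧ S.typLo m k = 1 ∧ S.plc R c₀ m j = (x, y) ∧
    S.plc R c₀ m k = (x + 1, y + 1) ∧
    ((S.up m = false ∧ (x + 1, y) = S.cellPos R c₀ m k ∧ (x, y + 1) = S.cellPos R c₀ (m + 1) j) ∨
      (S.up m = true ∧ (x + 1, y) = S.cellPos R c₀ m j ∧ (x, y + 1) = S.cellPos R c₀ (m + 1) k))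

/-- The strands of diagonally neighbouring cells. -/
theorem neighbour_cases (hR : S.OnRibbon R c₀) {m m' : ℕ} {k k' : Fin S.n}
    (h : S.cellPos R c₀ m' k' = S.cellPos R c₀ m k + (-1, 1)) :
    m' = m + 1 ∧ ((S.up m = false ∧ k'.1 + 1 = k.1) ∨ (S.up m = true ∧ k.1 + 1 = k'.1)) := by
  have e1 := cellPos_content (S := S) (R := R) (c₀ := c₀) m k
  have e2 := cellPos_content (S := S) (R := R) (c₀ := c₀) m' k'
  have e3 := congrArg Prod.fst h
  have e4 := congrArg Prod.snd h
  simp only [Prod.fst_add, Prod.snd_add] at e3 e4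
  obtain rfl : m' = m + 1 := by omega
  refine ⟨rfl, ?_⟩
  cases hu : S.up m
  · left
    have e5 := congrArg Prod.fst (cellPos_succ_right hR hu k')
    simp only [Prod.fst_add] at e5
    simp only [cellPos, InfiniteRibbon.shufflePos] at e3 e5
    exact ⟨rfl, by omega⟩
  · right
    have e5 := congrArg Prod.fst (cellPos_succ_up hR hu k')
    simp only [Prod.fst_add] at e5
    simp only [cellPos, InfiniteRibbon.shufflePos] at e3 e5
    exact ⟨rfl, by omega⟩

theorem pairAt_of_gap (hR : S.OnRibbon R c₀) {m : ℕ} {j k : Fin S.n} (hjk : j.1 + 1 = k.1)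
    (h1 : S.typHi m j = 1) (h2 : S.typLo m k = 1) :
    S.PairAt R c₀ m j k (S.plc R c₀ m j).1 (S.plc R c₀ m j).2 := by
  have e := cellPos_of_val (S := S) (R := R) (c₀ := c₀) (m := m) hjk.symm
  have e' := cellPos_of_val (S := S) (R := R) (c₀ := c₀) (m := m + 1) hjk.symm
  refine ⟨hjk, h1, h2, rfl, ?_, ?_⟩
  · cases hu : S.up m
    · rw [plc_right hR hu, plc_right hR hu, e]
      refine Prod.ext ?_ ?_ <;> simp only [Prod.fst_add, Prod.snd_add] <;> push_cast <;> ring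
    · rw [plc_up hR hu, plc_up hR hu, e]
      refine Prod.ext ?_ ?_ <;> simp only [Prod.fst_add, Prod.snd_add] <;> push_cast <;> ring
  · cases hu : S.up m
    · refine Or.inl ⟨rfl, ?_, ?_⟩
      · rw [plc_right hR hu, e]
        refine Prod.ext ?_ ?_ <;> simp only [Prod.fst_add, Prod.snd_add] <;> push_cast <;> ring
      · rw [plc_right hR hu, cellPos_succ_right hR hu]
        refine Prod.ext ?_ ?_ <;> simp only [Prod.fst_add, Prod.snd_add] <;> ring
    · refine Or.inr ⟨rfl, ?_, ?_⟩
      · rw [plc_up hR hu]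
        refine Prod.ext ?_ ?_ <;> simp only [Prod.fst_add, Prod.snd_add] <;> ring
      · rw [plc_up hR hu, e', cellPos_succ_up hR hu]
        refine Prod.ext ?_ ?_ <;> simp only [Prod.fst_add, Prod.snd_add] <;> push_cast <;> ring

/-- Diagonally neighbouring cells lie in adjacent columns and on consecutive strands. The direction
of the step decides which of the two cells lies on the earlier strand. -/
theorem exists_pairAt (hR : S.OnRibbon R c₀) {x y : ℤ} (hs : (x + 1, y) ∈ S.cells R c₀)
    (ht : (x, y + 1) ∈ S.cells R c₀) : ∃ m j k, m < S.L ∧ S.PairAt R c₀ m j k x y := by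
  obtain ⟨m, k, hm, hk, h1⟩ := exists_cellPos hs
  obtain ⟨m', k', hm', hk', h2⟩ := exists_cellPos ht
  have h : S.cellPos R c₀ m' k' = S.cellPos R c₀ m k + (-1, 1) := by
    rw [← h1, ← h2]; refine Prod.ext ?_ ?_ <;> simp
  obtain ⟨rfl, ⟨hu, hkk⟩ | ⟨hu, hkk⟩⟩ := neighbour_cases hR h
  · have hp := pairAt_of_gap hR (m := m) hkk (by simp [typHi, hi, hu, hk']) (by simp [typLo, lo, hu, hk])
    have e : S.plc R c₀ m k' = (x, y) := by
      rw [plc_right hR hu]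
      have e2 := cellPos_succ_right hR hu k'
      rw [← h2] at e2
      have e3 := congrArg Prod.fst e2
      have e4 := congrArg Prod.snd e2
      refine Prod.ext ?_ ?_ <;> simp only [Prod.fst_add, Prod.snd_add] at * <;> omega
    rw [e] at hp
    exact ⟨m, k', k, hm, hp⟩
  · have hp := pairAt_of_gap hR (m := m) hkk (by simp [typHi, hi, hu, hk]) (by simp [typLo, lo, hu, hk'])
    have e : S.plc R c₀ m k = (x, y) := by
      rw [plc_up hR hu, ← h1]
      refine Prod.ext ?_ ?_ <;> simp
    rw [e] at hp
    exact ⟨m, k, k', hm, hp⟩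

variable (S) in
/-- The chips of a chain. -/
def ChipAt (V : Fin (S.L + 1) → Fin S.n → S.Val) (m q : ℕ) : Prop :=
  Chip S.n (extend (S.lo m (V (Fin.ofNat (S.L + 1) m)) (V (Fin.ofNat (S.L + 1) (m + 1)))))
    (extend (S.hi m (V (Fin.ofNat (S.L + 1) m)) (V (Fin.ofNat (S.L + 1) (m + 1))))) q

theorem chipAt_iff {V : Fin (S.L + 1) → Fin S.n → S.Val} {m : ℕ} {j k : Fin S.n}
    (hjk : j.1 + 1 = k.1) : S.ChipAt V m j ↔
      S.lo m (V (Fin.ofNat (S.L + 1) m)) (V (Fin.ofNat (S.L + 1) (m + 1))) k ≤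
        S.hi m (V (Fin.ofNat (S.L + 1) m)) (V (Fin.ofNat (S.L + 1) (m + 1))) j := by
  unfold ChipAt Chip
  rw [hjk, extend_coe, extend_coe, Fin.le_def]
  exact and_iff_right k.2

/-- Strands of different types have their values in different bands, so two neighbouring strands
cannot exchange partners unless both are active at the gap. -/
theorem not_chipAt {V : Fin (S.L + 1) → Fin S.n → S.Val} (hV : S.IsChain parCol parCol V) {m : ℕ}
    (hm : m < S.L) {j k : Fin S.n} (hjk : j.1 + 1 = k.1)
    (ht : ¬ (S.typHi m j = 1 ∧ S.typLo m k = 1)) : ¬ S.ChipAt V m j := by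
  rw [chipAt_iff hjk, not_le, show Fin.ofNat (S.L + 1) m = _ from ofNat_castSucc ⟨m, hm⟩,
    show Fin.ofNat (S.L + 1) (m + 1) = _ from ofNat_succ ⟨m, hm⟩]
  exact (hV.proper (⟨m, hm⟩ : Fin S.L).castSucc).hi_lt_lo hm (hV.proper (⟨m, hm⟩ : Fin S.L).succ)
    (Fin.lt_def.2 (by omega)) ht

theorem IsChain.tableau_entry' {V : Fin (S.L + 1) → Fin S.n → S.Val}
    (hV : S.IsChain parCol parCol V) (hR : S.OnRibbon R c₀) {m : ℕ} {k : Fin S.n}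
    (hk : S.typ m k = 1) {p : ℤ × ℤ} (hp : p ∈ S.cells R c₀) (e : p = S.cellPos R c₀ m k) :
    (((hV.tableau hR).entry ⟨p, hp⟩ : ℕ+) : ℕ) = ent V m k := by
  subst e; exact hV.tableau_entry hR hk

variable (S R c₀) in
/-- The positions of the lower column of a gap. -/
def loPos (m : ℕ) : Fin S.n → ℤ × ℤ := S.lo m (S.cellPos R c₀ m) (S.cellPos R c₀ (m + 1))

variable (S R c₀) in
/-- The positions of the upper column of a gap. -/
def hiPos (m : ℕ) : Fin S.n → ℤ × ℤ := S.hi m (S.cellPos R c₀ m) (S.cellPos R c₀ (m + 1))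

theorem PairAt.mem {m : ℕ} {j k : Fin S.n} {x y : ℤ} (h : S.PairAt R c₀ m j k x y) :
    (x + 1, y) ∈ S.cells R c₀ ∧ (x, y + 1) ∈ S.cells R c₀ := by
  obtain ⟨-, h1, h2, -, -, ⟨hu, e1, e2⟩ | ⟨hu, e1, e2⟩⟩ := h
  · simp only [typHi, typLo, lo, hi, hu, Bool.false_eq_true, if_false] at h1 h2
    rw [e1, e2]; exact ⟨cellPos_mem.2 h2, cellPos_mem.2 h1⟩
  · simp only [typHi, typLo, lo, hi, hu, if_true] at h1 h2
    rw [e1, e2]; exact ⟨cellPos_mem.2 h1, cellPos_mem.2 h2⟩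

/-- The lines between two neighbouring cells in terms of the places next to them. -/
theorem PairAt.colour_iff {V : Fin (S.L + 1) → Fin S.n → S.Val}
    (hV : S.IsChain parCol parCol V) (hR : S.OnRibbon R c₀) {m : ℕ}
    {j k : Fin S.n} {x y : ℤ} (h : S.PairAt R c₀ m j k x y) (hs : (x + 1, y) ∈ S.cells R c₀)
    (ht : (x, y + 1) ∈ S.cells R c₀) (c : ℤ × ℤ → Bool) :
    (((hV.tableau hR).entry ⟨_, hs⟩ ≤ (hV.tableau hR).entry ⟨_, ht⟩ →
        c (x + 1, y) = c (x, y) ∧ c (x, y + 1) = c (x + 1, y + 1)) ∧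
      ((hV.tableau hR).entry ⟨_, ht⟩ < (hV.tableau hR).entry ⟨_, hs⟩ →
        c (x + 1, y) = c (x + 1, y + 1) ∧ c (x, y + 1) = c (x, y))) ↔
    ((S.ChipAt V m j → c (S.loPos R c₀ m k) = c (S.plc R c₀ m j) ∧
        c (S.hiPos R c₀ m j) = c (S.plc R c₀ m k)) ∧
      (¬ S.ChipAt V m j → c (S.loPos R c₀ m k) = c (S.plc R c₀ m k) ∧
        c (S.hiPos R c₀ m j) = c (S.plc R c₀ m j))) := by
  obtain ⟨hjk, h1, h2, p1, p2, ⟨hu, e1, e2⟩ | ⟨hu, e1, e2⟩⟩ := h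
  -- For a step to the right the lower left cell belongs to `lo`, and a chip means `i ≤ j`.
  · have hu' : ¬ S.up m = true := by simp [hu]
    have hb := S.base_succ m
    simp only [typHi, typLo, lo, hi, if_neg hu'] at h1 h2 hb
    have s1 := hV.ent_spec h1
    have s2 := hV.ent_spec h2
    rw [chipAt_iff hjk, p1, p2, ← PNat.coe_le_coe, ← PNat.coe_lt_coe,
      hV.tableau_entry' hR h2 hs e1, hV.tableau_entry' hR h1 ht e2]
    simp only [loPos, hiPos, lo, hi, if_neg hu']
    rw [← e1, ← e2, Fin.le_def, s1.2.2, s2.2.2, hb]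
    simp only [add_zero, Nat.add_le_add_iff_left, not_le]
  -- For a step up the lower left cell belongs to `hi`. Because of the growth of `base`, a chip now
  -- means `j < i`, so the two conditions change places.
  · have hb := S.base_succ m
    simp only [typHi, typLo, lo, hi, if_pos hu] at h1 h2 hb
    have s1 := hV.ent_spec h1
    have s2 := hV.ent_spec h2
    rw [chipAt_iff hjk, p1, p2, ← PNat.coe_le_coe, ← PNat.coe_lt_coe,
      hV.tableau_entry' hR h1 hs e1, hV.tableau_entry' hR h2 ht e2]
    simp only [loPos, hiPos, lo, hi, if_pos hu]
    rw [← e1, ← e2, Fin.le_def, s1.2.2, s2.2.2, hb]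
    have q1 : S.base m + 1 + ent V (m + 1) k ≤ S.base m + ent V m j ↔
      ent V (m + 1) k < ent V m j := by omega
    have q2 : ¬ ent V (m + 1) k < ent V m j ↔ ent V m j ≤ ent V (m + 1) k := not_lt
    rw [q1, q2]
    tauto

/-- The conditions on a colouring at the cells that have only one neighbour in a gap. -/
def LoneOK (V : Fin (S.L + 1) → Fin S.n → S.Val) (R : InfiniteRibbon) (c₀ : ℤ)
    (c : ℤ × ℤ → Bool) : Prop :=
  ∀ m < S.L, (∀ k, S.typLo m k = 1 → (∀ j : Fin S.n, j.1 + 1 = k.1 → S.typHi m j ≠ 1) →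
      c (S.loPos R c₀ m k) = c (S.plc R c₀ m k)) ∧
    ∀ j, S.typHi m j = 1 → (∀ k : Fin S.n, j.1 + 1 = k.1 → S.typLo m k ≠ 1) →
      c (S.hiPos R c₀ m j) = c (S.plc R c₀ m j)

/-- The place diagonally above and to the right lies in the next column. It belongs to the preceding
strand if the step goes to the right and to the following one if it goes up. -/
theorem not_mem_after_iff (hR : S.OnRibbon R c₀) {m : ℕ} {k : Fin S.n} :
    R.shufflePos k (c₀ + m) + (-1, 1) ∉ S.cells R c₀ ↔ ∀ j : Fin S.n,
      (S.up m = false → j.1 + 1 = k.1 → S.typ (m + 1) j ≠ 1) ∧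
      (S.up m = true → k.1 + 1 = j.1 → S.typ (m + 1) j ≠ 1) := by
  have fwd : ∀ j : Fin S.n, ((S.up m = false ∧ j.1 + 1 = k.1) ∨ (S.up m = true ∧ k.1 + 1 = j.1)) →
      R.shufflePos k (c₀ + m) + (-1, 1) = S.cellPos R c₀ (m + 1) j := by
    change ∀ j : Fin S.n, _ → S.cellPos R c₀ m k + (-1, 1) = S.cellPos R c₀ (m + 1) j
    rintro j (⟨hu, h⟩ | ⟨hu, h⟩)
    · rw [cellPos_succ_right hR hu, cellPos_of_val h.symm]
      refine Prod.ext ?_ ?_ <;> simp only [Prod.fst_add, Prod.snd_add] <;> push_cast <;> ring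
    · rw [cellPos_succ_up hR hu, cellPos_of_val h.symm]
      refine Prod.ext ?_ ?_ <;> simp only [Prod.fst_add, Prod.snd_add] <;> push_cast <;> ring
  constructor
  · intro h j
    refine ⟨fun hu hj ht => h ?_, fun hu hj ht => h ?_⟩
    · rw [fwd j (Or.inl ⟨hu, hj⟩)]; exact cellPos_mem.2 ht
    · rw [fwd j (Or.inr ⟨hu, hj⟩)]; exact cellPos_mem.2 ht
  · intro h hmem
    obtain ⟨m', k', -, ht, e⟩ := exists_cellPos hmem
    obtain ⟨rfl, ⟨hu, hj⟩ | ⟨hu, hj⟩⟩ := neighbour_cases (k := k) hR e.symm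
    · exact (h k').1 hu hj ht
    · exact (h k').2 hu hj ht

theorem not_mem_before_iff (hR : S.OnRibbon R c₀) {m : ℕ} {k : Fin S.n} :
    R.shufflePos k (c₀ + (m + 1 : ℕ)) + (1, -1) ∉ S.cells R c₀ ↔ ∀ j : Fin S.n,
      (S.up m = false → k.1 + 1 = j.1 → S.typ m j ≠ 1) ∧
      (S.up m = true → j.1 + 1 = k.1 → S.typ m j ≠ 1) := by
  have fwd : ∀ j : Fin S.n, ((S.up m = false ∧ k.1 + 1 = j.1) ∨ (S.up m = true ∧ j.1 + 1 = k.1)) →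
      R.shufflePos k (c₀ + (m + 1 : ℕ)) + (1, -1) = S.cellPos R c₀ m j := by
    change ∀ j : Fin S.n, _ → S.cellPos R c₀ (m + 1) k + (1, -1) = S.cellPos R c₀ m j
    rintro j (⟨hu, h⟩ | ⟨hu, h⟩)
    · rw [cellPos_succ_right hR hu, cellPos_of_val (k' := j) h.symm]
      refine Prod.ext ?_ ?_ <;> simp only [Prod.fst_add, Prod.snd_add] <;> push_cast <;> ring
    · rw [cellPos_succ_up hR hu, cellPos_of_val (k' := k) h.symm]
      refine Prod.ext ?_ ?_ <;> simp only [Prod.fst_add, Prod.snd_add] <;> push_cast <;> ring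
  constructor
  · intro h j
    refine ⟨fun hu hj ht => h ?_, fun hu hj ht => h ?_⟩
    · rw [fwd j (Or.inl ⟨hu, hj⟩)]; exact cellPos_mem.2 ht
    · rw [fwd j (Or.inr ⟨hu, hj⟩)]; exact cellPos_mem.2 ht
  · intro h hmem
    obtain ⟨m', k', -, ht, e⟩ := exists_cellPos hmem
    have e' : S.cellPos R c₀ (m + 1) k = S.cellPos R c₀ m' k' + (-1, 1) := by
      rw [← e]
      change S.cellPos R c₀ (m + 1) k = S.cellPos R c₀ (m + 1) k + (1, -1) + (-1, 1)
      rw [add_assoc]; simp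
    obtain ⟨hm, h'⟩ := neighbour_cases hR e'
    obtain rfl : m' = m := by omega
    rcases h' with ⟨hu, hj⟩ | ⟨hu, hj⟩
    · exact (h k').1 hu hj ht
    · exact (h k').2 hu hj ht

/-- Colourings that are constant along the lines of a shuffle tableau. -/
theorem shuffleLine_iff {V : Fin (S.L + 1) → Fin S.n → S.Val} (hV : S.IsChain parCol parCol V)
    (hR : S.OnRibbon R c₀) (c : ℤ × ℤ → Bool) :
    (∀ p q, R.ShuffleLine (S.firstContent c₀) (S.lastContent c₀) (hV.tableau hR) p q → c p = c q) ↔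
      (∀ m < S.L, ∀ j k : Fin S.n, j.1 + 1 = k.1 → S.typHi m j = 1 → S.typLo m k = 1 →
        (S.ChipAt V m j → c (S.loPos R c₀ m k) = c (S.plc R c₀ m j) ∧
          c (S.hiPos R c₀ m j) = c (S.plc R c₀ m k)) ∧
        (¬ S.ChipAt V m j → c (S.loPos R c₀ m k) = c (S.plc R c₀ m k) ∧
          c (S.hiPos R c₀ m j) = c (S.plc R c₀ m j))) ∧ LoneOK V R c₀ c := by
  have hact : ∀ {m : ℕ} {k : Fin S.n}, S.typ m k = 1 →
      S.firstContent c₀ k ≤ c₀ + m ∧ c₀ + m < S.lastContent c₀ k := by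
    intro m k h
    have := (S.active m k).1 h
    unfold firstContent lastContent
    omega
  constructor
  · intro h
    refine ⟨fun m hm j k hjk h1 h2 => ?_, fun m hm => ⟨fun k h1 h2 => ?_, fun j h1 h2 => ?_⟩⟩
    · have hp := pairAt_of_gap hR hjk h1 h2
      obtain ⟨hs, ht⟩ := hp.mem
      refine (hp.colour_iff hV hR hs ht c).1 ⟨fun hle => ⟨?_, ?_⟩, fun hlt => ⟨?_, ?_⟩⟩
      · exact h _ _ (.lower_vertical _ _ hs ht hle)
      · exact h _ _ (.upper_vertical _ _ hs ht hle)
      · exact h _ _ (.lower_horizontal _ _ hs ht hlt)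
      · exact h _ _ (.upper_horizontal _ _ hs ht hlt)
    · cases hu : S.up m
      · simp only [typHi, typLo, loPos, lo, hi, hu, Bool.false_eq_true, if_false] at h1 h2 ⊢
        refine h _ _ (.lone_after k _ (hact h1).1 (hact h1).2 ((not_mem_after_iff hR).2 fun j => ?_))
        exact ⟨fun _ hj => h2 j hj, fun hu' => by simp [hu] at hu'⟩
      · simp only [typHi, typLo, loPos, lo, hi, hu, if_true] at h1 h2 ⊢
        rw [← placeBefore_eq_plc hR]
        refine h _ _ (.lone_before k _ (hact h1).1 (hact h1).2 ((not_mem_before_iff hR).2 fun j => ?_))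
        exact ⟨fun hu' => by simp [hu] at hu', fun _ hj => h2 j hj⟩
    · cases hu : S.up m
      · simp only [typHi, typLo, hiPos, lo, hi, hu, Bool.false_eq_true, if_false] at h1 h2 ⊢
        rw [← placeBefore_eq_plc hR]
        refine h _ _ (.lone_before j _ (hact h1).1 (hact h1).2 ((not_mem_before_iff hR).2 fun k => ?_))
        exact ⟨fun _ hj => h2 k hj, fun hu' => by simp [hu] at hu'⟩
      · simp only [typHi, typLo, hiPos, lo, hi, hu, if_true] at h1 h2 ⊢
        refine h _ _ (.lone_after j _ (hact h1).1 (hact h1).2 ((not_mem_after_iff hR).2 fun k => ?_))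
        exact ⟨fun hu' => by simp [hu] at hu', fun _ hj => h2 k hj⟩
  · rintro ⟨hpair, hlone⟩ p q hpq
    have key : ∀ x y (hs : (x + 1, y) ∈ S.cells R c₀) (ht : (x, y + 1) ∈ S.cells R c₀),
        ((hV.tableau hR).entry ⟨_, hs⟩ ≤ (hV.tableau hR).entry ⟨_, ht⟩ →
          c (x + 1, y) = c (x, y) ∧ c (x, y + 1) = c (x + 1, y + 1)) ∧
        ((hV.tableau hR).entry ⟨_, ht⟩ < (hV.tableau hR).entry ⟨_, hs⟩ →
          c (x + 1, y) = c (x + 1, y + 1) ∧ c (x, y + 1) = c (x, y)) := by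
      intro x y hs ht
      obtain ⟨m, j, k, hm, hp⟩ := exists_pairAt hR hs ht
      exact (hp.colour_iff hV hR hs ht c).2 (hpair m hm j k hp.1 hp.2.1 hp.2.2.1)
    -- Every strand starts after the column `0`, so each box has a gap before it.
    have hcol : ∀ (k : Fin S.n) (d : ℤ), S.firstContent c₀ k ≤ d → d < S.lastContent c₀ k →
        ∃ m, d = c₀ + ((m + 1 : ℕ) : ℤ) ∧ S.typ (m + 1) k = 1 := by
      intro k d h1 h2
      have := S.a_pos k
      unfold firstContent at h1
      unfold lastContent at h2
      exact ⟨(d - c₀ - 1).toNat, by push_cast; omega, (S.active _ _).2 (by omega)⟩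
    cases hpq with
    | lower_vertical x y hs ht h => exact ((key x y hs ht).1 h).1
    | upper_vertical x y hs ht h => exact ((key x y hs ht).1 h).2
    | lower_horizontal x y hs ht h => exact ((key x y hs ht).2 h).1
    | upper_horizontal x y hs ht h => exact ((key x y hs ht).2 h).2
    | lone_after k d ha hb h =>
      obtain ⟨m, rfl, ht⟩ := hcol k d ha hb
      have h := (not_mem_after_iff hR).1 h
      have hl := hlone (m + 1) (lt_of_active ht)
      cases hu : S.up (m + 1)
      · have := hl.1 k
        simp only [typHi, typLo, loPos, lo, hi, hu, Bool.false_eq_true, if_false] at this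
        exact this ht fun j hj => (h j).1 hu hj
      · have := hl.2 k
        simp only [typHi, typLo, hiPos, lo, hi, hu, if_true] at this
        exact this ht fun j hj => (h j).2 hu hj
    | lone_before k d ha hb h =>
      obtain ⟨m, rfl, ht⟩ := hcol k d ha hb
      have h := (not_mem_before_iff hR).1 h
      have hl := hlone m (by have := lt_of_active ht; omega)
      rw [placeBefore_eq_plc hR]
      cases hu : S.up m
      · have := hl.2 k
        simp only [typHi, typLo, hiPos, lo, hi, hu, Bool.false_eq_true, if_false] at this
        exact this ht fun j hj => (h j).1 hu hj
      · have := hl.1 k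
        simp only [typHi, typLo, loPos, lo, hi, hu, if_true] at this
        exact this ht fun j hj => (h j).2 hu hj

end Strands

/-! ### Colours of the places between columns. -/

/-- Compatible colourings of two adjacent columns in terms of the colours of the places between
them. -/
theorem compat_iff_places {n : ℕ} (lo hi : ℕ → ℕ) (flo fhi : Fin n → Bool) :
    Compat n lo hi (extendCol flo) (extendCol fhi) ↔ ∃ d : Fin n → Bool,
      (∀ j k : Fin n, j.1 + 1 = k.1 → (Chip n lo hi j → flo k = d j ∧ fhi j = d k) ∧
        (¬ Chip n lo hi j → flo k = d k ∧ fhi j = d j)) ∧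
      (∀ k : Fin n, (∀ j : Fin n, j.1 + 1 ≠ k.1) → flo k = d k) ∧
      ∀ j : Fin n, (∀ k : Fin n, j.1 + 1 ≠ k.1) → fhi j = d j := by
  have hin : ∀ j k : Fin n, j.1 + 1 = k.1 → inFlip n lo hi (extendCol flo) (extendCol fhi) k =
      if Chip n lo hi j then fhi j else flo k := by
    intro j k h
    rw [← h, inFlip, extendCol_coe, h, extendCol_coe]
  have hout : ∀ j k : Fin n, j.1 + 1 = k.1 → outFlip n lo hi (extendCol flo) (extendCol fhi) j =
      if Chip n lo hi j then flo k else fhi j := by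
    intro j k h
    rw [outFlip, extendCol_coe, h, extendCol_coe]
  have hin0 : ∀ k : Fin n, (∀ j : Fin n, j.1 + 1 ≠ k.1) →
      inFlip n lo hi (extendCol flo) (extendCol fhi) k = flo k := by
    intro k h
    rcases hk : k.1 with _ | q
    · rw [inFlip, ← hk, extendCol_coe]
    · exact absurd hk.symm (h ⟨q, by omega⟩)
  have hout0 : ∀ j : Fin n, (∀ k : Fin n, j.1 + 1 ≠ k.1) →
      outFlip n lo hi (extendCol flo) (extendCol fhi) j = fhi j := by
    intro j h
    rw [outFlip, if_neg fun hc => h ⟨_, hc.1⟩ rfl, extendCol_coe]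
  constructor
  · intro h
    have h' : ∀ q : Fin n, inFlip n lo hi (extendCol flo) (extendCol fhi) q =
        outFlip n lo hi (extendCol flo) (extendCol fhi) q := fun q => h q q.2
    refine ⟨fun q => outFlip n lo hi (extendCol flo) (extendCol fhi) q, fun j k hjk => ?_,
      fun k hk => ?_, fun j hj => ?_⟩
    · beta_reduce
      rw [← h' k, hin j k hjk, hout j k hjk]
      exact ⟨fun hc => by simp [hc], fun hc => by simp [hc]⟩
    · beta_reduce; rw [← h' k, hin0 k hk]
    · beta_reduce; rw [hout0 j hj]
  · rintro ⟨d, h1, h2, h3⟩ q hq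
    have e1 : inFlip n lo hi (extendCol flo) (extendCol fhi) (⟨q, hq⟩ : Fin n) = d ⟨q, hq⟩ := by
      by_cases hj : ∃ j : Fin n, j.1 + 1 = (⟨q, hq⟩ : Fin n).1
      · obtain ⟨j, hj⟩ := hj
        rw [hin j _ hj]
        split_ifs with hc
        · exact ((h1 j _ hj).1 hc).2
        · exact ((h1 j _ hj).2 hc).1
      · push Not at hj
        rw [hin0 _ hj, h2 _ hj]
    have e2 : outFlip n lo hi (extendCol flo) (extendCol fhi) (⟨q, hq⟩ : Fin n) = d ⟨q, hq⟩ := by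
      by_cases hk : ∃ k : Fin n, (⟨q, hq⟩ : Fin n).1 + 1 = k.1
      · obtain ⟨k, hk⟩ := hk
        rw [hout _ k hk]
        split_ifs with hc
        · exact ((h1 _ k hk).1 hc).1
        · exact ((h1 _ k hk).2 hc).2
      · push Not at hk
        rw [hout0 _ hk, h3 _ hk]
    exact e1.trans e2.symm

namespace Strands

variable {S : Strands} {R : InfiniteRibbon} {c₀ : ℤ}

theorem plc_content (hR : S.OnRibbon R c₀) (m : ℕ) (k : Fin S.n) :
    (S.plc R c₀ m k).2 - (S.plc R c₀ m k).1 = 2 * (c₀ + m) + 1 := by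
  have h := cellPos_content (S := S) (R := R) (c₀ := c₀) m k
  cases hu : S.up m
  · rw [plc_right hR hu]; simp only [Prod.fst_add, Prod.snd_add]; omega
  · rw [plc_up hR hu]; simp only [Prod.fst_add, Prod.snd_add]; omega

theorem plc_inj (hR : S.OnRibbon R c₀) {m m' : ℕ} {k k' : Fin S.n}
    (h : S.plc R c₀ m k = S.plc R c₀ m' k') : m = m' ∧ k = k' := by
  have h1 := plc_content hR m k
  have h2 := plc_content hR m' k'
  rw [h] at h1
  obtain rfl : m = m' := by omega
  refine ⟨rfl, ?_⟩
  cases hu : S.up m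
  · rw [plc_right hR hu, plc_right hR hu] at h
    exact (cellPos_inj (add_right_cancel h)).2
  · rw [plc_up hR hu, plc_up hR hu] at h
    exact (cellPos_inj (add_right_cancel h)).2

theorem plc_ne_cellPos (hR : S.OnRibbon R c₀) {m m' : ℕ} {k k' : Fin S.n} :
    S.plc R c₀ m k ≠ S.cellPos R c₀ m' k' := by
  intro h
  have h1 := plc_content hR m k
  have h2 := cellPos_content (S := S) (R := R) (c₀ := c₀) m' k'
  rw [h] at h1
  omega

/-- Colourings of the cells and of the places can be prescribed. -/
theorem exists_colouring (hR : S.OnRibbon R c₀) (g d : ℕ → Fin S.n → Bool) :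
    ∃ c : ℤ × ℤ → Bool, (∀ m k, c (S.cellPos R c₀ m k) = g m k) ∧
      ∀ m k, c (S.plc R c₀ m k) = d m k := by
  classical
  refine ⟨fun p => decide ((∃ m k, p = S.cellPos R c₀ m k ∧ g m k = true) ∨
    ∃ m k, p = S.plc R c₀ m k ∧ d m k = true), fun m k => ?_, fun m k => ?_⟩
  · rw [Bool.eq_iff_iff, decide_eq_true_iff]
    refine ⟨?_, fun h => Or.inl ⟨m, k, rfl, h⟩⟩
    rintro (⟨m', k', h, h'⟩ | ⟨m', k', h, -⟩)
    · obtain ⟨rfl, rfl⟩ := cellPos_inj h; exact h'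
    · exact absurd h.symm (plc_ne_cellPos hR)
  · rw [Bool.eq_iff_iff, decide_eq_true_iff]
    refine ⟨?_, fun h => Or.inr ⟨m, k, rfl, h⟩⟩
    rintro (⟨m', k', h, -⟩ | ⟨m', k', h, h'⟩)
    · exact absurd h (plc_ne_cellPos hR)
    · obtain ⟨rfl, rfl⟩ := plc_inj hR h; exact h'

/-- The lines of a chain in terms of the places between the columns. -/
theorem isPlanar_iff_places (V : Fin (S.L + 1) → Fin S.n → S.Val) (φL φR : Fin S.n → Bool) :
    S.IsPlanar V φL φR ↔ ∃ g d : ℕ → Fin S.n → Bool, (∀ m k, S.Idle m k →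
      g m k = S.idleCol φL φR m k) ∧ ∀ m < S.L,
      (∀ j k : Fin S.n, j.1 + 1 = k.1 →
        (S.ChipAt V m j → S.lo m (g m) (g (m + 1)) k = d m j ∧
          S.hi m (g m) (g (m + 1)) j = d m k) ∧
        (¬ S.ChipAt V m j → S.lo m (g m) (g (m + 1)) k = d m k ∧
          S.hi m (g m) (g (m + 1)) j = d m j)) ∧
      (∀ k : Fin S.n, (∀ j : Fin S.n, j.1 + 1 ≠ k.1) → S.lo m (g m) (g (m + 1)) k = d m k) ∧
      ∀ j : Fin S.n, (∀ k : Fin S.n, j.1 + 1 ≠ k.1) → S.hi m (g m) (g (m + 1)) j = d m j := by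
  unfold IsPlanar
  simp only [compat_iff_places]
  constructor
  · rintro ⟨g, h1, h2⟩
    choose d hd using h1
    refine ⟨fun m k => if h : m < S.L + 1 then g ⟨m, h⟩ k else S.idleCol φL φR m k,
      fun m k => if h : m < S.L then d ⟨m, h⟩ k else false, fun m k hI => ?_, fun m hm => ?_⟩
    · dsimp only
      split_ifs with h
      · exact h2 ⟨m, h⟩ k hI
      · rfl
    · have e := hd ⟨m, hm⟩
      simp only [← ofNat_castSucc, ← ofNat_succ] at e
      have e1 : (fun k => if h : m < S.L + 1 then g ⟨m, h⟩ k else S.idleCol φL φR m k) =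
          g (Fin.ofNat (S.L + 1) m) := by
        funext k
        rw [dif_pos (by omega), show Fin.ofNat (S.L + 1) m = _ from
          ofNat_coe ⟨m, by omega⟩]
      have e2 : (fun k => if h : m + 1 < S.L + 1 then g ⟨m + 1, h⟩ k else
          S.idleCol φL φR (m + 1) k) = g (Fin.ofNat (S.L + 1) (m + 1)) := by
        funext k
        rw [dif_pos (by omega), show Fin.ofNat (S.L + 1) (m + 1) = _ from
          ofNat_coe ⟨m + 1, by omega⟩]
      beta_reduce
      rw [e1, e2]
      simp only [dif_pos hm]
      exact e
  · rintro ⟨g, d, h1, h2⟩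
    refine ⟨fun m => g m, fun m => ⟨d m, ?_⟩, fun m k hI => h1 m k hI⟩
    have e := h2 m m.2
    unfold ChipAt at e
    simp only [ofNat_castSucc, ofNat_succ] at e
    exact e

/-- The type of a shuffle tableau in terms of its chain. -/
theorem tlType_le_ker_iff {V : Fin (S.L + 1) → Fin S.n → S.Val} (hV : S.IsChain parCol parCol V)
    (hR : S.OnRibbon R c₀) (φL φR : Fin S.n → Bool) :
    R.tlType (S.firstContent c₀) (S.lastContent c₀) (hV.tableau hR) ≤
      Setoid.ker (Sum.elim φL φR) ↔ S.IsPlanar V φL φR := by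
  have hbd : ∀ c : ℤ × ℤ → Bool, (∀ p, c (R.shuffleBoundary (S.firstContent c₀)
      (S.lastContent c₀) p) = Sum.elim φL φR p) ↔ ∀ m k,
      (S.typ m k ≠ 1 → S.typ (m + 1) k = 1 → c (S.plc R c₀ m k) = S.idleCol φL φR m k) ∧
      (S.typ m k = 1 → S.typ (m + 1) k ≠ 1 →
        c (S.plc R c₀ m k) = S.idleCol φL φR (m + 1) k) := by
    intro c
    have hL : ∀ k, R.shuffleBoundary (S.firstContent c₀) (S.lastContent c₀) (Sum.inl k) =
        S.plc R c₀ (S.b k - 1) k := by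
      intro k
      have := S.a_lt k
      unfold plc
      rw [InfiniteRibbon.shuffleBoundary, lastContent, show c₀ + (S.b k : ℤ) - 1 =
        c₀ + ((S.b k - 1 : ℕ) : ℤ) by omega]
    have hF : ∀ k, R.shuffleBoundary (S.firstContent c₀) (S.lastContent c₀) (Sum.inr k) =
        S.plc R c₀ (S.a k - 1) k := by
      intro k
      have := S.a_pos k
      rw [← placeBefore_eq_plc hR, InfiniteRibbon.shuffleBoundary, firstContent,
        show S.a k - 1 + 1 = S.a k by omega]
    constructor
    · intro h m k
      rw [Ne, Ne, S.active, S.active]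
      refine ⟨fun h1 h2 => ?_, fun h1 h2 => ?_⟩
      · have := h (Sum.inr k)
        rw [hF, Sum.elim_inr, show S.a k - 1 = m by omega] at this
        rw [this, idleCol, if_neg (by omega)]
      · have := h (Sum.inl k)
        rw [hL, Sum.elim_inl, show S.b k - 1 = m by omega] at this
        rw [this, idleCol, if_pos (by omega)]
    · rintro h (k | k)
      · have h1 := S.a_lt k
        have := (h (S.b k - 1) k).2 ((S.active _ _).2 (by omega)) (by rw [Ne, S.active]; omega)
        rw [hL, this, idleCol, if_pos (by omega), Sum.elim_inl]
      · have h1 := S.a_pos k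
        have h2 := S.a_lt k
        have := (h (S.a k - 1) k).1 (by rw [Ne, S.active]; omega) ((S.active _ _).2 (by omega))
        rw [hF, this, idleCol, if_neg (by omega), Sum.elim_inr]
  rw [InfiniteRibbon.tlType, comap_eqvGen_le_ker_iff, isPlanar_iff_places]
  simp only [hbd, shuffleLine_iff]
  constructor
  · rintro ⟨c, ⟨hpair, hlone⟩, hb⟩
    -- The colours of the diagram are continued along the idle strands by the prescribed boundary
    -- colours. They fit together at the points `P_k` and `Q_k`.
    set g : ℕ → Fin S.n → Bool := fun m k =>
      if S.typ m k = 1 then c (S.cellPos R c₀ m k) else S.idleCol φL φR m k with hg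
    set d : ℕ → Fin S.n → Bool := fun m k => if S.typ m k = 1 ∨ S.typ (m + 1) k = 1 then
      c (S.plc R c₀ m k) else S.idleCol φL φR m k with hd
    have glo : ∀ m k, S.typLo m k = 1 →
        S.lo m (g m) (g (m + 1)) k = c (S.loPos R c₀ m k) := by
      intro m k h
      unfold loPos
      unfold typLo at h
      unfold lo at *
      split_ifs at * <;> simp only [hg, h, if_true]
    have ghi : ∀ m k, S.typHi m k = 1 →
        S.hi m (g m) (g (m + 1)) k = c (S.hiPos R c₀ m k) := by
      intro m k h
      unfold hiPos
      unfold typHi at h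
      unfold hi at *
      split_ifs at * <;> simp only [hg, h, if_true]
    have dact : ∀ m k, S.typLo m k = 1 ∨ S.typHi m k = 1 → d m k = c (S.plc R c₀ m k) := by
      intro m k h
      refine if_pos ?_
      unfold typLo typHi lo hi at h
      split_ifs at h
      · exact h.symm
      · exact h
    have side : ∀ m k, (S.typ m k ≠ 1 → g m k = d m k) ∧
        (S.typ (m + 1) k ≠ 1 → g (m + 1) k = d m k) := by
      intro m k
      simp only [hg, hd]
      by_cases h1 : S.typ m k = 1 <;> by_cases h2 : S.typ (m + 1) k = 1
      · exact ⟨fun h => absurd h1 h, fun h => absurd h2 h⟩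
      · rw [if_pos (Or.inl h1), if_neg h2, (hb m k).2 h1 h2]
        exact ⟨fun h => absurd h1 h, fun _ => rfl⟩
      · rw [if_pos (Or.inr h2), if_neg h1, (hb m k).1 h1 h2]
        exact ⟨fun _ => rfl, fun h => absurd h2 h⟩
      · rw [if_neg (not_or.2 ⟨h1, h2⟩), if_neg h1, if_neg h2]
        exact ⟨fun _ => rfl, fun _ => (S.idleCol_succ φL φR h1 h2).symm⟩
    have hidle : ∀ m k, (S.typLo m k ≠ 1 → S.lo m (g m) (g (m + 1)) k = d m k) ∧
        (S.typHi m k ≠ 1 → S.hi m (g m) (g (m + 1)) k = d m k) := by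
      intro m k
      have h := side m k
      unfold typLo typHi lo hi
      split_ifs
      · exact h.symm
      · exact h
    have hlo : ∀ m < S.L, ∀ k, (∀ j : Fin S.n, j.1 + 1 = k.1 →
        ¬ (S.typHi m j = 1 ∧ S.typLo m k = 1)) → S.lo m (g m) (g (m + 1)) k = d m k := by
      intro m hm k h
      by_cases ht : S.typLo m k = 1
      · rw [glo m k ht, dact m k (Or.inl ht)]
        exact (hlone m hm).1 k ht fun j hj hj' => h j hj ⟨hj', ht⟩
      · exact (hidle m k).1 ht
    have hhi : ∀ m < S.L, ∀ j, (∀ k : Fin S.n, j.1 + 1 = k.1 →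
        ¬ (S.typHi m j = 1 ∧ S.typLo m k = 1)) → S.hi m (g m) (g (m + 1)) j = d m j := by
      intro m hm j h
      by_cases ht : S.typHi m j = 1
      · rw [ghi m j ht, dact m j (Or.inr ht)]
        exact (hlone m hm).2 j ht fun k hk hk' => h k hk ⟨ht, hk'⟩
      · exact (hidle m j).2 ht
    refine ⟨g, d, fun m k hI => if_neg hI, fun m hm => ⟨fun j k hjk => ?_,
      fun k hk => hlo m hm k fun j hj => absurd hj (hk j),
      fun j hj => hhi m hm j fun k hk => absurd hk (hj k)⟩⟩
    by_cases ht : S.typHi m j = 1 ∧ S.typLo m k = 1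
    · rw [glo m k ht.2, ghi m j ht.1, dact m k (Or.inl ht.2), dact m j (Or.inr ht.1)]
      exact hpair m hm j k hjk ht.1 ht.2
    · refine ⟨fun hc => absurd hc (not_chipAt hV hm hjk ht), fun _ => ⟨hlo m hm k ?_, hhi m hm j ?_⟩⟩
      · intro j' hj'
        rwa [show j' = j from Fin.ext (by omega)]
      · intro k' hk'
        rwa [show k' = k from Fin.ext (by omega)]
  · rintro ⟨g, d, hidle, hgap⟩
    obtain ⟨c, hc, hc'⟩ := exists_colouring hR g d
    have clo : ∀ m k, c (S.loPos R c₀ m k) = S.lo m (g m) (g (m + 1)) k := by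
      intro m k
      unfold loPos lo
      split_ifs <;> exact hc _ _
    have chi : ∀ m k, c (S.hiPos R c₀ m k) = S.hi m (g m) (g (m + 1)) k := by
      intro m k
      unfold hiPos hi
      split_ifs <;> exact hc _ _
    have hlo : ∀ m < S.L, ∀ k, (∀ j : Fin S.n, j.1 + 1 = k.1 →
        ¬ (S.typHi m j = 1 ∧ S.typLo m k = 1)) → S.lo m (g m) (g (m + 1)) k = d m k := by
      intro m hm k h
      by_cases hj : ∃ j : Fin S.n, j.1 + 1 = k.1
      · obtain ⟨j, hj⟩ := hj
        exact (((hgap m hm).1 j k hj).2 (not_chipAt hV hm hj (h j hj))).1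
      · push Not at hj
        exact (hgap m hm).2.1 k hj
    have hhi : ∀ m < S.L, ∀ j, (∀ k : Fin S.n, j.1 + 1 = k.1 →
        ¬ (S.typHi m j = 1 ∧ S.typLo m k = 1)) → S.hi m (g m) (g (m + 1)) j = d m j := by
      intro m hm j h
      by_cases hk : ∃ k : Fin S.n, j.1 + 1 = k.1
      · obtain ⟨k, hk⟩ := hk
        exact (((hgap m hm).1 j k hk).2 (not_chipAt hV hm hk (h k hk))).2
      · push Not at hk
        exact (hgap m hm).2.2 j hk
    refine ⟨c, ⟨fun m hm j k hjk _ _ => ?_, fun m hm => ⟨fun k h1 h2 => ?_, fun j h1 h2 => ?_⟩⟩,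
      fun m k => ⟨fun h1 h2 => ?_, fun h1 h2 => ?_⟩⟩
    · rw [clo, chi, hc', hc']
      exact (hgap m hm).1 j k hjk
    · rw [clo, hc']
      exact hlo m hm k fun j hj h => h2 j hj h.1
    · rw [chi, hc']
      exact hhi m hm j fun k hk h => h2 k hk h.2
    · have hm := lt_of_active h2
      rw [hc', ← hidle m k h1]
      cases hu : S.up m
      · have := hlo m (by omega) k
        simp only [typLo, lo, hu, Bool.false_eq_true, if_false] at this
        exact (this fun j _ h => h1 h.2).symm
      · have := hhi m (by omega) k
        simp only [typHi, hi, hu, if_true] at this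
        exact (this fun j _ h => h1 h.1).symm
    · have hm := lt_of_active h1
      rw [hc', ← hidle (m + 1) k h2]
      cases hu : S.up m
      · have := hhi m hm k
        simp only [typHi, hi, hu, Bool.false_eq_true, if_false] at this
        exact (this fun j _ h => h2 h.1).symm
      · have := hlo m hm k
        simp only [typLo, lo, hu, if_true] at this
        exact (this fun j _ h => h2 h.2).symm

end Strands

/-! ### Comparison of immanants and shuffle tableaux. -/

/-- The Schur function of an empty diagram is `1`. -/
theorem schur_empty_truncEq (N : ℕ) {D : Finset (ℤ × ℤ)} (hD : D = ∅) : TruncEq N (schur D) 1 := by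
  subst hD
  have h := weightSum_truncEq (D := ∅) (𝒮 := Set.univ) (N := N) (ι := Unit) (P := fun _ => True)
    (fun _ _ => ⟨fun p => absurd p.2 (Finset.notMem_empty _),
      fun p => absurd p.2 (Finset.notMem_empty _), fun p => absurd p.2 (Finset.notMem_empty _)⟩)
    (fun _ _ _ _ _ => rfl) (fun _ _ => Set.mem_univ _)
    (fun T _ _ => ⟨(), trivial, Tableau.ext (funext fun p => absurd p.2 (Finset.notMem_empty _))⟩)
    (w := fun _ => 1) (fun _ _ => by simp)
  simpa [schur] using h

namespace Strands

variable {S : Strands} {R : InfiniteRibbon} {c₀ : ℤ}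

/-- The Schur functions of ribbons as generating functions of paths. -/
theorem ribbonMatrix_truncEq (hR : S.OnRibbon R c₀) (i j : Fin S.n) :
    TruncEq S.N (R.ribbonMatrix (S.firstContent c₀) (S.lastContent c₀) i j)
      (S.pathGF seriesVar S.L (S.idleVal S.L i) j) := by
  rw [S.pathGF_last, InfiniteRibbon.ribbonMatrix, Matrix.of_apply]
  rcases lt_trichotomy (S.a j) (S.b i) with h | h | h
  · rw [if_pos h, if_pos (by unfold firstContent lastContent; omega), sum_entryGF]
    refine (R.schur_segment_truncEq S.N (d := S.b i - S.a j - 1)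
      (by unfold firstContent lastContent; omega)).trans ?_
    refine TruncEq.sum _ fun V _ => ?_
    have e : R.RibbonSeq (S.firstContent c₀ j) (S.b i - S.a j - 1) V ↔
        ∀ m : Fin (S.b i - S.a j - 1), StepRel (S.up (S.a j + m)) (V m.castSucc) (V m.succ) := by
      refine forall_congr' fun m => ?_
      rw [hR, firstContent, Nat.cast_add, ← add_assoc]
    rw [ite_congr_iff e]
    exact TruncEq.refl _ _
  · rw [if_neg h.not_lt, if_pos h, if_pos (by unfold firstContent lastContent; omega)]
    refine schur_empty_truncEq _ ?_
    rw [firstContent, lastContent, h, InfiniteRibbon.segment, Finset.Ico_self, Finset.image_empty]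
  · rw [if_neg h.not_gt, if_neg h.ne', if_neg (by unfold firstContent lastContent; omega)]
    exact TruncEq.refl _ _

open Classical in
/-- The shuffle tableaux of a given type correspond to the chains with a given diagram. -/
theorem weightSum_tlType_truncEq (hR : S.OnRibbon R c₀) (u : AvoidingPerm S.n) :
    TruncEq S.N (weightSum {T : Tableau (S.cells R c₀) |
        R.tlType (S.firstContent c₀) (S.lastContent c₀) T = tlMatching u})
      (∑ V : Fin (S.L + 1) → Fin S.n → S.Val, if S.IsChain parCol parCol V ∧
        ∀ f f', S.IsPlanar V f f' ↔ Colourable (reducedWord u.1) f f' then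
          S.chainWt seriesVar V else 0) := by
  refine (weightSum_truncEq (P := fun V => S.IsChain parCol parCol V ∧
      ∀ f f', S.IsPlanar V f f' ↔ Colourable (reducedWord u.1) f f')
    (fun V hV => hV.1.tableau hR)
    (fun V W hV hW h => hV.1.tableau_injective hW.1 hR h) (fun V hV => ?_) (fun T hT hN => ?_)
    fun V hV => hV.1.chainWt_eq hR).trans
    (TruncEq.sum _ fun V _ => ite_congr_iff Iff.rfl ▸ TruncEq.refl _ _)
  · refine (eq_tlMatching_iff u).2 fun f f' => ?_
    rw [tlType_le_ker_iff hV.1 hR]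
    exact hV.2 f f'
  · have hc := isChain_chainOf hR T hN
    have ht := tableau_chainOf hR T hN
    refine ⟨chainOf T hN, ⟨hc, fun f f' => ?_⟩, ht⟩
    rw [← tlType_le_ker_iff hc hR, ht]
    exact (eq_tlMatching_iff u).1 hT f f'

/-- The immanants of ribbon matrices count shuffle tableaux. -/
theorem tlImmanant_ribbonMatrix_truncEq (hR : S.OnRibbon R c₀) (u : AvoidingPerm S.n) :
    TruncEq S.N (tlImmanant u (R.ribbonMatrix (S.firstContent c₀) (S.lastContent c₀)))
      (weightSum {T : Tableau (S.cells R c₀) |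
        R.tlType (S.firstContent c₀) (S.lastContent c₀) T = tlMatching u}) := by
  refine (TruncEq.tlImmanant (Y := Matrix.of fun i j =>
    S.pathGF seriesVar S.L (S.idleVal S.L i) j) (fun i j => ribbonMatrix_truncEq hR i j) u).trans ?_
  rw [S.tlImmanant_pathGF seriesVar u]
  exact (weightSum_tlType_truncEq hR u).symm

end Strands

end RibbonTL

theorem corollary3p10 (R : RibbonTL.InfiniteRibbon) (lam mu : YoungDiagram) (hsub : mu ≤ lam)
    (hcomp : R.Compatible (RibbonTL.skewCells lam mu))
    (τ : RibbonTL.AvoidingPerm (R.numRibbons (RibbonTL.skewCells lam mu))) :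
    RibbonTL.tlImmanant τ (R.decompositionMatrix (RibbonTL.skewCells lam mu)) =
      RibbonTL.weightSum
        {T : RibbonTL.Tableau
            (R.shuffleShape (R.endingTuple (RibbonTL.skewCells lam mu))
              (R.startingTuple (RibbonTL.skewCells lam mu))) |
          R.tlType (R.endingTuple (RibbonTL.skewCells lam mu))
              (R.startingTuple (RibbonTL.skewCells lam mu)) T =
            RibbonTL.tlMatching τ} := by
  -- Chains carry only entries up to `N`, so both sides are compared in the first `N` variables.
  refine RibbonTL.eq_of_truncEq fun N => ?_
  obtain ⟨A, hA⟩ := (Set.finite_range (R.endingTuple (RibbonTL.skewCells lam mu))).bddBelow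
  obtain ⟨B, hB⟩ := (Set.finite_range (R.startingTuple (RibbonTL.skewCells lam mu))).bddAbove
  -- The content `A - 1` of the column `0` precedes all ribbons, so every strand is still at its
  -- source there.
  have h₀ : ∀ k, A - 1 < R.endingTuple (RibbonTL.skewCells lam mu) k := fun k => by
    have := hA (Set.mem_range_self k); omega
  -- The last column has content at least `B`, where every ribbon has ended.
  have hL : ∀ k, R.startingTuple (RibbonTL.skewCells lam mu) k ≤
      A - 1 + ((B - A + 1).toNat : ℕ) := fun k => by
    have := hB (Set.mem_range_self k); omega
  have h := RibbonTL.Strands.tlImmanant_ribbonMatrix_truncEq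
    (S := R.strands lam mu hcomp (A - 1) _ N h₀ hL) (R := R) (c₀ := A - 1) (fun _ => rfl) τ
  have ha : (R.strands lam mu hcomp (A - 1) _ N h₀ hL).firstContent (A - 1) =
      R.endingTuple (RibbonTL.skewCells lam mu) := funext fun k => by
    have := h₀ k
    simp only [RibbonTL.Strands.firstContent, RibbonTL.InfiniteRibbon.strands]; omega
  have hb : (R.strands lam mu hcomp (A - 1) _ N h₀ hL).lastContent (A - 1) =
      R.startingTuple (RibbonTL.skewCells lam mu) := funext fun k => by
    have := h₀ k
    have := R.endingTuple_lt_startingTuple (RibbonTL.skewCells lam mu) k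
    simp only [RibbonTL.Strands.lastContent, RibbonTL.InfiniteRibbon.strands]; omega
  unfold RibbonTL.Strands.cells at h
  rw [ha, hb] at h
  exact h
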